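/- We work over $\mathbb{C}$. Let $\pi\colon\widetilde C\to C$ be an admissible double cover of a nodal curve, with involution $\tau$ of the connected nodal curve $\widetilde C$ and $C=\widetilde C/\tau$, satisfying Beauville's condition $(*)$: the fixed points of $\tau$ are exactly the singular points of $\widetilde C$, and at each of them the two local branches are not exchanged by $\tau$. Let $\nu\colon\hat C\to\widetilde C$ and $\nu_N\colon N\to C$ be the normalizations, and write $\pi$ also for the induced morphism $\hat C\to N$. For a node $x$ of $\widetilde C$ write $\nu^{-1}(x)=\{p_x,q_x\}$. The curves $\hat C$ and $N$ may be disconnected. Let $L$ be a line bundle on $\widetilde C$ with $\tau^*L\cong L$. Then there is a linearization of $L$, i.e. an isomorphism $\varphi\colon\tau^*L\to L$ with $\varphi^2=\mathrm{Id}$ (meaning $\varphi\circ\tau^*\varphi=\mathrm{Id}$), and there are a set $I\subseteq\widetilde C_{\mathrm{sing}}$ and a line bundle $\hat M_1$ on $N$ with $$\nu^*L\cong\pi^*\hat M_1\Big(\sum_{x\in I}(p_x+q_x)\Big).\qquad(1)$$ Fix any such $I$, $\hat M_1$ and isomorphism (1), and let $J=\widetilde C_{\mathrm{sing}}\setminus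 I$. Then there is also a line bundle $\hat M_2$ on $N$ with $$\nu^*L\cong\pi^*\hat M_2\Big(\sum_{x\in J}(p_x+q_x)\Big),\qquad(2)$$ and, if $\widetilde C$ is smooth, one with $\hat M_2\not\cong\hat M_1$. Fix any such $\hat M_2$ and isomorphism (2), with $\hat M_2\not\cong\hat M_1$ in case $\widetilde C$ is smooth. Let $\nu_1\colon N_1\to C$ be the normalization of $C$ at the points $\pi(x)$, $x\in I$, and let $\nu_2\colon N_2\to C$ be the normalization of $C$ at the points $\pi(x)$, $x\in J$. Let $M_1$ be the sheaf on $N_1$ obtained from $\hat M_1$ by using, for $x\in J$, the identification of the fibres of $\hat M_1$ at $\pi(p_x)$ and $\pi(q_x)$ given through (1) by $(\nu^*L)_{p_x}=L_x=(\nu^*L)_{q_x}$; that is, the sections of $M_1$ are the sections of $\hat M_1$ whose values at these points correspond. Let $M_2$ be the sheaf on $N_2$ obtained in the same way from $\hat M_2$ and (2), using the points $x\in I$. Then $M_1$ and $M_2$ are line bundles, and for every linearization $\varphi$ of $L$ there is an isomorphism $$\pi_*L\cong\nu_{1*}M_1\oplus\nu_{2*}M_2$$ such that, possibly after replacing $\varphi$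 by $-\varphi$, $\nu_{1*}M_1$ is the $+1$-eigenspace and $\nu_{2*}M_2$ is the $-1$-eigenspace for the action of $\varphi$ on $\pi_*L$. Finally, if $\operatorname{Norm}L\cong\omega_C$, then $M_1$ is a theta characteristic on $N_1$ and $M_2$ is a theta characteristic on $N_2$: $M_i^{\otimes2}\cong\omega_{N_i}$, where $\omega$ denotes the dualizing sheaf. -/

import Mathlib

open CategoryTheory CategoryTheory.Limits AlgebraicGeometry TopologicalSpace

namespace PrymEigen

/-! ### Nodal curves -/

/-- `R` is a discrete valuation ring (in particular a domain). -/
def IsDVR (R : Type*) [CommRing R] : Prop :=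
  ∃ _ : IsDomain R, IsDiscreteValuationRing R

/-- The local ring `R` of a reduced curve at a closed point is that of an ordinary double point
(a node): `R` has dimension one, its integral closure `R'` in the total ring of fractions has
exactly two maximal ideals (the two branches), and `δ = length (R' / R) = 1`. -/
def IsNodeRing (R : Type*) [CommRing R] : Prop :=
  ringKrullDim R = 1 ∧
  Nat.card (MaximalSpectrum (integralClosure R (FractionRing R))) = 2 ∧
  Module.length R ((integralClosure R (FractionRing R)) ⧸
    LinearMap.range (Algebra.linearMap R (integralClosure R (FractionRing R)))) = 1

/-- A (not necessarily connected) nodal curve over `ℂ`: a proper reduced `ℂ`-scheme, each closed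
point of which is either a smooth point of dimension one or a node. -/
structure IsNodalCurve {X : Scheme.{0}} (s : X ⟶ Spec (.of ℂ)) : Prop where
  proper : IsProper s
  reduced : IsReduced X
  smooth_or_node : ∀ x : X, IsClosed {x} →
    IsDVR (X.presheaf.stalk x) ∨ IsNodeRing (X.presheaf.stalk x)

/-- The set of singular (closed) points of a curve. -/
def singularPoints (X : Scheme.{0}) : Set X :=
  {x | IsClosed {x} ∧ ¬ IsDVR (X.presheaf.stalk x)}

/-- `f : X ⟶ Y` is the normalization of the reduced curve `Y` at the finite set `S` of closed
points: `f` is finite, it is an isomorphism away from `S`, and `X` is normal at each point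
over `S`. This determines `X` up to a unique isomorphism over `Y`. -/
structure IsNormalizationAt {X Y : Scheme.{0}} (f : X ⟶ Y) (S : Set Y) : Prop where
  finite : IsFinite f
  iso_away : ∀ U : Y.Opens, Disjoint (U : Set Y) S → IsIso (f ∣_ U)
  normal : ∀ x : X, f x ∈ S → IsDVR (X.presheaf.stalk x)

/-- The (full) normalization of a reduced curve. -/
def IsNormalization {X Y : Scheme.{0}} (f : X ⟶ Y) : Prop :=
  IsNormalizationAt f (singularPoints Y)

/-! ### Admissible double covers -/

lemma le_preimage_preimage {X Y : Scheme.{0}} {τ : X ⟶ X} {π : X ⟶ Y} (h : τ ≫ π = π)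
    (U : Y.Opens) : π ⁻¹ᵁ U ≤ τ ⁻¹ᵁ (π ⁻¹ᵁ U) := by
  rw [← Scheme.Hom.comp_preimage, h]

/-- The action `f ↦ τ^* f` of `τ` on functions on `π⁻¹ U`, for `π` invariant under `τ`. -/
noncomputable def invol {X Y : Scheme.{0}} {τ : X ⟶ X} {π : X ⟶ Y} (h : τ ≫ π = π)
    (U : Y.Opens) : Γ(X, π ⁻¹ᵁ U) ⟶ Γ(X, π ⁻¹ᵁ U) :=
  τ.appLE (π ⁻¹ᵁ U) (π ⁻¹ᵁ U) (le_preimage_preimage h U)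

/-- `π : C' ⟶ C` is an admissible double cover of the nodal curve `C`, with involution `τ`,
satisfying Beauville's condition `(*)`: `C'` is a connected nodal curve, `C` is the quotient
`C' / τ`, the fixed points of `τ` are exactly the singular points of `C'`, and `τ` does not
exchange the two branches at any of them. A branch at a singular point is a point over it of the
normalization `n : Y ⟶ C'`, to which `τ` lifts (uniquely) as `t`. -/
structure IsAdmissibleDoubleCover {C' C : Scheme.{0}} (s' : C' ⟶ Spec (.of ℂ))
    (s : C ⟶ Spec (.of ℂ)) (τ : C' ⟶ C') (π : C' ⟶ C) : Prop where
  nodal_total : IsNodalCurve s'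
  nodal_base : IsNodalCurve s
  connected : ConnectedSpace C'
  comp_structure : π ≫ s = s'
  involution : τ ≫ τ = 𝟙 C'
  finite : IsFinite π
  invariant : τ ≫ π = π
  app_injective : ∀ U : C.Opens, Function.Injective (π.app U)
  mem_range_app : ∀ (U : C.Opens) (f : Γ(C', π ⁻¹ᵁ U)), invol invariant U f = f →
    f ∈ Set.range (π.app U)
  fixed_iff : ∀ x : C', IsClosed {x} → (τ x = x ↔ x ∈ singularPoints C')
  branches : ∀ (Y : Scheme.{0}) (n : Y ⟶ C') (t : Y ⟶ Y), IsNormalization n → t ≫ n = n ≫ τ →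
    ∀ p : Y, n p ∈ singularPoints C' → t p = p

/-! ### Line bundles -/

section Modules

variable {X Y : Scheme.{0}}

/-- A line bundle (invertible sheaf): a sheaf of modules locally isomorphic to the structure
sheaf. -/
def IsLineBundle (M : X.Modules) : Prop :=
  ∀ x : X, ∃ U : X.Opens, x ∈ U ∧
    Nonempty (M.restrict U.ι ≅ SheafOfModules.unit (U : Scheme.{0}).ringCatSheaf)

/-- Restriction of sections of a sheaf of modules. -/
noncomputable def res (M : X.Modules) {U V : X.Opens} (h : V ≤ U) : Γ(M, U) →+ Γ(M, V) :=
  (M.presheaf.map (homOfLE h).op).hom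

/-- The pullback of a section along a morphism of schemes. -/
noncomputable def pullSec (f : X ⟶ Y) (M : Y.Modules) (V : Y.Opens) :
    Γ(M, V) →+ Γ((Scheme.Modules.pullback f).obj M, f ⁻¹ᵁ V) :=
  (((Scheme.Modules.pullbackPushforwardAdjunction f).unit.app M).app V).hom

/-- The ideal of functions on `V` which vanish at the point `p ∈ V`. -/
noncomputable def idealAt (V : X.Opens) (p : X) (hp : p ∈ V) : Ideal Γ(X, V) :=
  (IsLocalRing.maximalIdeal (X.presheaf.stalk p)).comap (X.presheaf.germ V p hp).hom

/-- The section `s` of `M` vanishes at the point `p`: its germ at `p` lies in `𝔪_p M_p`. -/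
def VanishesAt (M : X.Modules) {U : X.Opens} (s : Γ(M, U)) (p : X) : Prop :=
  ∃ (V : X.Opens) (h : V ≤ U) (hp : p ∈ V),
    res M h s ∈ idealAt V p hp • (⊤ : Submodule Γ(X, V) Γ(M, V))

/-- `s` is a generator of `M` over `U`, i.e. `f ↦ f s` is an isomorphism `𝒪_U ≅ M|_U`. -/
def IsGenerator (M : X.Modules) {U : X.Opens} (s : Γ(M, U)) : Prop :=
  ∀ (V : X.Opens) (h : V ≤ U), Function.Bijective fun f : Γ(X, V) => f • res M h s

/-- The tensor product of sheaves of modules: the sheaf associated to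
`U ↦ M(U) ⊗ N(U)`. -/
noncomputable def tensor (M N : X.Modules) : X.Modules :=
  (PresheafOfModules.sheafification (𝟙 X.ringCatSheaf.obj)).obj
    (PresheafOfModules.Monoidal.tensorObj (R := X.presheaf) M.val N.val)

/-- `j` exhibits `B` as the twist `A(D)`, for `D` a reduced effective divisor (given as a set of
smooth points of a curve): `j` is the natural inclusion `A ⟶ A(D) ≅ B`, i.e. it is injective and
its image consists of the sections of `B` vanishing at the points of `D`. -/
def IsTwist {A B : X.Modules} (j : A ⟶ B) (D : Set X) : Prop :=
  ∀ U : X.Opens, Function.Injective (j.app U) ∧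
    ∀ s : Γ(B, U), s ∈ Set.range (j.app U) ↔ ∀ p ∈ U, p ∈ D → VanishesAt B s p

/-- A linearization of the sheaf `L` with respect to the involution `τ`: an isomorphism
`φ : τ^* L ⟶ L` with `φ² = id`. It is given through its adjoint `L ⟶ τ_* L`. -/
def IsLinearization {τ : X ⟶ X} (h : τ ≫ τ = 𝟙 X) (L : X.Modules)
    (φ : L ⟶ (Scheme.Modules.pushforward τ).obj L) : Prop :=
  φ ≫ (Scheme.Modules.pushforward τ).map φ ≫ (Scheme.Modules.pushforwardComp τ τ).hom.app L ≫
    (Scheme.Modules.pushforwardCongr h).hom.app L ≫ (Scheme.Modules.pushforwardId X).hom.app L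
    = 𝟙 L

/-- The endomorphism of `π_* L` induced by `φ : τ^* L ⟶ L` (given as `L ⟶ τ_* L`). -/
noncomputable def action {τ : X ⟶ X} {π : X ⟶ Y} (h : τ ≫ π = π) {L : X.Modules}
    (φ : L ⟶ (Scheme.Modules.pushforward τ).obj L) :
    (Scheme.Modules.pushforward π).obj L ⟶ (Scheme.Modules.pushforward π).obj L :=
  (Scheme.Modules.pushforward π).map φ ≫ (Scheme.Modules.pushforwardComp τ π).hom.app L ≫
    (Scheme.Modules.pushforwardCongr h).hom.app L

/-- The line bundle `W` on `Y` is (isomorphic to) the norm of the line bundle `L` on `X`, for the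
double cover `π : X ⟶ Y = X / τ`. The norm of a function `f` on `π⁻¹ U` is the function `g` on `U`
with `π^* g = f · τ^* f`; the norm of `L` is the line bundle on `Y` whose transition functions are
the norms of those of `L`. Equivalently there is a norm map `π_* L ⟶ W`, compatible with norms
of functions and sending generators to generators. -/
def IsNorm {τ : X ⟶ X} {π : X ⟶ Y} (h : τ ≫ π = π) (L : X.Modules) (W : Y.Modules) : Prop :=
  IsLineBundle W ∧ ∃ N : ∀ U : Y.Opens, Γ(L, π ⁻¹ᵁ U) → Γ(W, U),
    (∀ (U V : Y.Opens) (i : V ≤ U) (s : Γ(L, π ⁻¹ᵁ U)),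
      N V (res L (π.preimage_mono i) s) = res W i (N U s)) ∧
    (∀ (U : Y.Opens) (s : Γ(L, π ⁻¹ᵁ U)) (f : Γ(X, π ⁻¹ᵁ U)) (g : Γ(Y, U)),
      π.app U g = f * invol h U f → N U (f • s) = g • N U s) ∧
    (∀ (U : Y.Opens) (s : Γ(L, π ⁻¹ᵁ U)), IsGenerator L s → IsGenerator W (N U s))

end Modules

/-! ### The dualizing sheaf of a nodal curve -/

section Differentials

variable {A K : Type*} [CommRing A] [CommRing K] [Algebra ℂ K]

/-- The differentials of `K` over `ℂ` of the form `∑ aᵢ d bᵢ` with `aᵢ`, `bᵢ` in (the image of)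
`A`. -/
noncomputable def regularDifferentials (φ : A →+* K) : AddSubgroup (Ω[K⁄ℂ]) :=
  AddSubgroup.closure (Set.range fun x : A × A => φ x.1 • KaehlerDifferential.D ℂ K (φ x.2))

/-- For a discrete valuation ring `A` with fraction field `K`: the differential `η` has at most a
simple pole, with residue `c`, i.e. `η - c dt/t` is regular for a uniformizer `t`. -/
def HasSimplePole (φ : A →+* K) (η : Ω[K⁄ℂ]) (c : ℂ) : Prop :=
  ∃ (t : A) (u : K), Irreducible t ∧ u * φ t = 1 ∧
    η - (algebraMap ℂ K c * u) • KaehlerDifferential.D ℂ K (φ t) ∈ regularDifferentials φ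

end Differentials

section Dualizing

variable {X Y : Scheme.{0}}

/-- The `ℂ`-algebra structure on the local rings of a `ℂ`-scheme. -/
noncomputable abbrev stalkAlgebra (s : X ⟶ Spec (.of ℂ)) (x : X) :
    Algebra ℂ (X.presheaf.stalk x) :=
  ((Scheme.ΓSpecIso (.of ℂ)).inv ≫ s.appTop ≫ X.presheaf.germ ⊤ x trivial).hom.toAlgebra

/-- The generic points (of irreducible components) of `Y` which lie over `U`. -/
abbrev GenericOver (n : Y ⟶ X) (U : X.Opens) : Type :=
  {ξ : Y // (∀ η : Y, η ⤳ ξ → η = ξ) ∧ n ξ ∈ U}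

/-- For `n : Y ⟶ X` the normalization of a nodal curve, `W` is (isomorphic to) the sheaf of
Rosenlicht differentials on `X`: its sections over `U` are the rational differentials `ω` on
`n⁻¹ U` having at most simple poles at the points over each closed point `x ∈ U`, the residues at
the points over `x` adding up to zero. (So `ω` is regular over the smooth points, and at a node the
two residues are opposite.) A rational differential is a family of differentials of the function
fields of the components. -/
def IsRosenlicht (n : Y ⟶ X) [∀ y : Y, Algebra ℂ (Y.presheaf.stalk y)] (W : X.Modules) : Prop :=
  ∃ ρ : ∀ U : X.Opens, Γ(W, U) →+ ∀ ξ : GenericOver n U, Ω[Y.presheaf.stalk ξ.1⁄ℂ],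
    (∀ (U V : X.Opens) (i : V ≤ U) (s : Γ(W, U)) (ξ : GenericOver n V),
      ρ V (res W i s) ξ = ρ U s ⟨ξ.1, ξ.2.1, i ξ.2.2⟩) ∧
    (∀ (U : X.Opens) (f : Γ(X, U)) (s : Γ(W, U)) (ξ : GenericOver n U),
      ρ U (f • s) ξ = Y.presheaf.germ (n ⁻¹ᵁ U) ξ.1 ξ.2.2 (n.app U f) • ρ U s ξ) ∧
    (∀ U : X.Opens, Function.Injective (ρ U)) ∧
    (∀ (U : X.Opens) (ω : ∀ ξ : GenericOver n U, Ω[Y.presheaf.stalk ξ.1⁄ℂ]),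
      ω ∈ Set.range (ρ U) ↔ ∀ x ∈ U, IsClosed {x} → ∃ r : Y → ℂ,
        (∀ p : Y, n p = x → ∀ (ξ : GenericOver n U) (h : ξ.1 ⤳ p),
          HasSimplePole (Y.presheaf.stalkSpecializes h).hom (ω ξ) (r p)) ∧
        ∑ᶠ p ∈ {p : Y | n p = x}, r p = 0)

/-- `W` is the dualizing sheaf `ω_X` of the nodal curve `s : X ⟶ Spec ℂ`, with normalization
`n : Y ⟶ X`. (Up to isomorphism this does not depend on `n`, which is unique.) -/
def IsDualizing (s : X ⟶ Spec (.of ℂ)) (n : Y ⟶ X) (W : X.Modules) : Prop :=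
  IsNodalCurve s ∧ IsNormalization n ∧
    letI := fun y : Y => stalkAlgebra (n ≫ s) y
    IsRosenlicht n W

/-- `M` is a theta characteristic on the nodal curve `X`: a line bundle with `M ⊗ M ≅ ω_X`. -/
def IsThetaCharacteristic (s : X ⟶ Spec (.of ℂ)) (n : Y ⟶ X) (M : X.Modules) : Prop :=
  IsLineBundle M ∧ IsDualizing s n (tensor M M)

end Dualizing

/-! ### Line bundles on partial normalizations obtained by identification of fibres -/

/-- The situation: `ν : Ĉ ⟶ C'` is the normalization, `π : Ĉ ⟶ N` a morphism, `μ : N ⟶ N₁`,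
`L` a line bundle on `C'`, `M̂` a line bundle on `N`, with `j : π^* M̂ ⟶ ν^* L` an isomorphism
near the points over `J ⊆ C'`. Then `a : M ⟶ μ_* M̂` exhibits `M` as the sheaf on `N₁` obtained
from `M̂` by using, for each `x ∈ J` with `ν⁻¹(x) = {p, q}`, the identification
`M̂_{π p} = (ν^* L)_p = L_x = (ν^* L)_q = M̂_{π q}` of fibres: `a` is injective with image the
sections `m` of `M̂` such that the values at the points `p`, `q` over `x` of the corresponding
section of `ν^* L` come from a single element of the fibre `L_x`, for each `x ∈ J`. -/
def IsGluing {C' Ch N N₁ : Scheme.{0}} (ν : Ch ⟶ C') (π : Ch ⟶ N) (μ : N ⟶ N₁)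
    (L : C'.Modules) (Mh : N.Modules)
    (j : (Scheme.Modules.pullback π).obj Mh ⟶ (Scheme.Modules.pullback ν).obj L) (J : Set C')
    {M : N₁.Modules} (a : M ⟶ (Scheme.Modules.pushforward μ).obj Mh) : Prop :=
  ∀ V : N₁.Opens, Function.Injective (a.app V) ∧
    ∀ m : Γ(Mh, μ ⁻¹ᵁ V), m ∈ Set.range (a.app V) ↔
      ∀ x ∈ J, ∃ (U : C'.Opens) (l : Γ(L, U)), x ∈ U ∧
        ∀ p ∈ π ⁻¹ᵁ (μ ⁻¹ᵁ V), ν p = x →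
          VanishesAt ((Scheme.Modules.pullback ν).obj L)
            (res _ inf_le_left (j.app (π ⁻¹ᵁ (μ ⁻¹ᵁ V)) (pullSec π Mh (μ ⁻¹ᵁ V) m)) -
              res _ inf_le_right (pullSec ν L U l) :
              Γ((Scheme.Modules.pullback ν).obj L, (π ⁻¹ᵁ (μ ⁻¹ᵁ V)) ⊓ (ν ⁻¹ᵁ U))) p

end PrymEigen

namespace PrymEigen

/-! ### Sections of the structure sheaf -/

section Functions

variable {X Y Z : Scheme.{0}}

/-- Restriction of functions. -/
noncomputable def fres {U V : X.Opens} (h : V ≤ U) : Γ(X, U) →+* Γ(X, V) :=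
  (X.presheaf.map (homOfLE h).op).hom

lemma mem_of_le_preimage {f : X ⟶ Y} {U : Y.Opens} {V : X.Opens} (h : V ≤ f ⁻¹ᵁ U) {p : X}
    (hp : p ∈ V) : f p ∈ U := h hp

/-- Pullback of functions, followed by restriction. -/
noncomputable def pb (f : X ⟶ Y) {U : Y.Opens} {V : X.Opens} (h : V ≤ f ⁻¹ᵁ U) :
    Γ(Y, U) →+* Γ(X, V) :=
  (f.appLE U V h).hom

@[simp] lemma fres_fres {U V W : X.Opens} (h : V ≤ U) (h' : W ≤ V) (f : Γ(X, U)) :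
    fres h' (fres h f) = fres (h'.trans h) f := by
  simp only [fres, ← CommRingCat.comp_apply, ← Functor.map_comp]; rfl

@[simp] lemma fres_self {U : X.Opens} (h : U ≤ U) (f : Γ(X, U)) : fres h f = f := by
  have : (homOfLE h).op = 𝟙 _ := rfl
  simp only [fres, this, CategoryTheory.Functor.map_id]; rfl

@[simp] lemma fres_pb (f : X ⟶ Y) {U : Y.Opens} {V W : X.Opens} (h : V ≤ f ⁻¹ᵁ U) (h' : W ≤ V)
    (x : Γ(Y, U)) : fres h' (pb f h x) = pb f (h'.trans h) x := by
  simp only [fres, pb, ← CommRingCat.comp_apply, Scheme.Hom.appLE_map]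

@[simp] lemma pb_fres (f : X ⟶ Y) {U V : Y.Opens} {W : X.Opens} (h : V ≤ U) (h' : W ≤ f ⁻¹ᵁ V)
    (x : Γ(Y, U)) : pb f h' (fres h x) = pb f (h'.trans (f.preimage_mono h)) x := by
  simp only [fres, pb, ← CommRingCat.comp_apply, Scheme.Hom.map_appLE]

lemma pb_pb (f : X ⟶ Y) (g : Y ⟶ Z) {U : Z.Opens} {V : Y.Opens} {W : X.Opens} (h : V ≤ g ⁻¹ᵁ U)
    (h' : W ≤ f ⁻¹ᵁ V) (x : Γ(Z, U)) :
    pb f h' (pb g h x) = pb (f ≫ g) (h'.trans (f.preimage_mono h)) x := by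
  simp only [pb, ← CommRingCat.comp_apply, Scheme.Hom.appLE_comp_appLE]

lemma pb_congr {f g : X ⟶ Y} (e : f = g) {U : Y.Opens} {V : X.Opens} (h : V ≤ f ⁻¹ᵁ U)
    (x : Γ(Y, U)) : pb f h x = pb g (e ▸ h) x := by subst e; rfl

lemma pb_id {U V : X.Opens} (h : V ≤ 𝟙 X ⁻¹ᵁ U) (x : Γ(X, U)) : pb (𝟙 X) h x = fres h x := by
  simp only [pb, fres, Scheme.Hom.appLE, Scheme.Hom.id_app]; rfl

lemma app_eq_pb (f : X ⟶ Y) {U : Y.Opens} (x : Γ(Y, U)) : f.app U x = pb f le_rfl x := by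
  rw [pb, Scheme.Hom.appLE_eq_app]

lemma germ_fres {U V : X.Opens} (h : V ≤ U) (f : Γ(X, U)) (p : X) (hp : p ∈ V) :
    X.presheaf.germ V p hp (fres h f) = X.presheaf.germ U p (h hp) f :=
  TopCat.Presheaf.germ_res_apply X.presheaf (homOfLE h) p hp f

lemma germ_pb (f : X ⟶ Y) {U : Y.Opens} {V : X.Opens} (h : V ≤ f ⁻¹ᵁ U) (x : Γ(Y, U)) (p : X)
    (hp : p ∈ V) : X.presheaf.germ V p hp (pb f h x) =
      (f.stalkMap p) (Y.presheaf.germ U (f p) (mem_of_le_preimage h hp) x) := by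
  have h1 : pb f h x = fres h (f.app U x) := by rw [app_eq_pb, fres_pb]
  rw [h1, germ_fres]
  exact (Scheme.Hom.germ_stalkMap_apply f U p (mem_of_le_preimage h hp) x).symm

lemma germ_eq_iff {U : X.Opens} (f g : Γ(X, U)) (p : X) (hp : p ∈ U) :
    X.presheaf.germ U p hp f = X.presheaf.germ U p hp g ↔
      ∃ (V : X.Opens) (h : V ≤ U), p ∈ V ∧ fres h f = fres h g := by
  constructor
  · intro h
    obtain ⟨W, hW, iU, iV, e⟩ := X.presheaf.germ_eq p hp hp f g h
    exact ⟨W, iU.le, hW, e⟩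
  · rintro ⟨V, h, hV, e⟩
    rw [← germ_fres h f p hV, e, germ_fres]

lemma exists_germ (p : X) (a : X.presheaf.stalk p) :
    ∃ (V : X.Opens) (hV : p ∈ V) (f : Γ(X, V)), X.presheaf.germ V p hV f = a := by
  obtain ⟨V, hV, f, e⟩ := X.presheaf.exists_germ_eq a
  exact ⟨V, hV, f, e⟩

lemma fun_ext {U : X.Opens} (f g : Γ(X, U))
    (h : ∀ x ∈ U, ∃ (V : X.Opens) (hV : V ≤ U), x ∈ V ∧ fres hV f = fres hV g) : f = g := by
  choose V hVU hxV e using fun x : U => h x.1 x.2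
  refine X.sheaf.eq_of_locally_eq' (fun x : U => V x) U (fun x => homOfLE (hVU x)) ?_ f g e
  intro x hx
  exact Opens.mem_iSup.2 ⟨⟨x, hx⟩, hxV ⟨x, hx⟩⟩

lemma exists_fun_glue {U : X.Opens} (P : ∀ V : X.Opens, Γ(X, V) → Prop)
    (hres : ∀ V W (h : W ≤ V) s, V ≤ U → P V s → P W (fres h s))
    (huniq : ∀ V ≤ U, ∀ s t, P V s → P V t → s = t)
    (hloc : ∀ x ∈ U, ∃ V ≤ U, x ∈ V ∧ ∃ s, P V s) :
    ∃ s : Γ(X, U), ∀ V (h : V ≤ U) t, P V t → fres h s = t := by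
  choose V hVU hxV s hs using fun x : U => hloc x.1 x.2
  obtain ⟨t, ht⟩ : ∃ t : Γ(X, U), ∀ x, fres (hVU x) t = s x := (X.sheaf.existsUnique_gluing' (fun x : U => V x) U
    (fun x => homOfLE (hVU x)) (fun x hx => Opens.mem_iSup.2 ⟨⟨x, hx⟩, hxV ⟨x, hx⟩⟩) s
    (fun i j => huniq _ (inf_le_left.trans (hVU i)) _ _ (hres _ _ inf_le_left _ (hVU i) (hs i))
      (hres _ _ inf_le_right _ (hVU j) (hs j)))).exists
  refine ⟨t, fun W hW w hw => fun_ext _ _ fun x hx => ?_⟩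
  refine ⟨W ⊓ V ⟨x, hW hx⟩, inf_le_left, ⟨hx, hxV ⟨x, hW hx⟩⟩, ?_⟩
  refine huniq _ (inf_le_left.trans hW) _ _ ?_ (hres _ _ _ _ hW hw)
  have h1 : fres (hVU ⟨x, hW hx⟩) t = s ⟨x, hW hx⟩ := ht ⟨x, hW hx⟩
  have := hres _ (W ⊓ V ⟨x, hW hx⟩) inf_le_right _ (hVU ⟨x, hW hx⟩) (hs ⟨x, hW hx⟩)
  rw [← h1] at this
  simpa using this

/-! ### Vanishing of functions at points -/

lemma mem_idealAt {V : X.Opens} {p : X} {hp : p ∈ V} {f : Γ(X, V)} :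
    f ∈ idealAt V p hp ↔
      X.presheaf.germ V p hp f ∈ IsLocalRing.maximalIdeal (X.presheaf.stalk p) := Iff.rfl

instance idealAt_isPrime (V : X.Opens) (p : X) (hp : p ∈ V) : (idealAt V p hp).IsPrime := by
  unfold idealAt; infer_instance

lemma fres_mem_idealAt {U V : X.Opens} (h : V ≤ U) (f : Γ(X, U)) {p : X} (hp : p ∈ V) :
    fres h f ∈ idealAt V p hp ↔ f ∈ idealAt U p (h hp) := by
  rw [mem_idealAt, mem_idealAt, germ_fres]

lemma pb_mem_idealAt (f : X ⟶ Y) {U : Y.Opens} {V : X.Opens} (h : V ≤ f ⁻¹ᵁ U) (x : Γ(Y, U))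
    {p : X} (hp : p ∈ V) : pb f h x ∈ idealAt V p hp ↔ x ∈ idealAt U (f p) (mem_of_le_preimage h hp) := by
  rw [mem_idealAt, mem_idealAt, germ_pb, IsLocalRing.mem_maximalIdeal, IsLocalRing.mem_maximalIdeal,
    mem_nonunits_iff, mem_nonunits_iff]
  exact not_congr (isUnit_map_iff (f.stalkMap p).hom _)

lemma notMem_idealAt_iff {V : X.Opens} {p : X} {hp : p ∈ V} {f : Γ(X, V)} :
    f ∉ idealAt V p hp ↔ p ∈ X.basicOpen f := by
  rw [mem_idealAt, Scheme.mem_basicOpen _ _ _ hp, IsLocalRing.mem_maximalIdeal, mem_nonunits_iff,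
    not_not]

lemma isUnit_of_notMem_idealAt {V : X.Opens} (f : Γ(X, V))
    (h : ∀ p (hp : p ∈ V), f ∉ idealAt V p hp) : IsUnit f := by
  have : X.basicOpen f = V :=
    le_antisymm (X.basicOpen_le f) fun p hp => notMem_idealAt_iff.1 (h p hp)
  have h2 := RingedSpace.isUnit_res_basicOpen X.toRingedSpace f
  have h3 : IsUnit (fres (X.basicOpen_le f) f) := h2
  have h4 := h3.map (fres (U := X.basicOpen f) this.ge)
  simpa using h4

lemma not_isUnit_of_mem_idealAt {V : X.Opens} {f : Γ(X, V)} {p : X} {hp : p ∈ V}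
    (h : f ∈ idealAt V p hp) : ¬ IsUnit f :=
  fun hu => (idealAt_isPrime V p hp).ne_top (Ideal.eq_top_of_isUnit_mem _ h hu)

lemma exists_isUnit_fres {V : X.Opens} {f : Γ(X, V)} {p : X} {hp : p ∈ V}
    (h : f ∉ idealAt V p hp) : ∃ (W : X.Opens) (hW : W ≤ V), p ∈ W ∧ IsUnit (fres hW f) :=
  ⟨X.basicOpen f, X.basicOpen_le f, notMem_idealAt_iff.1 h,
    RingedSpace.isUnit_res_basicOpen X.toRingedSpace f⟩

end Functions

/-! ### Sections of sheaves of modules -/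

section Sections

variable {X Y Z : Scheme.{0}} {M M' : X.Modules}

@[simp] lemma res_res {U V W : X.Opens} (h : V ≤ U) (h' : W ≤ V) (s : Γ(M, U)) :
    res M h' (res M h s) = res M (h'.trans h) s := by
  simp only [res, ← ConcreteCategory.comp_apply]
  exact (ConcreteCategory.congr_hom (M.presheaf.map_comp (homOfLE h).op (homOfLE h').op) s).symm

@[simp] lemma res_self {U : X.Opens} (h : U ≤ U) (s : Γ(M, U)) : res M h s = s :=
  ConcreteCategory.congr_hom (M.presheaf.map_id (Opposite.op U)) s

@[simp] lemma res_smul {U V : X.Opens} (h : V ≤ U) (f : Γ(X, U)) (s : Γ(M, U)) :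
    res M h (f • s) = fres h f • res M h s :=
  M.map_smul (homOfLE h) f s

lemma app_res (α : M ⟶ M') {U V : X.Opens} (h : V ≤ U) (s : Γ(M, U)) :
    α.app V (res M h s) = res M' h (α.app U s) :=
  ConcreteCategory.congr_hom (α.mapPresheaf.naturality (homOfLE h).op) s

lemma mod_ext {U : X.Opens} (s t : Γ(M, U))
    (h : ∀ x ∈ U, ∃ (V : X.Opens) (hV : V ≤ U), x ∈ V ∧ res M hV s = res M hV t) : s = t := by
  choose V hVU hxV e using fun x : U => h x.1 x.2
  refine TopCat.Sheaf.eq_of_locally_eq' ⟨M.presheaf, M.isSheaf⟩ (fun x : U => V x) U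
    (fun x => homOfLE (hVU x)) ?_ s t e
  intro x hx
  exact Opens.mem_iSup.2 ⟨⟨x, hx⟩, hxV ⟨x, hx⟩⟩

lemma exists_mod_glue {U : X.Opens} (P : ∀ V : X.Opens, Γ(M, V) → Prop)
    (hres : ∀ V W (h : W ≤ V) s, V ≤ U → P V s → P W (res M h s))
    (huniq : ∀ V ≤ U, ∀ s t, P V s → P V t → s = t)
    (hloc : ∀ x ∈ U, ∃ V ≤ U, x ∈ V ∧ ∃ s, P V s) :
    ∃ s : Γ(M, U), ∀ V (h : V ≤ U) t, P V t → res M h s = t := by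
  choose V hVU hxV s hs using fun x : U => hloc x.1 x.2
  obtain ⟨t, ht, -⟩ := TopCat.Sheaf.existsUnique_gluing' ⟨M.presheaf, M.isSheaf⟩
    (fun x : U => V x) U
    (fun x => homOfLE (hVU x)) (fun x hx => Opens.mem_iSup.2 ⟨⟨x, hx⟩, hxV ⟨x, hx⟩⟩) s
    (fun i j => huniq _ (inf_le_left.trans (hVU i)) _ _ (hres _ _ inf_le_left _ (hVU i) (hs i))
      (hres _ _ inf_le_right _ (hVU j) (hs j)))
  refine ⟨t, fun W hW w hw => mod_ext _ _ fun x hx => ?_⟩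
  refine ⟨W ⊓ V ⟨x, hW hx⟩, inf_le_left, ⟨hx, hxV ⟨x, hW hx⟩⟩, ?_⟩
  refine huniq _ (inf_le_left.trans hW) _ _ ?_ (hres _ _ _ _ hW hw)
  have h1 : res M (hVU ⟨x, hW hx⟩) t = s ⟨x, hW hx⟩ := ht ⟨x, hW hx⟩
  have := hres _ (W ⊓ V ⟨x, hW hx⟩) inf_le_right _ (hVU ⟨x, hW hx⟩) (hs ⟨x, hW hx⟩)
  rw [← h1] at this
  simpa using this

/-! ### Generators -/

namespace IsGenerator

variable {U : X.Opens} {e : Γ(M, U)}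

lemma res (he : IsGenerator M e) {V : X.Opens} (h : V ≤ U) :
    IsGenerator M (PrymEigen.res M h e) := by
  intro W hW
  simpa using he W (hW.trans h)

lemma exists_smul (he : IsGenerator M e) {V : X.Opens} (h : V ≤ U) (s : Γ(M, V)) :
    ∃ f : Γ(X, V), s = f • PrymEigen.res M h e := by
  obtain ⟨f, hf⟩ := (he V h).2 s
  exact ⟨f, hf.symm⟩

lemma exists_smul' (he : IsGenerator M e) (s : Γ(M, U)) : ∃ f : Γ(X, U), s = f • e := by
  simpa using he.exists_smul le_rfl s

lemma smul_injective (he : IsGenerator M e) {V : X.Opens} (h : V ≤ U) {f g : Γ(X, V)}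
    (hfg : f • PrymEigen.res M h e = g • PrymEigen.res M h e) : f = g :=
  (he V h).1 hfg

lemma smul_injective' (he : IsGenerator M e) {f g : Γ(X, U)} (hfg : f • e = g • e) : f = g :=
  he.smul_injective le_rfl (by simpa using hfg)

lemma unit_smul (he : IsGenerator M e) {u : Γ(X, U)} (hu : IsUnit u) : IsGenerator M (u • e) := by
  intro V h
  obtain ⟨v, hv⟩ := hu.map (fres h)
  have : (fun f : Γ(X, V) => f • PrymEigen.res M h (u • e)) =
      (fun f : Γ(X, V) => f • PrymEigen.res M h e) ∘ (fun f => f * v) := by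
    funext f
    simp [hv, mul_smul]
  rw [this]
  exact (he V h).comp (Units.mulRight_bijective v)

lemma isUnit_of_smul (he : IsGenerator M e) {u : Γ(X, U)} (hu : IsGenerator M (u • e)) :
    IsUnit u := by
  obtain ⟨v, hv⟩ := hu.exists_smul' e
  have : (1 : Γ(X, U)) = v * u := he.smul_injective' (by rw [mul_smul, ← hv, one_smul])
  exact IsUnit.of_mul_eq_one v (by rw [mul_comm, ← this])

lemma of_locally {U : X.Opens} (e : Γ(M, U)) (h : ∀ x ∈ U, ∃ (V : X.Opens) (hV : V ≤ U), x ∈ V ∧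
    IsGenerator M (PrymEigen.res M hV e)) : IsGenerator M e := by
  intro W hW
  constructor
  · intro f g hfg
    refine fun_ext _ _ fun x hx => ?_
    obtain ⟨V, hV, hxV, hg⟩ := h x (hW hx)
    refine ⟨W ⊓ V, inf_le_left, ⟨hx, hxV⟩, hg.smul_injective inf_le_right ?_⟩
    have := congrArg (PrymEigen.res M (inf_le_left : W ⊓ V ≤ W)) hfg
    simpa using this
  · intro s
    obtain ⟨f, hf⟩ := exists_fun_glue (U := W)
      (fun V f => ∃ (h1 : V ≤ W), f • PrymEigen.res M (h1.trans hW) e = PrymEigen.res M h1 s ∧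
        ∃ (V' : X.Opens) (h2 : V' ≤ U), V ≤ V' ∧ IsGenerator M (PrymEigen.res M h2 e))
      (by
        rintro V V' hV f - ⟨h1, h2, V₁, h3, h4, h5⟩
        refine ⟨hV.trans h1, ?_, V₁, h3, hV.trans h4, h5⟩
        have := congrArg (PrymEigen.res M hV) h2
        simpa using this)
      (by
        rintro V - f g ⟨h1, h2, V₁, h3, h4, h5⟩ ⟨_, h2', _⟩
        exact h5.smul_injective h4 (by simpa using h2.trans h2'.symm))
      (by
        intro x hx
        obtain ⟨V, hV, hxV, hg⟩ := h x (hW hx)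
        obtain ⟨f, hf⟩ := hg.exists_smul (inf_le_right : W ⊓ V ≤ V)
          (PrymEigen.res M (inf_le_left : W ⊓ V ≤ W) s)
        exact ⟨W ⊓ V, inf_le_left, ⟨hx, hxV⟩, f, inf_le_left, by simpa using hf.symm, V, hV,
          inf_le_right, hg⟩)
    refine ⟨f, mod_ext _ _ fun x hx => ?_⟩
    obtain ⟨V, hV, hxV, hg⟩ := h x (hW hx)
    obtain ⟨f', hf'⟩ := hg.exists_smul (inf_le_right : W ⊓ V ≤ V)
      (PrymEigen.res M (inf_le_left : W ⊓ V ≤ W) s)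
    refine ⟨W ⊓ V, inf_le_left, ⟨hx, hxV⟩, ?_⟩
    have := hf (W ⊓ V) inf_le_left f' ⟨inf_le_left, by simpa using hf'.symm, V, hV,
          inf_le_right, hg⟩
    simp [this, hf']

lemma map_iso (he : IsGenerator M e) (α : M ≅ M') : IsGenerator M' (α.hom.app U e) := by
  intro V h
  have : (fun f : Γ(X, V) => f • PrymEigen.res M' h (α.hom.app U e)) =
      (fun s => α.hom.app V s) ∘ (fun f : Γ(X, V) => f • PrymEigen.res M h e) := by
    funext f
    simp [← app_res]
  rw [this]
  refine Function.Bijective.comp ?_ (he V h)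
  exact ConcreteCategory.bijective_of_isIso (α.hom.app V)

lemma of_map_iso {e : Γ(M, U)} (α : M ≅ M') (he : IsGenerator M' (α.hom.app U e)) :
    IsGenerator M e := by
  have := he.map_iso α.symm
  have h2 : α.symm.hom.app U (α.hom.app U e) = e := by
    have := congrArg (fun β : M ⟶ M => β.app U) α.hom_inv_id
    exact ConcreteCategory.congr_hom this e
  rwa [h2] at this

end IsGenerator

/-! ### Vanishing of sections -/

lemma vanishesAt_res_iff {U V : X.Opens} (h : V ≤ U) (s : Γ(M, U)) {p : X} (hp : p ∈ V) :
    VanishesAt M (res M h s) p ↔ VanishesAt M s p := by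
  constructor
  · rintro ⟨W, hW, hpW, hs⟩
    exact ⟨W, hW.trans h, hpW, by simpa using hs⟩
  · rintro ⟨W, hW, hpW, hs⟩
    refine ⟨W ⊓ V, inf_le_right, ⟨hpW, hp⟩, ?_⟩
    have : res M (inf_le_right : W ⊓ V ≤ V) (res M h s) =
      res M (inf_le_left : W ⊓ V ≤ W) (res M hW s) := by simp
    rw [this]
    refine Submodule.smul_induction_on hs ?_ ?_
    · intro r hr n _
      rw [res_smul]
      exact Submodule.smul_mem_smul ((fres_mem_idealAt _ _ _).2 hr) trivial
    · intro x y hx hy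
      rw [map_add]
      exact add_mem hx hy

lemma IsGenerator.vanishesAt_smul_iff {U : X.Opens} {e : Γ(M, U)} (he : IsGenerator M e)
    (f : Γ(X, U)) {p : X} (hp : p ∈ U) : VanishesAt M (f • e) p ↔ f ∈ idealAt U p hp := by
  constructor
  · rintro ⟨W, hW, hpW, hs⟩
    have key : ∀ s ∈ idealAt W p hpW • (⊤ : Submodule Γ(X, W) Γ(M, W)),
        ∃ g ∈ idealAt W p hpW, s = g • PrymEigen.res M hW e := by
      intro s hs
      refine Submodule.smul_induction_on hs ?_ ?_
      · intro r hr n _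
        obtain ⟨g, rfl⟩ := he.exists_smul hW n
        exact ⟨r * g, Ideal.mul_mem_right _ _ hr, by rw [mul_smul]⟩
      · rintro x y ⟨g, hg, rfl⟩ ⟨g', hg', rfl⟩
        exact ⟨g + g', add_mem hg hg', by rw [add_smul]⟩
    obtain ⟨g, hg, e1⟩ := key _ hs
    rw [res_smul] at e1
    rw [← he.smul_injective hW e1] at hg
    exact (fres_mem_idealAt _ _ _).1 hg
  · intro hf
    exact ⟨U, le_rfl, hp, by
      rw [res_self]; exact Submodule.smul_mem_smul hf trivial⟩

end Sections


/-! ### Morphisms of sheaves of modules given on sections -/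

section MkHom

variable {X Y Z : Scheme.{0}}

/-- A morphism of sheaves of modules given by compatible linear maps on sections. -/
noncomputable def mkHom (F G : X.Modules) (f : ∀ U : X.Opens, Γ(F, U) →+ Γ(G, U))
    (hres : ∀ (U V : X.Opens) (h : V ≤ U) (s : Γ(F, U)), f V (res F h s) = res G h (f U s))
    (hsmul : ∀ (U : X.Opens) (r : Γ(X, U)) (s : Γ(F, U)), f U (r • s) = r • f U s) : F ⟶ G :=
  ⟨PresheafOfModules.homMk
    { app := fun U => AddCommGrpCat.ofHom (f U.unop)
      naturality := fun U V i => by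
        ext s
        exact hres U.unop V.unop i.unop.le s }
    (fun U r m => hsmul U.unop r m)⟩

lemma hom_ext' {F G : X.Modules} {f g : F ⟶ G} (h : ∀ U (s : Γ(F, U)), f.app U s = g.app U s) :
    f = g := by
  ext U s
  exact h U s

lemma app_neg' {F G : X.Modules} (f : F ⟶ G) (U : X.Opens) (s : Γ(F, U)) :
    (-f).app U s = - f.app U s := rfl

/-- A bijective morphism of sheaves of modules is an isomorphism. -/
lemma isIso_of_bijective {F G : X.Modules} (f : F ⟶ G)
    (h : ∀ U, Function.Bijective (f.app U)) : IsIso f := by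
  rw [Scheme.Modules.Hom.isIso_iff_isIso_app]
  intro U
  exact (ConcreteCategory.isIso_iff_bijective _).2 (h U)

/-- The sheaf of submodules given by a local condition on sections. -/
noncomputable def subsheaf (F : X.Modules) (S : ∀ U : X.Opens, Submodule Γ(X, U) Γ(F, U))
    (hres : ∀ (U V : X.Opens) (h : V ≤ U) (s : Γ(F, U)), s ∈ S U → res F h s ∈ S V)
    (hloc : ∀ (U : X.Opens) (s : Γ(F, U)),
      (∀ x ∈ U, ∃ (V : X.Opens) (h : V ≤ U), x ∈ V ∧ res F h s ∈ S V) → s ∈ S U) : X.Modules where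
  val := PresheafOfModules.Submodule.toPresheafOfModules (M := F.val)
    { obj := fun U => S U.unop
      map := fun {U V} i s hs => hres U.unop V.unop i.unop.le s hs }
  isSheaf := by
    change TopCat.Presheaf.IsSheaf (X := X) _
    rw [TopCat.Presheaf.isSheaf_iff_isSheafUniqueGluing]
    intro ι U sf hsf
    have hc : TopCat.Presheaf.IsCompatible F.presheaf U (fun i => (sf i).1) := fun i j =>
      congrArg Subtype.val (hsf i j)
    obtain ⟨t, ht, hu⟩ := TopCat.Sheaf.existsUnique_gluing ⟨F.presheaf, F.isSheaf⟩ U _ hc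
    have hmem : t ∈ S (iSup U) := by
      refine hloc _ _ fun x hx => ?_
      obtain ⟨i, hi⟩ := Opens.mem_iSup.1 hx
      refine ⟨U i, le_iSup U i, hi, ?_⟩
      have : res F (le_iSup U i) t = (sf i).1 := ht i
      rw [this]
      exact (sf i).2
    refine ⟨⟨t, hmem⟩, fun i => Subtype.ext (ht i), fun t' ht' => Subtype.ext (hu t'.1 fun i => ?_)⟩
    exact congrArg Subtype.val (ht' i)

section

variable (F : X.Modules) (S : ∀ U : X.Opens, Submodule Γ(X, U) Γ(F, U))
    (hres : ∀ (U V : X.Opens) (h : V ≤ U) (s : Γ(F, U)), s ∈ S U → res F h s ∈ S V)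
    (hloc : ∀ (U : X.Opens) (s : Γ(F, U)),
      (∀ x ∈ U, ∃ (V : X.Opens) (h : V ≤ U), x ∈ V ∧ res F h s ∈ S V) → s ∈ S U)

/-- The inclusion of a sheaf of submodules. -/
noncomputable def subsheafι : subsheaf F S hres hloc ⟶ F :=
  ⟨PresheafOfModules.Submodule.ι (M := F.val)
    { obj := fun U => S U.unop
      map := fun {U V} i s hs => hres U.unop V.unop i.unop.le s hs }⟩

lemma subsheafι_injective (U : X.Opens) :
    Function.Injective ((subsheafι F S hres hloc).app U) :=
  fun _ _ h => Subtype.ext h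

lemma mem_range_subsheafι (U : X.Opens) (s : Γ(F, U)) :
    s ∈ Set.range ((subsheafι F S hres hloc).app U) ↔ s ∈ S U :=
  ⟨fun ⟨t, ht⟩ => ht ▸ t.2, fun h => ⟨⟨s, h⟩, rfl⟩⟩

end

/-! ### Local triviality -/

variable (X) in
/-- The structure sheaf as a module. -/
noncomputable abbrev unitMod : X.Modules := SheafOfModules.unit X.ringCatSheaf

/-- A function, as a section of the structure sheaf considered as a module. -/
def unitSec {U : X.Opens} (f : Γ(X, U)) :
    Γ((unitMod X), U) := f

lemma smul_unitSec {U : X.Opens} (r f : Γ(X, U)) : r • unitSec f = unitSec (r * f) := rfl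

lemma res_unitSec {U V : X.Opens} (h : V ≤ U) (f : Γ(X, U)) :
    res (unitMod X) h (unitSec f) = unitSec (fres h f) := rfl

lemma isGenerator_unitSec_one (U : X.Opens) :
    IsGenerator (unitMod X) (unitSec (1 : Γ(X, U))) := by
  intro V h
  have : (fun f : Γ(X, V) => f • res (unitMod X) h
      (unitSec (1 : Γ(X, U)))) = fun f => unitSec f := by
    funext f
    rw [res_unitSec, map_one, smul_unitSec, mul_one]
  rw [this]
  exact Function.bijective_id

/-- The morphism from the structure sheaf given by a global section. -/
noncomputable def ofSection {M : X.Modules} (e : Γ(M, ⊤)) : unitMod X ⟶ M :=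
  mkHom _ M (fun U =>
      { toFun := fun r => (show Γ(X, U) from r) • res M le_top e
        map_zero' := zero_smul Γ(X, U) _
        map_add' := fun a b => add_smul (R := Γ(X, U)) a b _ })
      (fun U V h r => by
        have h1 := res_smul (M := M) h (show Γ(X, U) from r) (res M le_top e)
        rw [res_res] at h1
        exact h1.symm)
      (fun U r s => mul_smul (α := Γ(X, U)) r s _)

lemma ofSection_app {M : X.Modules} (e : Γ(M, ⊤)) (U : X.Opens) (r : Γ(X, U)) :
    (ofSection e).app U (unitSec r) = r • res M le_top e := rfl

lemma unitMod_hom_ext {M : X.Modules} {f g : unitMod X ⟶ M}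
    (h : f.app ⊤ (unitSec 1) = g.app ⊤ (unitSec 1)) : f = g := by
  have key : ∀ (f : unitMod X ⟶ M) U (s : Γ(unitMod X, U)), f.app U s =
      (show Γ(X, U) from s) • res M le_top (f.app ⊤ (unitSec 1)) := by
    intro f U s
    have h1 : s = (show Γ(X, U) from s) • res (unitMod X) le_top (unitSec (1 : Γ(X, ⊤))) := by
      rw [res_unitSec, map_one, smul_unitSec, mul_one]; rfl
    conv_lhs => rw [h1]
    rw [← app_res, Scheme.Modules.Hom.app_smul]
  refine hom_ext' fun U s => ?_
  rw [key f, key g, h]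

lemma exists_unit_iso {M : X.Modules} {e : Γ(M, ⊤)} (he : IsGenerator M e) :
    ∃ α : unitMod X ≅ M, α.hom.app ⊤ (unitSec 1) = e := by
  have : IsIso (ofSection e) := isIso_of_bijective _ fun U => he U le_top
  refine ⟨asIso (ofSection e), ?_⟩
  change (ofSection e).app ⊤ (unitSec 1) = e
  rw [ofSection_app]
  simp

lemma isGenerator_restrict_iff {M : Y.Modules} (f : X ⟶ Y) [IsOpenImmersion f] {W : X.Opens}
    (e : Γ(M, f ''ᵁ W)) :
    IsGenerator (M.restrict f) (U := W) e ↔ IsGenerator M e := by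
  have key : ∀ (V : X.Opens) (h : V ≤ W), (fun r : Γ(X, V) => (r • res (M.restrict f) h e :
      Γ(M.restrict f, V))) = (fun r : Γ(Y, f ''ᵁ V) => r • res M (f.image_mono h) e) ∘
        (f.appIso V).inv := fun V h => rfl
  have hb : ∀ V : X.Opens, Function.Bijective (f.appIso V).inv := fun V =>
    ConcreteCategory.bijective_of_isIso _
  constructor
  · intro he V hV
    obtain ⟨V', rfl⟩ : ∃ V' : X.Opens, f ''ᵁ V' = V := by
      refine ⟨f ⁻¹ᵁ V, ?_⟩
      rw [Scheme.Hom.image_preimage_eq_opensRange_inf, inf_eq_right]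
      exact hV.trans (f.image_le_opensRange W)
    have hV' : V' ≤ W := by
      have := f.preimage_mono hV
      rwa [f.preimage_image_eq, f.preimage_image_eq] at this
    have h1 := he V' hV'
    rw [key V' hV'] at h1
    exact (Function.Bijective.of_comp_iff _ (hb V')).1 h1
  · intro he V hV
    rw [key V hV]
    exact (he _ _).comp (hb V)

lemma isGenerator_of_eq {M : X.Modules} {U V : X.Opens} (h : U = V) {e : Γ(M, U)}
    (he : IsGenerator M (res M h.ge e)) : IsGenerator M e := by
  subst h
  simpa using he

lemma isLineBundle_iff {M : X.Modules} :
    IsLineBundle M ↔ ∀ x : X, ∃ (U : X.Opens) (e : Γ(M, U)), x ∈ U ∧ IsGenerator M e := by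
  refine forall_congr' fun x => ⟨?_, ?_⟩
  · rintro ⟨U, hx, ⟨α⟩⟩
    have h1 := (isGenerator_unitSec_one (X := (U : Scheme.{0})) ⊤).map_iso α.symm
    exact ⟨U.ι ''ᵁ ⊤, α.symm.hom.app ⊤ (unitSec 1), by simpa using hx,
      (isGenerator_restrict_iff U.ι _).1 h1⟩
  · rintro ⟨U, e, hx, he⟩
    have hU : U.ι ''ᵁ ⊤ = U := by simp
    have h1 := (isGenerator_restrict_iff (M := M) U.ι (W := ⊤) (res M hU.le e)).2 (he.res hU.le)
    obtain ⟨α, -⟩ := exists_unit_iso h1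
    exact ⟨U, hx, ⟨α.symm⟩⟩

end MkHom

/-! ### Pullback of sections -/

section PullSec

variable {X Y Z : Scheme.{0}}

/-- The pullback of a section, restricted to a smaller open set. -/
noncomputable def psec (f : X ⟶ Y) (M : Y.Modules) {U : Y.Opens} {V : X.Opens}
    (h : V ≤ f ⁻¹ᵁ U) : Γ(M, U) →+ Γ((Scheme.Modules.pullback f).obj M, V) :=
  (res _ h).comp (pullSec f M U)

lemma pullSec_eq_psec (f : X ⟶ Y) (M : Y.Modules) {U : Y.Opens} (s : Γ(M, U)) :
    pullSec f M U s = psec f M le_rfl s := by simp [psec]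

lemma pullSec_res (f : X ⟶ Y) (M : Y.Modules) {U V : Y.Opens} (h : V ≤ U) (s : Γ(M, U)) :
    pullSec f M V (res M h s) = res _ (f.preimage_mono h) (pullSec f M U s) :=
  app_res ((Scheme.Modules.pullbackPushforwardAdjunction f).unit.app M) h s

lemma pullSec_smul (f : X ⟶ Y) (M : Y.Modules) {U : Y.Opens} (r : Γ(Y, U)) (s : Γ(M, U)) :
    pullSec f M U (r • s) = f.app U r • pullSec f M U s :=
  ((Scheme.Modules.pullbackPushforwardAdjunction f).unit.app M).app_smul r s

@[simp] lemma res_psec (f : X ⟶ Y) (M : Y.Modules) {U : Y.Opens} {V W : X.Opens}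
    (h : V ≤ f ⁻¹ᵁ U) (h' : W ≤ V) (s : Γ(M, U)) :
    res _ h' (psec f M h s) = psec f M (h'.trans h) s := by
  simp [psec]

@[simp] lemma psec_res (f : X ⟶ Y) (M : Y.Modules) {U V : Y.Opens} {W : X.Opens}
    (h : V ≤ U) (h' : W ≤ f ⁻¹ᵁ V) (s : Γ(M, U)) :
    psec f M h' (res M h s) = psec f M (h'.trans (f.preimage_mono h)) s := by
  simp [psec, pullSec_res]

lemma psec_smul (f : X ⟶ Y) (M : Y.Modules) {U : Y.Opens} {V : X.Opens}
    (h : V ≤ f ⁻¹ᵁ U) (r : Γ(Y, U)) (s : Γ(M, U)) :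
    psec f M h (r • s) = pb f h r • psec f M h s := by
  simp only [psec, AddMonoidHom.comp_apply, pullSec_smul, res_smul, app_eq_pb, fres_pb]

lemma pullback_map_pullSec (f : X ⟶ Y) {M M' : Y.Modules} (α : M ⟶ M') {U : Y.Opens}
    (s : Γ(M, U)) :
    ((Scheme.Modules.pullback f).map α).app (f ⁻¹ᵁ U) (pullSec f M U s) =
      pullSec f M' U (α.app U s) := by
  have := (Scheme.Modules.pullbackPushforwardAdjunction f).unit.naturality α
  have h2 := congrArg (fun β => Scheme.Modules.Hom.app β U) this
  exact (ConcreteCategory.congr_hom h2 s).symm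

lemma pullSec_comp (f : X ⟶ Y) (g : Y ⟶ Z) (M : Z.Modules) {U : Z.Opens} (s : Γ(M, U)) :
    ((Scheme.Modules.pullbackComp f g).inv.app M).app ((f ≫ g) ⁻¹ᵁ U) (pullSec (f ≫ g) M U s) =
      pullSec f _ (g ⁻¹ᵁ U) (pullSec g M U s) := by
  have h1 := unit_conjugateEquiv
    ((Scheme.Modules.pullbackPushforwardAdjunction g).comp
      (Scheme.Modules.pullbackPushforwardAdjunction f))
    (Scheme.Modules.pullbackPushforwardAdjunction (f ≫ g)) (Scheme.Modules.pullbackComp f g).inv M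
  rw [Scheme.Modules.conjugateEquiv_pullbackComp_inv] at h1
  have h2 := congrArg (fun β => Scheme.Modules.Hom.app β U) h1
  exact (ConcreteCategory.congr_hom h2 s).symm

lemma restrictIso_pullSec (f : X ⟶ Y) [IsOpenImmersion f] (M : Y.Modules) {U : Y.Opens}
    (s : Γ(M, U)) :
    ((Scheme.Modules.restrictFunctorIsoPullback f).hom.app M).app (f ⁻¹ᵁ U)
      (res M (f.image_preimage_le U) s : Γ(M, f ''ᵁ (f ⁻¹ᵁ U))) = pullSec f M U s := by
  have h1 := Adjunction.unit_leftAdjointUniq_hom_app (Scheme.Modules.restrictAdjunction f)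
    (Scheme.Modules.pullbackPushforwardAdjunction f) M
  have h2 := congrArg (fun β => Scheme.Modules.Hom.app β U) h1
  exact ConcreteCategory.congr_hom h2 s

lemma isGenerator_pullSec_iff_of_isOpenImmersion (f : X ⟶ Y) [IsOpenImmersion f] (M : Y.Modules)
    {U : Y.Opens} (s : Γ(M, U)) :
    IsGenerator _ (pullSec f M U s) ↔ IsGenerator M (res M (f.image_preimage_le U) s) := by
  rw [← restrictIso_pullSec, ← isGenerator_restrict_iff f]
  exact ⟨fun h => h.of_map_iso ((Scheme.Modules.restrictFunctorIsoPullback f).app M),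
    fun h => h.map_iso ((Scheme.Modules.restrictFunctorIsoPullback f).app M)⟩

lemma pullback_hom_ext (f : X ⟶ Y) {M : Y.Modules} {G : X.Modules}
    {α β : (Scheme.Modules.pullback f).obj M ⟶ G}
    (h : ∀ U (s : Γ(M, U)), α.app _ (pullSec f M U s) = β.app _ (pullSec f M U s)) : α = β := by
  apply ((Scheme.Modules.pullbackPushforwardAdjunction f).homEquiv _ _).injective
  rw [Adjunction.homEquiv_unit, Adjunction.homEquiv_unit]
  exact hom_ext' h

/-- The morphism on the pullback adjoint to a morphism to the pushforward. -/
noncomputable def adj (f : X ⟶ Y) {M : Y.Modules} {G : X.Modules}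
    (a : M ⟶ (Scheme.Modules.pushforward f).obj G) : (Scheme.Modules.pullback f).obj M ⟶ G :=
  ((Scheme.Modules.pullbackPushforwardAdjunction f).homEquiv _ _).symm a

lemma adj_pullSec (f : X ⟶ Y) {M : Y.Modules} {G : X.Modules}
    (a : M ⟶ (Scheme.Modules.pushforward f).obj G) {U : Y.Opens} (s : Γ(M, U)) :
    (adj f a).app (f ⁻¹ᵁ U) (pullSec f M U s) = a.app U s := by
  have h1 := ((Scheme.Modules.pullbackPushforwardAdjunction f).homEquiv M G).apply_symm_apply a
  rw [Adjunction.homEquiv_unit] at h1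
  have h2 := congrArg (fun γ : M ⟶ (Scheme.Modules.pushforward f).obj G =>
    Scheme.Modules.Hom.app γ U) h1
  exact ConcreteCategory.congr_hom h2 s

/-- The canonical morphism from the structure sheaf to the pushforward of the structure sheaf. -/
noncomputable def unitToPushforward (f : X ⟶ Y) :
    unitMod Y ⟶ (Scheme.Modules.pushforward f).obj (unitMod X) :=
  mkHom _ _ (fun U => (f.app U).hom.toAddMonoidHom)
    (fun U V h r => by
      have h1 : f.app V (fres h (show Γ(Y, U) from r)) =
          fres (f.preimage_mono h) (f.app U (show Γ(Y, U) from r)) := by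
        rw [app_eq_pb, app_eq_pb, pb_fres, fres_pb]
      exact h1)
    (fun U r s => map_mul (f.app U).hom r s)

lemma unitToPushforward_app (f : X ⟶ Y) (U : Y.Opens) (r : Γ(Y, U)) :
    (unitToPushforward f).app U (unitSec r) = unitSec (f.app U r) := rfl

lemma isGenerator_pullSec_unit (f : X ⟶ Y) :
    IsGenerator _ (pullSec f (unitMod Y) ⊤ (unitSec 1)) := by
  let e : Γ((Scheme.Modules.pullback f).obj (unitMod Y), ⊤) := pullSec f (unitMod Y) ⊤ (unitSec 1)
  let γ := ofSection e
  let δ := adj f (unitToPushforward f)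
  have h1 : δ.app ⊤ e = unitSec 1 := by
    have := adj_pullSec f (unitToPushforward f) (unitSec (1 : Γ(Y, ⊤)))
    rw [unitToPushforward_app, map_one] at this
    exact this
  have h2 : γ.app ⊤ (unitSec 1) = e := by rw [ofSection_app, res_self, one_smul]
  have h3 : γ ≫ δ = 𝟙 _ := by
    refine unitMod_hom_ext ?_
    change δ.app ⊤ (γ.app ⊤ (unitSec 1)) = unitSec 1
    rw [h2, h1]
  have h4 : δ ≫ γ = 𝟙 _ := by
    apply ((Scheme.Modules.pullbackPushforwardAdjunction f).homEquiv _ _).injective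
    rw [Adjunction.homEquiv_unit, Adjunction.homEquiv_unit]
    refine unitMod_hom_ext ?_
    change γ.app ⊤ (δ.app ⊤ e) = e
    rw [h1, h2]
  have h5 := (isGenerator_unitSec_one (X := X) ⊤).map_iso ⟨γ, δ, h3, h4⟩
  have h6 : IsGenerator _ e := by rw [← h2]; exact h5
  exact h6

lemma isGenerator_pullSec_of_eq_top (f : X ⟶ Y) (M : Y.Modules) {U : Y.Opens} (hU : U = ⊤)
    {e : Γ(M, U)} (he : IsGenerator M e) : IsGenerator _ (pullSec f M U e) := by
  subst hU
  obtain ⟨α, rfl⟩ := exists_unit_iso he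
  rw [← pullback_map_pullSec]
  exact (isGenerator_pullSec_unit f).map_iso ((Scheme.Modules.pullback f).mapIso α)

lemma isGenerator_pullSec_comp_iff (f : X ⟶ Y) (g : Y ⟶ Z) (M : Z.Modules) {U : Z.Opens}
    (s : Γ(M, U)) : IsGenerator _ (pullSec (f ≫ g) M U s) ↔
      IsGenerator _ (pullSec f _ (g ⁻¹ᵁ U) (pullSec g M U s)) := by
  rw [← pullSec_comp]
  exact ⟨fun h => h.map_iso ((Scheme.Modules.pullbackComp f g).symm.app M),
    fun h => h.of_map_iso ((Scheme.Modules.pullbackComp f g).symm.app M)⟩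

/-- The pullback of a generator is a generator. -/
theorem IsGenerator.pullSec (f : X ⟶ Y) {M : Y.Modules} {U : Y.Opens} {e : Γ(M, U)}
    (he : IsGenerator M e) : IsGenerator _ (pullSec f M U e) := by
  have h1 : IsGenerator _ (PrymEigen.pullSec U.ι M U e) :=
    (isGenerator_pullSec_iff_of_isOpenImmersion _ _ _).2 (he.res _)
  have h2 : IsGenerator _ (PrymEigen.pullSec (f ∣_ U) _ (U.ι ⁻¹ᵁ U) (PrymEigen.pullSec U.ι M U e)) :=
    isGenerator_pullSec_of_eq_top _ _ (by simp) h1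
  rw [← isGenerator_pullSec_comp_iff] at h2
  have h3 : ∀ (a b : ((f ⁻¹ᵁ U : X.Opens) : Scheme.{0}) ⟶ Y), a = b →
      IsGenerator _ (PrymEigen.pullSec a M U e) → IsGenerator _ (PrymEigen.pullSec b M U e) := by
    rintro a b rfl h
    exact h
  have h4 := h3 _ _ (morphismRestrict_ι f U) h2
  rw [isGenerator_pullSec_comp_iff, isGenerator_pullSec_iff_of_isOpenImmersion] at h4
  have h5 : f ⁻¹ᵁ U = (f ⁻¹ᵁ U).ι ''ᵁ ((f ⁻¹ᵁ U).ι ⁻¹ᵁ (f ⁻¹ᵁ U)) := by simp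
  exact isGenerator_of_eq h5 h4

lemma IsGenerator.psec (f : X ⟶ Y) {M : Y.Modules} {U : Y.Opens} {V : X.Opens} {e : Γ(M, U)}
    (he : IsGenerator M e) (h : V ≤ f ⁻¹ᵁ U) : IsGenerator _ (psec f M h e) :=
  (he.pullSec f).res h

end PullSec


section Tensor

variable {X : Scheme.{0}}

/-- The presheaf tensor product. -/
noncomputable abbrev preTensor (M N : X.Modules) :
    PresheafOfModules (X.presheaf ⋙ forget₂ CommRingCat RingCat) :=
  PresheafOfModules.Monoidal.tensorObj (R := X.presheaf) M.val N.val

/-- The sheafification map. -/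
noncomputable def toTensor (M N : X.Modules) (U : X.Opens) :
    TensorProduct Γ(X, U) Γ(M, U) Γ(N, U) →+ Γ(tensor M N, U) :=
  ((CategoryTheory.toSheafify (Opens.grothendieckTopology X)
    (preTensor M N).presheaf).app (Opposite.op U)).hom

lemma toTensor_smul (M N : X.Modules) {U : X.Opens} (r : Γ(X, U))
    (t : TensorProduct Γ(X, U) Γ(M, U) Γ(N, U)) :
    toTensor M N U (r • t) = r • toTensor M N U t :=
  (((PresheafOfModules.sheafificationAdjunction (𝟙 X.ringCatSheaf.obj)).unit.app
    (preTensor M N)).app (Opposite.op U)).hom.map_smul r t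

lemma res_toTensor (M N : X.Modules) {U V : X.Opens} (h : V ≤ U)
    (t : TensorProduct Γ(X, U) Γ(M, U) Γ(N, U)) :
    res _ h (toTensor M N U t) =
      toTensor M N V ((preTensor M N).presheaf.map (homOfLE h).op t) :=
  (ConcreteCategory.congr_hom ((CategoryTheory.toSheafify (Opens.grothendieckTopology X)
    (preTensor M N).presheaf).naturality (homOfLE h).op) t).symm

lemma preTensor_map_tmul (M N : X.Modules) {U V : X.Opens} (h : V ≤ U) (m : Γ(M, U)) (n : Γ(N, U)) :
    (preTensor M N).presheaf.map (homOfLE h).op (TensorProduct.tmul Γ(X, U) m n) =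
      (TensorProduct.tmul Γ(X, V) (res M h m) (res N h n) : TensorProduct Γ(X, V) Γ(M, V) Γ(N, V)) :=
  rfl

lemma toTensor_locally_injective (M N : X.Modules) {U : X.Opens}
    (t : TensorProduct Γ(X, U) Γ(M, U) Γ(N, U)) (ht : toTensor M N U t = 0) (x : X) (hx : x ∈ U) :
    ∃ (V : X.Opens) (h : V ≤ U), x ∈ V ∧
      (preTensor M N).presheaf.map (homOfLE h).op t = 0 := by
  have h1 := Presheaf.equalizerSieve_mem (Opens.grothendieckTopology X)
    (CategoryTheory.toSheafify (Opens.grothendieckTopology X) (preTensor M N).presheaf)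
    (X := Opposite.op U) t 0 (by rw [map_zero]; exact ht)
  obtain ⟨V, i, hi, hxV⟩ := h1 x hx
  refine ⟨V, i.le, hxV, ?_⟩
  have h2 : (preTensor M N).presheaf.map i.op t = (preTensor M N).presheaf.map i.op 0 := hi
  rw [map_zero] at h2
  exact h2

lemma toTensor_locally_surjective (M N : X.Modules) {U : X.Opens} (s : Γ(tensor M N, U)) (x : X)
    (hx : x ∈ U) : ∃ (V : X.Opens) (h : V ≤ U), x ∈ V ∧
      ∃ t : TensorProduct Γ(X, V) Γ(M, V) Γ(N, V), toTensor M N V t = res _ h s := by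
  have h1 := Presheaf.imageSieve_mem (Opens.grothendieckTopology X)
    (CategoryTheory.toSheafify (Opens.grothendieckTopology X) (preTensor M N).presheaf)
    (U := Opposite.op U) s
  obtain ⟨V, i, ⟨t, ht⟩, hxV⟩ := h1 x hx
  exact ⟨V, i.le, hxV, t, ht⟩

/-- The product of two sections, as a section of the tensor product. -/
noncomputable def tmulSec {M N : X.Modules} {U : X.Opens} (m : Γ(M, U)) (n : Γ(N, U)) :
    Γ(tensor M N, U) :=
  toTensor M N U (TensorProduct.tmul Γ(X, U) m n)

lemma res_tmulSec {M N : X.Modules} {U V : X.Opens} (h : V ≤ U) (m : Γ(M, U)) (n : Γ(N, U)) :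
    res _ h (tmulSec m n) = tmulSec (res M h m) (res N h n) := by
  rw [tmulSec, res_toTensor]; rfl

lemma tmulSec_smul_smul {M N : X.Modules} {U : X.Opens} (f g : Γ(X, U)) (m : Γ(M, U))
    (n : Γ(N, U)) : tmulSec (f • m) (g • n) = (f * g) • tmulSec m n := by
  rw [tmulSec, tmulSec, ← toTensor_smul, TensorProduct.smul_tmul_smul]

lemma IsGenerator.exists_tmul {M N : X.Modules} {U : X.Opens} {m : Γ(M, U)} {n : Γ(N, U)}
    (hm : IsGenerator M m) (hn : IsGenerator N n) (t : TensorProduct Γ(X, U) Γ(M, U) Γ(N, U)) :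
    ∃ f : Γ(X, U), t = f • TensorProduct.tmul Γ(X, U) m n := by
  induction t using TensorProduct.induction_on with
  | zero => exact ⟨0, by simp⟩
  | tmul a b =>
    obtain ⟨f, rfl⟩ := hm.exists_smul' a
    obtain ⟨g, rfl⟩ := hn.exists_smul' b
    exact ⟨f * g, by rw [TensorProduct.smul_tmul_smul]⟩
  | add a b ha hb =>
    obtain ⟨f, rfl⟩ := ha
    obtain ⟨g, rfl⟩ := hb
    exact ⟨f + g, by rw [add_smul]⟩

lemma IsGenerator.smul_tmul_eq_zero {M N : X.Modules} {U : X.Opens} {m : Γ(M, U)} {n : Γ(N, U)}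
    (hm : IsGenerator M m) (hn : IsGenerator N n) {f : Γ(X, U)}
    (h : f • TensorProduct.tmul Γ(X, U) m n = 0) : f = 0 := by
  have hm' := hm U le_rfl
  have hn' := hn U le_rfl
  simp only [PrymEigen.res_self] at hm' hn'
  let α : Γ(X, U) ≃ₗ[Γ(X, U)] Γ(M, U) := LinearEquiv.ofBijective (LinearMap.toSpanSingleton _ _ m) hm'
  let β : Γ(X, U) ≃ₗ[Γ(X, U)] Γ(N, U) := LinearEquiv.ofBijective (LinearMap.toSpanSingleton _ _ n) hn'
  have hα : α.symm m = 1 := by rw [LinearEquiv.symm_apply_eq]; exact (one_smul _ m).symm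
  have hβ : β.symm n = 1 := by rw [LinearEquiv.symm_apply_eq]; exact (one_smul _ n).symm
  have := congrArg ((TensorProduct.congr α.symm β.symm).trans (TensorProduct.lid _ _)) h
  simpa [hα, hβ] using this

theorem IsGenerator.tmulSec {M N : X.Modules} {U : X.Opens} {m : Γ(M, U)} {n : Γ(N, U)}
    (hm : IsGenerator M m) (hn : IsGenerator N n) : IsGenerator (tensor M N) (tmulSec m n) := by
  have hinj : ∀ (V : X.Opens) (h : V ≤ U) (f : Γ(X, V)),
      f • PrymEigen.res _ h (PrymEigen.tmulSec m n) = 0 → f = 0 := by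
    intro V h f hf
    rw [res_tmulSec, PrymEigen.tmulSec, ← toTensor_smul] at hf
    refine fun_ext _ _ fun x hx => ?_
    obtain ⟨W, hW, hxW, h1⟩ := toTensor_locally_injective M N _ hf x hx
    refine ⟨W, hW, hxW, ?_⟩
    rw [map_zero]
    refine ((hm.res h).res hW).smul_tmul_eq_zero ((hn.res h).res hW) ?_
    refine Eq.trans ?_ h1
    rw [TensorProduct.smul_tmul', TensorProduct.smul_tmul']
    refine Eq.trans ?_ (preTensor_map_tmul M N hW _ _).symm
    rw [res_smul]
  have hinj' : ∀ (V : X.Opens) (h : V ≤ U) (f g : Γ(X, V)),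
      f • PrymEigen.res _ h (PrymEigen.tmulSec m n) =
        g • PrymEigen.res _ h (PrymEigen.tmulSec m n) → f = g := by
    intro V h f g hfg
    exact sub_eq_zero.1 (hinj V h _ (by rw [sub_smul, hfg, sub_self]))
  intro V h
  refine ⟨fun f g hfg => hinj' V h f g hfg, fun s => ?_⟩
  have hloc : ∀ x ∈ V, ∃ (W : X.Opens) (hW : W ≤ V), x ∈ W ∧ ∃ f : Γ(X, W),
      f • PrymEigen.res _ (hW.trans h) (PrymEigen.tmulSec m n) = PrymEigen.res _ hW s := by
    intro x hx
    obtain ⟨W, hW, hxW, t, ht⟩ := toTensor_locally_surjective M N s x hx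
    obtain ⟨f, rfl⟩ := (hm.res (hW.trans h)).exists_tmul (hn.res (hW.trans h)) t
    refine ⟨W, hW, hxW, f, ?_⟩
    rw [← ht, toTensor_smul, res_tmulSec]; rfl
  obtain ⟨f, hf⟩ := exists_fun_glue (U := V)
    (fun W f => ∃ hW : W ≤ V,
      f • PrymEigen.res _ (hW.trans h) (PrymEigen.tmulSec m n) = PrymEigen.res _ hW s)
    (by
      rintro W W' hW f - ⟨h1, h2⟩
      refine ⟨hW.trans h1, ?_⟩
      have := congrArg (PrymEigen.res _ hW) h2
      simpa using this)
    (by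
      rintro W hW f g ⟨_, h1⟩ ⟨_, h2⟩
      exact hinj' W (hW.trans h) f g (h1.trans h2.symm))
    (fun x hx => by
      obtain ⟨W, hW, hxW, f, hf⟩ := hloc x hx
      exact ⟨W, hW, hxW, f, hW, hf⟩)
  refine ⟨f, mod_ext _ _ fun x hx => ?_⟩
  obtain ⟨W, hW, hxW, g, hg⟩ := hloc x hx
  refine ⟨W, hW, hxW, ?_⟩
  rw [← hg, ← hf W hW g ⟨hW, hg⟩]
  simp

end Tensor

/-! ### Morphisms to a pushforward -/

section HomLE

variable {X Y Z : Scheme.{0}}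

/-- The map on sections given by a morphism to a pushforward, followed by restriction. -/
noncomputable def homLE {f : X ⟶ Y} {L : Y.Modules} {G : X.Modules}
    (a : L ⟶ (Scheme.Modules.pushforward f).obj G) {U : Y.Opens} {V : X.Opens} (h : V ≤ f ⁻¹ᵁ U) :
    Γ(L, U) →+ Γ(G, V) :=
  (res G h).comp (a.app U).hom

section

variable {f : X ⟶ Y} {L : Y.Modules} {G : X.Modules}
    (a : L ⟶ (Scheme.Modules.pushforward f).obj G)

lemma app_eq_homLE {U : Y.Opens} (s : Γ(L, U)) : a.app U s = homLE a le_rfl s :=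
  (res_self (M := G) le_rfl _).symm

@[simp] lemma res_homLE {U : Y.Opens} {V W : X.Opens} (h : V ≤ f ⁻¹ᵁ U) (h' : W ≤ V) (s : Γ(L, U)) :
    res G h' (homLE a h s) = homLE a (h'.trans h) s :=
  res_res (M := G) h h' _

@[simp] lemma homLE_res {U V : Y.Opens} {W : X.Opens} (h : V ≤ U) (h' : W ≤ f ⁻¹ᵁ V) (s : Γ(L, U)) :
    homLE a h' (res L h s) = homLE a (h'.trans (f.preimage_mono h)) s := by
  have h1 : a.app V (res L h s) = res G (f.preimage_mono h) (a.app U s) := app_res a h s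
  change res G h' (a.app V (res L h s)) = _
  rw [h1]
  exact res_res (M := G) _ _ _

@[simp] lemma homLE_smul {U : Y.Opens} {V : X.Opens} (h : V ≤ f ⁻¹ᵁ U) (r : Γ(Y, U)) (s : Γ(L, U)) :
    homLE a h (r • s) = pb f h r • homLE a h s := by
  have h1 : a.app U (r • s) = f.app U r • (show Γ(G, f ⁻¹ᵁ U) from a.app U s) := a.app_smul r s
  change res G h (a.app U (r • s)) = _
  rw [h1, res_smul, app_eq_pb, fres_pb]
  rfl

end

lemma adj_psec (f : X ⟶ Y) {M : Y.Modules} {G : X.Modules}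
    (a : M ⟶ (Scheme.Modules.pushforward f).obj G) {U : Y.Opens} {V : X.Opens} (h : V ≤ f ⁻¹ᵁ U)
    (s : Γ(M, U)) : (adj f a).app V (psec f M h s) = homLE a h s := by
  change (adj f a).app V (res _ h (pullSec f M U s)) = _
  rw [app_res, adj_pullSec]
  rfl

/-- The morphism to the pushforward adjoint to a morphism on the pullback. -/
noncomputable def coadj (f : X ⟶ Y) {M : Y.Modules} {G : X.Modules}
    (j : (Scheme.Modules.pullback f).obj M ⟶ G) : M ⟶ (Scheme.Modules.pushforward f).obj G :=
  ((Scheme.Modules.pullbackPushforwardAdjunction f).homEquiv _ _) j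

lemma homLE_coadj (f : X ⟶ Y) {M : Y.Modules} {G : X.Modules}
    (j : (Scheme.Modules.pullback f).obj M ⟶ G) {U : Y.Opens} {V : X.Opens} (h : V ≤ f ⁻¹ᵁ U)
    (s : Γ(M, U)) : homLE (coadj f j) h s = j.app V (psec f M h s) := by
  have h1 : adj f (coadj f j) = j :=
    ((Scheme.Modules.pullbackPushforwardAdjunction f).homEquiv _ _).symm_apply_apply j
  rw [← adj_psec, h1]

/-- The lift of a morphism `L ⟶ τ_* L` to the pullback of `L` along an equivariant morphism. -/
noncomputable def liftHom (f : X ⟶ Y) (t : X ⟶ X) (τ : Y ⟶ Y) (h : t ≫ f = f ≫ τ) {L : Y.Modules}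
    (φ : L ⟶ (Scheme.Modules.pushforward τ).obj L) :
    (Scheme.Modules.pullback f).obj L ⟶
      (Scheme.Modules.pushforward t).obj ((Scheme.Modules.pullback f).obj L) :=
  adj f (φ ≫ (Scheme.Modules.pushforward τ).map
      ((Scheme.Modules.pullbackPushforwardAdjunction f).unit.app L) ≫
    (Scheme.Modules.pushforwardComp f τ).hom.app _ ≫
    (Scheme.Modules.pushforwardCongr h.symm).hom.app _ ≫
    (Scheme.Modules.pushforwardComp t f).inv.app _)

lemma homLE_liftHom (f : X ⟶ Y) (t : X ⟶ X) (τ : Y ⟶ Y) (h : t ≫ f = f ≫ τ) {L : Y.Modules}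
    (φ : L ⟶ (Scheme.Modules.pushforward τ).obj L) {U : Y.Opens} {V W : X.Opens}
    {U' : Y.Opens}
    (hV : V ≤ f ⁻¹ᵁ U) (hW : W ≤ t ⁻¹ᵁ V) (hU' : U' ≤ τ ⁻¹ᵁ U) (hW' : W ≤ f ⁻¹ᵁ U') (s : Γ(L, U)) :
    homLE (liftHom f t τ h φ) hW (psec f L hV s) = psec f L hW' (homLE φ hU' s) := by
  have h0 : t ⁻¹ᵁ (f ⁻¹ᵁ U) ≤ f ⁻¹ᵁ (τ ⁻¹ᵁ U) := by
    rw [← Scheme.Hom.comp_preimage, h]; exact le_rfl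
  have h1 : (liftHom f t τ h φ).app (f ⁻¹ᵁ U) (pullSec f L U s) =
      (show Γ((Scheme.Modules.pullback f).obj L, t ⁻¹ᵁ (f ⁻¹ᵁ U)) from res _ h0
        (pullSec f L (τ ⁻¹ᵁ U) (show Γ(L, τ ⁻¹ᵁ U) from φ.app U s))) := by
    unfold liftHom
    rw [adj_pullSec]
    rfl
  have h2 : homLE (liftHom f t τ h φ) hW (psec f L hV s) =
      homLE (liftHom f t τ h φ) (U := f ⁻¹ᵁ U) (hW.trans (t.preimage_mono hV)) (pullSec f L U s) :=
    homLE_res _ hV hW _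
  rw [h2]
  refine (congrArg (res ((Scheme.Modules.pullback f).obj L) (hW.trans (t.preimage_mono hV)))
    h1).trans ?_
  refine Eq.trans ?_ (psec_res f L hU' hW' (show Γ(L, τ ⁻¹ᵁ U) from φ.app U s)).symm
  exact res_res (M := (Scheme.Modules.pullback f).obj L) _ _ _

lemma isLinearization_iff {τ : X ⟶ X} (h : τ ≫ τ = 𝟙 X) (L : X.Modules)
    (φ : L ⟶ (Scheme.Modules.pushforward τ).obj L) :
    IsLinearization h L φ ↔ ∀ (U V W : X.Opens) (hV : V ≤ τ ⁻¹ᵁ U) (hW : W ≤ τ ⁻¹ᵁ V) (hWU : W ≤ U)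
      (s : Γ(L, U)), homLE φ hW (homLE φ hV s) = res L hWU s := by
  have key : ∀ (U V W : X.Opens) (hV : V ≤ τ ⁻¹ᵁ U) (hW : W ≤ τ ⁻¹ᵁ V) (hWU : W ≤ U) (s : Γ(L, U)),
    homLE φ hW (homLE φ hV s) = res L hWU ((φ ≫ (Scheme.Modules.pushforward τ).map φ ≫
      (Scheme.Modules.pushforwardComp τ τ).hom.app L ≫
      (Scheme.Modules.pushforwardCongr h).hom.app L ≫
        (Scheme.Modules.pushforwardId X).hom.app L).app U s) := by
    intro U V W hV hW hWU s
    refine (homLE_res φ hV hW (show Γ(L, τ ⁻¹ᵁ U) from φ.app U s)).trans ?_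
    have h2 : τ ⁻¹ᵁ (τ ⁻¹ᵁ U) = U := by rw [← Scheme.Hom.comp_preimage, h]; rfl
    have h3 : (φ ≫ (Scheme.Modules.pushforward τ).map φ ≫
      (Scheme.Modules.pushforwardComp τ τ).hom.app L ≫
      (Scheme.Modules.pushforwardCongr h).hom.app L ≫
        (Scheme.Modules.pushforwardId X).hom.app L).app U s =
        res L h2.ge (φ.app (τ ⁻¹ᵁ U) (φ.app U s)) := rfl
    rw [h3]
    exact (res_res (M := L) _ _ _).symm
  constructor
  · intro hφ U V W hV hW hWU s
    rw [key U V W hV hW hWU s, hφ]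
    rfl
  · intro hφ
    refine hom_ext' fun U s => ?_
    have h2 : τ ⁻¹ᵁ (τ ⁻¹ᵁ U) = U := by rw [← Scheme.Hom.comp_preimage, h]; rfl
    have h3 := key U (τ ⁻¹ᵁ U) U le_rfl h2.ge le_rfl s
    rw [res_self, hφ _ _ _ _ _ le_rfl, res_self] at h3
    exact h3.symm

/-- A direct sum decomposition, as an isomorphism with the biproduct. -/
noncomputable def biprodIso {C : Type*} [Category C] [Preadditive C] [HasBinaryBiproducts C]
    {A B P : C} (b₁ : A ⟶ P) (b₂ : B ⟶ P) (p₁ : P ⟶ A) (p₂ : P ⟶ B) (h₁₁ : b₁ ≫ p₁ = 𝟙 A)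
    (h₁₂ : b₁ ≫ p₂ = 0) (h₂₁ : b₂ ≫ p₁ = 0) (h₂₂ : b₂ ≫ p₂ = 𝟙 B)
    (h : p₁ ≫ b₁ + p₂ ≫ b₂ = 𝟙 P) : P ≅ A ⊞ B where
  hom := biprod.lift p₁ p₂
  inv := biprod.desc b₁ b₂
  hom_inv_id := by simpa using h
  inv_hom_id := by ext <;> simp [h₁₁, h₁₂, h₂₁, h₂₂]

end HomLE


/-! ### Points and functions on affine open sets -/

section Affine

variable {X Y : Scheme.{0}}

lemma idealAt_eq_primeIdealOf {U : X.Opens} (hU : IsAffineOpen U) {p : X} (hp : p ∈ U) :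
    idealAt U p hp = (hU.primeIdealOf ⟨p, hp⟩).asIdeal := by
  rw [hU.primeIdealOf_eq_map_closedPoint]; rfl

lemma exists_idealAt_eq {U : X.Opens} (hU : IsAffineOpen U) (P : Ideal Γ(X, U)) [hP : P.IsPrime] :
    ∃ (p : X) (hp : p ∈ U), idealAt U p hp = P := by
  let y : PrimeSpectrum Γ(X, U) := ⟨P, hP⟩
  have hsurj : Function.Surjective hU.isoSpec.hom := hU.isoSpec.hom.homeomorph.surjective
  obtain ⟨x, hx⟩ := hsurj y
  refine ⟨x.1, x.2, ?_⟩
  rw [idealAt_eq_primeIdealOf hU]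
  have : hU.primeIdealOf ⟨x.1, x.2⟩ = y := hx
  rw [this]

lemma specializes_of_idealAt_le {U : X.Opens} (hU : IsAffineOpen U) {p q : X} {hp : p ∈ U}
    {hq : q ∈ U} (h : idealAt U p hp ≤ idealAt U q hq) : p ⤳ q := by
  rw [specializes_iff_forall_open]
  intro W hW hqW
  obtain ⟨f, hf, hqf⟩ := hU.exists_basicOpen_le (V := ⟨W, hW⟩) ⟨q, hqW⟩ hq
  exact hf (notMem_idealAt_iff.1 fun h' => notMem_idealAt_iff.2 hqf (h h'))

lemma idealAt_le_of_specializes {U : X.Opens} {p q : X} {hp : p ∈ U}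
    {hq : q ∈ U} (h : p ⤳ q) : idealAt U p hp ≤ idealAt U q hq := by
  intro f hf
  by_contra hq'
  exact notMem_idealAt_iff.2 (h.mem_open (X.basicOpen f).2 (notMem_idealAt_iff.1 hq')) hf

lemma isMaximal_idealAt {U : X.Opens} (hU : IsAffineOpen U) {p : X} (hp : p ∈ U)
    (h : IsClosed {p}) : (idealAt U p hp).IsMaximal := by
  rw [idealAt_eq_primeIdealOf hU]
  exact hU.primeIdealOf_isMaximal_of_isClosed _ h

lemma exists_mul_germ {U : X.Opens} (hU : IsAffineOpen U) {p : X} (hp : p ∈ U)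
    (a : X.presheaf.stalk p) : ∃ f g : Γ(X, U), g ∉ idealAt U p hp ∧
      X.presheaf.germ U p hp g * a = X.presheaf.germ U p hp f := by
  let := TopCat.Presheaf.algebra_section_stalk X.presheaf (⟨p, hp⟩ : U)
  have := hU.isLocalization_stalk ⟨p, hp⟩
  obtain ⟨⟨f, g⟩, h⟩ := IsLocalization.surj (hU.primeIdealOf ⟨p, hp⟩).asIdeal.primeCompl a
  refine ⟨f, g.1, ?_, (mul_comm _ _).trans h⟩
  rw [idealAt_eq_primeIdealOf hU]
  exact g.2

lemma germ_eq_zero_iff {U : X.Opens} (hU : IsAffineOpen U) {p : X} (hp : p ∈ U) (f : Γ(X, U)) :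
    X.presheaf.germ U p hp f = 0 ↔ ∃ g, g ∉ idealAt U p hp ∧ g * f = 0 := by
  let := TopCat.Presheaf.algebra_section_stalk X.presheaf (⟨p, hp⟩ : U)
  have := hU.isLocalization_stalk ⟨p, hp⟩
  refine (IsLocalization.map_eq_zero_iff (hU.primeIdealOf ⟨p, hp⟩).asIdeal.primeCompl _ _).trans ?_
  rw [idealAt_eq_primeIdealOf hU]
  exact ⟨fun ⟨m, h⟩ => ⟨m.1, m.2, h⟩, fun ⟨m, hm, h⟩ => ⟨⟨m, hm⟩, h⟩⟩

lemma exists_pow_mul_eq_fres {U V : X.Opens} (hU : IsAffineOpen U) (f : Γ(X, U))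
    (hV : V = X.basicOpen f) (hVU : V ≤ U) (c : Γ(X, V)) :
    ∃ (n : ℕ) (d : Γ(X, U)), fres hVU f ^ n * c = fres hVU d := by
  subst hV
  have := hU.isLocalization_basicOpen f
  obtain ⟨⟨d, ⟨_, n, rfl⟩⟩, h⟩ := IsLocalization.surj (Submonoid.powers f) c
  refine ⟨n, d, ?_⟩
  rw [mul_comm, ← map_pow]
  exact h

lemma exists_pow_mul_eq_zero {U V : X.Opens} (hU : IsAffineOpen U) (f : Γ(X, U))
    (hV : V = X.basicOpen f) (hVU : V ≤ U) (c : Γ(X, U)) (hc : fres hVU c = 0) :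
    ∃ n : ℕ, f ^ n * c = 0 := by
  subst hV
  have := hU.isLocalization_basicOpen f
  obtain ⟨⟨_, n, rfl⟩, h⟩ := (IsLocalization.map_eq_zero_iff (Submonoid.powers f) _ c).1 hc
  exact ⟨n, h⟩

lemma exists_affine_le (x : X) {W : X.Opens} (hx : x ∈ W) :
    ∃ U : X.Opens, IsAffineOpen U ∧ x ∈ U ∧ U ≤ W := by
  obtain ⟨_, ⟨U, hU, rfl⟩, hxU, h⟩ := X.isBasis_affineOpens.exists_subset_of_mem_open hx W.2
  exact ⟨U, hU, hxU, h⟩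

/-- A function on a reduced scheme which vanishes at all points is zero. -/
lemma eq_zero_of_forall_mem_idealAt [IsReduced X] {U : X.Opens} (f : Γ(X, U))
    (h : ∀ p (hp : p ∈ U), f ∈ idealAt U p hp) : f = 0 := by
  rw [← basicOpen_eq_bot_iff, eq_bot_iff]
  intro p hp
  exact (notMem_idealAt_iff (hp := X.basicOpen_le f hp)).2 hp (h p _)

lemma pb_injective [IsReduced Y] (f : X ⟶ Y) {U : Y.Opens} {V : X.Opens} (h : V ≤ f ⁻¹ᵁ U)
    (hs : ∀ y ∈ U, ∃ x ∈ V, f x = y) : Function.Injective (pb f h) := by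
  rw [injective_iff_map_eq_zero]
  intro g hg
  refine eq_zero_of_forall_mem_idealAt g fun y hy => ?_
  obtain ⟨x, hx, rfl⟩ := hs y hy
  rw [← pb_mem_idealAt f h g hx, hg]
  exact zero_mem _

end Affine

/-! ### Finite morphisms -/

section Finite

variable {X Y : Scheme.{0}} (f : X ⟶ Y) [IsFinite f]

lemma isClosed_singleton_of_isFinite {x : X} (h : IsClosed {f x}) : IsClosed {x} := by
  have h1 := f.isDiscrete_preimage_singleton (f x)
  have h2 : IsClosed (f ⁻¹' {f x}) := h.preimage f.continuous
  have : DiscreteTopology (f ⁻¹' {f x}) := h1.to_subtype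
  have h3 : IsClosed ({⟨x, rfl⟩} : Set (f ⁻¹' {f x})) := isClosed_discrete _
  have h4 := (h2.isClosedEmbedding_subtypeVal.isClosed_iff_image_isClosed).1 h3
  simpa using h4

lemma isClosed_singleton_apply {x : X} (h : IsClosed {x}) : IsClosed {f x} := by
  have := f.isClosedMap _ h
  simpa using this

/-- An open set which contains the fibre over `y` contains the inverse image of a neighbourhood
of `y`. -/
lemma exists_tube (y : Y) (W : X.Opens) (h : ∀ x, f x = y → x ∈ W) :
    ∃ V : Y.Opens, y ∈ V ∧ f ⁻¹ᵁ V ≤ W := by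
  have h1 := f.isClosedMap _ W.2.isClosed_compl
  refine ⟨⟨_, h1.isOpen_compl⟩, ?_, ?_⟩
  · rintro ⟨x, hx, rfl⟩
    exact hx (h x rfl)
  · intro x hx
    by_contra hxW
    exact hx ⟨x, hxW, rfl⟩

lemma exists_affine_tube (y : Y) {V₀ : Y.Opens} (hy : y ∈ V₀) (W : X.Opens)
    (h : ∀ x, f x = y → x ∈ W) :
    ∃ V : Y.Opens, IsAffineOpen V ∧ y ∈ V ∧ V ≤ V₀ ∧ f ⁻¹ᵁ V ≤ W := by
  obtain ⟨V, hyV, hV⟩ := exists_tube f y W h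
  obtain ⟨V', hV', hy', hle⟩ := exists_affine_le y (W := V₀ ⊓ V) ⟨hy, hyV⟩
  exact ⟨V', hV', hy', hle.trans inf_le_left, (f.preimage_mono (hle.trans inf_le_right)).trans hV⟩

end Finite

/-! ### Regular points of dimension one -/

section RegularPoints

variable {X Y : Scheme.{0}}

/-- A function `t` near `p` is a local parameter at `p`. -/
def IsParam {U : X.Opens} (t : Γ(X, U)) (p : X) (hp : p ∈ U) : Prop :=
  Irreducible (X.presheaf.germ U p hp t)

lemma isParam_fres {U V : X.Opens} (h : V ≤ U) (t : Γ(X, U)) {p : X} (hp : p ∈ V) :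
    IsParam (fres h t) p hp ↔ IsParam t p (h hp) := by
  rw [IsParam, IsParam, germ_fres]

lemma exists_specializes_ne {p : X} (h : IsDVR (X.presheaf.stalk p)) :
    ∃ ξ : X, ξ ⤳ p ∧ ξ ≠ p := by
  obtain ⟨hd, hv⟩ := h
  obtain ⟨U, hU, hp, -⟩ := exists_affine_le p (W := ⊤) trivial
  have hpr : (RingHom.ker (X.presheaf.germ U p hp).hom).IsPrime := RingHom.ker_isPrime _
  obtain ⟨ξ, hξ, e⟩ := exists_idealAt_eq hU (RingHom.ker (X.presheaf.germ U p hp).hom)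
  refine ⟨ξ, specializes_of_idealAt_le hU (hp := hξ) (hq := hp) ?_, ?_⟩
  · rw [e]
    intro f hf
    rw [mem_idealAt]
    have : X.presheaf.germ U p hp f = 0 := hf
    rw [this]
    exact zero_mem _
  · rintro rfl
    obtain ⟨t, ht⟩ := IsDiscreteValuationRing.exists_irreducible (X.presheaf.stalk ξ)
    obtain ⟨f, g, hg, h1⟩ := exists_mul_germ hU hp t
    have h2 : f ∈ idealAt U ξ hp := by
      rw [mem_idealAt, ← h1]
      refine Ideal.mul_mem_left _ _ ?_
      exact (IsLocalRing.mem_maximalIdeal _).2 ht.not_isUnit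
    have h3 : f ∈ RingHom.ker (X.presheaf.germ U ξ hp).hom := e ▸ h2
    have h4 : X.presheaf.germ U ξ hp f = 0 := h3
    rw [h4] at h1
    rcases mul_eq_zero.1 h1 with h5 | h5
    · exact hg (by rw [mem_idealAt, h5]; exact zero_mem _)
    · exact ht.ne_zero h5

/-- If a power of every function vanishing at the closed point `p` is divisible by `t` near `p`,
then `p` is the only zero of `t` near `p`. -/
lemma exists_zero_only [IsLocallyNoetherian X] {p : X} (hcl : IsClosed {p}) {U : X.Opens}
    (hp : p ∈ U) (t : Γ(X, U))
    (h : ∀ a ∈ IsLocalRing.maximalIdeal (X.presheaf.stalk p), ∃ n : ℕ,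
      X.presheaf.germ U p hp t ∣ a ^ n) :
    ∃ (V : X.Opens) (hV : V ≤ U), IsAffineOpen V ∧ p ∈ V ∧
      ∀ q (hq : q ∈ V), t ∈ idealAt U q (hV hq) → q = p := by
  obtain ⟨U₀, hU₀, hp₀, hle⟩ := exists_affine_le p hp
  have : IsNoetherianRing Γ(X, U₀) := IsLocallyNoetherian.component_noetherian ⟨U₀, hU₀⟩
  obtain ⟨S, hS⟩ := (isNoetherianRing_iff_ideal_fg _).1 this (idealAt U₀ p hp₀)
  have key : ∀ a ∈ S, ∃ (V : X.Opens) (hV : V ≤ U₀), p ∈ V ∧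
      ∀ q (hq : q ∈ V), t ∈ idealAt U q (hle (hV hq)) → a ∈ idealAt U₀ q (hV hq) := by
    intro a ha
    have ha' : a ∈ idealAt U₀ p hp₀ := hS ▸ Ideal.subset_span ha
    obtain ⟨n, c, hc⟩ := h _ (mem_idealAt.1 ha')
    obtain ⟨W, hpW, c', rfl⟩ := exists_germ p c
    have hpI : p ∈ W ⊓ U₀ := ⟨hpW, hp₀⟩
    have h1 : X.presheaf.germ (W ⊓ U₀) p hpI (fres inf_le_right (a ^ n)) =
        X.presheaf.germ (W ⊓ U₀) p hpI (fres (inf_le_right.trans hle) t *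
          fres inf_le_left c') := by
      rw [map_mul, germ_fres, germ_fres, germ_fres, map_pow, hc]
    obtain ⟨V, hV, hpV, h2⟩ := (germ_eq_iff _ _ _ _).1 h1
    refine ⟨V, hV.trans inf_le_right, hpV, fun q hq htq => ?_⟩
    refine (idealAt_isPrime U₀ q _).mem_of_pow_mem n ?_
    rw [← fres_mem_idealAt (hV.trans inf_le_right) _ hq, ← fres_fres inf_le_right hV, h2, map_mul]
    refine Ideal.mul_mem_right _ _ ?_
    rw [fres_fres, fres_mem_idealAt]
    exact htq
  choose! V hV hpV hz using key
  have hfin : ∃ V' : X.Opens, p ∈ V' ∧ ∀ a ∈ S, V' ≤ V a := by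
    refine ⟨S.inf V, ?_, fun a ha => Finset.inf_le ha⟩
    classical
    clear hS hz hV
    induction S using Finset.induction_on with
    | empty => trivial
    | insert a S _ ih =>
      rw [Finset.inf_insert]
      exact ⟨hpV a (by simp), ih fun b hb => hpV b (by simp [hb])⟩
  obtain ⟨V', hpV', hV'⟩ := hfin
  obtain ⟨V'', hV'', hp'', hle''⟩ := exists_affine_le p (W := U₀ ⊓ V') ⟨hp₀, hpV'⟩
  refine ⟨V'', (hle''.trans inf_le_left).trans hle, hV'', hp'', fun q hq htq => ?_⟩
  have h1 : idealAt U₀ p hp₀ ≤ idealAt U₀ q ((hle''.trans inf_le_left) hq) := by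
    rw [← hS, Ideal.span_le]
    intro a ha
    exact hz a ha q (hV' a ha (hle'' hq).2) htq
  have := specializes_of_idealAt_le hU₀ h1
  simpa using this.mem_closed hcl rfl

lemma IsParam.exists_zero_only [IsLocallyNoetherian X] {p : X} (hcl : IsClosed {p})
    (hd : IsDVR (X.presheaf.stalk p)) {U : X.Opens} {hp : p ∈ U} {t : Γ(X, U)}
    (ht : IsParam t p hp) :
    ∃ (V : X.Opens) (hV : V ≤ U), IsAffineOpen V ∧ p ∈ V ∧
      ∀ q (hq : q ∈ V), t ∈ idealAt U q (hV hq) → q = p := by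
  obtain ⟨_, _⟩ := hd
  refine PrymEigen.exists_zero_only hcl hp t fun a ha => ⟨1, ?_⟩
  rw [ht.maximalIdeal_eq, Ideal.mem_span_singleton] at ha
  simpa using ha

lemma isParam_iff {p : X} (hd : IsDVR (X.presheaf.stalk p)) {U : X.Opens} {hp : p ∈ U}
    {t : Γ(X, U)} : IsParam t p hp ↔
      X.presheaf.germ U p hp t ∈ IsLocalRing.maximalIdeal (X.presheaf.stalk p) ∧
      X.presheaf.germ U p hp t ∉ IsLocalRing.maximalIdeal (X.presheaf.stalk p) ^ 2 := by
  obtain ⟨_, _⟩ := hd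
  constructor
  · intro ht
    refine ⟨(IsLocalRing.mem_maximalIdeal _).2 ht.not_isUnit, fun h => ?_⟩
    rw [ht.maximalIdeal_eq, Ideal.span_singleton_pow, Ideal.mem_span_singleton, sq] at h
    exact ht.not_isUnit (isUnit_of_dvd_one ((mul_dvd_mul_iff_left ht.ne_zero).1 (by simpa using h)))
  · rintro ⟨h1, h2⟩
    refine ⟨h1, fun a b hab => ?_⟩
    by_contra! hne
    refine h2 ?_
    rw [hab, sq]
    exact Ideal.mul_mem_mul ((IsLocalRing.mem_maximalIdeal _).2 hne.1)
      ((IsLocalRing.mem_maximalIdeal _).2 hne.2)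

lemma exists_isParam {p : X} (hd : IsDVR (X.presheaf.stalk p)) :
    ∃ (U : X.Opens) (hp : p ∈ U) (t : Γ(X, U)), IsParam t p hp := by
  obtain ⟨_, _⟩ := hd
  obtain ⟨t, ht⟩ := IsDiscreteValuationRing.exists_irreducible (X.presheaf.stalk p)
  obtain ⟨U, hp, t₀, rfl⟩ := exists_germ p t
  exact ⟨U, hp, t₀, ht⟩

/-- For a finite morphism `f` there is a local parameter at a given closed point `p` which has no
other zeros over a neighbourhood of `f p`. -/
lemma exists_isParam_tube (f : X ⟶ Y) [IsFinite f] [IsLocallyNoetherian X] {p : X}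
    (hcl : IsClosed {p}) (hd : IsDVR (X.presheaf.stalk p)) {W : Y.Opens} (hW : f p ∈ W) :
    ∃ (V : Y.Opens) (_ : V ≤ W) (hp : f p ∈ V) (t : Γ(X, f ⁻¹ᵁ V)), IsAffineOpen V ∧
      IsParam t p hp ∧ ∀ q (hq : q ∈ f ⁻¹ᵁ V), t ∈ idealAt _ q hq → q = p := by
  classical
  obtain ⟨V₀, hV₀, hy₀, hle₀⟩ := exists_affine_le (f p) hW
  have hU : IsAffineOpen (f ⁻¹ᵁ V₀) := hV₀.preimage f
  have hpU : p ∈ f ⁻¹ᵁ V₀ := hy₀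
  have hfin : (f ⁻¹' {f p} \ {p}).Finite := (f.finite_preimage_singleton (f p)).sdiff
  have hfib : ∀ q ∈ hfin.toFinset, q ∈ f ⁻¹ᵁ V₀ := by
    intro q hq
    have h1 : f q = f p := ((Set.Finite.mem_toFinset _).1 hq).1
    change f q ∈ V₀
    rw [h1]; exact hy₀
  let I := idealAt (f ⁻¹ᵁ V₀) p hpU
  let J2 : Ideal Γ(X, f ⁻¹ᵁ V₀) := (IsLocalRing.maximalIdeal (X.presheaf.stalk p) ^ 2).comap
    (X.presheaf.germ _ p hpU).hom
  let F : Option X → Ideal Γ(X, f ⁻¹ᵁ V₀) := fun o => o.elim J2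
    (fun q => if hq : q ∈ f ⁻¹ᵁ V₀ then idealAt _ q hq else ⊤)
  have hF : ¬ ∃ i ∈ Finset.insertNone hfin.toFinset, I ≤ F i := by
    rintro ⟨i, hi, hle⟩
    rcases i with _ | q
    · obtain ⟨U₁, hp₁, t, ht⟩ := exists_isParam hd
      obtain ⟨a, b, hb, e⟩ := exists_mul_germ hU hpU (X.presheaf.germ U₁ p hp₁ t)
      obtain ⟨h1, h2⟩ := (isParam_iff hd).1 ht
      have ha : a ∈ I := by
        refine mem_idealAt.2 ?_
        rw [← e]; exact Ideal.mul_mem_left _ _ h1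
      have ha2 : X.presheaf.germ _ p hpU a ∈ IsLocalRing.maximalIdeal (X.presheaf.stalk p) ^ 2 :=
        hle ha
      rw [← e] at ha2
      have hbu : IsUnit (X.presheaf.germ _ p hpU b) := by
        rwa [mem_idealAt, IsLocalRing.mem_maximalIdeal, mem_nonunits_iff, not_not] at hb
      exact h2 ((Ideal.unit_mul_mem_iff_mem _ hbu).1 ha2)
    · have hq : q ∈ hfin.toFinset := Finset.some_mem_insertNone.1 hi
      have hqU := hfib q hq
      have h1 : F (some q) = idealAt _ q hqU := by simp only [F, Option.elim]; rw [dif_pos hqU]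
      rw [h1] at hle
      have := (specializes_of_idealAt_le hU hle).mem_closed hcl rfl
      exact ((Set.Finite.mem_toFinset _).1 hq).2 this
  rw [← Ideal.subset_union_prime (R := Γ(X, f ⁻¹ᵁ V₀)) none none] at hF
  · obtain ⟨t, htI, htF⟩ := Set.not_subset.1 hF
    simp only [Set.mem_iUnion, not_exists] at htF
    have htp : IsParam t p hpU :=
      (isParam_iff hd).2 ⟨htI, fun h => htF none (Finset.mem_coe.2 (by simp)) h⟩
    obtain ⟨O, hO, -, hpO, hz⟩ := htp.exists_zero_only hcl hd
    obtain ⟨V, hV, hyV, hVle, htube⟩ := exists_affine_tube f (f p) hy₀ (O ⊔ X.basicOpen t) (by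
      intro q hq
      by_cases hqp : q = p
      · subst hqp; exact Or.inl hpO
      · refine Or.inr ?_
        have hqf : q ∈ hfin.toFinset := (Set.Finite.mem_toFinset _).2 ⟨hq, hqp⟩
        have hqU := hfib q hqf
        have h1 : F (some q) = idealAt _ q hqU := by simp only [F, Option.elim]; rw [dif_pos hqU]
        have h2 := htF (some q) (Finset.mem_coe.2 (Finset.some_mem_insertNone.2 hqf))
        rw [h1] at h2
        exact notMem_idealAt_iff.1 h2)
    refine ⟨V, hVle.trans hle₀, hyV, fres (f.preimage_mono hVle) t, hV,
      (isParam_fres _ _ _).2 htp, fun q hq htq => ?_⟩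
    rw [fres_mem_idealAt] at htq
    rcases htube hq with h | h
    · exact hz q h htq
    · exact absurd htq (notMem_idealAt_iff.2 h)
  · intro i hi h1 _
    rcases i with _ | q
    · exact absurd rfl h1
    · have hqU := hfib q (Finset.some_mem_insertNone.1 hi)
      have h1 : F (some q) = idealAt _ q hqU := by simp only [F, Option.elim]; rw [dif_pos hqU]
      rw [h1]; infer_instance

end RegularPoints


/-! ### Extension of functions over regular points -/

section Extension

variable {X Y : Scheme.{0}}

lemma exists_fun_glue_two {U V W : X.Opens} (hU : U ≤ W) (hV : V ≤ W) (hW : W ≤ U ⊔ V)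
    (f : Γ(X, U)) (g : Γ(X, V))
    (h : fres (inf_le_left : U ⊓ V ≤ U) f = fres (inf_le_right : U ⊓ V ≤ V) g) :
    ∃ a : Γ(X, W), fres hU a = f ∧ fres hV a = g := by
  have h' : ∀ (T : X.Opens) (h1 : T ≤ U) (h2 : T ≤ V), fres h1 f = fres h2 g := by
    intro T h1 h2
    have := congrArg (fres (le_inf h1 h2)) h
    simpa using this
  obtain ⟨a, ha⟩ := exists_fun_glue (U := W)
    (fun T s => (∃ h : T ≤ U, s = fres h f) ∨ ∃ h : T ≤ V, s = fres h g)
    (by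
      rintro T T' hT s - (⟨h1, rfl⟩ | ⟨h1, rfl⟩)
      · exact Or.inl ⟨hT.trans h1, by simp⟩
      · exact Or.inr ⟨hT.trans h1, by simp⟩)
    (by
      rintro T - s t (⟨h1, rfl⟩ | ⟨h1, rfl⟩) (⟨h2, rfl⟩ | ⟨h2, rfl⟩)
      · rfl
      · exact h' _ _ _
      · exact (h' _ _ _).symm
      · rfl)
    (by
      intro x hx
      rcases hW hx with h1 | h1
      · exact ⟨U, hU, h1, f, Or.inl ⟨le_rfl, by simp⟩⟩
      · exact ⟨V, hV, h1, g, Or.inr ⟨le_rfl, by simp⟩⟩)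
  exact ⟨a, ha U hU f (Or.inl ⟨le_rfl, by simp⟩), ha V hV g (Or.inr ⟨le_rfl, by simp⟩)⟩

/-- A function `g` defined away from the regular point `f p` of a curve extends over `f p` if its
pullback along the finite morphism `f` extends over the regular point `p`. -/
lemma exists_extension (f : X ⟶ Y) [IsFinite f] [IsLocallyNoetherian Y] {p : X}
    (hd : IsDVR (X.presheaf.stalk p)) (hdy : IsDVR (Y.presheaf.stalk (f p)))
    (hcl : IsClosed {f p}) {V V' : Y.Opens} (hV : V' ≤ V) (hp : f p ∈ V)
    (hVV' : ∀ q ∈ V, q ≠ f p → q ∈ V') (g : Γ(Y, V')) {U : X.Opens} (hU : p ∈ U) (a : Γ(X, U))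
    (hag : pb f (inf_le_right : U ⊓ f ⁻¹ᵁ V' ≤ f ⁻¹ᵁ V') g =
      fres (inf_le_left : U ⊓ f ⁻¹ᵁ V' ≤ U) a) :
    ∃ g' : Γ(Y, V), fres hV g' = g := by
  by_cases hpV' : f p ∈ V'
  · have : V ≤ V' := fun q hq => by
      by_cases h : q = f p
      · exact h ▸ hpV'
      · exact hVV' q hq h
    exact ⟨fres this g, by simp⟩
  obtain ⟨V₀, hp₀, t₀, ht₀⟩ := exists_isParam hdy
  have hp₁ : f p ∈ V₀ ⊓ V := ⟨hp₀, hp⟩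
  have ht₁ : IsParam (fres (inf_le_left : V₀ ⊓ V ≤ V₀) t₀) (f p) hp₁ := (isParam_fres _ _ _).2 ht₀
  obtain ⟨V₁, hV₁, hV₁a, hpV₁, hz⟩ := ht₁.exists_zero_only hcl hdy
  set t : Γ(Y, V₁) := fres hV₁ (fres (inf_le_left : V₀ ⊓ V ≤ V₀) t₀) with ht
  have htp : IsParam t (f p) hpV₁ := (isParam_fres _ _ _).2 ht₁
  have hz' : ∀ q (hq : q ∈ V₁), t ∈ idealAt V₁ q hq → q = f p := fun q hq h =>
    hz q hq ((fres_mem_idealAt _ _ _).1 h)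
  have hV₁V : V₁ ≤ V := hV₁.trans inf_le_right
  have hD : Y.basicOpen t ≤ V' := by
    intro q hq
    refine hVV' q (hV₁V (Y.basicOpen_le t hq)) ?_
    rintro rfl
    exact (notMem_idealAt_iff (hp := hpV₁)).2 hq
      ((IsLocalRing.mem_maximalIdeal _).2 htp.not_isUnit)
  obtain ⟨n, b, hb⟩ := exists_pow_mul_eq_fres hV₁a t rfl (Y.basicOpen_le t) (fres hD g)
  have hmemD : ∀ q ∈ V₁, q ≠ f p → q ∈ Y.basicOpen t := fun q hq h =>
    (notMem_idealAt_iff (hp := hq)).1 fun h' => h (hz' q hq h')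
  obtain ⟨_, _⟩ := hdy
  obtain ⟨c, hc⟩ : Y.presheaf.germ V₁ (f p) hpV₁ (t ^ n) ∣ Y.presheaf.germ V₁ (f p) hpV₁ b := by
    by_contra hndvd
    obtain ⟨c, hc⟩ := (ValuationRing.dvd_total (Y.presheaf.germ V₁ (f p) hpV₁ (t ^ n))
      (Y.presheaf.germ V₁ (f p) hpV₁ b)).resolve_left hndvd
    have hcm : ¬ IsUnit c := by
      rintro ⟨u, rfl⟩
      exact hndvd ⟨↑u⁻¹, by rw [hc, mul_assoc, Units.mul_inv, mul_one]⟩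
    obtain ⟨_, _⟩ := hd
    set A := (X.presheaf.germ U p hU) a
    have hpp : p ∈ U ⊓ f ⁻¹ᵁ V₁ := ⟨hU, hpV₁⟩
    obtain ⟨W, hWa, hpW, hWle⟩ := exists_affine_le p hpp
    have hWU : W ≤ U := hWle.trans inf_le_left
    have hWV : W ≤ f ⁻¹ᵁ V₁ := hWle.trans inf_le_right
    have htne : X.presheaf.germ W p hpW (pb f hWV t) ≠ 0 := by
      intro h0
      obtain ⟨ξ, hξ, hne⟩ := exists_specializes_ne (X := X) (p := p) ⟨‹_›, ‹_›⟩
      rw [← map_zero (X.presheaf.germ W p hpW).hom] at h0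
      obtain ⟨O, hO, hpO, e⟩ := (germ_eq_iff _ _ _ _).1 h0
      have hξO : ξ ∈ O := hξ.mem_open O.2 hpO
      have h1 : pb f hWV t ∈ idealAt W ξ (hO hξO) := by
        rw [← fres_mem_idealAt hO _ hξO, e, map_zero]
        exact zero_mem _
      rw [pb_mem_idealAt] at h1
      have h2 := hz' _ _ h1
      have h3 : IsClosed {ξ} := isClosed_singleton_of_isFinite f (h2 ▸ hcl)
      exact hne (by simpa using (hξ.mem_closed h3 rfl).symm)
    have h1 : X.presheaf.germ W p hpW (pb f hWV t) ^ n * A = X.presheaf.germ W p hpW (pb f hWV b) := by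
      have hA : A = X.presheaf.germ W p hpW (fres hWU a) := (germ_fres hWU a p hpW).symm
      have hW' : X.basicOpen (pb f hWV t) ≤ f ⁻¹ᵁ (Y.basicOpen t) := by
        intro q hq
        have hqW : q ∈ W := X.basicOpen_le _ hq
        exact (notMem_idealAt_iff (hp := mem_of_le_preimage hWV hqW)).1 fun h =>
          (notMem_idealAt_iff (hp := hqW)).2 hq ((pb_mem_idealAt _ _ _ _).2 h)
      have h2 : fres (X.basicOpen_le (pb f hWV t))
          (pb f hWV t ^ n * fres hWU a - pb f hWV b) = 0 := by
        have e1 := congrArg (pb f hW') hb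
        have e2 := congrArg (fres (le_inf ((X.basicOpen_le (pb f hWV t)).trans hWU)
          (hW'.trans (f.preimage_mono hD)))) hag
        simp only [map_mul, map_pow, pb_fres, fres_pb, fres_fres] at e1 e2
        simp only [map_sub, map_mul, map_pow, fres_pb, fres_fres]
        rw [← e2, ← e1, sub_self]
      obtain ⟨m, hm⟩ := exists_pow_mul_eq_zero hWa _ rfl _ _ h2
      have h3 := congrArg (X.presheaf.germ W p hpW) hm
      rw [map_mul, map_pow, map_zero] at h3
      have h4 := (mul_eq_zero.1 h3).resolve_left (pow_ne_zero _ htne)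
      rw [map_sub, map_mul, map_pow, sub_eq_zero] at h4
      rw [hA]; exact h4
    have h2 : X.presheaf.germ W p hpW (pb f hWV t) ^ n =
        X.presheaf.germ W p hpW (pb f hWV b) * (f.stalkMap p) c := by
      have := congrArg (f.stalkMap p) hc
      rw [map_mul, map_pow, map_pow] at this
      rw [germ_pb, germ_pb]
      exact this
    rw [← h1, mul_assoc] at h2
    have h3 : A * (f.stalkMap p) c = 1 :=
      mul_left_cancel₀ (pow_ne_zero n htne) (by rw [mul_one]; exact h2.symm)
    exact hcm ((isUnit_map_iff (f.stalkMap p).hom c).1 (IsUnit.of_mul_eq_one _ (mul_comm A _ ▸ h3)))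
  obtain ⟨O, hpO, c', rfl⟩ := exists_germ (f p) c
  have hpI : f p ∈ O ⊓ V₁ := ⟨hpO, hpV₁⟩
  have e1 : Y.presheaf.germ (O ⊓ V₁) (f p) hpI (fres inf_le_right b) =
      Y.presheaf.germ (O ⊓ V₁) (f p) hpI (fres inf_le_right (t ^ n) * fres inf_le_left c') := by
    rw [map_mul, germ_fres, germ_fres, germ_fres, hc]
  obtain ⟨V₂, hV₂, hpV₂, e2⟩ := (germ_eq_iff _ _ _ _).1 e1
  have hV₂V₁ : V₂ ≤ V₁ := hV₂.trans inf_le_right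
  obtain ⟨g', hg', -⟩ := exists_fun_glue_two hV (hV₂V₁.trans hV₁V) (fun q hq => by
      by_cases h : q = f p
      · exact Or.inr (h ▸ hpV₂)
      · exact Or.inl (hVV' q hq h)) g (fres (hV₂.trans inf_le_left) c') (by
      have hle : V' ⊓ V₂ ≤ Y.basicOpen t := fun q hq => hmemD q (hV₂V₁ hq.2) (by
        rintro rfl; exact hpV' hq.1)
      have hu : IsUnit (fres (inf_le_right.trans hV₂V₁ : V' ⊓ V₂ ≤ V₁) t) :=
        isUnit_of_notMem_idealAt _ fun q hq => by
          rw [fres_mem_idealAt, notMem_idealAt_iff]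
          exact hle hq
      refine (hu.pow n).mul_left_cancel ?_
      have e3 := congrArg (fres hle) hb
      have e4 := congrArg (fres (inf_le_right : V' ⊓ V₂ ≤ V₂)) e2
      simp only [map_mul, map_pow, fres_fres] at e3 e4 ⊢
      rw [e3, e4])
  exact ⟨g', hg'⟩

end Extension

/-! ### Constants -/

section Constants

variable {X Y : Scheme.{0}}

lemma le_preimage_top (f : X ⟶ Y) (U : X.Opens) : U ≤ f ⁻¹ᵁ ⊤ := fun _ _ => trivial

/-- Constant functions on a scheme over `ℂ`. -/
noncomputable def cst (s : X ⟶ Spec (.of ℂ)) (U : X.Opens) : ℂ →+* Γ(X, U) :=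
  (pb s (le_preimage_top s U)).comp (Scheme.ΓSpecIso (.of ℂ)).inv.hom

@[simp] lemma fres_cst (s : X ⟶ Spec (.of ℂ)) {U V : X.Opens} (h : V ≤ U) (c : ℂ) :
    fres h (cst s U c) = cst s V c := by
  simp [cst]

lemma pb_cst (f : X ⟶ Y) {s : Y ⟶ Spec (.of ℂ)} {s' : X ⟶ Spec (.of ℂ)} (h : f ≫ s = s')
    {U : Y.Opens} {V : X.Opens} (hV : V ≤ f ⁻¹ᵁ U) (c : ℂ) : pb f hV (cst s U c) = cst s' V c := by
  subst h
  simp only [cst, RingHom.comp_apply]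
  rw [pb_pb]

lemma germ_cst (s : X ⟶ Spec (.of ℂ)) (U : X.Opens) (p : X) (hp : p ∈ U) (c : ℂ) :
    X.presheaf.germ U p hp (cst s U c) = (stalkAlgebra s p).algebraMap c := by
  have h : cst s U c = fres (le_preimage_top s U) (s.app ⊤ ((Scheme.ΓSpecIso (.of ℂ)).inv c)) := by
    rw [app_eq_pb, fres_pb]; rfl
  rw [h, germ_fres]
  rfl

lemma exists_cst_sub_mem (s : X ⟶ Spec (.of ℂ)) [LocallyOfFiniteType s] {p : X} (hp : IsClosed {p})
    {U : X.Opens} (hpU : p ∈ U) (f : Γ(X, U)) : ∃ c : ℂ, f - cst s U c ∈ idealAt U p hpU := by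
  let ψ : CommRingCat.of ℂ ⟶ X.residueField p :=
    (Scheme.ΓSpecIso (.of ℂ)).inv ≫ s.appTop ≫ X.presheaf.germ ⊤ p trivial ≫ X.residue p
  have hψ : Spec.map ψ = X.fromSpecResidueField p ≫ s := by
    refine ext_of_isAffine ?_
    rw [Scheme.Hom.comp_appTop, Scheme.fromSpecResidueField, Scheme.Hom.comp_appTop,
      Scheme.fromSpecStalk_appTop, ← cancel_epi (Scheme.ΓSpecIso (.of ℂ)).inv,
      ← Scheme.ΓSpecIso_inv_naturality]
    have hid : (Spec (X.presheaf.stalk p)).presheaf.map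
      (homOfLE (le_top : (⊤ : (Spec (X.presheaf.stalk p)).Opens) ≤ ⊤)).op = 𝟙 _ :=
      CategoryTheory.Functor.map_id _ _
    simp only [ψ, Category.assoc, hid, Category.comp_id]
    rw [← Scheme.ΓSpecIso_inv_naturality]
  have hfin : IsFinite (X.fromSpecResidueField p ≫ s) := by
    rw [isClosed_singleton_iff_isClosedImmersion] at hp
    rw [isFinite_iff_locallyOfFiniteType_of_jacobsonSpace]
    infer_instance
  have hsurj : Function.Surjective ψ.hom := by
    refine (IsAlgClosed.ringHom_bijective_of_isIntegral ψ.hom ?_).2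
    rw [← IsIntegralHom.SpecMap_iff, hψ]
    infer_instance
  obtain ⟨c, hc⟩ := hsurj (X.residue p (X.presheaf.germ U p hpU f))
  refine ⟨c, ?_⟩
  rw [mem_idealAt, map_sub, germ_cst, ← IsLocalRing.residue_eq_zero_iff, map_sub, sub_eq_zero]
  exact hc.symm

lemma exists_eq_cst (s : X ⟶ Spec (.of ℂ)) [IsProper s] [IsReduced X] [ConnectedSpace X]
    (f : Γ(X, ⊤)) : ∃ c : ℂ, f = cst s ⊤ c := by
  have h1 : (cst s ⊤).IsIntegral := by
    have h2 := isIntegral_appTop_of_universallyClosed s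
    have h3 : cst s ⊤ = s.appTop.hom.comp (Scheme.ΓSpecIso (.of ℂ)).inv.hom := by
      ext c
      exact (app_eq_pb s (U := ⊤) ((Scheme.ΓSpecIso (.of ℂ)).inv c)).symm
    rw [h3]
    exact RingHom.isIntegral_respectsIso.2 s.appTop.hom
      (Scheme.ΓSpecIso (.of ℂ)).symm.commRingCatIsoToRingEquiv h2
  obtain ⟨P, hP, hPf⟩ := h1 f
  have hsplit := IsAlgClosed.splits P
  have hzero : ∀ x : X, ∃ c ∈ P.roots.toFinset, f - cst s ⊤ c ∈ idealAt ⊤ x trivial := by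
    intro x
    rw [hsplit.eq_prod_roots, hP.leadingCoeff, Polynomial.C_1, one_mul,
      Polynomial.eval₂_multiset_prod] at hPf
    have h2 : ((P.roots.map fun a => Polynomial.X - Polynomial.C a).map
      (Polynomial.eval₂ (cst s ⊤) f)).prod ∈ idealAt ⊤ x trivial := hPf ▸ zero_mem _
    rw [(idealAt_isPrime ⊤ x trivial).multiset_prod_mem_iff_exists_mem] at h2
    obtain ⟨g, hg, hgx⟩ := h2
    simp only [Multiset.map_map, Multiset.mem_map, Function.comp_apply] at hg
    obtain ⟨c, hc, rfl⟩ := hg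
    exact ⟨c, by simpa using hc, by simpa using hgx⟩
  choose c hc hcx using hzero
  have huniq : ∀ (x : X) (d : ℂ), f - cst s ⊤ d ∈ idealAt ⊤ x trivial → d = c x := by
    intro x d hd
    by_contra hne
    have h3 := sub_mem hd (hcx x)
    rw [sub_sub_sub_cancel_left, ← map_sub] at h3
    exact not_isUnit_of_mem_idealAt h3 ((IsUnit.mk0 _ (sub_ne_zero.2 (Ne.symm hne))).map (cst s ⊤))
  have hlc : IsLocallyConstant c := by
    rw [IsLocallyConstant.iff_isOpen_fiber]
    intro d
    have : c ⁻¹' {d} = ⋂ d' ∈ (P.roots.toFinset.erase d), (X.basicOpen (f - cst s ⊤ d') : Set X) := by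
      ext x
      simp only [Set.mem_preimage, Set.mem_singleton_iff, Set.mem_iInter, SetLike.mem_coe]
      constructor
      · rintro rfl d' hd'
        refine (notMem_idealAt_iff (hp := Opens.mem_top x)).1 fun h => ?_
        exact (Finset.mem_erase.1 hd').1 (huniq x d' h)
      · intro h
        by_contra hne
        exact (notMem_idealAt_iff (hp := Opens.mem_top x)).2 (h (c x) (Finset.mem_erase.2 ⟨hne, hc x⟩)) (hcx x)
    rw [this]
    exact isOpen_biInter_finset fun d' _ => (X.basicOpen _).2
  obtain ⟨x₀⟩ := (inferInstance : Nonempty X)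
  refine ⟨c x₀, sub_eq_zero.1 (eq_zero_of_forall_mem_idealAt _ fun x _ => ?_)⟩
  rw [hlc.apply_eq_of_preconnectedSpace x₀ x]
  exact hcx x

lemma exists_closed_mem (s : X ⟶ Spec (.of ℂ)) [LocallyOfFiniteType s] {U : X.Opens} {x : X}
    (hx : x ∈ U) : ∃ y ∈ U, IsClosed {y} ∧ x ⤳ y := by
  have : JacobsonSpace X := LocallyOfFiniteType.jacobsonSpace s
  obtain ⟨y, ⟨hy, hyU⟩, hcl⟩ := nonempty_inter_closedPoints (X := X)
    (Z := closure {x} ∩ U) ⟨x, subset_closure rfl, hx⟩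
    (isClosed_closure.isLocallyClosed.inter U.2.isLocallyClosed)
  exact ⟨y, hyU, hcl, specializes_iff_mem_closure.2 hy⟩

end Constants


/-! ### Normality of a general localization of an algebra of finite type -/

section Algebra

lemma exists_conductor (k A : Type) [Field k] [CharZero k] [CommRing A] [IsDomain A] [Algebra k A]
    [Algebra.FiniteType k A] :
    ∃ f : A, f ≠ 0 ∧ ∀ x : FractionRing A, IsIntegral A x →
      ∃ a : A, algebraMap A (FractionRing A) f * x = algebraMap A _ a := by
  obtain ⟨n, g, hg, hfin⟩ := exists_finite_inj_algHom_of_fg k A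
  let R₀ := MvPolynomial (Fin n) k
  let K := FractionRing A
  let : Algebra R₀ A := g.toRingHom.toAlgebra
  have : Module.Finite R₀ A := hfin
  have : FaithfulSMul R₀ A := (faithfulSMul_iff_algebraMap_injective R₀ A).2 hg
  let : Algebra (FractionRing R₀) K := FractionRing.liftAlgebra R₀ K
  have : IsScalarTower R₀ (FractionRing R₀) K := FractionRing.isScalarTower_liftAlgebra R₀ K
  have : Module.Finite (FractionRing R₀) K := 
    Module.Finite.of_isLocalization R₀ A (nonZeroDivisors R₀)
  have : CharZero (FractionRing R₀) := by
    refine charZero_of_injective_algebraMap (R := k) (A := FractionRing R₀) ?_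
    exact (algebraMap k (FractionRing R₀)).injective
  have hB : Module.Finite R₀ (integralClosure R₀ K) :=
    IsIntegralClosure.finite R₀ (FractionRing R₀) K (integralClosure R₀ K)
  obtain ⟨S, hS⟩ := hB.fg_top
  obtain ⟨f, hf⟩ := IsLocalization.exist_integer_multiples_of_finset (nonZeroDivisors A)
    (S.map ⟨Subtype.val, Subtype.val_injective⟩ : Finset K)
  refine ⟨f, nonZeroDivisors.ne_zero f.2, fun x hx => ?_⟩
  have hx' : IsIntegral R₀ x := isIntegral_trans (A := A) x hx
  have hmem : (⟨x, hx'⟩ : integralClosure R₀ K) ∈ Submodule.span R₀ (S : Set (integralClosure R₀ K)) :=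
    hS ▸ trivial
  have key : ∀ y ∈ Submodule.span R₀ (S : Set (integralClosure R₀ K)),
      ∃ a : A, algebraMap A K f * y.1 = algebraMap A K a := by
    intro y hy
    induction hy using Submodule.span_induction with
    | mem y hy =>
      obtain ⟨a, ha⟩ := hf y.1 (Finset.mem_map.2 ⟨y, hy, rfl⟩)
      exact ⟨a, by rw [ha, Algebra.smul_def]⟩
    | zero => exact ⟨0, by simp⟩
    | add y z _ _ h1 h2 =>
      obtain ⟨a, ha⟩ := h1
      obtain ⟨b, hb⟩ := h2
      refine ⟨a + b, ?_⟩
      rw [map_add, ← ha, ← hb]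
      exact mul_add _ _ _
    | smul r y _ h =>
      obtain ⟨a, ha⟩ := h
      refine ⟨algebraMap R₀ A r * a, ?_⟩
      rw [map_mul, ← ha, ← IsScalarTower.algebraMap_apply]
      change algebraMap A K f * (r • y.1) = _
      rw [Algebra.smul_def]; ring
  exact key _ hmem

/-- A domain, with a conductor outside a prime ideal, is not a node at this prime. -/
lemma not_isNodeRing_of_conductor {A R : Type} [CommRing A] [IsDomain A] [CommRing R] [Algebra A R]
    (P : Ideal A) [P.IsPrime] [IsLocalization.AtPrime R P] {f : A} (hfP : f ∉ P)
    (hf : ∀ x : FractionRing A, IsIntegral A x →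
      ∃ a : A, algebraMap A (FractionRing A) f * x = algebraMap A _ a) : ¬ IsNodeRing R := by
  rintro ⟨-, -, hlen⟩
  have hle : P.primeCompl ≤ nonZeroDivisors A := P.primeCompl_le_nonZeroDivisors
  have : IsDomain R := IsLocalization.isDomain_of_le_nonZeroDivisors R hle
  let K := FractionRing R
  have hinj : Function.Injective (algebraMap A K) := by
    rw [IsScalarTower.algebraMap_eq A R K]
    exact (IsFractionRing.injective R K).comp (IsLocalization.injective R hle)
  have : FaithfulSMul A K := (faithfulSMul_iff_algebraMap_injective A K).2 hinj
  have : IsFractionRing A K := IsFractionRing.of_field A K fun z => by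
    obtain ⟨x, y, hy, rfl⟩ := IsFractionRing.div_surjective (A := R) z
    obtain ⟨a, b, rfl⟩ := IsLocalization.exists_mk'_eq P.primeCompl x
    obtain ⟨c, d, rfl⟩ := IsLocalization.exists_mk'_eq P.primeCompl y
    have h1 : ∀ (a : A) (b : P.primeCompl), algebraMap R K (IsLocalization.mk' R a b) =
        algebraMap A K a / algebraMap A K b := by
      intro a b
      have hb : algebraMap A K b ≠ 0 :=
        (map_ne_zero_iff _ hinj).2 (nonZeroDivisors.ne_zero (hle b.2))
      rw [eq_div_iff hb, IsScalarTower.algebraMap_apply A R K, IsScalarTower.algebraMap_apply A R K,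
        ← map_mul, IsLocalization.mk'_spec]
    refine ⟨a * d, b * c, ?_⟩
    rw [h1, h1, div_div_div_eq, map_mul, map_mul]
  let e : FractionRing A ≃ₐ[A] K := FractionRing.algEquiv A K
  have hsurj : ∀ x : K, IsIntegral R x → ∃ r : R, algebraMap R K r = x := by
    intro x hx
    obtain ⟨m, hm⟩ := IsIntegral.exists_multiple_integral_of_isLocalization P.primeCompl x hx
    obtain ⟨a, ha⟩ := hf (e.symm (m • x)) (hm.map e.symm.toAlgHom)
    have h1 := congrArg e ha
    rw [map_mul, e.commutes, e.commutes, e.apply_symm_apply, Submonoid.smul_def, Algebra.smul_def,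
      ← mul_assoc, ← map_mul] at h1
    have hmem : f * m.1 ∈ P.primeCompl := P.primeCompl.mul_mem hfP m.2
    refine ⟨IsLocalization.mk' R a ⟨f * m.1, hmem⟩, ?_⟩
    have hne : algebraMap A K (f * m.1) ≠ 0 :=
      (map_ne_zero_iff _ (IsFractionRing.injective A K)).2 (nonZeroDivisors.ne_zero (hle hmem))
    refine mul_left_cancel₀ hne ?_
    rw [h1, IsScalarTower.algebraMap_apply A R K, ← map_mul, IsLocalization.mk'_spec'_mk,
      ← IsScalarTower.algebraMap_apply]
  have htop : LinearMap.range (Algebra.linearMap R (integralClosure R (FractionRing R))) = ⊤ := by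
    rw [LinearMap.range_eq_top]
    rintro ⟨x, hx⟩
    obtain ⟨r, hr⟩ := hsurj x hx
    exact ⟨r, Subtype.ext hr⟩
  rw [htop, Module.length_eq_zero_iff.2 inferInstance] at hlen
  exact zero_ne_one hlen

end Algebra

/-! ### Node rings -/

section NodeRing

variable {R : Type} [CommRing R]

lemma IsNodeRing.isCoatom (h : IsNodeRing R) :
    IsCoatom (LinearMap.range (Algebra.linearMap R (integralClosure R (FractionRing R)))) :=
  isSimpleModule_iff_isCoatom.1 (Module.length_eq_one_iff.1 h.2.2)

lemma IsNodeRing.exists_ne (h : IsNodeRing R) :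
    ∃ M₁ M₂ : MaximalSpectrum (integralClosure R (FractionRing R)), M₁ ≠ M₂ := by
  obtain ⟨a, b, hab, -⟩ := Nat.card_eq_two_iff.1 h.2.1
  exact ⟨a, b, hab⟩

lemma IsNodeRing.krullDimLE (h : IsNodeRing R) : Ring.KrullDimLE 1 R := by
  rw [Ring.krullDimLE_iff, h.1]; rfl

variable [IsLocalRing R]

lemma map_maximalIdeal_le (M : Ideal (integralClosure R (FractionRing R))) [hM : M.IsMaximal] :
    (IsLocalRing.maximalIdeal R).map (algebraMap R _) ≤ M := by
  rw [Ideal.map_le_iff_le_comap]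
  have h1 : (M.comap (algebraMap R (integralClosure R (FractionRing R)))).IsMaximal :=
    Ideal.isMaximal_comap_of_isIntegral_of_isMaximal M
  rw [IsLocalRing.eq_maximalIdeal h1]

/-- The radical of the integral closure of a node is contained in the node. -/
lemma IsNodeRing.exists_eq_of_pow_mem (h : IsNodeRing R)
    (r : integralClosure R (FractionRing R)) (n : ℕ)
    (hr : r ^ n ∈ (IsLocalRing.maximalIdeal R).map (algebraMap R _)) :
    ∃ a : R, algebraMap R _ a = r := by
  have hrJ : ∀ M : Ideal (integralClosure R (FractionRing R)), M.IsMaximal → r ∈ M :=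
    fun M hM => hM.isPrime.mem_of_pow_mem n (map_maximalIdeal_le M hr)
  let J : Ideal (integralClosure R (FractionRing R)) := sInf {M | M.IsMaximal}
  have hrJ' : r ∈ J := Ideal.mem_sInf.2 fun {M} hM => hrJ M hM
  rcases h.isCoatom.le_iff.1 (le_sup_left : _ ≤ LinearMap.range (Algebra.linearMap R _) ⊔
    J.restrictScalars R) with h1 | h1
  · exfalso
    obtain ⟨M₁, M₂, hne⟩ := h.exists_ne
    have : ¬ M₁.asIdeal ≤ M₂.asIdeal := fun hle =>
      hne (MaximalSpectrum.ext (M₁.isMaximal.eq_of_le M₂.isMaximal.ne_top hle))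
    obtain ⟨b, hb1, hb2⟩ := Set.not_subset.1 this
    have hb : b ∈ LinearMap.range (Algebra.linearMap R _) ⊔ J.restrictScalars R := h1 ▸ trivial
    obtain ⟨_, ⟨a, rfl⟩, j, hj, rfl⟩ := Submodule.mem_sup.1 hb
    have hj1 : j ∈ M₁.asIdeal := Ideal.mem_sInf.1 hj M₁.isMaximal
    have hj2 : j ∈ M₂.asIdeal := Ideal.mem_sInf.1 hj M₂.isMaximal
    have ha1 : algebraMap R _ a ∈ M₁.asIdeal := (Submodule.add_mem_iff_left _ hj1).1 hb1
    have ha : a ∈ IsLocalRing.maximalIdeal R := by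
      have hm := M₁.isMaximal
      have h1 : (M₁.asIdeal.comap (algebraMap R _)).IsMaximal :=
        Ideal.isMaximal_comap_of_isIntegral_of_isMaximal M₁.asIdeal
      rw [← IsLocalRing.eq_maximalIdeal h1]
      exact ha1
    have hm2 := M₂.isMaximal
    exact hb2 (add_mem (map_maximalIdeal_le M₂.asIdeal (Ideal.mem_map_of_mem _ ha)) hj2)
  · have : r ∈ LinearMap.range (Algebra.linearMap R _) ⊔ J.restrictScalars R :=
      Submodule.mem_sup_right hrJ'
    rw [h1] at this
    exact this

/-- An element of the integral closure of a node which vanishes on exactly one of the branches. -/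
lemma IsNodeRing.exists_not_isUnit (h : IsNodeRing R) :
    ∃ r : integralClosure R (FractionRing R), ¬ IsUnit r ∧
      ∀ n : ℕ, r ^ n ∉ (IsLocalRing.maximalIdeal R).map (algebraMap R _) := by
  obtain ⟨M₁, M₂, hne⟩ := h.exists_ne
  have : ¬ M₁.asIdeal ≤ M₂.asIdeal := fun hle =>
    hne (MaximalSpectrum.ext (M₁.isMaximal.eq_of_le M₂.isMaximal.ne_top hle))
  obtain ⟨b, hb1, hb2⟩ := Set.not_subset.1 this
  have hm2 := M₂.isMaximal
  refine ⟨b, fun hu => M₁.isMaximal.ne_top (Ideal.eq_top_of_isUnit_mem _ hb1 hu), fun n hn => hb2 ?_⟩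
  exact M₂.isMaximal.isPrime.mem_of_pow_mem n (map_maximalIdeal_le M₂.asIdeal hn)

/-- In a node every non-zerodivisor generates an ideal with radical the maximal ideal. -/
lemma IsNodeRing.exists_dvd_pow (h : IsNodeRing R) {t : R} (ht : t ∈ nonZeroDivisors R) (a : R)
    (ha : a ∈ IsLocalRing.maximalIdeal R) : ∃ n : ℕ, t ∣ a ^ n := by
  have : a ∈ (Ideal.span {t}).radical := by
    rw [Ideal.radical_eq_sInf]
    refine Ideal.mem_sInf.2 ?_
    rintro P ⟨htP, hP⟩
    rcases Ring.krullDimLE_one_iff.1 h.krullDimLE P hP with h1 | h1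
    · exact absurd ht (notMem_nonZeroDivisors_of_mem_mem_minimalPrimes
        (htP (Ideal.mem_span_singleton_self t)) h1)
    · rwa [IsLocalRing.eq_maximalIdeal h1]
  obtain ⟨n, hn⟩ := this
  exact ⟨n, Ideal.mem_span_singleton.1 hn⟩

end NodeRing

section Transport

variable {R S : Type} [CommRing R] [CommRing S]

lemma IsDVR.of_ringEquiv (e : R ≃+* S) (h : IsDVR R) : IsDVR S := by
  obtain ⟨_, _⟩ := h
  have : IsDomain S := MulEquiv.isDomain R e.symm.toMulEquiv
  exact ⟨this, IsDiscreteValuationRing.RingEquivClass.isDiscreteValuationRing e⟩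

lemma IsNodeRing.of_ringEquiv (e : R ≃+* S) (h : IsNodeRing R) : IsNodeRing S := by
  let eK : FractionRing R ≃+* FractionRing S := IsFractionRing.ringEquivOfRingEquiv e
  have heK : ∀ r : R, eK (algebraMap R _ r) = algebraMap S _ (e r) := fun r =>
    IsFractionRing.ringEquivOfRingEquiv_algebraMap e r
  have hint : ∀ x, IsIntegral R x → IsIntegral S (eK x) := by
    rintro x ⟨p, hp, hx⟩
    refine ⟨p.map e.toRingHom, hp.map _, ?_⟩
    rw [Polynomial.eval₂_map]
    have h1 := congrArg eK hx
    have h2 : (algebraMap S (FractionRing S)).comp e.toRingHom =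
      eK.toRingHom.comp (algebraMap R (FractionRing R)) := RingHom.ext fun r => (heK r).symm
    rw [map_zero] at h1
    rw [h2, ← h1]
    exact (Polynomial.hom_eval₂ p _ eK.toRingHom x).symm
  have hint' : ∀ x, IsIntegral S x → IsIntegral R (eK.symm x) := by
    rintro x ⟨p, hp, hx⟩
    refine ⟨p.map e.symm.toRingHom, hp.map _, ?_⟩
    rw [Polynomial.eval₂_map]
    have h1 := congrArg eK.symm hx
    have h2 : (algebraMap R (FractionRing R)).comp e.symm.toRingHom =
      eK.symm.toRingHom.comp (algebraMap S (FractionRing S)) := RingHom.ext fun r => by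
        refine eK.injective ?_
        change eK (algebraMap R _ (e.symm r)) = eK (eK.symm _)
        rw [heK]; simp
    rw [map_zero] at h1
    rw [h2, ← h1]
    exact (Polynomial.hom_eval₂ p _ eK.symm.toRingHom x).symm
  let eI : integralClosure R (FractionRing R) ≃+* integralClosure S (FractionRing S) :=
    { toFun := fun x => ⟨eK x.1, hint _ x.2⟩
      invFun := fun x => ⟨eK.symm x.1, hint' _ x.2⟩
      left_inv := fun x => Subtype.ext (eK.symm_apply_apply _)
      right_inv := fun x => Subtype.ext (eK.apply_symm_apply _)
      map_mul' := fun x y => Subtype.ext (map_mul eK _ _)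
      map_add' := fun x y => Subtype.ext (map_add eK _ _) }
  have heI : ∀ r : R, eI (algebraMap R _ r) = algebraMap S _ (e r) := fun r => Subtype.ext (heK r)
  refine ⟨?_, ?_, ?_⟩
  · rw [← h.1]; exact (ringKrullDim_eq_of_ringEquiv e).symm
  · rw [← h.2.1]
    refine Nat.card_congr
      { toFun := fun M => ⟨M.asIdeal.comap eI, ?_⟩
        invFun := fun M => ⟨M.asIdeal.comap eI.symm, ?_⟩
        left_inv := fun M => ?_
        right_inv := fun M => ?_ }
    · have := M.isMaximal
      exact Ideal.comap_isMaximal_of_equiv eI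
    · have := M.isMaximal
      exact Ideal.comap_isMaximal_of_equiv eI.symm
    · refine MaximalSpectrum.ext (Ideal.ext fun x => ?_)
      change eI (eI.symm x) ∈ M.asIdeal ↔ _
      rw [eI.apply_symm_apply]
    · refine MaximalSpectrum.ext (Ideal.ext fun x => ?_)
      change eI.symm (eI x) ∈ M.asIdeal ↔ _
      rw [eI.symm_apply_apply]
  · rw [Module.length_eq_one_iff, isSimpleModule_iff_isCoatom]
    let σ : R →+* S := e
    let σ' : S →+* R := e.symm
    have : RingHomInvPair σ σ' := RingHomInvPair.of_ringEquiv e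
    have : RingHomInvPair σ' σ := RingHomInvPair.of_ringEquiv e.symm
    let eL : integralClosure R (FractionRing R) ≃ₛₗ[σ] integralClosure S (FractionRing S) :=
      { eI with
        map_smul' := fun r x => by
          change eI (r • x) = σ r • eI x
          rw [Algebra.smul_def, map_mul, heI, Algebra.smul_def]; rfl }
    have h1 := ((Submodule.orderIsoMapComap eL).isCoatom_iff _).2 h.isCoatom
    convert h1 using 1
    ext x
    constructor
    · rintro ⟨s, rfl⟩
      exact ⟨_, ⟨e.symm s, rfl⟩, (heI _).trans (by rw [e.apply_symm_apply]; rfl)⟩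
    · rintro ⟨_, ⟨r, rfl⟩, rfl⟩
      exact ⟨e r, (heI r).symm⟩

end Transport


/-! ### Nodal curves -/

namespace IsNodalCurve

variable {X : Scheme.{0}} {s : X ⟶ Spec (.of ℂ)} (hX : IsNodalCurve s)
include hX

lemma locallyOfFiniteType : LocallyOfFiniteType s := by
  have := hX.proper; infer_instance

lemma isLocallyNoetherian : IsLocallyNoetherian X := by
  have := hX.proper
  exact LocallyOfFiniteType.isLocallyNoetherian s

lemma compactSpace : CompactSpace X := by
  have := hX.proper
  exact (quasiCompact_iff_compactSpace s).1 inferInstance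

lemma noetherianSpace : NoetherianSpace X := by
  have := hX.isLocallyNoetherian
  have := hX.compactSpace
  have : IsNoetherian X := {}
  infer_instance

lemma ringKrullDim_stalk {x : X} (hx : IsClosed {x}) : ringKrullDim (X.presheaf.stalk x) = 1 := by
  rcases hX.smooth_or_node x hx with h | h
  · obtain ⟨_, _⟩ := h
    exact IsPrincipalIdealRing.ringKrullDim_eq_one _ (IsDiscreteValuationRing.not_isField _)
  · exact h.1

lemma eq_or_eq_of_specializes {x z w : X} (hx : IsClosed {x}) (h₁ : z ⤳ x) (h₂ : w ⤳ z) :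
    z = x ∨ w = z := by
  by_contra! h
  have h3 := ringKrullDim_stalk_eq_coheight x
  rw [hX.ringKrullDim_stalk hx] at h3
  have hlt : ∀ {a b : X}, b ⤳ a → b ≠ a → a < b := by
    intro a b hab hne
    have hle : a ≤ b := hab
    refine lt_of_le_not_ge hle fun h' => hne ?_
    have h'' : a ⤳ b := h'
    exact (hab.antisymm h'').eq
  have h4 := Order.coheight_add_one_le (hlt h₁ h.1)
  have h5 := Order.coheight_add_one_le (hlt h₂ h.2)
  have h6 : (Order.coheight x : ℕ∞) = 1 := by exact_mod_cast h3.symm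
  rw [h6] at h4
  have h7 : Order.coheight z = 0 := by
    have : Order.coheight z + 1 ≤ 0 + 1 := by simpa using h4
    simpa using (ENat.add_le_add_iff_right ENat.one_ne_top).1 this
  rw [h7] at h5
  simp at h5

/-- The singular points do not accumulate at a non-closed point. -/
lemma exists_disjoint_singularPoints {z : X} (hz : ¬ IsClosed {z}) :
    ∃ U : X.Opens, z ∈ U ∧ Disjoint (U : Set X) (singularPoints X) := by
  have := hX.locallyOfFiniteType
  have := hX.isLocallyNoetherian
  have := hX.reduced
  obtain ⟨y, -, hy, hzy⟩ := exists_closed_mem s (U := ⊤) (x := z) trivial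
  have hgen : ∀ w, w ⤳ z → w = z := fun w hw =>
    (hX.eq_or_eq_of_specializes hy hzy hw).resolve_left fun h => hz (h ▸ hy)
  have hirr : closure {z} ∈ irreducibleComponents X := by
    refine ⟨isIrreducible_singleton.closure, fun T hT hle => ?_⟩
    obtain ⟨w, hw⟩ := QuasiSober.sober hT.closure isClosed_closure
    have hwz : w ⤳ z := by
      rw [specializes_iff_mem_closure, hw]
      exact subset_closure (hle (subset_closure rfl))
    rw [hgen w hwz] at hw
    exact subset_closure.trans hw.ge
  have hfield := isField_stalk_of_closure_mem_irreducibleComponents X z hirr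
  obtain ⟨U, hzU, hU, hinj⟩ := X.exists_germ_injective z
  let := hfield.toField
  have hdom : IsDomain Γ(X, U) := hinj.isDomain (X.presheaf.germ U z hzU).hom
  let : Algebra ℂ Γ(X, U) := (cst s U).toAlgebra
  have hft : Algebra.FiniteType ℂ Γ(X, U) := by
    have h1 := LocallyOfFiniteType.finiteType_appLE s (U := ⊤) (isAffineOpen_top _)
      (V := U) hU (le_preimage_top s U)
    exact h1.comp (RingHom.FiniteType.of_surjective _
      (ConcreteCategory.bijective_of_isIso (Scheme.ΓSpecIso (.of ℂ)).inv).2)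
  obtain ⟨f, hf0, hf⟩ := exists_conductor ℂ Γ(X, U)
  refine ⟨X.basicOpen f, ?_, ?_⟩
  · refine (notMem_idealAt_iff (hp := hzU)).1 fun h => hf0 ?_
    rw [mem_idealAt, IsLocalRing.isField_iff_maximalIdeal_eq.1 hfield, Ideal.mem_bot] at h
    exact hinj (h.trans (map_zero _).symm)
  · rw [Set.disjoint_left]
    rintro x hx ⟨hxc, hxs⟩
    have hxU : x ∈ U := X.basicOpen_le f hx
    let := TopCat.Presheaf.algebra_section_stalk X.presheaf (⟨x, hxU⟩ : U)
    have := hU.isLocalization_stalk ⟨x, hxU⟩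
    have hn := (hX.smooth_or_node x hxc).resolve_left hxs
    refine not_isNodeRing_of_conductor (hU.primeIdealOf ⟨x, hxU⟩).asIdeal (f := f) ?_ hf hn
    rw [← idealAt_eq_primeIdealOf hU, notMem_idealAt_iff]
    exact hx

lemma finite_singularPoints : (singularPoints X).Finite := by
  have := hX.noetherianSpace
  let O : Set X := ⋃₀ {U | IsOpen U ∧ Disjoint U (singularPoints X)}
  have hO : IsOpen O := isOpen_sUnion fun U hU => hU.1
  have hcl : ∀ z ∈ Oᶜ, IsClosed {z} := by
    intro z hz
    by_contra h
    obtain ⟨U, hzU, hU⟩ := hX.exists_disjoint_singularPoints h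
    exact hz ⟨U, ⟨U.2, hU⟩, hzU⟩
  have hsub : singularPoints X ⊆ Oᶜ := by
    rintro x hx ⟨U, ⟨-, hU⟩, hxU⟩
    exact Set.disjoint_left.1 hU hxU hx
  refine Set.Finite.subset ?_ hsub
  obtain ⟨S, hS, hSc, hSi, e⟩ := NoetherianSpace.exists_finite_set_isClosed_irreducible
    hO.isClosed_compl
  rw [e]
  refine hS.sUnion fun T hT => ?_
  obtain ⟨w, hw⟩ := QuasiSober.sober (hSi T hT) (hSc T hT)
  have hwT : w ∈ T := hw ▸ subset_closure rfl
  have : T = {w} := by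
    rw [← hw.def]
    exact (hcl w (e ▸ ⟨T, hT, hwT⟩)).closure_eq
  rw [this]
  exact Set.finite_singleton w

lemma isClosed_of_subset {S : Set X} (hS : S ⊆ singularPoints X) : IsClosed S := by
  have hfin := hX.finite_singularPoints.subset hS
  rw [← Set.biUnion_of_singleton S]
  exact hfin.isClosed_biUnion fun x hx => (hS hx).1

end IsNodalCurve


section IsoOver

variable {X Y : Scheme.{0}} (f : Y ⟶ X)

lemma isIso_morphismRestrict_mono {V V' : X.Opens} (h : V' ≤ V) (hV : IsIso (f ∣_ V)) :
    IsIso (f ∣_ V') := by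
  have h1 := (MorphismProperty.isomorphisms Scheme).arrow_mk_iso_iff
    (morphismRestrictRestrict f V (V.ι ⁻¹ᵁ V'))
  have h2 : V.ι ''ᵁ (V.ι ⁻¹ᵁ V') = V' := by
    rw [Scheme.Hom.image_preimage_eq_opensRange_inf, Scheme.Opens.opensRange_ι, inf_eq_right]
    exact h
  rw [h2] at h1
  exact h1.1 (MorphismProperty.isomorphisms.infer_property _)

lemma isIso_morphismRestrict_of_locally {V : X.Opens}
    (h : ∀ x ∈ V, ∃ V' ≤ V, x ∈ V' ∧ IsIso (f ∣_ V')) : IsIso (f ∣_ V) := by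
  choose W hWV hxW hW using fun x : V => h x.1 x.2
  refine (IsZariskiLocalAtTarget.of_iSup_eq_top (P := MorphismProperty.isomorphisms Scheme)
    (fun x : V => V.ι ⁻¹ᵁ W x) ?_ fun x => ?_ : MorphismProperty.isomorphisms Scheme (f ∣_ V))
  · refine eq_top_iff.2 fun x _ => Opens.mem_iSup.2 ⟨x, ?_⟩
    exact hxW x
  · have h1 := (MorphismProperty.isomorphisms Scheme).arrow_mk_iso_iff
      (morphismRestrictRestrict f V (V.ι ⁻¹ᵁ W x))
    have h2 : V.ι ''ᵁ (V.ι ⁻¹ᵁ W x) = W x := by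
      rw [Scheme.Hom.image_preimage_eq_opensRange_inf, Scheme.Opens.opensRange_ι, inf_eq_right]
      exact hWV x
    rw [h2] at h1
    exact h1.2 (hW x)

lemma pb_bijective_of_isIso {V : X.Opens} (hV : IsIso (f ∣_ V)) {V' : X.Opens} (h : V' ≤ V) :
    Function.Bijective (pb f (le_refl (f ⁻¹ᵁ V'))) := by
  have h1 := isIso_morphismRestrict_mono f h hV
  have h2 : IsIso ((f ∣_ V').app ⊤) := inferInstance
  have h3 : (f ∣_ V').app ⊤ = _ := morphismRestrict_app' f V' ⊤
  rw [h3] at h2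
  have h4 : Function.Bijective (pb f (U := V'.ι ''ᵁ ⊤)
      (V := (f ⁻¹ᵁ V').ι ''ᵁ (f ∣_ V') ⁻¹ᵁ ⊤) (by
        rw [image_morphismRestrict_preimage])) :=
    (ConcreteCategory.isIso_iff_bijective _).1 h2
  have e1 : V'.ι ''ᵁ ⊤ = V' := by simp
  have e2 : (f ⁻¹ᵁ V').ι ''ᵁ (f ∣_ V') ⁻¹ᵁ ⊤ = f ⁻¹ᵁ V' := by simp
  have key : ∀ (A : X.Opens) (B : Y.Opens) (h : B ≤ f ⁻¹ᵁ A), A = V' → B = f ⁻¹ᵁ V' →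
      Function.Bijective (pb f h) → Function.Bijective (pb f (le_refl (f ⁻¹ᵁ V'))) := by
    rintro A B h rfl rfl h'
    exact h'
  exact key _ _ _ e1 e2 h4

lemma isIso_of_pb_bijective [IsAffineHom f] {V : X.Opens} (hV : IsAffineOpen V)
    (h : Function.Bijective (pb f (le_refl (f ⁻¹ᵁ V)))) : IsIso (f ∣_ V) := by
  rw [isIso_morphismRestrict_iff_isIso_app f hV, ConcreteCategory.isIso_iff_bijective]
  have : (f.app V : Γ(X, V) → Γ(Y, f ⁻¹ᵁ V)) = pb f le_rfl := funext fun x => app_eq_pb f x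
  rw [this]
  exact h

lemma existsUnique_of_isIso {V : X.Opens} (hV : IsIso (f ∣_ V)) {x : X} (hx : x ∈ V) :
    ∃! y, f y = x := by
  have h2 : Function.Bijective (f ∣_ V) := (Scheme.homeoOfIso (asIso (f ∣_ V))).bijective
  obtain ⟨y, hy⟩ := h2.2 ⟨x, hx⟩
  have h3 : ∀ y : (f ⁻¹ᵁ V : Y.Opens), ((f ∣_ V) y).1 = f y.1 := fun y =>
    morphismRestrict_base_coe f V y
  refine ⟨y.1, (h3 y).symm.trans (congrArg Subtype.val hy), fun z hz => ?_⟩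
  have hz' : z ∈ f ⁻¹ᵁ V := by
    change f z ∈ V
    rwa [hz]
  have h4 : (⟨z, hz'⟩ : (f ⁻¹ᵁ V : Y.Opens)) = y := by
    apply h2.1
    rw [hy]
    exact Subtype.ext ((h3 ⟨z, hz'⟩).trans hz)
  exact congrArg Subtype.val h4

lemma stalkMap_bijective_of_isIso {V : X.Opens} (hV : IsIso (f ∣_ V)) {y : Y} (hy : f y ∈ V) :
    Function.Bijective (f.stalkMap y) := by
  have h1 := (MorphismProperty.isomorphisms CommRingCat).arrow_mk_iso_iff
    (morphismRestrictStalkMap f V ⟨y, hy⟩)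
  have h2 : IsIso ((f ∣_ V).stalkMap ⟨y, hy⟩) :=
    ((isIso_iff_isIso_stalkMap (f ∣_ V)).1 hV).2 ⟨y, hy⟩
  have h3 : IsIso (f.stalkMap y) := h1.1 h2
  exact (ConcreteCategory.isIso_iff_bijective _).1 h3

/-- The isomorphism of local rings at a point near which a morphism is an isomorphism. -/
noncomputable def stalkEquiv {V : X.Opens} (hV : IsIso (f ∣_ V)) {y : Y} (hy : f y ∈ V) :
    X.presheaf.stalk (f y) ≃+* Y.presheaf.stalk y :=
  RingEquiv.ofBijective (f.stalkMap y).hom (stalkMap_bijective_of_isIso f hV hy)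

lemma isDVR_iff_of_isIso {V : X.Opens} (hV : IsIso (f ∣_ V)) {y : Y} (hy : f y ∈ V) :
    IsDVR (X.presheaf.stalk (f y)) ↔ IsDVR (Y.presheaf.stalk y) :=
  ⟨fun h => h.of_ringEquiv (stalkEquiv f hV hy), fun h => h.of_ringEquiv (stalkEquiv f hV hy).symm⟩

end IsoOver

/-! ### The normalization of a node -/

/-- Near the node `x` of `X`, the morphism `f : Y ⟶ X` is the normalization. -/
structure IsNodeFibre {X Y : Scheme.{0}} (f : Y ⟶ X) (x : X) (V₀ : X.Opens) : Prop where
  finite : IsFinite f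
  noeth : IsLocallyNoetherian X
  closed : IsClosed {x}
  node : IsNodeRing (X.presheaf.stalk x)
  mem : x ∈ V₀
  iso : ∀ V ≤ V₀, x ∉ V → IsIso (f ∣_ V)
  dvr : ∀ p, f p = x → IsDVR (Y.presheaf.stalk p)

namespace IsNodeFibre

variable {X Y : Scheme.{0}} {f : Y ⟶ X} {x : X} {V₀ : X.Opens} (H : IsNodeFibre f x V₀)

include H

lemma apply_ne_of_specializes {p ξ : Y} (h : ξ ⤳ p) (hne : ξ ≠ p) : f ξ ≠ x := by
  intro hx
  have := H.finite
  have h1 : IsClosed {ξ} := isClosed_singleton_of_isFinite f (by rw [hx]; exact H.closed)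
  exact hne (h1.closure_eq ▸ h.mem_closure : p ∈ ({ξ} : Set Y)).symm

lemma germ_pb_ne_zero {V : X.Opens} {h : Γ(X, V)}
    (hz : ∀ q (hq : q ∈ V), h ∈ idealAt V q hq → q = x) {p : Y} (hp : f p = x) (hpV : f p ∈ V) :
    Y.presheaf.germ (f ⁻¹ᵁ V) p hpV (pb f le_rfl h) ≠ 0 := by
  intro h0
  obtain ⟨ξ, hξ, hne⟩ := exists_specializes_ne (H.dvr p hp)
  have hξV : ξ ∈ f ⁻¹ᵁ V := hξ.mem_open (f ⁻¹ᵁ V).2 hpV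
  have h2 : Y.presheaf.germ (f ⁻¹ᵁ V) ξ hξV (pb f le_rfl h) = 0 := by
    have h3 := ConcreteCategory.congr_hom
      (Y.presheaf.germ_stalkSpecializes (U := f ⁻¹ᵁ V) hpV hξ) (pb f le_rfl h)
    rw [← h3]
    change (Y.presheaf.stalkSpecializes hξ).hom (Y.presheaf.germ (f ⁻¹ᵁ V) p hpV (pb f le_rfl h)) = 0
    rw [h0, map_zero]
  have h4 : pb f le_rfl h ∈ idealAt (f ⁻¹ᵁ V) ξ hξV := by
    rw [mem_idealAt, h2]; exact zero_mem _
  rw [pb_mem_idealAt] at h4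
  exact H.apply_ne_of_specializes hξ hne (hz _ _ h4)

lemma eq_zero_of_mul {V : X.Opens} {h : Γ(X, V)}
    (hz : ∀ q (hq : q ∈ V), h ∈ idealAt V q hq → q = x) {U : Y.Opens} (hU : U ≤ f ⁻¹ᵁ V)
    (b : Γ(Y, U)) (hb : pb f hU h * b = 0) : b = 0 := by
  refine fun_ext _ _ fun p hp => ?_
  have key : Y.presheaf.germ U p hp b = Y.presheaf.germ U p hp 0 := by
    have h1 := congrArg (Y.presheaf.germ U p hp) hb
    rw [map_mul, map_zero] at h1
    rw [map_zero]
    by_cases hpx : f p = x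
    · obtain ⟨_, _⟩ := H.dvr p hpx
      have h2 : pb f hU h = fres hU (pb f le_rfl h) := by rw [fres_pb]
      rw [h2, germ_fres] at h1
      exact (mul_eq_zero.1 h1).resolve_left (H.germ_pb_ne_zero hz hpx (hU hp))
    · have h2 : pb f hU h ∉ idealAt U p hp := by
        rw [pb_mem_idealAt]
        exact fun h3 => hpx (hz _ _ h3)
      have h3 : IsUnit (Y.presheaf.germ U p hp (pb f hU h)) := by
        rw [mem_idealAt, IsLocalRing.mem_maximalIdeal, mem_nonunits_iff, not_not] at h2
        exact h2
      exact (h3.mul_right_eq_zero).1 h1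
  exact (germ_eq_iff _ _ _ _).1 key

/-- Functions near the fibre of the normalization over a node, as fractions. -/
lemma exists_ringHom {V : X.Opens} (hV : IsAffineOpen V) (hVV : V ≤ V₀) (hx : x ∈ V) {h : Γ(X, V)}
    (hz : ∀ q (hq : q ∈ V), h ∈ idealAt V q hq → q = x)
    (hxh : h ∈ idealAt V x hx)
    (hn : X.presheaf.germ V x hx h ∈ nonZeroDivisors (X.presheaf.stalk x)) :
    ∃ θ : Γ(Y, f ⁻¹ᵁ V) →+* FractionRing (X.presheaf.stalk x),
      (∀ a, θ (pb f le_rfl a) = algebraMap _ _ (X.presheaf.germ V x hx a)) ∧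
      ∀ b, θ b = 0 → ∃ g, g ∉ idealAt V x hx ∧ pb f le_rfl g * b = 0 := by
  have := H.finite
  have hD : x ∉ X.basicOpen h := fun h' => notMem_idealAt_iff.2 h' hxh
  have hDV : X.basicOpen h ≤ V := X.basicOpen_le h
  have hiso := H.iso (X.basicOpen h) (hDV.trans hVV) hD
  let e := RingEquiv.ofBijective _ (pb_bijective_of_isIso f hiso le_rfl)
  have : IsLocalization.Away h Γ(X, X.basicOpen h) := hV.isLocalization_basicOpen h
  have hu : IsUnit (((algebraMap (X.presheaf.stalk x) (FractionRing (X.presheaf.stalk x))).comp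
      (X.presheaf.germ V x hx).hom) h) := 
    IsLocalization.map_units (FractionRing (X.presheaf.stalk x))
      (⟨_, hn⟩ : nonZeroDivisors (X.presheaf.stalk x))
  let l : Γ(X, X.basicOpen h) →+* FractionRing (X.presheaf.stalk x) :=
    IsLocalization.Away.lift h hu
  have hl : ∀ a, l (fres hDV a) = algebraMap _ _ (X.presheaf.germ V x hx a) := fun a =>
    IsLocalization.Away.lift_eq h hu a
  have he : ∀ c, e c = pb f le_rfl c := fun c => rfl
  refine ⟨l.comp ((e.symm : _ →+* _).comp (fres (f.preimage_mono hDV))), fun a => ?_, fun b hb => ?_⟩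
  · rw [← hl]
    change l (e.symm (fres (f.preimage_mono hDV) (pb f le_rfl a))) = _
    congr 1
    rw [RingEquiv.symm_apply_eq, he, fres_pb, pb_fres]
  · obtain ⟨c, hc⟩ := e.surjective (fres (f.preimage_mono hDV) b)
    have hb' : l c = 0 := by
      rw [← hb]
      change l c = l (e.symm _)
      rw [← hc, RingEquiv.symm_apply_apply]
    obtain ⟨n, d, hd⟩ := exists_pow_mul_eq_fres hV h rfl hDV c
    have hd0 : X.presheaf.germ V x hx d = 0 := by
      have h1 := congrArg l hd
      rw [map_mul, hb', mul_zero, hl] at h1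
      exact (IsFractionRing.injective (X.presheaf.stalk x) (FractionRing (X.presheaf.stalk x)))
        (h1.symm.trans (map_zero _).symm)
    obtain ⟨g, hg, hgd⟩ := (germ_eq_zero_iff hV hx d).1 hd0
    refine ⟨g, hg, ?_⟩
    have hpow : ∀ (k : ℕ) (b : Γ(Y, f ⁻¹ᵁ V)), pb f le_rfl h ^ k * b = 0 → b = 0 := by
      intro k
      induction k with
      | zero => intro b hb; simpa using hb
      | succ k ih => 
        intro b hb
        rw [pow_succ, mul_assoc] at hb
        exact H.eq_zero_of_mul hz le_rfl _ (ih _ hb)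
    have hres : ∀ b : Γ(Y, f ⁻¹ᵁ V), fres (f.preimage_mono hDV) b = 0 → b = 0 := by
      intro b hb
      obtain ⟨k, hk⟩ := exists_pow_mul_eq_zero (hV.preimage f) (pb f le_rfl h)
        (V := f ⁻¹ᵁ X.basicOpen h) (by rw [Scheme.preimage_basicOpen, app_eq_pb])
        (f.preimage_mono hDV) b hb
      exact hpow k b hk
    apply hpow n
    apply hres
    have h1 := congrArg (pb f (le_refl (f ⁻¹ᵁ X.basicOpen h))) hd
    have h2 := congrArg (pb f (le_refl (f ⁻¹ᵁ V))) hgd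
    have h3 : fres (f.preimage_mono hDV) b = pb f le_rfl c := hc.symm
    have h4 := congrArg (fres (f.preimage_mono hDV)) h2
    simp only [map_mul, map_pow, map_zero, fres_pb, pb_fres] at h1 h4 ⊢
    rw [h3]
    calc _ = pb f _ g * (pb f _ h ^ n * pb f _ c) := by ring
      _ = _ := by rw [h1, h4]

end IsNodeFibre


lemma IsNodeRing.map_dvd_map {R O : Type} [CommRing R] [IsLocalRing R] (hR : IsNodeRing R)
    [CommRing O] (hO : IsDVR O) (ψ : R →+* O) {a h : R}
    (hh : h ∈ IsLocalRing.maximalIdeal R) (hψ : ψ h ≠ 0)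
    (r : integralClosure R (FractionRing R)) (hr : algebraMap R _ h * r = algebraMap R _ a) :
    ψ h ∣ ψ a := by
  obtain ⟨_, _⟩ := hO
  let L := FractionRing O
  have hu : ∀ g : nonZeroDivisors R, IsUnit (((algebraMap O L).comp ψ) g) := by
    rintro ⟨g, hg⟩
    obtain ⟨n, c, hc⟩ := hR.exists_dvd_pow hg h hh
    have h1 : ψ g ≠ 0 := by
      intro h0
      have h2 := congrArg ψ hc
      rw [map_mul, h0, zero_mul, map_pow] at h2
      exact hψ (eq_zero_of_pow_eq_zero h2)
    exact (IsUnit.mk0 _ ((map_ne_zero_iff _ (IsFractionRing.injective O L)).2 h1))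
  let ρ : FractionRing R →+* L := IsLocalization.lift hu
  have hρ : ∀ g, ρ (algebraMap R _ g) = algebraMap O L (ψ g) := fun g => IsLocalization.lift_eq hu g
  have hint : IsIntegral O (ρ r) :=
    IsIntegral.map_of_comp_eq ψ ρ (by ext g; exact (hρ g).symm) r.2
  obtain ⟨β, hβ⟩ := IsIntegrallyClosed.isIntegral_iff.1 hint
  refine ⟨β, ?_⟩
  apply IsFractionRing.injective O L
  have h1 := congrArg (fun z => ρ (z : integralClosure R (FractionRing R)).1) hr
  change ρ (algebraMap R _ h * r.1) = ρ (algebraMap R _ a) at h1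
  rw [map_mul, hρ, hρ] at h1
  rw [map_mul, hβ, h1]

namespace IsNodeFibre

variable {X Y : Scheme.{0}} {f : Y ⟶ X} {x : X} {V₀ : X.Opens} (H : IsNodeFibre f x V₀)

include H

lemma pow_mem_map {V : X.Opens} (hV : IsAffineOpen V) (hx : x ∈ V) (b : Γ(Y, f ⁻¹ᵁ V))
    (hb : ∀ p (hp : p ∈ f ⁻¹ᵁ V), f p = x → b ∈ idealAt _ p hp) :
    ∃ n : ℕ, b ^ n ∈ (idealAt V x hx).map (pb f (le_refl (f ⁻¹ᵁ V))) := by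
  have := H.finite
  change b ∈ ((idealAt V x hx).map (pb f (le_refl (f ⁻¹ᵁ V)))).radical
  rw [Ideal.radical_eq_sInf, Submodule.mem_sInf]
  rintro P ⟨hP, hPp⟩
  obtain ⟨q, hq, rfl⟩ := exists_idealAt_eq (hV.preimage f) P
  have h1 : idealAt V x hx ≤ idealAt V (f q) hq := by
    intro a ha
    have h2 := hP (Ideal.mem_map_of_mem _ ha)
    rwa [pb_mem_idealAt] at h2
  have h2 := specializes_of_idealAt_le hV h1
  refine hb q hq ?_
  exact (H.closed.closure_eq ▸ h2.mem_closure : f q ∈ ({x} : Set X))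

/-- Functions near the fibre of the normalization over a node, as elements of the integral closure
of the local ring of the node. -/
lemma exists_ringHom_integralClosure {V : X.Opens} (hV : IsAffineOpen V) (hVV : V ≤ V₀) (hx : x ∈ V)
    {h : Γ(X, V)} (hz : ∀ q (hq : q ∈ V), h ∈ idealAt V q hq → q = x)
    (hxh : h ∈ idealAt V x hx)
    (hn : X.presheaf.germ V x hx h ∈ nonZeroDivisors (X.presheaf.stalk x)) :
    ∃ θ : Γ(Y, f ⁻¹ᵁ V) →+*
        integralClosure (X.presheaf.stalk x) (FractionRing (X.presheaf.stalk x)),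
      (∀ a, θ (pb f le_rfl a) = algebraMap _ _ (X.presheaf.germ V x hx a)) ∧
      (∀ b, θ b = 0 → ∃ g, g ∉ idealAt V x hx ∧ pb f le_rfl g * b = 0) ∧
      (∀ b, (∀ p (hp : p ∈ f ⁻¹ᵁ V), f p = x → b ∈ idealAt _ p hp) → ∃ n : ℕ, θ b ^ n ∈
        (IsLocalRing.maximalIdeal (X.presheaf.stalk x)).map (algebraMap _ _)) := by
  have := H.finite
  obtain ⟨θ, h1, h2⟩ := H.exists_ringHom hV hVV hx hz hxh hn
  have hint : ∀ b, IsIntegral (X.presheaf.stalk x) (θ b) := by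
    intro b
    obtain ⟨p, hp, hpb⟩ := f.isIntegral_app V hV b
    refine ⟨p.map (X.presheaf.germ V x hx).hom, hp.map _, ?_⟩
    rw [Polynomial.eval₂_map]
    have h3 : (algebraMap (X.presheaf.stalk x) (FractionRing (X.presheaf.stalk x))).comp
        (X.presheaf.germ V x hx).hom = θ.comp (f.app V).hom := by
      ext a
      have h4 := h1 a
      rw [← app_eq_pb] at h4
      exact h4.symm
    rw [h3, ← Polynomial.hom_eval₂, hpb, map_zero]
  let θ' : Γ(Y, f ⁻¹ᵁ V) →+*
      integralClosure (X.presheaf.stalk x) (FractionRing (X.presheaf.stalk x)) :=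
    θ.codRestrict (integralClosure (X.presheaf.stalk x) (FractionRing (X.presheaf.stalk x))) hint
  have h1' : ∀ a, θ' (pb f le_rfl a) = algebraMap _ _ (X.presheaf.germ V x hx a) :=
    fun a => Subtype.ext (h1 a)
  refine ⟨θ', h1', fun b hb => h2 b (congrArg Subtype.val hb), fun b hb => ?_⟩
  obtain ⟨n, hn⟩ := H.pow_mem_map hV hx b hb
  refine ⟨n, ?_⟩
  rw [← map_pow]
  have h3 := Ideal.mem_map_of_mem θ' hn
  rw [Ideal.map_map] at h3
  have h4 : θ'.comp (pb f (le_refl (f ⁻¹ᵁ V))) =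
      (algebraMap (X.presheaf.stalk x) _).comp (X.presheaf.germ V x hx).hom := by
    ext1 a
    exact h1' a
  rw [h4, ← Ideal.map_map] at h3
  refine Ideal.map_mono (Ideal.map_le_iff_le_comap.2 ?_) h3
  exact le_rfl

/-- A presentation of an element of the integral closure separating the branches of the node. -/
lemma exists_presentation {W : X.Opens} (hxW : x ∈ W) :
    ∃ (V : X.Opens) (_ : V ≤ W) (hx : x ∈ V) (a h : Γ(X, V))
      (r : integralClosure (X.presheaf.stalk x) (FractionRing (X.presheaf.stalk x))),
      IsAffineOpen V ∧ (∀ q (hq : q ∈ V), h ∈ idealAt V q hq → q = x) ∧ h ∈ idealAt V x hx ∧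
      X.presheaf.germ V x hx h ∈ nonZeroDivisors (X.presheaf.stalk x) ∧ ¬ IsUnit r ∧
      (∀ n : ℕ, r ^ n ∉ (IsLocalRing.maximalIdeal (X.presheaf.stalk x)).map (algebraMap _ _)) ∧
      algebraMap _ _ (X.presheaf.germ V x hx h) * r = algebraMap _ _ (X.presheaf.germ V x hx a) := by
  have := H.noeth
  obtain ⟨r, hr, hrn⟩ := H.node.exists_not_isUnit
  obtain ⟨⟨α, η, hη⟩, hαη⟩ := IsLocalization.surj (nonZeroDivisors (X.presheaf.stalk x)) r.1
  have hr' : algebraMap (X.presheaf.stalk x) (integralClosure (X.presheaf.stalk x)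
      (FractionRing (X.presheaf.stalk x))) η * r = algebraMap _ _ α :=
    Subtype.ext ((mul_comm _ _).trans hαη)
  have hηm : η ∈ IsLocalRing.maximalIdeal (X.presheaf.stalk x) := by
    rw [IsLocalRing.mem_maximalIdeal, mem_nonunits_iff]
    rintro ⟨u, rfl⟩
    have h1 : r = algebraMap _ _ ((↑u⁻¹ : X.presheaf.stalk x) * α) := by
      rw [map_mul, ← hr', ← mul_assoc, ← map_mul, Units.inv_mul, map_one, one_mul]
    refine hrn 1 ?_
    rw [pow_one, h1]
    refine Ideal.mem_map_of_mem _ ?_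
    rw [IsLocalRing.mem_maximalIdeal, mem_nonunits_iff]
    intro hu
    exact hr (h1 ▸ hu.map _)
  obtain ⟨V₁, hx₁, a₁, rfl⟩ := exists_germ x α
  obtain ⟨V₂, hx₂, h₁, rfl⟩ := exists_germ x η
  have hxI : x ∈ V₁ ⊓ V₂ ⊓ W := ⟨⟨hx₁, hx₂⟩, hxW⟩
  have hI₁ : V₁ ⊓ V₂ ⊓ W ≤ V₁ := inf_le_left.trans inf_le_left
  have hI₂ : V₁ ⊓ V₂ ⊓ W ≤ V₂ := inf_le_left.trans inf_le_right
  obtain ⟨V, hV, hVa, hx, hz⟩ := exists_zero_only H.closed hxI (fres hI₂ h₁) (by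
    intro a ha
    rw [germ_fres]
    exact H.node.exists_dvd_pow hη a ha)
  refine ⟨V, hV.trans inf_le_right, hx, fres (hV.trans hI₁) a₁, fres (hV.trans hI₂) h₁, r, hVa,
    fun q hq h0 => hz q hq ?_, ?_, ?_, hr, hrn, ?_⟩
  · rw [fres_mem_idealAt] at h0 ⊢
    exact h0
  · rw [fres_mem_idealAt]; exact hηm
  · rw [germ_fres]; exact hη
  · rw [germ_fres, germ_fres]; exact hr'

/-- A function on the normalization of a node vanishing at all points over the node descends. -/
theorem exists_descend {W : X.Opens} (hxW : x ∈ W) (b : Γ(Y, f ⁻¹ᵁ W))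
    (hb : ∀ p (hp : p ∈ f ⁻¹ᵁ W), f p = x → b ∈ idealAt _ p hp) :
    ∃ (V : X.Opens) (hV : V ≤ W), x ∈ V ∧ ∃ a : Γ(X, V), pb f le_rfl a =
      fres (f.preimage_mono hV) b := by
  have hxI : x ∈ W ⊓ V₀ := ⟨hxW, H.mem⟩
  obtain ⟨V, hV, hx, -, h, -, hVa, hz, hxh, hn, -⟩ := H.exists_presentation hxI
  obtain ⟨θ, h1, h2, h3⟩ :=
    H.exists_ringHom_integralClosure hVa (hV.trans inf_le_right) hx hz hxh hn
  let b' := fres (f.preimage_mono (hV.trans inf_le_left)) b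
  obtain ⟨n, hn⟩ := h3 b' fun p hp hpx => (fres_mem_idealAt _ _ hp).2 (hb p _ hpx)
  obtain ⟨a₀, ha₀⟩ := H.node.exists_eq_of_pow_mem _ n hn
  obtain ⟨c, g, hg, hgc⟩ := exists_mul_germ hVa hx a₀
  have h4 : θ (pb f le_rfl g * b' - pb f le_rfl c) = 0 := by
    rw [map_sub, map_mul, h1, h1, ← ha₀, ← map_mul, hgc, sub_self]
  obtain ⟨g₂, hg₂, h5⟩ := h2 _ h4
  have hgg : g * g₂ ∉ idealAt V x hx := fun h6 =>
    ((idealAt_isPrime V x hx).mem_or_mem h6).elim hg hg₂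
  obtain ⟨V', hV', hxV', hu⟩ := exists_isUnit_fres hgg
  rw [map_mul] at hu
  obtain ⟨u, hu₁⟩ := isUnit_of_mul_isUnit_left hu
  have hu₂ := (isUnit_of_mul_isUnit_right hu).map (pb f (le_refl (f ⁻¹ᵁ V')))
  refine ⟨V', hV'.trans (hV.trans inf_le_left), hxV', (↑u⁻¹ : Γ(X, V')) * fres hV' c, ?_⟩
  have h6 := congrArg (fres (f.preimage_mono hV')) h5
  simp only [map_mul, map_sub, map_zero, fres_pb, pb_fres, b', fres_fres] at h6 hu₂ ⊢
  have h7 := hu₂.mul_right_eq_zero.1 h6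
  rw [← sub_eq_zero.1 h7, ← mul_assoc]
  have h8 : pb f (le_refl (f ⁻¹ᵁ V')) (↑u⁻¹ : Γ(X, V')) * pb f (f.preimage_mono hV') g = 1 := by
    rw [← pb_fres f hV' le_rfl, ← hu₁, ← map_mul, Units.inv_mul, map_one]
  rw [h8, one_mul]

lemma exists_mul_eq {V : X.Opens} (hx : x ∈ V) {a h : Γ(X, V)}
    (r : integralClosure (X.presheaf.stalk x) (FractionRing (X.presheaf.stalk x)))
    (hz : ∀ q (hq : q ∈ V), h ∈ idealAt V q hq → q = x) (hxh : h ∈ idealAt V x hx)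
    (hr : algebraMap _ _ (X.presheaf.germ V x hx h) * r = algebraMap _ _ (X.presheaf.germ V x hx a)) :
    ∃ b : Γ(Y, f ⁻¹ᵁ V), pb f le_rfl h * b = pb f le_rfl a := by
  have hloc : ∀ p ∈ f ⁻¹ᵁ V, ∃ V' ≤ f ⁻¹ᵁ V, p ∈ V' ∧ ∃ s, ∃ h' : V' ≤ f ⁻¹ᵁ V,
      pb f h' h * s = pb f h' a := by
    intro p hp
    by_cases hpx : f p = x
    · have hdvd : Y.presheaf.germ (f ⁻¹ᵁ V) p hp (pb f le_rfl h) ∣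
          Y.presheaf.germ (f ⁻¹ᵁ V) p hp (pb f le_rfl a) := by
        have h0 := H.germ_pb_ne_zero hz hpx hp
        have hd := H.dvr p hpx
        subst hpx
        rw [germ_pb] at h0 ⊢
        rw [germ_pb]
        exact H.node.map_dvd_map hd (f.stalkMap p).hom hxh h0 r hr
      obtain ⟨β, hβ⟩ := hdvd
      obtain ⟨W, hpW, s, rfl⟩ := exists_germ p β
      have hpI : p ∈ f ⁻¹ᵁ V ⊓ W := ⟨hp, hpW⟩
      have h1 : Y.presheaf.germ (f ⁻¹ᵁ V ⊓ W) p hpI (pb f inf_le_left h * fres inf_le_right s) =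
          Y.presheaf.germ (f ⁻¹ᵁ V ⊓ W) p hpI (pb f inf_le_left a) := by
        have e : ∀ c, pb f (inf_le_left : f ⁻¹ᵁ V ⊓ W ≤ f ⁻¹ᵁ V) c =
          fres inf_le_left (pb f le_rfl c) := fun c => by rw [fres_pb]
        rw [map_mul, e, e, germ_fres, germ_fres, germ_fres]
        exact hβ.symm
      obtain ⟨V', hV', hpV', e⟩ := (germ_eq_iff _ _ _ _).1 h1
      refine ⟨V', hV'.trans inf_le_left, hpV', fres (hV'.trans inf_le_right) s,
        hV'.trans inf_le_left, ?_⟩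
      simpa using e
    · have h2 : pb f le_rfl h ∉ idealAt (f ⁻¹ᵁ V) p hp := by
        rw [pb_mem_idealAt]
        exact fun h3 => hpx (hz _ _ h3)
      obtain ⟨W, hW, hpW, u, hu⟩ := exists_isUnit_fres h2
      rw [fres_pb] at hu
      refine ⟨W, hW, hpW, (↑u⁻¹ : Γ(Y, W)) * pb f hW a, hW, ?_⟩
      rw [← hu, Units.mul_inv_cancel_left]
  obtain ⟨b, hb⟩ := exists_fun_glue (U := f ⁻¹ᵁ V)
    (fun V' s => ∃ h' : V' ≤ f ⁻¹ᵁ V, pb f h' h * s = pb f h' a)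
    (by
      rintro V' W hWV s hV ⟨h', e⟩
      refine ⟨hWV.trans h', ?_⟩
      have := congrArg (fres hWV) e
      simpa using this)
    (by
      rintro V' - s t ⟨h', e⟩ ⟨_, e'⟩
      refine sub_eq_zero.1 (H.eq_zero_of_mul hz h' _ ?_)
      rw [mul_sub, e, e', sub_self])
    hloc
  refine ⟨b, fun_ext _ _ fun p hp => ?_⟩
  obtain ⟨V', hV', hpV', s, h', e⟩ := hloc p hp
  refine ⟨V', hV', hpV', ?_⟩
  rw [map_mul, hb V' hV' s ⟨h', e⟩, fres_pb, fres_pb]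
  exact e

/-- There are at least two points over a node. -/
theorem exists_ne : ∃ p q, f p = x ∧ f q = x ∧ p ≠ q := by
  by_contra! hcon
  have := H.finite
  obtain ⟨V, hV, hx, a, h, r, hVa, hz, hxh, hn, hr, hrn, hrah⟩ := H.exists_presentation H.mem
  obtain ⟨b, hb⟩ := H.exists_mul_eq hx r hz hxh hrah
  have key : ∀ (V' : X.Opens) (hV' : V' ≤ V) (_ : IsAffineOpen V') (hx' : x ∈ V'),
      ∃ θ : Γ(Y, f ⁻¹ᵁ V') →+*
        integralClosure (X.presheaf.stalk x) (FractionRing (X.presheaf.stalk x)),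
      θ (fres (f.preimage_mono hV') b) = r ∧
      (∀ b, (∀ p (hp : p ∈ f ⁻¹ᵁ V'), f p = x → b ∈ idealAt _ p hp) → ∃ n : ℕ, θ b ^ n ∈
        (IsLocalRing.maximalIdeal (X.presheaf.stalk x)).map (algebraMap _ _)) := by
    intro V' hV' hVa' hx'
    obtain ⟨θ, h1, -, h3⟩ := H.exists_ringHom_integralClosure (h := fres hV' h) hVa'
      (hV'.trans hV) hx' (fun q hq h0 => hz q (hV' hq) ((fres_mem_idealAt _ _ _).1 h0))
      ((fres_mem_idealAt _ _ _).2 hxh) (by rw [germ_fres]; exact hn)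
    refine ⟨θ, ?_, h3⟩
    have h4 := congrArg (fun z => θ (fres (f.preimage_mono hV') z)) hb
    have e : ∀ c : Γ(X, V), fres (f.preimage_mono hV') (pb f le_rfl c) = pb f le_rfl (fres hV' c) :=
      fun c => by rw [fres_pb, pb_fres]
    simp only [map_mul, e, h1, germ_fres] at h4
    rw [← hrah] at h4
    have h5 := congrArg Subtype.val h4
    have h6 : IsUnit (algebraMap (X.presheaf.stalk x) (FractionRing (X.presheaf.stalk x))
        (X.presheaf.germ V x hx h)) :=
      IsLocalization.map_units (FractionRing (X.presheaf.stalk x))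
        (⟨_, hn⟩ : nonZeroDivisors (X.presheaf.stalk x))
    exact Subtype.ext (h6.mul_left_cancel h5)
  by_cases hall : ∀ p (hp : p ∈ f ⁻¹ᵁ V), f p = x → b ∈ idealAt _ p hp
  · obtain ⟨θ, h1, h2⟩ := key V le_rfl hVa hx
    obtain ⟨n, hn⟩ := h2 b hall
    rw [fres_self] at h1
    rw [h1] at hn
    exact hrn n hn
  · push Not at hall
    obtain ⟨p, hp, hpx, hbp⟩ := hall
    obtain ⟨W, hW, hpW, hu⟩ := exists_isUnit_fres hbp
    obtain ⟨V', hVa', hx', hV', hVW⟩ := exists_affine_tube f x hx W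
      fun q hq => by rwa [← hcon p q hpx hq]
    obtain ⟨θ, h1, -⟩ := key V' hV' hVa' hx'
    have h2 := (hu.map (fres hVW)).map θ
    rw [fres_fres, h1] at h2
    exact hr h2

end IsNodeFibre


section Division

variable {X : Scheme.{0}}

lemma mem_idealAt_congr {U : X.Opens} {p q : X} (h : p = q) (hp : p ∈ U) (hq : q ∈ U)
    (f : Γ(X, U)) : f ∈ idealAt U p hp ↔ f ∈ idealAt U q hq := by
  subst h; rfl

lemma eq_of_germ_eq {U : X.Opens} (f g : Γ(X, U))
    (h : ∀ p (hp : p ∈ U), X.presheaf.germ U p hp f = X.presheaf.germ U p hp g) : f = g :=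
  fun_ext _ _ fun p hp => (germ_eq_iff _ _ _ _).1 (h p hp)

lemma isUnit_germ_iff {U : X.Opens} {f : Γ(X, U)} {p : X} {hp : p ∈ U} :
    IsUnit (X.presheaf.germ U p hp f) ↔ f ∉ idealAt U p hp := by
  rw [mem_idealAt, IsLocalRing.mem_maximalIdeal, mem_nonunits_iff, not_not]

lemma mul_left_cancel_of_germ {U : X.Opens} {n b c : Γ(X, U)}
    (hn : ∀ p (hp : p ∈ U), X.presheaf.germ U p hp n ∈ nonZeroDivisors (X.presheaf.stalk p))
    (h : n * b = n * c) : b = c := by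
  refine eq_of_germ_eq _ _ fun p hp => ?_
  have h1 := congrArg (X.presheaf.germ U p hp) h
  rw [map_mul, map_mul] at h1
  exact (mul_cancel_left_mem_nonZeroDivisors (hn p hp)).1 h1

lemma exists_mul_eq_of_germ_dvd {U : X.Opens} (n a : Γ(X, U))
    (hn : ∀ p (hp : p ∈ U), X.presheaf.germ U p hp n ∈ nonZeroDivisors (X.presheaf.stalk p))
    (h : ∀ p (hp : p ∈ U), X.presheaf.germ U p hp n ∣ X.presheaf.germ U p hp a) :
    ∃ b, a = n * b := by
  have hloc : ∀ p ∈ U, ∃ V ≤ U, p ∈ V ∧ ∃ s : Γ(X, V), ∃ h' : V ≤ U, fres h' a = fres h' n * s := by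
    intro p hp
    obtain ⟨β, hβ⟩ := h p hp
    obtain ⟨W, hpW, s, rfl⟩ := exists_germ p β
    have hpI : p ∈ U ⊓ W := ⟨hp, hpW⟩
    have h1 : X.presheaf.germ (U ⊓ W) p hpI (fres inf_le_left a) =
        X.presheaf.germ (U ⊓ W) p hpI (fres inf_le_left n * fres inf_le_right s) := by
      rw [map_mul, germ_fres, germ_fres, germ_fres]
      exact hβ
    obtain ⟨V', hV', hpV', e⟩ := (germ_eq_iff _ _ _ _).1 h1
    refine ⟨V', hV'.trans inf_le_left, hpV', fres (hV'.trans inf_le_right) s,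
      hV'.trans inf_le_left, ?_⟩
    simpa using e
  obtain ⟨b, hb⟩ := exists_fun_glue (U := U)
    (fun V' s => ∃ h' : V' ≤ U, fres h' a = fres h' n * s)
    (by
      rintro V' W hWV s hV ⟨h', e⟩
      refine ⟨hWV.trans h', ?_⟩
      have := congrArg (fres hWV) e
      simpa using this)
    (by
      rintro V' - s t ⟨h', e⟩ ⟨_, e'⟩
      refine mul_left_cancel_of_germ (n := fres h' n) (fun p hp => ?_) (e.symm.trans e')
      rw [germ_fres]
      exact hn p _)
    hloc
  refine ⟨b, fun_ext _ _ fun p hp => ?_⟩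
  obtain ⟨V', hV', hpV', s, h', e⟩ := hloc p hp
  refine ⟨V', hV', hpV', ?_⟩
  rw [map_mul, hb V' hV' s ⟨h', e⟩]
  exact e

lemma germ_mem_nonZeroDivisors_of_notMem {U : X.Opens} {f : Γ(X, U)} {p : X} {hp : p ∈ U}
    (h : f ∉ idealAt U p hp) :
    X.presheaf.germ U p hp f ∈ nonZeroDivisors (X.presheaf.stalk p) :=
  (isUnit_germ_iff.2 h).mem_nonZeroDivisors

lemma IsParam.mem_idealAt {U : X.Opens} {t : Γ(X, U)} {p : X} {hp : p ∈ U} (h : IsParam t p hp) :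
    t ∈ idealAt U p hp := by
  rw [PrymEigen.mem_idealAt, IsLocalRing.mem_maximalIdeal, mem_nonunits_iff]
  exact h.not_isUnit

lemma IsParam.germ_mem_nonZeroDivisors {U : X.Opens} {t : Γ(X, U)} {p : X} {hp : p ∈ U}
    (hd : IsDVR (X.presheaf.stalk p)) (h : IsParam t p hp) :
    X.presheaf.germ U p hp t ∈ nonZeroDivisors (X.presheaf.stalk p) := by
  obtain ⟨_, _⟩ := hd
  exact mem_nonZeroDivisors_of_ne_zero h.ne_zero

lemma IsParam.germ_dvd {U : X.Opens} {t : Γ(X, U)} {p : X} {hp : p ∈ U}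
    (hd : IsDVR (X.presheaf.stalk p)) (h : IsParam t p hp) {a : Γ(X, U)} (ha : a ∈ idealAt U p hp) :
    X.presheaf.germ U p hp t ∣ X.presheaf.germ U p hp a := by
  obtain ⟨_, _⟩ := hd
  rw [← Ideal.mem_span_singleton, ← (Irreducible.maximalIdeal_eq h)]
  exact ha

/-- A function vanishing at `p` is divisible by a parameter at `p` with no other zeros. -/
lemma IsParam.exists_eq_mul {U : X.Opens} {t : Γ(X, U)} {p : X} {hp : p ∈ U}
    (hd : IsDVR (X.presheaf.stalk p)) (h : IsParam t p hp)
    (hz : ∀ q (hq : q ∈ U), t ∈ idealAt U q hq → q = p) {a : Γ(X, U)} (ha : a ∈ idealAt U p hp) :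
    ∃ b, a = t * b := by
  refine exists_mul_eq_of_germ_dvd t a (fun q hq => ?_) fun q hq => ?_
  · by_cases hqp : q = p
    · subst hqp; exact h.germ_mem_nonZeroDivisors hd
    · exact germ_mem_nonZeroDivisors_of_notMem fun h' => hqp (hz q hq h')
  · by_cases hqp : q = p
    · subst hqp; exact h.germ_dvd hd ha
    · exact (isUnit_germ_iff.2 fun h' => hqp (hz q hq h')).dvd

lemma isDVR_of_maximalIdeal_eq_span {R : Type*} [CommRing R] [IsLocalRing R] [IsNoetherianRing R]
    (g : R) (hg : IsLocalRing.maximalIdeal R = Ideal.span {g}) (hn : ¬ IsNilpotent g) : IsDVR R := by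
  have hgm : g ∈ IsLocalRing.maximalIdeal R := by rw [hg]; exact Ideal.mem_span_singleton_self g
  have hpow : ∀ a : R, a ≠ 0 → ∃ (n : ℕ) (u : R), IsUnit u ∧ a = g ^ n * u := by
    intro a ha
    have h1 := Ideal.iInf_pow_eq_bot_of_isLocalRing (IsLocalRing.maximalIdeal R)
      (IsLocalRing.maximalIdeal.isMaximal R).ne_top
    have h2 : ∃ n, a ∉ IsLocalRing.maximalIdeal R ^ n := by
      by_contra! h3
      exact ha (by rw [← Ideal.mem_bot, ← h1]; exact (Submodule.mem_iInf _).2 h3)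
    classical
    have h3 := Nat.find_spec h2
    have h4 : Nat.find h2 ≠ 0 := by
      intro h0
      rw [h0, pow_zero, Ideal.one_eq_top] at h3
      exact h3 trivial
    obtain ⟨n, hn⟩ := Nat.exists_eq_succ_of_ne_zero h4
    have h5 : a ∈ IsLocalRing.maximalIdeal R ^ n := not_not.1 (Nat.find_min h2 (by omega))
    rw [hg, Ideal.span_singleton_pow, Ideal.mem_span_singleton] at h5
    obtain ⟨u, rfl⟩ := h5
    refine ⟨n, u, ?_, rfl⟩
    by_contra hu
    have h6 : u ∈ IsLocalRing.maximalIdeal R := hu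
    refine h3 ?_
    rw [hn, pow_succ]
    exact Ideal.mul_mem_mul (Ideal.pow_mem_pow hgm n) h6
  have hdom : IsDomain R := by
    have : NoZeroDivisors R := ⟨by
      intro a b hab
      by_contra! hcon
      obtain ⟨n, u, hu, rfl⟩ := hpow a hcon.1
      obtain ⟨m, v, hv, rfl⟩ := hpow b hcon.2
      refine hn ⟨n + m, ?_⟩
      refine ((hu.mul hv).mul_left_eq_zero).1 ?_
      rw [← hab]; ring⟩
    exact NoZeroDivisors.to_isDomain R
  refine ⟨hdom, ?_⟩
  have hf : ¬ IsField R := by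
    rw [IsLocalRing.isField_iff_maximalIdeal_eq]
    intro h0
    rw [h0] at hgm
    exact hn ⟨1, by rw [pow_one]; exact hgm⟩
  have hp : (IsLocalRing.maximalIdeal R).IsPrincipal := ⟨⟨g, hg⟩⟩
  exact ((IsDiscreteValuationRing.TFAE R hf).out 0 4).2 hp

lemma sub_mem_idealAt_of_fixed (s : X ⟶ Spec (.of ℂ)) [LocallyOfFiniteType s] {t : X ⟶ X}
    (ht : t ≫ s = s) {p : X} (hcl : IsClosed {p}) (hp : t p = p) {U V : X.Opens} (hV : V ≤ t ⁻¹ᵁ U)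
    (hVU : V ≤ U) (hpV : p ∈ V) (f : Γ(X, U)) : pb t hV f - fres hVU f ∈ idealAt V p hpV := by
  obtain ⟨c, hc⟩ := exists_cst_sub_mem s hcl (hVU hpV) f
  have h1 : pb t hV (f - cst s U c) ∈ idealAt V p hpV :=
    (pb_mem_idealAt t hV _ hpV).2 ((mem_idealAt_congr hp _ (hVU hpV) _).2 hc)
  have h2 : fres hVU (f - cst s U c) ∈ idealAt V p hpV := (fres_mem_idealAt _ _ hpV).2 hc
  have h3 := (idealAt V p hpV).sub_mem h1 h2
  rw [map_sub, map_sub, pb_cst t ht, fres_cst] at h3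
  simpa using h3

lemma mem_idealAt_of_add_self (s : X ⟶ Spec (.of ℂ)) {V : X.Opens} {p : X}
    {hp : p ∈ V} {a : Γ(X, V)} (h : a + a ∈ idealAt V p hp) : a ∈ idealAt V p hp := by
  have h1 := (idealAt V p hp).mul_mem_left (cst s V (1 / 2)) h
  have h2 : cst s V (1 / 2) * (a + a) = a := by
    rw [← mul_two, mul_comm a, ← mul_assoc, ← map_ofNat (cst s V) 2, ← map_mul]
    norm_num
  rwa [h2] at h1

lemma cst_mem_idealAt_iff (s : X ⟶ Spec (.of ℂ)) {V : X.Opens} {p : X} {hp : p ∈ V} {c : ℂ} :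
    cst s V c ∈ idealAt V p hp ↔ c = 0 := by
  refine ⟨fun h => by_contra fun hc => ?_, fun h => by rw [h, map_zero]; exact zero_mem _⟩
  exact not_isUnit_of_mem_idealAt h ((IsUnit.mk0 c hc).map (cst s V))

end Division

/-! ### Quotients by involutions -/

section Quotient

variable {X Y : Scheme.{0}} {f : X ⟶ Y} {t : X ⟶ X}

/-- The action of an involution on functions on invariant open sets. -/
noncomputable def tw (h : t ≫ f = f) {U : Y.Opens} : Γ(X, f ⁻¹ᵁ U) →+* Γ(X, f ⁻¹ᵁ U) :=
  pb t (le_preimage_preimage h U)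

variable (f t) in
/-- `f : X ⟶ Y` is the quotient of `X` by the involution `t`. -/
structure IsInvolutionQuotient : Prop where
  finite : IsFinite f
  comp : t ≫ f = f
  invol : t ≫ t = 𝟙 X
  inj : ∀ U : Y.Opens, Function.Injective (pb f (le_refl (f ⁻¹ᵁ U)))
  desc : ∀ (U : Y.Opens) (a : Γ(X, f ⁻¹ᵁ U)), tw comp a = a → ∃ g, pb f (le_refl (f ⁻¹ᵁ U)) g = a

lemma tw_pb (h : t ≫ f = f) {U V : Y.Opens} (hV : f ⁻¹ᵁ V ≤ f ⁻¹ᵁ U) (g : Γ(Y, U)) :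
    tw h (pb f hV g) = pb f hV g := by
  rw [tw, pb_pb, pb_congr h]

lemma tw_fres (h : t ≫ f = f) {U V : Y.Opens} (hV : f ⁻¹ᵁ V ≤ f ⁻¹ᵁ U) (a : Γ(X, f ⁻¹ᵁ U)) :
    tw h (fres hV a) = fres hV (tw h a) := by
  rw [tw, pb_fres, tw, fres_pb]

lemma tw_tw (h : t ≫ f = f) (h' : t ≫ t = 𝟙 X) {U : Y.Opens} (a : Γ(X, f ⁻¹ᵁ U)) :
    tw h (tw h a) = a := by
  rw [tw, pb_pb, pb_congr h']
  exact (pb_id le_rfl a).trans (fres_self le_rfl a)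

lemma apply_apply_of_invol (h' : t ≫ t = 𝟙 X) (p : X) : t (t p) = p := by
  rw [← Scheme.Hom.comp_apply, h']; rfl

lemma apply_invol (h : t ≫ f = f) (p : X) : f (t p) = f p := by
  rw [← Scheme.Hom.comp_apply, h]

lemma tw_mem_idealAt (h : t ≫ f = f) {U : Y.Opens} {a : Γ(X, f ⁻¹ᵁ U)} {p : X} {hp : p ∈ f ⁻¹ᵁ U} :
    tw h a ∈ idealAt _ p hp ↔ a ∈ idealAt (f ⁻¹ᵁ U) (t p) (le_preimage_preimage h U hp) :=
  pb_mem_idealAt _ _ _ _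

lemma isDVR_of_invol (h' : t ≫ t = 𝟙 X) {p : X} (hp : IsDVR (X.presheaf.stalk p)) :
    IsDVR (X.presheaf.stalk (t p)) := by
  have h1 : IsIso t := ⟨t, h', h'⟩
  have h2 : IsIso (t ∣_ ⊤) := inferInstance
  exact (isDVR_iff_of_isIso t h2 trivial).2 hp

lemma isClosed_of_invol (h' : t ≫ t = 𝟙 X) {p : X} (hp : IsClosed {p}) : IsClosed {t p} := by
  have h1 : IsIso t := ⟨t, h', h'⟩
  have := (Scheme.homeoOfIso (asIso t)).isClosedMap _ hp
  rw [Set.image_singleton] at this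
  exact this

namespace IsInvolutionQuotient

variable (H : IsInvolutionQuotient f t)

include H

lemma exists_apply_eq (y : Y) : ∃ x, f x = y := by
  by_contra! h
  have := H.finite
  obtain ⟨V, hy, hV⟩ := exists_tube f y ⊥ fun x hx => (h x hx).elim
  have h1 : (1 : Γ(Y, V)) = 0 := by
    apply H.inj V
    refine fun_ext _ _ fun x hx => (?_ : False).elim
    exact (hV hx : x ∈ (⊥ : X.Opens))
  have h2 : (0 : Γ(Y, V)) ∈ idealAt V y hy := zero_mem _
  rw [← h1] at h2
  exact (idealAt_isPrime V y hy).ne_top ((Ideal.eq_top_iff_one _).2 h2)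

lemma eq_or_eq_of_apply_eq {p q : X} (hp : IsClosed {p}) (h : f q = f p) : q = p ∨ q = t p := by
  by_contra! hcon
  have := H.finite
  obtain ⟨V, hV, hpV, -⟩ := exists_affine_le (f p) (Opens.mem_top (f p))
  have hVp := hV.preimage f
  have hcl : IsClosed {f q} := by rw [h]; exact isClosed_singleton_apply f hp
  have hq := isClosed_singleton_of_isFinite f hcl
  have hqV : q ∈ f ⁻¹ᵁ V := by
    change f q ∈ V
    rwa [h]
  have htV : t p ∈ f ⁻¹ᵁ V := le_preimage_preimage H.comp V hpV
  have h1 : ∃ a ∈ idealAt (f ⁻¹ᵁ V) q hqV, a ∉ idealAt (f ⁻¹ᵁ V) p hpV ∧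
      a ∉ idealAt (f ⁻¹ᵁ V) (t p) htV := by
    by_contra! h2
    have h3 : ((idealAt (f ⁻¹ᵁ V) q hqV : Ideal _) : Set Γ(X, f ⁻¹ᵁ V)) ⊆
        (idealAt (f ⁻¹ᵁ V) p hpV : Set _) ∪ (idealAt (f ⁻¹ᵁ V) (t p) htV : Set _) := by
      intro a ha
      by_cases hap : a ∈ idealAt (f ⁻¹ᵁ V) p hpV
      · exact Or.inl hap
      · exact Or.inr (h2 a ha hap)
    have hm := isMaximal_idealAt hVp hqV hq
    rcases Ideal.subset_union.1 h3 with h4 | h4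
    · have h5 := specializes_of_idealAt_le hVp h4
      exact hcon.1 ((hq.closure_eq ▸ h5.mem_closure : p ∈ ({q} : Set X)).symm)
    · have h5 := specializes_of_idealAt_le hVp h4
      exact hcon.2 ((hq.closure_eq ▸ h5.mem_closure : t p ∈ ({q} : Set X)).symm)
  obtain ⟨a, haq, hap, hat⟩ := h1
  obtain ⟨g, hg⟩ := H.desc V (a * tw H.comp a) (by
    rw [map_mul, tw_tw _ H.invol, mul_comm])
  have h5 : pb f le_rfl g ∈ idealAt (f ⁻¹ᵁ V) q hqV := by
    rw [hg]; exact Ideal.mul_mem_right _ _ haq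
  have h6 : pb f le_rfl g ∈ idealAt (f ⁻¹ᵁ V) p hpV := by
    rw [pb_mem_idealAt] at h5
    exact (pb_mem_idealAt _ _ _ _).2 ((mem_idealAt_congr h _ _ _).1 h5)
  rw [hg] at h6
  rcases (idealAt_isPrime _ p hpV).mem_or_mem h6 with h7 | h7
  · exact hap h7
  · exact hat ((tw_mem_idealAt H.comp).1 h7)

/-- At a point with trivial stabilizer, the quotient of a smooth curve is smooth. -/
theorem isDVR_apply [IsLocallyNoetherian X] [IsLocallyNoetherian Y] {p : X} (hcl : IsClosed {p})
    (hd : IsDVR (X.presheaf.stalk p)) (hne : t p ≠ p) : IsDVR (Y.presheaf.stalk (f p)) := by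
  have := H.finite
  obtain ⟨V, -, hp, a, hVa, hpar, hz⟩ := exists_isParam_tube f hcl hd (Opens.mem_top (f p))
  have htp : t p ∈ f ⁻¹ᵁ V := le_preimage_preimage H.comp V hp
  obtain ⟨g, hg⟩ := H.desc V (a * tw H.comp a) (by
    rw [map_mul, tw_tw _ H.invol, mul_comm])
  have hz' : ∀ q (hq : q ∈ f ⁻¹ᵁ V), tw H.comp a ∈ idealAt _ q hq → q = t p := by
    intro q hq h1
    rw [tw_mem_idealAt] at h1
    rw [← hz _ _ h1, apply_apply_of_invol H.invol]
  have hpart : ∀ q (hq : q ∈ f ⁻¹ᵁ V), q = p → IsParam a q hq := by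
    rintro q hq rfl; exact hpar
  have hdt := isDVR_of_invol H.invol hd
  have hpar' : IsParam (tw H.comp a) (t p) htp := by
    have h1 := hpart (t (t p)) (by rw [apply_apply_of_invol H.invol]; exact hp)
      (apply_apply_of_invol H.invol p)
    have h2 : IsIso t := ⟨t, H.invol, H.invol⟩
    have h3 : IsIso (t ∣_ ⊤) := inferInstance
    unfold IsParam tw
    rw [germ_pb]
    exact (MulEquiv.irreducible_iff (stalkEquiv t (y := t p) h3 trivial)).2 h1
  have hun : ∀ q (hq : q ∈ f ⁻¹ᵁ V), q ≠ p → IsUnit (X.presheaf.germ _ q hq a) :=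
    fun q hq hqp => isUnit_germ_iff.2 fun h => hqp (hz q hq h)
  have hun' : ∀ q (hq : q ∈ f ⁻¹ᵁ V), q ≠ t p → IsUnit (X.presheaf.germ _ q hq (tw H.comp a)) :=
    fun q hq hqp => isUnit_germ_iff.2 fun h => hqp (hz' q hq h)
  have hnz : ∀ q (hq : q ∈ f ⁻¹ᵁ V), X.presheaf.germ _ q hq (a * tw H.comp a) ∈
      nonZeroDivisors (X.presheaf.stalk q) := by
    intro q hq
    rw [map_mul]
    refine mul_mem ?_ ?_
    · by_cases hqp : q = p
      · subst hqp; exact hpar.germ_mem_nonZeroDivisors hd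
      · exact (hun q hq hqp).mem_nonZeroDivisors
    · by_cases hqp : q = t p
      · subst hqp; exact hpar'.germ_mem_nonZeroDivisors hdt
      · exact (hun' q hq hqp).mem_nonZeroDivisors
  have hdiv : ∀ b ∈ idealAt V (f p) hp, g ∣ b := by
    intro b hb
    have hbp : pb f le_rfl b ∈ idealAt (f ⁻¹ᵁ V) p hp := (pb_mem_idealAt _ _ _ _).2 hb
    have hbt : pb f le_rfl b ∈ idealAt (f ⁻¹ᵁ V) (t p) htp :=
      (pb_mem_idealAt _ _ _ _).2 ((mem_idealAt_congr (apply_invol H.comp p) _ _ _).2 hb)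
    obtain ⟨c, hc⟩ := exists_mul_eq_of_germ_dvd (a * tw H.comp a) (pb f le_rfl b) hnz (by
      intro q hq
      rw [map_mul]
      by_cases hqp : q = p
      · subst hqp
        rw [(hun' q hq hne.symm).mul_right_dvd]
        exact hpar.germ_dvd hd hbp
      · rw [(hun q hq hqp).mul_left_dvd]
        by_cases hqt : q = t p
        · subst hqt
          exact hpar'.germ_dvd hdt hbt
        · exact (hun' q hq hqt).dvd)
    obtain ⟨d, rfl⟩ := H.desc V c (by
      refine mul_left_cancel_of_germ hnz ?_
      rw [← hc, ← tw_pb H.comp le_rfl b, hc, map_mul, map_mul, tw_tw _ H.invol, mul_comm a])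
    refine ⟨d, H.inj V ?_⟩
    rw [hc, ← hg, map_mul]
  have hgm : g ∈ idealAt V (f p) hp := by
    rw [← pb_mem_idealAt f (le_refl (f ⁻¹ᵁ V)) g hp, hg]
    exact Ideal.mul_mem_right _ _ hpar.mem_idealAt
  refine isDVR_of_maximalIdeal_eq_span (Y.presheaf.germ V (f p) hp g) (le_antisymm ?_ ?_) ?_
  · intro b hb
    obtain ⟨c, d, hd', hdc⟩ := exists_mul_germ hVa hp b
    have hu : IsUnit (Y.presheaf.germ V (f p) hp d) := isUnit_germ_iff.2 hd'
    have hc : c ∈ idealAt V (f p) hp := by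
      rw [mem_idealAt, ← hdc]
      exact Ideal.mul_mem_left _ _ hb
    obtain ⟨k, rfl⟩ := hdiv c hc
    rw [Ideal.mem_span_singleton, ← hu.dvd_mul_left, hdc, map_mul]
    exact Dvd.intro _ rfl
  · rw [Ideal.span_singleton_le_iff_mem]
    exact hgm
  · rintro ⟨n, hn⟩
    have h1 := congrArg (f.stalkMap p) hn
    rw [map_zero, map_pow, ← germ_pb f (le_refl (f ⁻¹ᵁ V)) g p hp, hg] at h1
    have h2 := pow_mem (hnz p hp) n
    rw [h1] at h2
    obtain ⟨_, _⟩ := hd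
    exact nonZeroDivisors.ne_zero h2 rfl

end IsInvolutionQuotient

end Quotient


section

variable {X Y : Scheme.{0}} (f : Y ⟶ X)

lemma exists_isolating {Z : Type*} [TopologicalSpace Z] {F : Set Z} (hF : F.Finite)
    (hcl : ∀ z ∈ F, IsClosed ({z} : Set Z)) (z : Z) :
    ∃ U : Opens Z, z ∈ U ∧ ∀ q ∈ U, q ∈ F → q = z := by
  refine ⟨⟨(F \ {z})ᶜ, ?_⟩, fun h => h.2 rfl, fun q hq hqF => by_contra fun hne => hq ⟨hqF, hne⟩⟩
  rw [isOpen_compl_iff, ← Set.biUnion_of_singleton (F \ {z})]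
  exact (hF.subset Set.sdiff_subset).isClosed_biUnion fun q hq => hcl q hq.1

lemma exists_preimage_eq {U : X.Opens} (hU : IsIso (f ∣_ U)) {V : Y.Opens} (hV : V ≤ f ⁻¹ᵁ U) :
    ∃ V₀ ≤ U, f ⁻¹ᵁ V₀ = V := by
  refine ⟨U.ι ''ᵁ ((f ∣_ U) ''ᵁ ((f ⁻¹ᵁ U).ι ⁻¹ᵁ V)), ?_, ?_⟩
  · rintro _ ⟨x, -, rfl⟩
    exact x.2
  · ext p
    constructor
    · rintro ⟨_, ⟨q, hq, rfl⟩, h⟩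
      have h1 : f q.1 = f p := (morphismRestrict_base_coe f U q).symm.trans h
      obtain ⟨_, -, hu⟩ := existsUnique_of_isIso f hU q.2
      have h2 : q.1 = p := (hu _ rfl).trans (hu _ h1.symm).symm
      exact h2 ▸ hq
    · intro hp
      exact ⟨_, ⟨⟨p, hV hp⟩, hp, rfl⟩, morphismRestrict_base_coe f U ⟨p, hV hp⟩⟩

lemma eq_of_comp_eq {U : X.Opens} (hU : IsIso (f ∣_ U)) {T : Scheme.{0}} {a b : T ⟶ Y}
    (h : a ≫ f = b ≫ f) (hr : ∀ x, f (a x) ∈ U) : a = b := by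
  have ha : Set.range a ⊆ Set.range (f ⁻¹ᵁ U).ι := by
    rintro _ ⟨x, rfl⟩
    rw [Scheme.Opens.range_ι]
    exact hr x
  have hb : Set.range b ⊆ Set.range (f ⁻¹ᵁ U).ι := by
    rintro _ ⟨x, rfl⟩
    rw [Scheme.Opens.range_ι]
    change f (b x) ∈ U
    rw [← Scheme.Hom.comp_apply, ← h]
    exact hr x
  have h1 : IsOpenImmersion.lift (f ⁻¹ᵁ U).ι a ha = IsOpenImmersion.lift (f ⁻¹ᵁ U).ι b hb := by
    rw [← cancel_mono (f ∣_ U), ← cancel_mono U.ι, Category.assoc, Category.assoc, morphismRestrict_ι,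
      IsOpenImmersion.lift_fac_assoc, IsOpenImmersion.lift_fac_assoc, h]
  rw [← IsOpenImmersion.lift_fac (f ⁻¹ᵁ U).ι a ha, h1, IsOpenImmersion.lift_fac]

end

namespace IsNormalizationAt

variable {X Y : Scheme.{0}} {f : Y ⟶ X} {S : Set X} (H : IsNormalizationAt f S)
  (hS : IsClosed S) (hcl : ∀ x ∈ S, IsClosed {x})

include H

lemma isIso : IsIso (f ∣_ (⟨Sᶜ, hS.isOpen_compl⟩ : X.Opens)) :=
  H.iso_away _ disjoint_compl_left

include hcl in
lemma exists_specializes {y : Y} (hy : f y ∈ S) : ∃ ξ, ξ ⤳ y ∧ f ξ ∉ S := by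
  obtain ⟨ξ, hξ, hne⟩ := exists_specializes_ne (H.normal y hy)
  refine ⟨ξ, hξ, fun h => hne ?_⟩
  have := H.finite
  have h1 : IsClosed {ξ} := isClosed_singleton_of_isFinite f (hcl _ h)
  exact (h1.closure_eq ▸ hξ.mem_closure : y ∈ ({ξ} : Set Y)).symm

include hS in
lemma isReduced [IsReduced X] : IsReduced Y := by
  have : ∀ y : Y, _root_.IsReduced (Y.presheaf.stalk y) := by
    intro y
    by_cases hy : f y ∈ S
    · obtain ⟨_, _⟩ := H.normal y hy
      infer_instance
    · exact isReduced_of_injective (stalkEquiv f (H.isIso hS) (y := y) hy).symm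
        (stalkEquiv f (H.isIso hS) (y := y) hy).symm.injective
  exact isReduced_of_isReduced_stalk Y

include hcl in
lemma isDominant : IsDominant (f ⁻¹ᵁ (⟨Sᶜ, hS.isOpen_compl⟩ : X.Opens)).ι := by
  refine ⟨fun y => ?_⟩
  rw [Scheme.Opens.range_ι]
  by_cases hy : f y ∈ S
  · obtain ⟨ξ, hξ, hξS⟩ := H.exists_specializes hcl hy
    exact closure_mono (by rintro _ rfl; exact hξS) hξ.mem_closure
  · exact subset_closure hy

include hS in
lemma isDVR (hd : ∀ x, IsClosed {x} → x ∉ S → IsDVR (X.presheaf.stalk x)) {y : Y}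
    (hy : IsClosed {y}) : IsDVR (Y.presheaf.stalk y) := by
  have := H.finite
  by_cases hyS : f y ∈ S
  · exact H.normal y hyS
  · exact (isDVR_iff_of_isIso f (H.isIso hS) hyS).1 (hd _ (isClosed_singleton_apply f hy) hyS)

end IsNormalizationAt

/-- An admissible double cover, together with the induced double cover of the normalizations. -/
structure Cover where
  (C' C Ch N : Scheme.{0})
  (s' : C' ⟶ Spec (.of ℂ))
  (s : C ⟶ Spec (.of ℂ))
  (τ : C' ⟶ C')
  (π : C' ⟶ C)
  adm : IsAdmissibleDoubleCover s' s τ π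
  ν : Ch ⟶ C'
  norm_total : IsNormalization ν
  νN : N ⟶ C
  norm_base : IsNormalization νN
  τh : Ch ⟶ Ch
  lift : τh ≫ ν = ν ≫ τ
  πh : Ch ⟶ N
  comm : πh ≫ νN = ν ≫ π

namespace Cover

variable (D : Cover)

instance : IsFinite D.π := D.adm.finite
instance : IsFinite D.ν := D.norm_total.finite
instance : IsFinite D.νN := D.norm_base.finite
instance : IsFinite D.πh := by
  have : IsFinite (D.πh ≫ D.νN) := by
    rw [D.comm]; infer_instance
  exact IsFinite.of_comp D.πh D.νN
instance : IsProper D.s' := D.adm.nodal_total.proper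
instance : IsProper D.s := D.adm.nodal_base.proper
instance : IsReduced D.C' := D.adm.nodal_total.reduced
instance : IsReduced D.C := D.adm.nodal_base.reduced
instance : ConnectedSpace D.C' := D.adm.connected
instance : IsLocallyNoetherian D.C' := D.adm.nodal_total.isLocallyNoetherian
instance : IsLocallyNoetherian D.C := D.adm.nodal_base.isLocallyNoetherian
instance : IsLocallyNoetherian D.Ch := LocallyOfFiniteType.isLocallyNoetherian D.ν
instance : IsLocallyNoetherian D.N := LocallyOfFiniteType.isLocallyNoetherian D.νN

lemma quot : IsInvolutionQuotient D.π D.τ where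
  finite := D.adm.finite
  comp := D.adm.invariant
  invol := D.adm.involution
  inj U := by
    have h := D.adm.app_injective U
    intro a b hab
    exact h (by rw [app_eq_pb, app_eq_pb, hab])
  desc U a ha := by
    obtain ⟨g, hg⟩ := D.adm.mem_range_app U a ha
    exact ⟨g, by rw [← hg, app_eq_pb]⟩

/-- The structure morphisms of the normalizations. -/
noncomputable abbrev sh : D.Ch ⟶ Spec (.of ℂ) := D.ν ≫ D.s'
noncomputable abbrev sN : D.N ⟶ Spec (.of ℂ) := D.νN ≫ D.s

lemma π_s : D.π ≫ D.s = D.s' := D.adm.comp_structure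
lemma τ_s' : D.τ ≫ D.s' = D.s' := by rw [← D.π_s, reassoc_of% D.adm.invariant]
lemma τh_sh : D.τh ≫ D.sh = D.sh := by rw [sh, reassoc_of% D.lift, D.τ_s']
lemma πh_sN : D.πh ≫ D.sN = D.sh := by rw [sN, reassoc_of% D.comm, D.π_s]

/-- The nodes of the covering curve, and their images. -/
abbrev S : Set D.C' := singularPoints D.C'
abbrev T : Set D.C := D.π '' D.S

lemma finite_S : D.S.Finite := D.adm.nodal_total.finite_singularPoints
lemma isClosed_S : IsClosed D.S := D.adm.nodal_total.isClosed_of_subset subset_rfl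
lemma finite_T : D.T.Finite := D.finite_S.image _
lemma isClosed_T : IsClosed D.T := D.π.isClosedMap _ D.isClosed_S

lemma isClosed_of_mem_T {y : D.C} (hy : y ∈ D.T) : IsClosed {y} := by
  obtain ⟨x, hx, rfl⟩ := hy
  exact isClosed_singleton_apply D.π hx.1

lemma τ_apply {x : D.C'} (hx : x ∈ D.S) : D.τ x = x := (D.adm.fixed_iff x hx.1).2 hx

lemma apply_mem_T_iff {x : D.C'} : D.π x ∈ D.T ↔ x ∈ D.S := by
  refine ⟨?_, fun h => ⟨x, h, rfl⟩⟩
  rintro ⟨x', hx', h⟩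
  rcases D.quot.eq_or_eq_of_apply_eq hx'.1 h.symm with rfl | rfl
  · exact hx'
  · rwa [D.τ_apply hx']

lemma eq_of_apply_eq {x x' : D.C'} (hx : x ∈ D.S) (h : D.π x' = D.π x) : x' = x := by
  rcases D.quot.eq_or_eq_of_apply_eq hx.1 h with rfl | rfl
  · rfl
  · rw [D.τ_apply hx]

lemma isDVR_C' {x : D.C'} (hx : IsClosed {x}) (hS : x ∉ D.S) : IsDVR (D.C'.presheaf.stalk x) := by
  by_contra h
  exact hS ⟨hx, h⟩

lemma isDVR_C {y : D.C} (hy : IsClosed {y}) (hT : y ∉ D.T) : IsDVR (D.C.presheaf.stalk y) := by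
  obtain ⟨x, rfl⟩ := D.quot.exists_apply_eq y
  have hx : x ∉ D.S := fun h => hT (D.apply_mem_T_iff.2 h)
  have hcl := isClosed_singleton_of_isFinite D.π hy
  exact D.quot.isDVR_apply hcl (D.isDVR_C' hcl hx) fun h => hx ((D.adm.fixed_iff x hcl).1 h)

lemma singularPoints_subset_T : singularPoints D.C ⊆ D.T :=
  fun _ hy => by_contra fun h => hy.2 (D.isDVR_C hy.1 h)

/-- The normalization of the covering curve, as a partial normalization at the nodes. -/
lemma normAt_total : IsNormalizationAt D.ν D.S := D.norm_total

lemma isDVR_Ch {p : D.Ch} (hp : IsClosed {p}) : IsDVR (D.Ch.presheaf.stalk p) :=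
  D.normAt_total.isDVR D.isClosed_S (fun _ hx hxS => D.isDVR_C' hx hxS) hp

lemma isDVR_N {p : D.N} (hp : IsClosed {p}) : IsDVR (D.N.presheaf.stalk p) :=
  IsNormalizationAt.isDVR (S := singularPoints D.C) D.norm_base
    (D.adm.nodal_base.isClosed_of_subset subset_rfl)
    (fun x hx hxS => by_contra fun h => hxS ⟨hx, h⟩) hp

/-- The normalization of the base curve, as a partial normalization at the images of the nodes
of the covering curve. -/
lemma normAt_base : IsNormalizationAt D.νN D.T where
  finite := inferInstance
  iso_away U hU := D.norm_base.iso_away U (hU.mono_right D.singularPoints_subset_T)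
  normal x hx := D.isDVR_N (isClosed_singleton_of_isFinite D.νN (D.isClosed_of_mem_T hx))

instance : IsReduced D.Ch := D.normAt_total.isReduced D.isClosed_S
instance : IsReduced D.N := D.normAt_base.isReduced D.isClosed_T

/-- The complement of the nodes in the covering curve. -/
def G' : D.C'.Opens := ⟨D.Sᶜ, D.isClosed_S.isOpen_compl⟩
/-- The complement of the images of the nodes in the base curve. -/
def G : D.C.Opens := ⟨D.Tᶜ, D.isClosed_T.isOpen_compl⟩

lemma preimage_G : D.π ⁻¹ᵁ D.G = D.G' := by
  ext x
  exact not_congr D.apply_mem_T_iff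

lemma isIso_ν : IsIso (D.ν ∣_ D.G') := D.normAt_total.isIso D.isClosed_S
lemma isIso_νN : IsIso (D.νN ∣_ D.G) := D.normAt_base.isIso D.isClosed_T

instance : IsDominant (D.ν ⁻¹ᵁ D.G').ι :=
  D.normAt_total.isDominant D.isClosed_S fun _ hx => hx.1

lemma τh_τh : D.τh ≫ D.τh = 𝟙 D.Ch := by
  have h : (D.τh ≫ D.τh) ≫ D.ν = 𝟙 D.Ch ≫ D.ν := by
    rw [Category.assoc, D.lift, reassoc_of% D.lift, D.adm.involution, Category.comp_id,
      Category.id_comp]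
  refine ext_of_isDominant_of_isSeparated D.ν h (D.ν ⁻¹ᵁ D.G').ι ?_
  refine eq_of_comp_eq D.ν D.isIso_ν (by rw [Category.assoc, h, Category.assoc]) fun x => ?_
  rw [← Scheme.Hom.comp_apply, Category.assoc, h, Category.id_comp, Scheme.Hom.comp_apply]
  exact x.2

lemma τh_πh : D.τh ≫ D.πh = D.πh := by
  have h : (D.τh ≫ D.πh) ≫ D.νN = D.πh ≫ D.νN := by
    rw [Category.assoc, D.comm, reassoc_of% D.lift, D.adm.invariant]
  refine ext_of_isDominant_of_isSeparated D.νN h (D.ν ⁻¹ᵁ D.G').ι ?_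
  refine eq_of_comp_eq D.νN D.isIso_νN (by rw [Category.assoc, h, Category.assoc]) fun x => ?_
  rw [← Scheme.Hom.comp_apply, Category.assoc, h, D.comm, Scheme.Hom.comp_apply,
    Scheme.Hom.comp_apply]
  exact D.preimage_G.ge (x.2 : D.ν ((D.ν ⁻¹ᵁ D.G').ι x) ∈ D.G')

lemma νN_πh (p : D.Ch) : D.νN (D.πh p) = D.π (D.ν p) := by
  rw [← Scheme.Hom.comp_apply, D.comm, Scheme.Hom.comp_apply]

lemma ν_τh (p : D.Ch) : D.ν (D.τh p) = D.τ (D.ν p) := by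
  rw [← Scheme.Hom.comp_apply, D.lift, Scheme.Hom.comp_apply]

lemma τh_apply {p : D.Ch} (hp : D.ν p ∈ D.S) : D.τh p = p :=
  D.adm.branches _ D.ν D.τh D.norm_total D.lift p hp

lemma exists_specializes_N {z : D.N} (hz : D.νN z ∈ D.T) : ∃ ξ, ξ ⤳ z ∧ D.νN ξ ∉ D.T :=
  D.normAt_base.exists_specializes (fun _ h => D.isClosed_of_mem_T h) hz

lemma πh_surjective (z : D.N) : ∃ p, D.πh p = z := by
  have h1 : ∀ z, D.νN z ∉ D.T → ∃ p, D.πh p = z := by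
    intro z hz
    obtain ⟨x, hx⟩ := D.quot.exists_apply_eq (D.νN z)
    have hxS : x ∈ D.G' := fun h => hz (by rw [← hx]; exact D.apply_mem_T_iff.2 h)
    obtain ⟨p, hp, -⟩ := existsUnique_of_isIso D.ν D.isIso_ν hxS
    refine ⟨p, ?_⟩
    obtain ⟨_, -, hu⟩ := existsUnique_of_isIso D.νN D.isIso_νN hz
    exact (hu (D.πh p) ((D.νN_πh p).trans (by rw [hp, hx]))).trans (hu z rfl).symm
  by_cases hz : D.νN z ∈ D.T
  · obtain ⟨ξ, hξ, hξT⟩ := D.exists_specializes_N hz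
    obtain ⟨η, rfl⟩ := h1 ξ hξT
    exact hξ.mem_closed D.πh.isClosedMap.isClosed_range ⟨η, rfl⟩
  · exact h1 z hz

lemma pb_πh_injective {V : D.N.Opens} {U : D.Ch.Opens} (h : U ≤ D.πh ⁻¹ᵁ V)
    (h' : D.πh ⁻¹ᵁ V ≤ U) : Function.Injective (pb D.πh h) :=
  pb_injective _ _ fun z hz => by
    obtain ⟨p, rfl⟩ := D.πh_surjective z
    exact ⟨p, h' hz, rfl⟩

lemma finite_preimage_T : (D.νN ⁻¹' D.T).Finite :=
  D.finite_T.preimage' fun y _ => D.νN.finite_preimage_singleton y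

lemma isClosed_of_mem_preimage_T {z : D.N} (hz : D.νN z ∈ D.T) : IsClosed {z} :=
  isClosed_singleton_of_isFinite D.νN (D.isClosed_of_mem_T hz)

lemma exists_desc_away {V : D.N.Opens} (hV : V ≤ D.νN ⁻¹ᵁ D.G) (a : Γ(D.Ch, D.πh ⁻¹ᵁ V))
    (ha : tw D.τh_πh a = a) : ∃ g, pb D.πh (le_refl (D.πh ⁻¹ᵁ V)) g = a := by
  obtain ⟨V₀, hV₀, rfl⟩ := exists_preimage_eq D.νN D.isIso_νN hV
  have hle : D.ν ⁻¹ᵁ (D.π ⁻¹ᵁ V₀) = D.πh ⁻¹ᵁ (D.νN ⁻¹ᵁ V₀) := by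
    rw [← Scheme.Hom.comp_preimage, ← Scheme.Hom.comp_preimage, D.comm]
  have hG : D.π ⁻¹ᵁ V₀ ≤ D.G' := by
    rw [← D.preimage_G]; exact D.π.preimage_mono hV₀
  have hb := pb_bijective_of_isIso D.ν D.isIso_ν hG
  obtain ⟨b, hb'⟩ := hb.2 (fres hle.le a)
  have htw : tw D.adm.invariant b = b := by
    apply hb.1
    have hle' : D.ν ⁻¹ᵁ (D.π ⁻¹ᵁ V₀) ≤ D.τh ⁻¹ᵁ (D.ν ⁻¹ᵁ (D.π ⁻¹ᵁ V₀)) := by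
      rw [hle]; exact le_preimage_preimage D.τh_πh _
    have h1 : pb D.ν le_rfl (tw D.adm.invariant b) = pb D.τh hle' (pb D.ν le_rfl b) := by
      rw [tw, pb_pb, pb_pb, pb_congr D.lift]
    rw [h1, hb', pb_fres]
    have h2 := congrArg (fres hle.le) ha
    rw [tw, fres_pb] at h2
    exact h2
  obtain ⟨g, rfl⟩ := D.quot.desc V₀ b htw
  refine ⟨pb D.νN le_rfl g, ?_⟩
  have h3 := congrArg (fres hle.ge) hb'
  rw [fres_fres, fres_self, pb_pb, fres_pb] at h3
  rw [← h3, pb_pb, pb_congr D.comm]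

lemma exists_desc {V : D.N.Opens} (a : Γ(D.Ch, D.πh ⁻¹ᵁ V)) (ha : tw D.τh_πh a = a) :
    ∃ g, pb D.πh (le_refl (D.πh ⁻¹ᵁ V)) g = a := by
  have hloc : ∀ z ∈ V, ∃ W ≤ V, z ∈ W ∧ ∃ (s : Γ(D.N, W)) (hW : W ≤ V),
      pb D.πh le_rfl s = fres (D.πh.preimage_mono hW) a := by
    intro z hz
    by_cases hzT : D.νN z ∈ D.T
    · obtain ⟨U, hzU, hU⟩ := exists_isolating D.finite_preimage_T
        (fun z hz => D.isClosed_of_mem_preimage_T hz) z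
      have hW : U ⊓ V ⊓ D.νN ⁻¹ᵁ D.G ≤ U ⊓ V := inf_le_left
      obtain ⟨g, hg⟩ := D.exists_desc_away (V := U ⊓ V ⊓ D.νN ⁻¹ᵁ D.G) inf_le_right
        (fres (D.πh.preimage_mono (hW.trans inf_le_right)) a) (by rw [tw_fres, ha])
      obtain ⟨p, rfl⟩ := D.πh_surjective z
      have hcl := D.isClosed_of_mem_preimage_T hzT
      have hzI : D.πh p ∈ U ⊓ V := ⟨hzU, hz⟩
      obtain ⟨g', hg'⟩ := exists_extension D.πh (p := p)
        (D.isDVR_Ch (isClosed_singleton_of_isFinite D.πh hcl)) (D.isDVR_N hcl) hcl hW hzI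
        (fun q hq hne => ⟨hq, fun h => hne (hU q hq.1 h)⟩) g (U := D.πh ⁻¹ᵁ (U ⊓ V)) hzI
        (fres (D.πh.preimage_mono inf_le_right) a) (by
          have := congrArg (fres (inf_le_right :
            D.πh ⁻¹ᵁ (U ⊓ V) ⊓ D.πh ⁻¹ᵁ (U ⊓ V ⊓ D.νN ⁻¹ᵁ D.G) ≤ _)) hg
          simpa using this)
      refine ⟨U ⊓ V, inf_le_right, hzI, g', inf_le_right, ?_⟩
      have h1 : D.πh ⁻¹ᵁ (U ⊓ V ⊓ D.νN ⁻¹ᵁ D.G) ≤ D.πh ⁻¹ᵁ (U ⊓ V) := D.πh.preimage_mono hW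
      have h2 : fres h1 (pb D.πh le_rfl g') = fres h1 (fres (D.πh.preimage_mono inf_le_right) a) := by
        rw [fres_pb, fres_fres, ← hg, ← hg', pb_fres]
      refine sub_eq_zero.1 (eq_zero_of_forall_mem_idealAt _ fun q hq => ?_)
      have h3 : ∃ ξ, ξ ⤳ q ∧ ξ ∈ D.πh ⁻¹ᵁ (U ⊓ V ⊓ D.νN ⁻¹ᵁ D.G) := by
        by_cases hqS : D.ν q ∈ D.S
        · obtain ⟨ξ, hξ, hξS⟩ := D.normAt_total.exists_specializes (fun _ h => h.1) hqS
          refine ⟨ξ, hξ, hξ.mem_open (D.πh ⁻¹ᵁ (U ⊓ V)).2 hq, ?_⟩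
          change D.νN (D.πh ξ) ∉ D.T
          rw [D.νN_πh, D.apply_mem_T_iff]
          exact hξS
        · refine ⟨q, specializes_rfl, hq, ?_⟩
          change D.νN (D.πh q) ∉ D.T
          rw [D.νN_πh, D.apply_mem_T_iff]
          exact hqS
      obtain ⟨ξ, hξ, hξU⟩ := h3
      refine idealAt_le_of_specializes (hp := h1 hξU) hξ ?_
      rw [← fres_mem_idealAt h1 _ hξU, map_sub, h2, sub_self]
      exact zero_mem _
    · have hzI : z ∈ V ⊓ D.νN ⁻¹ᵁ D.G := ⟨hz, hzT⟩
      obtain ⟨g, hg⟩ := D.exists_desc_away (V := V ⊓ D.νN ⁻¹ᵁ D.G) inf_le_right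
        (fres (D.πh.preimage_mono inf_le_left) a) (by rw [tw_fres, ha])
      exact ⟨_, inf_le_left, hzI, g, inf_le_left, hg⟩
  obtain ⟨g, hg⟩ := exists_fun_glue (U := V)
    (fun W s => ∃ hW : W ≤ V, pb D.πh le_rfl s = fres (D.πh.preimage_mono hW) a)
    (by
      rintro W W' h s hW ⟨h', e⟩
      refine ⟨h.trans h', ?_⟩
      have := congrArg (fres (D.πh.preimage_mono h)) e
      simpa using this)
    (by
      rintro W - s t ⟨h', e⟩ ⟨_, e'⟩
      exact D.pb_πh_injective le_rfl le_rfl (e.trans e'.symm))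
    hloc
  refine ⟨g, fun_ext _ _ fun p hp => ?_⟩
  obtain ⟨W, hW, hpW, s, h', e⟩ := hloc (D.πh p) hp
  refine ⟨D.πh ⁻¹ᵁ W, D.πh.preimage_mono hW, hpW, ?_⟩
  rw [← e, ← hg W hW s ⟨h', e⟩, fres_pb, pb_fres]

lemma quoth : IsInvolutionQuotient D.πh D.τh where
  finite := inferInstance
  comp := D.τh_πh
  invol := D.τh_τh
  inj _ := D.pb_πh_injective le_rfl le_rfl
  desc _ a ha := D.exists_desc a ha

end Cover


namespace Cover

variable (D : Cover)

lemma isNodeFibre {x : D.C'} (hx : x ∈ D.S) :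
    IsNodeFibre D.ν x ⟨(D.S \ {x})ᶜ, (D.adm.nodal_total.isClosed_of_subset
      Set.sdiff_subset).isOpen_compl⟩ where
  finite := inferInstance
  noeth := inferInstance
  closed := hx.1
  node := (D.adm.nodal_total.smooth_or_node x hx.1).resolve_left hx.2
  mem h := h.2 rfl
  iso V hV hxV := D.normAt_total.iso_away V (Set.disjoint_left.2 fun z hz hzS =>
    hV hz ⟨hzS, by rintro rfl; exact hxV hz⟩)
  dvr p hp := D.normAt_total.normal p (by rwa [hp])

lemma ν_surjective (x : D.C') : ∃ p, D.ν p = x := by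
  by_cases hx : x ∈ D.S
  · obtain ⟨p, -, hp, -⟩ := (D.isNodeFibre hx).exists_ne
    exact ⟨p, hp⟩
  · exact (existsUnique_of_isIso D.ν D.isIso_ν hx).exists

lemma pb_ν_injective {V : D.C'.Opens} {U : D.Ch.Opens} (h : U ≤ D.ν ⁻¹ᵁ V)
    (h' : D.ν ⁻¹ᵁ V ≤ U) : Function.Injective (pb D.ν h) :=
  pb_injective _ _ fun z hz => by
    obtain ⟨p, rfl⟩ := D.ν_surjective z
    exact ⟨p, h' hz, rfl⟩

/-- A function on the normalization which vanishes at the points over the nodes descends. -/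
lemma exists_desc_ν {V : D.C'.Opens} (a : Γ(D.Ch, D.ν ⁻¹ᵁ V))
    (ha : ∀ p ∈ D.ν ⁻¹ᵁ V, D.ν p ∈ D.S → ∃ (W : D.C'.Opens) (_ : D.ν p ∈ W)
      (b : Γ(D.C', W)), ∀ q (hq : q ∈ D.ν ⁻¹ᵁ V ⊓ D.ν ⁻¹ᵁ W), D.ν q = D.ν p →
        fres inf_le_left a - pb D.ν inf_le_right b ∈ idealAt (D.ν ⁻¹ᵁ V ⊓ D.ν ⁻¹ᵁ W) q hq) :
    ∃ g, pb D.ν (le_refl (D.ν ⁻¹ᵁ V)) g = a := by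
  have hloc : ∀ x ∈ V, ∃ W ≤ V, x ∈ W ∧ ∃ (s : Γ(D.C', W)) (hW : W ≤ V),
      pb D.ν le_rfl s = fres (D.ν.preimage_mono hW) a := by
    intro x hx
    by_cases hxS : x ∈ D.S
    · obtain ⟨p, rfl⟩ := D.ν_surjective x
      obtain ⟨W, hW, b, hb⟩ := ha p hx hxS
      have hpI : D.ν p ∈ V ⊓ W := ⟨hx, hW⟩
      obtain ⟨V', hV', hpV', g, hg⟩ := (D.isNodeFibre hxS).exists_descend hpI
        (fres (D.ν.preimage_mono inf_le_left) a - pb D.ν (D.ν.preimage_mono inf_le_right) b)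
        (fun q hq hqp => by
          have := hb q hq hqp
          exact this)
      refine ⟨V', hV'.trans inf_le_left, hpV', g + fres (hV'.trans inf_le_right) b,
        hV'.trans inf_le_left, ?_⟩
      rw [map_add, hg, map_sub, fres_fres, fres_pb, pb_fres, sub_add_cancel]
    · have hxI : x ∈ V ⊓ D.G' := ⟨hx, hxS⟩
      obtain ⟨g, hg⟩ := (pb_bijective_of_isIso D.ν D.isIso_ν
        (inf_le_right : V ⊓ D.G' ≤ D.G')).2 (fres (D.ν.preimage_mono inf_le_left) a)
      exact ⟨V ⊓ D.G', inf_le_left, hxI, g, inf_le_left, hg⟩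
  obtain ⟨g, hg⟩ := exists_fun_glue (U := V)
    (fun W s => ∃ hW : W ≤ V, pb D.ν le_rfl s = fres (D.ν.preimage_mono hW) a)
    (by
      rintro W W' h s hW ⟨h', e⟩
      refine ⟨h.trans h', ?_⟩
      have := congrArg (fres (D.ν.preimage_mono h)) e
      simpa using this)
    (by
      rintro W - s t ⟨h', e⟩ ⟨_, e'⟩
      exact D.pb_ν_injective le_rfl le_rfl (e.trans e'.symm))
    hloc
  refine ⟨g, fun_ext _ _ fun p hp => ?_⟩
  obtain ⟨W, hW, hpW, s, h', e⟩ := hloc (D.ν p) hp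
  refine ⟨D.ν ⁻¹ᵁ W, D.ν.preimage_mono hW, hpW, ?_⟩
  rw [← e, ← hg W hW s ⟨h', e⟩, fres_pb, pb_fres]

/-- A global function on the normalization which is constant on the fibres over the nodes is
constant. -/
lemma exists_eq_cst_of_fibres (a : Γ(D.Ch, ⊤))
    (ha : ∀ x ∈ D.S, ∃ c : ℂ, ∀ p, D.ν p = x → a - cst D.sh ⊤ c ∈ idealAt ⊤ p trivial) :
    ∃ c : ℂ, a = cst D.sh ⊤ c := by
  have htop : D.ν ⁻¹ᵁ ⊤ ≤ ⊤ := le_top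
  obtain ⟨g, hg⟩ := D.exists_desc_ν (V := ⊤) (fres htop a) (by
    intro p hp hpS
    obtain ⟨c, hc⟩ := ha _ hpS
    refine ⟨⊤, trivial, cst D.s' ⊤ c, fun q hq hqp => ?_⟩
    have h1 := hc q hqp
    rw [fres_fres, pb_cst D.ν rfl]
    rw [← fres_mem_idealAt (le_top : D.ν ⁻¹ᵁ ⊤ ⊓ D.ν ⁻¹ᵁ ⊤ ≤ ⊤) _ hq, map_sub, fres_cst] at h1
    exact h1)
  obtain ⟨c, rfl⟩ := exists_eq_cst D.s' g
  refine ⟨c, ?_⟩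
  rw [pb_cst D.ν rfl] at hg
  have h1 := congrArg (fres (le_preimage_top D.ν ⊤)) hg
  rw [fres_cst, fres_fres, fres_self] at h1
  exact h1.symm

lemma eq_of_πh_eq {p q : D.Ch} (hp : D.ν p ∈ D.S) (h : D.πh q = D.πh p) : q = p := by
  have hcl : IsClosed {p} := isClosed_singleton_of_isFinite D.ν hp.1
  rcases D.quoth.eq_or_eq_of_apply_eq hcl h with rfl | rfl
  · rfl
  · exact D.τh_apply hp

lemma isClosed_of_mem_S {p : D.Ch} (hp : D.ν p ∈ D.S) : IsClosed {p} :=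
  isClosed_singleton_of_isFinite D.ν hp.1

lemma isDVR_of_mem_S {p : D.Ch} (hp : D.ν p ∈ D.S) : IsDVR (D.Ch.presheaf.stalk p) :=
  D.normAt_total.normal p hp

lemma tw_sub_mem {p : D.Ch} (hp : D.ν p ∈ D.S) {V : D.N.Opens} (hpV : p ∈ D.πh ⁻¹ᵁ V)
    (a : Γ(D.Ch, D.πh ⁻¹ᵁ V)) : tw D.τh_πh a - a ∈ idealAt _ p hpV := by
  have := sub_mem_idealAt_of_fixed D.sh D.τh_sh (D.isClosed_of_mem_S hp) (D.τh_apply hp)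
    (le_preimage_preimage D.τh_πh V) le_rfl hpV a
  rwa [fres_self] at this

lemma mem_idealAt_of_tw_eq_neg {p : D.Ch} (hp : D.ν p ∈ D.S) {V : D.N.Opens}
    (hpV : p ∈ D.πh ⁻¹ᵁ V) {a : Γ(D.Ch, D.πh ⁻¹ᵁ V)} (ha : tw D.τh_πh a = -a) :
    a ∈ idealAt _ p hpV := by
  have h1 := D.tw_sub_mem hp hpV a
  rw [ha, ← neg_add', Ideal.neg_mem_iff] at h1
  exact mem_idealAt_of_add_self D.sh h1

lemma exists_tube_zero_only {p : D.Ch} (hp : D.ν p ∈ D.S) {V : D.N.Opens} {hpV : p ∈ D.πh ⁻¹ᵁ V}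
    {t : Γ(D.Ch, D.πh ⁻¹ᵁ V)} (ht : IsParam t p hpV) :
    ∃ (V' : D.N.Opens) (hV' : V' ≤ V) (hp' : p ∈ D.πh ⁻¹ᵁ V'), IsAffineOpen V' ∧
      IsParam (fres (D.πh.preimage_mono hV') t) p hp' ∧ ∀ q (hq : q ∈ D.πh ⁻¹ᵁ V'),
        fres (D.πh.preimage_mono hV') t ∈ idealAt _ q hq → q = p := by
  obtain ⟨U, hU, -, hpU, hz⟩ := ht.exists_zero_only (D.isClosed_of_mem_S hp) (D.isDVR_of_mem_S hp)
  obtain ⟨V', hV'a, hp', hV', hV'U⟩ := exists_affine_tube D.πh (D.πh p) hpV U fun q hq => by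
    rwa [D.eq_of_πh_eq hp hq]
  refine ⟨V', hV', hp', hV'a, (isParam_fres _ _ _).2 ht, fun q hq h => hz q (hV'U hq) ?_⟩
  exact (fres_mem_idealAt (D.πh.preimage_mono hV') t hq).1 h

/-- The involution of the normalization does not admit an invariant parameter at a point over a
node. -/
lemma not_isParam_of_tw_eq {p : D.Ch} (hp : D.ν p ∈ D.S) {V : D.N.Opens} {hpV : p ∈ D.πh ⁻¹ᵁ V}
    {t : Γ(D.Ch, D.πh ⁻¹ᵁ V)} (htw : tw D.τh_πh t = t) : ¬ IsParam t p hpV := by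
  intro ht
  obtain ⟨V, hV, hpV, hVa, ht, hz⟩ := D.exists_tube_zero_only hp ht
  replace htw : tw D.τh_πh (fres (D.πh.preimage_mono hV) t) = fres (D.πh.preimage_mono hV) t := by
    rw [tw_fres, htw]
  generalize fres (D.πh.preimage_mono hV) t = t at ht hz htw
  have hd := D.isDVR_of_mem_S hp
  have hpow : ∀ (k : ℕ) (g : Γ(D.Ch, D.πh ⁻¹ᵁ V)), tw D.τh_πh g = -g →
      D.Ch.presheaf.germ _ p hpV g ∈ IsLocalRing.maximalIdeal (D.Ch.presheaf.stalk p) ^ k := by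
    intro k
    induction k with
    | zero => intro g _; rw [pow_zero, Ideal.one_eq_top]; trivial
    | succ k ih =>
      intro g hg
      obtain ⟨b, rfl⟩ := ht.exists_eq_mul hd hz (D.mem_idealAt_of_tw_eq_neg hp hpV hg)
      have hb : tw D.τh_πh b = -b := by
        refine mul_left_cancel_of_germ (n := t) (fun q hq => ?_) ?_
        · by_cases hqp : q = p
          · subst hqp; exact ht.germ_mem_nonZeroDivisors hd
          · exact germ_mem_nonZeroDivisors_of_notMem fun h' => hqp (hz q hq h')
        · rw [map_mul, htw] at hg
          rw [hg, mul_neg]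
      rw [map_mul, pow_succ']
      exact Ideal.mul_mem_mul ht.mem_idealAt (ih b hb)
  have hzero : ∀ a : Γ(D.Ch, D.πh ⁻¹ᵁ V),
      D.Ch.presheaf.germ _ p hpV (a - tw D.τh_πh a) = 0 := by
    intro a
    have h1 := Ideal.iInf_pow_eq_bot_of_isLocalRing
      (IsLocalRing.maximalIdeal (D.Ch.presheaf.stalk p)) (IsLocalRing.maximalIdeal.isMaximal _).ne_top
    rw [← Ideal.mem_bot, ← h1, Submodule.mem_iInf]
    exact fun k => hpow k _ (by rw [map_sub, tw_tw _ D.τh_τh, neg_sub])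
  have hUa := hVa.preimage D.πh
  have hnoeth : IsNoetherianRing Γ(D.Ch, D.πh ⁻¹ᵁ V) :=
    IsLocallyNoetherian.component_noetherian ⟨_, hUa⟩
  obtain ⟨g, hg, hgK⟩ : ∃ g, g ∉ idealAt (D.πh ⁻¹ᵁ V) p hpV ∧
      ∀ a ∈ RingHom.ker (D.Ch.presheaf.germ (D.πh ⁻¹ᵁ V) p hpV).hom, g * a = 0 := by
    obtain ⟨F, hF⟩ := (isNoetherianRing_iff_ideal_fg _).1 hnoeth
      (RingHom.ker (D.Ch.presheaf.germ (D.πh ⁻¹ᵁ V) p hpV).hom)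
    have h1 : ∀ a ∈ F, ∃ g, g ∉ idealAt (D.πh ⁻¹ᵁ V) p hpV ∧ g * a = 0 := fun a ha =>
      (germ_eq_zero_iff hUa hpV a).1 (by
        have : a ∈ RingHom.ker (D.Ch.presheaf.germ (D.πh ⁻¹ᵁ V) p hpV).hom :=
          hF ▸ Ideal.subset_span ha
        exact this)
    choose! g hg hga using h1
    refine ⟨∏ a ∈ F, g a, ?_, ?_⟩
    · rw [(idealAt_isPrime _ p hpV).prod_mem_iff]
      rintro ⟨a, ha, h2⟩
      exact hg a ha h2
    · rw [← hF]
      intro a ha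
      induction ha using Submodule.span_induction with
      | mem a ha =>
        obtain ⟨c, hc⟩ := Finset.dvd_prod_of_mem g ha
        rw [hc, mul_right_comm, hga a ha, zero_mul]
      | zero => rw [mul_zero]
      | add a b _ _ ha hb => rw [mul_add, ha, hb, add_zero]
      | smul r a _ ha => rw [smul_eq_mul, mul_left_comm, ha, mul_zero]
  obtain ⟨ξ, hξ, hξS⟩ := D.normAt_total.exists_specializes (fun _ h => h.1) hp
  have hpg : p ∈ D.Ch.basicOpen g := notMem_idealAt_iff.1 hg
  have hξI : ξ ∈ D.Ch.basicOpen g ⊓ D.ν ⁻¹ᵁ D.G' :=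
    ⟨hξ.mem_open (D.Ch.basicOpen g).2 hpg, hξS⟩
  obtain ⟨q, hq, hqcl, -⟩ := exists_closed_mem D.sh hξI
  have hqV : q ∈ D.πh ⁻¹ᵁ V := D.Ch.basicOpen_le g hq.1
  have hle : idealAt (D.πh ⁻¹ᵁ V) q hqV ≤
      idealAt (D.πh ⁻¹ᵁ V) (D.τh q) (le_preimage_preimage D.τh_πh V hqV) := by
    intro a ha
    rw [← tw_mem_idealAt D.τh_πh (hp := hqV)]
    have h1 := hgK (a - tw D.τh_πh a) (hzero a)
    have h2 : g * (a - tw D.τh_πh a) ∈ idealAt (D.πh ⁻¹ᵁ V) q hqV := by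
      rw [h1]; exact zero_mem _
    have h3 := ((idealAt_isPrime _ q hqV).mem_or_mem h2).resolve_left (notMem_idealAt_iff.2 hq.1)
    have h4 := (idealAt _ q hqV).sub_mem ha h3
    rwa [sub_sub_cancel] at h4
  have h1 := specializes_of_idealAt_le hUa hle
  have h2 : D.τh q = q := (hqcl.closure_eq ▸ h1.mem_closure : D.τh q ∈ ({q} : Set D.Ch))
  refine hq.2 ((D.adm.fixed_iff (D.ν q) (isClosed_singleton_apply D.ν hqcl)).1 ?_)
  rw [← D.ν_τh, h2]

/-- At a point over a node there is a parameter on which the involution acts by `-1`. -/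
lemma exists_anti_param {p : D.Ch} (hp : D.ν p ∈ D.S) {W : D.N.Opens} (hW : D.πh p ∈ W) :
    ∃ (V : D.N.Opens) (_ : V ≤ W) (hpV : p ∈ D.πh ⁻¹ᵁ V) (t : Γ(D.Ch, D.πh ⁻¹ᵁ V)),
      IsAffineOpen V ∧ IsParam t p hpV ∧ (∀ q (hq : q ∈ D.πh ⁻¹ᵁ V), t ∈ idealAt _ q hq → q = p) ∧
      tw D.τh_πh t = -t := by
  have hd := D.isDVR_of_mem_S hp
  obtain ⟨V, hV, hpV', t, -, ht, -⟩ := exists_isParam_tube D.πh (D.isClosed_of_mem_S hp) hd hW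
  have hpV : p ∈ D.πh ⁻¹ᵁ V := hpV'
  replace ht : IsParam t p hpV := ht
  have hpar : IsParam (t - tw D.τh_πh t) p hpV := by
    have h1 := D.not_isParam_of_tw_eq hp (hpV := hpV) (t := t + tw D.τh_πh t)
      (by rw [map_add, tw_tw _ D.τh_τh, add_comm])
    have htm := ht.mem_idealAt
    have httw : tw D.τh_πh t ∈ idealAt _ p hpV := by
      have := (idealAt _ p hpV).add_mem (D.tw_sub_mem hp hpV t) htm
      rwa [sub_add_cancel] at this
    rw [isParam_iff hd] at h1 ht ⊢
    refine ⟨(idealAt _ p hpV).sub_mem htm httw, fun h2 => ht.2 ?_⟩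
    have h3 : D.Ch.presheaf.germ _ p hpV (t + tw D.τh_πh t) ∈
        IsLocalRing.maximalIdeal (D.Ch.presheaf.stalk p) ^ 2 := by
      by_contra h4
      exact h1 ⟨(idealAt _ p hpV).add_mem htm httw, h4⟩
    have h4 := Ideal.mul_mem_left _ (D.Ch.presheaf.germ _ p hpV (cst D.sh _ (1 / 2)))
      (Ideal.add_mem _ h2 h3)
    rw [← map_add, ← map_mul] at h4
    have h5 : cst D.sh (D.πh ⁻¹ᵁ V) (1 / 2) * (t - tw D.τh_πh t + (t + tw D.τh_πh t)) = t := by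
      rw [sub_add_add_cancel, ← mul_two, mul_comm t, ← mul_assoc,
        ← map_ofNat (cst D.sh (D.πh ⁻¹ᵁ V)) 2, ← map_mul]
      norm_num
    rwa [h5] at h4
  obtain ⟨V', hV', hp', hV'a, h1, h2⟩ := D.exists_tube_zero_only hp hpar
  refine ⟨V', hV'.trans hV, hp', _, hV'a, h1, h2, ?_⟩
  rw [tw_fres, map_sub, tw_tw _ D.τh_τh, ← map_neg, neg_sub]

end Cover


section Vanishing

variable {X Y : Scheme.{0}} {M : X.Modules}

lemma res_mem_smul {U V : X.Opens} (h : V ≤ U) {p : X} (hp : p ∈ V) {s : Γ(M, U)}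
    (hs : s ∈ idealAt U p (h hp) • (⊤ : Submodule Γ(X, U) Γ(M, U))) :
    res M h s ∈ idealAt V p hp • (⊤ : Submodule Γ(X, V) Γ(M, V)) := by
  induction hs using Submodule.smul_induction_on' with
  | smul r hr n _ =>
    rw [res_smul]
    exact Submodule.smul_mem_smul ((fres_mem_idealAt h r hp).2 hr) trivial
  | add a _ b _ ha hb => rw [map_add]; exact add_mem ha hb

lemma VanishesAt.add {U : X.Opens} {s s' : Γ(M, U)} {p : X} (h : VanishesAt M s p)
    (h' : VanishesAt M s' p) : VanishesAt M (s + s') p := by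
  obtain ⟨V, hV, hp, h⟩ := h
  obtain ⟨V', hV', hp', h'⟩ := h'
  have hpI : p ∈ V ⊓ V' := ⟨hp, hp'⟩
  refine ⟨V ⊓ V', inf_le_left.trans hV, hpI, ?_⟩
  have h1 := res_mem_smul (inf_le_left : V ⊓ V' ≤ V) hpI h
  have h2 := res_mem_smul (inf_le_right : V ⊓ V' ≤ V') hpI h'
  rw [res_res] at h1 h2
  rw [map_add]
  exact add_mem h1 h2

lemma VanishesAt.neg {U : X.Opens} {s : Γ(M, U)} {p : X} (h : VanishesAt M s p) :
    VanishesAt M (-s) p := by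
  obtain ⟨V, hV, hp, h⟩ := h
  exact ⟨V, hV, hp, by rw [map_neg]; exact neg_mem h⟩

lemma VanishesAt.sub {U : X.Opens} {s s' : Γ(M, U)} {p : X} (h : VanishesAt M s p)
    (h' : VanishesAt M s' p) : VanishesAt M (s - s') p := by
  rw [sub_eq_add_neg]; exact h.add h'.neg

lemma vanishesAt_smul {U : X.Opens} {f : Γ(X, U)} (s : Γ(M, U)) {p : X} {hp : p ∈ U}
    (h : f ∈ idealAt U p hp) : VanishesAt M (f • s) p :=
  ⟨U, le_rfl, hp, by rw [res_self]; exact Submodule.smul_mem_smul h trivial⟩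

lemma VanishesAt.smul {U : X.Opens} {s : Γ(M, U)} {p : X} (h : VanishesAt M s p) (f : Γ(X, U)) :
    VanishesAt M (f • s) p := by
  obtain ⟨V, hV, hp, h⟩ := h
  refine ⟨V, hV, hp, ?_⟩
  rw [res_smul]
  exact Submodule.smul_mem _ _ h

lemma VanishesAt.homLE {f : Y ⟶ X} {G : Y.Modules} (a : M ⟶ (Scheme.Modules.pushforward f).obj G)
    {U : X.Opens} {V : Y.Opens} (h : V ≤ f ⁻¹ᵁ U) {s : Γ(M, U)} {p : Y} (hp : p ∈ V)
    (hs : VanishesAt M s (f p)) : VanishesAt G (PrymEigen.homLE a h s) p := by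
  obtain ⟨W, hW, hpW, hs⟩ := hs
  have hpI : p ∈ V ⊓ f ⁻¹ᵁ W := ⟨hp, hpW⟩
  refine ⟨V ⊓ f ⁻¹ᵁ W, inf_le_left, hpI, ?_⟩
  rw [res_homLE, ← homLE_res a hW inf_le_right]
  generalize res M hW s = s at hs
  induction hs using Submodule.smul_induction_on' with
  | smul r hr n _ =>
    rw [homLE_smul]
    exact Submodule.smul_mem_smul ((pb_mem_idealAt f _ r hpI).2 hr) trivial
  | add a _ b _ ha hb => rw [map_add]; exact add_mem ha hb

lemma IsLineBundle.exists_isGenerator_of_not_vanishesAt (hM : IsLineBundle M) {U : X.Opens}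
    {s : Γ(M, U)} {p : X} (hp : p ∈ U) (h : ¬ VanishesAt M s p) :
    ∃ (V : X.Opens) (hV : V ≤ U), p ∈ V ∧ IsGenerator M (res M hV s) := by
  obtain ⟨W, e, hpW, he⟩ := isLineBundle_iff.1 hM p
  have hpI : p ∈ U ⊓ W := ⟨hp, hpW⟩
  obtain ⟨f, hf⟩ := he.exists_smul (inf_le_right : U ⊓ W ≤ W) (res M inf_le_left s)
  have h1 : f ∉ idealAt (U ⊓ W) p hpI := by
    intro h2
    rw [← vanishesAt_res_iff (inf_le_left : U ⊓ W ≤ U) s hpI, hf] at h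
    exact h (vanishesAt_smul _ h2)
  obtain ⟨V, hV, hpV, hu⟩ := exists_isUnit_fres h1
  refine ⟨V, hV.trans inf_le_left, hpV, ?_⟩
  have h2 : res M (hV.trans inf_le_left) s = fres hV f • res M (hV.trans inf_le_right) e := by
    have := congrArg (res M hV) hf
    simpa using this
  rw [h2]
  exact (he.res _).unit_smul hu

lemma IsGenerator.not_vanishesAt {U : X.Opens} {e : Γ(M, U)} (he : IsGenerator M e) {p : X}
    (hp : p ∈ U) : ¬ VanishesAt M e p := by
  have h1 := he.vanishesAt_smul_iff 1 hp
  rw [one_smul] at h1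
  rw [h1]
  exact fun h => (idealAt_isPrime U p hp).ne_top ((Ideal.eq_top_iff_one _).2 h)

lemma exists_mod_glue_two {U V W : X.Opens} (hU : U ≤ W) (hV : V ≤ W) (hW : W ≤ U ⊔ V)
    (s : Γ(M, U)) (t : Γ(M, V))
    (h : res M (inf_le_left : U ⊓ V ≤ U) s = res M (inf_le_right : U ⊓ V ≤ V) t) :
    ∃ a : Γ(M, W), res M hU a = s ∧ res M hV a = t := by
  obtain ⟨a, ha⟩ := exists_mod_glue (M := M) (U := W)
    (fun V' r => (∃ h : V' ≤ U, r = res M h s) ∨ ∃ h : V' ≤ V, r = res M h t)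
    (by
      rintro A B hBA r - (⟨h, rfl⟩ | ⟨h, rfl⟩)
      · exact Or.inl ⟨hBA.trans h, by rw [res_res]⟩
      · exact Or.inr ⟨hBA.trans h, by rw [res_res]⟩)
    (by
      have key : ∀ (A : X.Opens) (h₁ : A ≤ U) (h₂ : A ≤ V), res M h₁ s = res M h₂ t := by
        intro A h₁ h₂
        have := congrArg (res M (le_inf h₁ h₂)) h
        simpa using this
      rintro A - r r' (⟨h₁, rfl⟩ | ⟨h₁, rfl⟩) (⟨h₂, rfl⟩ | ⟨h₂, rfl⟩)
      · rfl
      · exact key _ _ _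
      · exact (key _ _ _).symm
      · rfl)
    (by
      intro x hx
      rcases hW hx with h | h
      · exact ⟨U, hU, h, s, Or.inl ⟨le_rfl, by rw [res_self]⟩⟩
      · exact ⟨V, hV, h, t, Or.inr ⟨le_rfl, by rw [res_self]⟩⟩)
  exact ⟨a, ha U hU s (Or.inl ⟨le_rfl, by rw [res_self]⟩),
    ha V hV t (Or.inr ⟨le_rfl, by rw [res_self]⟩)⟩

/-- A section of a line bundle on an affine open set which vanishes at one of two closed points
but not at the other one. -/
lemma IsLineBundle.exists_separating (hM : IsLineBundle M) (f : X ⟶ Y) [IsFinite f] {p q : X}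
    (hp : IsClosed {p}) (hq : IsClosed {q}) (hpq : p ≠ q) (hf : ∀ r, f r = f p → r = p ∨ r = q) 
    (hfq : f q = f p) :
    ∃ (V : Y.Opens) (_ : f p ∈ V) (l : Γ(M, f ⁻¹ᵁ V)), ¬ VanishesAt M l p ∧ VanishesAt M l q := by
  obtain ⟨V, hV, hpV, -⟩ := exists_affine_le (f p) (Opens.mem_top (f p))
  have hpU : p ∈ f ⁻¹ᵁ V := hpV
  have hqU : q ∈ f ⁻¹ᵁ V := by
    change f q ∈ V
    rwa [hfq]
  have hVa := hV.preimage f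
  obtain ⟨A, e, hpA, he⟩ := isLineBundle_iff.1 hM p
  obtain ⟨B, e', hqB, he'⟩ := isLineBundle_iff.1 hM q
  have hpA' : p ∈ A ⊓ ⟨{q}ᶜ, hq.isOpen_compl⟩ := ⟨hpA, hpq⟩
  obtain ⟨g, hgA, hpg⟩ := hVa.exists_basicOpen_le ⟨p, hpA'⟩ hpU
  obtain ⟨g', hgB, hqg⟩ := hVa.exists_basicOpen_le ⟨q, hqB⟩ hqU
  obtain ⟨V', hV', hpV', hV'V, hV'D⟩ := exists_affine_tube f (f p) hpV
    (X.basicOpen g ⊔ X.basicOpen g') (by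
      intro r hr
      rcases hf r hr with rfl | rfl
      · exact Or.inl hpg
      · exact Or.inr hqg)
  have hU' := f.preimage_mono hV'V
  let G := fres hU' g
  let G' := fres hU' g'
  have hG : X.basicOpen G = f ⁻¹ᵁ V' ⊓ X.basicOpen g := Scheme.basicOpen_res _ _ _
  have hG' : X.basicOpen G' = f ⁻¹ᵁ V' ⊓ X.basicOpen g' := Scheme.basicOpen_res _ _ _
  have hGA : X.basicOpen G ≤ A := hG.le.trans (inf_le_right.trans (hgA.trans inf_le_left))
  have hGB : X.basicOpen G' ≤ B := hG'.le.trans (inf_le_right.trans hgB)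
  have hGU := X.basicOpen_le G
  have hGU' := X.basicOpen_le G'
  have hcov : f ⁻¹ᵁ V' ≤ X.basicOpen G ⊔ X.basicOpen G' := by
    intro r hr
    rcases hV'D hr with h | h
    · exact Or.inl (hG.ge ⟨hr, h⟩)
    · exact Or.inr (hG'.ge ⟨hr, h⟩)
  obtain ⟨c, hc⟩ := he'.exists_smul
    ((inf_le_right : X.basicOpen G ⊓ X.basicOpen G' ≤ X.basicOpen G').trans hGB)
    (res M (inf_le_left.trans hGA) e)
  obtain ⟨n, d, hd⟩ := exists_pow_mul_eq_fres ((hV'.preimage f).basicOpen G') (fres hGU' G)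
    (V := X.basicOpen G ⊓ X.basicOpen G') (by
      rw [inf_comm]; exact (Scheme.basicOpen_res _ _ _).symm) inf_le_right c
  obtain ⟨l, hl, -⟩ := exists_mod_glue_two hGU hGU' hcov (fres hGU G ^ n • res M hGA e)
    (d • res M hGB e') (by
      simp only [res_smul, res_res, ← hd, hc, mul_smul, map_pow, fres_fres])
  have hpG : p ∈ X.basicOpen G := hG.ge ⟨hpV', hpg⟩
  refine ⟨V', hpV', G • l, ?_, ?_⟩
  · rw [← vanishesAt_res_iff hGU _ hpG, res_smul, hl, ← mul_smul, ← pow_succ']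
    refine ((he.res hGA).unit_smul ?_).not_vanishesAt hpG
    exact (RingedSpace.isUnit_res_basicOpen X.toRingedSpace G).pow _
  · have hqV' : q ∈ f ⁻¹ᵁ V' := by
      change f q ∈ V'
      rwa [hfq]
    refine vanishesAt_smul (hp := hqV') l ?_
    rw [fres_mem_idealAt]
    by_contra h
    exact (hgA (notMem_idealAt_iff.1 h)).2 rfl

end Vanishing


section Action

variable {X Y : Scheme.{0}} {f : X ⟶ Y} {t : X ⟶ X} (h : t ≫ f = f) {L : X.Modules}
  (φ : L ⟶ (Scheme.Modules.pushforward t).obj L)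

/-- The action on sections over invariant open sets. -/
noncomputable def act {U : Y.Opens} : Γ(L, f ⁻¹ᵁ U) →+ Γ(L, f ⁻¹ᵁ U) :=
  homLE φ (le_preimage_preimage h U)

lemma act_smul {U : Y.Opens} (a : Γ(X, f ⁻¹ᵁ U)) (s : Γ(L, f ⁻¹ᵁ U)) :
    act h φ (a • s) = tw h a • act h φ s := homLE_smul _ _ _ _

lemma act_res {U V : Y.Opens} (hV : f ⁻¹ᵁ V ≤ f ⁻¹ᵁ U) (s : Γ(L, f ⁻¹ᵁ U)) :
    act h φ (res L hV s) = res L hV (act h φ s) := by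
  rw [act, act, homLE_res, res_homLE]

lemma homLE_neg {U V : X.Opens} (hV : V ≤ t ⁻¹ᵁ U) (s : Γ(L, U)) :
    homLE (-φ) hV s = -homLE φ hV s := by
  have h1 : (-φ).app U s = -(φ.app U s) := app_neg' φ U s
  change res L hV ((-φ).app U s) = -(res L hV (φ.app U s))
  rw [h1]
  exact map_neg (res L hV) _

lemma act_neg {U : Y.Opens} (s : Γ(L, f ⁻¹ᵁ U)) : act h (-φ) s = -act h φ s := homLE_neg _ _ _

variable {φ}

lemma IsLinearization.neg {h' : t ≫ t = 𝟙 X} (hφ : IsLinearization h' L φ) :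
    IsLinearization h' L (-φ) := by
  rw [isLinearization_iff] at hφ ⊢
  intro U V W hV hW hWU s
  rw [homLE_neg, homLE_neg, map_neg, neg_neg, hφ U V W hV hW hWU]

lemma IsLinearization.act_act {h' : t ≫ t = 𝟙 X} (hφ : IsLinearization h' L φ) {U : Y.Opens}
    (s : Γ(L, f ⁻¹ᵁ U)) : act h φ (act h φ s) = s := by
  rw [isLinearization_iff] at hφ
  exact (hφ _ _ _ _ _ le_rfl s).trans (res_self _ _)

variable (φ) in
/-- Near `y`, the sheaf `L` has a generator which is invariant under the action of `φ`. -/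
def HasInvGen (y : Y) : Prop :=
  ∃ (V : Y.Opens) (_ : y ∈ V) (e : Γ(L, f ⁻¹ᵁ V)), IsGenerator L e ∧ act h φ e = e

lemma HasInvGen.exists_le {y : Y} (H : HasInvGen h φ y) {W : Y.Opens} (hW : y ∈ W) :
    ∃ (V : Y.Opens) (_ : V ≤ W) (_ : y ∈ V) (e : Γ(L, f ⁻¹ᵁ V)),
      IsGenerator L e ∧ act h φ e = e := by
  obtain ⟨V, hy, e, he, hφ⟩ := H
  exact ⟨V ⊓ W, inf_le_right, ⟨hy, hW⟩, res L (f.preimage_mono inf_le_left) e, he.res _, by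
    rw [act_res, hφ]⟩

variable (hL : IsLineBundle L) (hφ : ∀ (U : Y.Opens) (s : Γ(L, f ⁻¹ᵁ U)), act h φ (act h φ s) = s)
  [IsFinite f]

include hL

lemma hasInvGen_of_not_vanishesAt {y : Y} {V : Y.Opens} (hy : y ∈ V) (e : Γ(L, f ⁻¹ᵁ V))
    (he : act h φ e = e) (hv : ∀ p, f p = y → ¬ VanishesAt L e p) : HasInvGen h φ y := by
  have h1 : ∀ p, f p = y → ∃ (W : X.Opens) (hW : W ≤ f ⁻¹ᵁ V), p ∈ W ∧ IsGenerator L (res L hW e) :=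
    fun p hp => hL.exists_isGenerator_of_not_vanishesAt
      (by change f p ∈ V; rwa [hp]) (hv p hp)
  choose! W hW hpW hg using h1
  obtain ⟨V', hV'a, hyV', hV'V, hV'W⟩ := exists_affine_tube f y hy (⨆ p : {p // f p = y}, W p.1)
    fun p hp => Opens.mem_iSup.2 ⟨⟨p, hp⟩, hpW p hp⟩
  refine ⟨V', hyV', res L (f.preimage_mono hV'V) e, IsGenerator.of_locally _ fun q hq => ?_, ?_⟩
  · obtain ⟨⟨p, hp⟩, hqW⟩ := Opens.mem_iSup.1 (hV'W hq)
    refine ⟨f ⁻¹ᵁ V' ⊓ W p, inf_le_left, ⟨hq, hqW⟩, ?_⟩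
    rw [res_res]
    have := (hg p hp).res (inf_le_right : f ⁻¹ᵁ V' ⊓ W p ≤ W p)
    rwa [res_res] at this
  · rw [act_res, he]

include hφ

lemma hasInvGen_of_ne (H : IsInvolutionQuotient f t) {p : X} (hp : IsClosed {p}) (hne : t p ≠ p) :
    HasInvGen h φ (f p) := by
  have hfib : ∀ r, f r = f p → r = p ∨ r = t p := fun r hr => H.eq_or_eq_of_apply_eq hp hr
  obtain ⟨V, hpV, l, hlp, hlq⟩ := hL.exists_separating f hp (isClosed_of_invol H.invol hp) hne.symm
    hfib (apply_invol H.comp p)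
  have hpU : p ∈ f ⁻¹ᵁ V := hpV
  have htU : t p ∈ f ⁻¹ᵁ V := le_preimage_preimage h V hpU
  have h1 : VanishesAt L (act h φ l) p := hlq.homLE φ _ hpU
  refine hasInvGen_of_not_vanishesAt h hL hpV (l + act h φ l) ?_ ?_
  · rw [map_add, hφ, add_comm]
  · intro r hr hv
    rcases hfib r hr with rfl | rfl
    · have := hv.sub h1
      rw [add_sub_cancel_right] at this
      exact hlp this
    · have h2 := hv.sub hlq
      rw [add_sub_cancel_left] at h2
      have h3 : VanishesAt L (act h φ (act h φ l)) p := h2.homLE φ _ hpU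
      rw [hφ] at h3
      exact hlp h3

variable (s : X ⟶ Spec (.of ℂ)) [LocallyOfFiniteType s]

include s in
omit [LocallyOfFiniteType s] in
lemma hasInvGen_of_sub_one_mem {p : X} (hfib : ∀ q, f q = f p → q = p) {V : Y.Opens}
    (hpV : p ∈ f ⁻¹ᵁ V) {e : Γ(L, f ⁻¹ᵁ V)} (he : IsGenerator L e) {u : Γ(X, f ⁻¹ᵁ V)}
    (hu : act h φ e = u • e) (h1 : u - 1 ∈ idealAt _ p hpV) : HasInvGen h φ (f p) := by
  refine hasInvGen_of_not_vanishesAt h hL hpV (e + act h φ e) ?_ ?_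
  · rw [map_add, hφ, add_comm]
  · intro q hq hv
    obtain rfl := hfib q hq
    have h2 : e + act h φ e = (1 + u) • e := by rw [add_smul, one_smul, hu]
    rw [h2, he.vanishesAt_smul_iff _ hpV] at hv
    have h3 := (idealAt _ q hpV).sub_mem hv h1
    have h4 : (1 + u) - (u - 1) = 1 + 1 := by ring
    rw [h4] at h3
    exact (idealAt_isPrime _ q hpV).ne_top ((Ideal.eq_top_iff_one _).2
      (mem_idealAt_of_add_self s h3))

variable (hs : t ≫ s = s)

include hs

/-- At a fixed point with a single preimage, exactly one of `φ` and `-φ` has an invariant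
generator. -/
lemma hasInvGen_or_of_eq {p : X} (hp : IsClosed {p}) (htp : t p = p) (hfib : ∀ q, f q = f p → q = p) :
    HasInvGen h φ (f p) ∨ HasInvGen h (-φ) (f p) := by
  obtain ⟨A, e, hpA, he⟩ := isLineBundle_iff.1 hL p
  obtain ⟨V, -, hpV', -, hVA⟩ := exists_affine_tube f (f p) (Opens.mem_top _) A
    fun q hq => by rwa [hfib q hq]
  have hpV : p ∈ f ⁻¹ᵁ V := hpV'
  replace he := he.res hVA
  generalize res L hVA e = e at he
  obtain ⟨u, hu⟩ := he.exists_smul' (act h φ e)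
  have huu : tw h u * u = 1 := by
    apply he.smul_injective'
    rw [one_smul, mul_smul, ← hu, ← act_smul, ← hu, hφ]
  obtain ⟨c, hc⟩ := exists_cst_sub_mem s hp hpV u
  have h1 := sub_mem_idealAt_of_fixed s hs hp htp (le_preimage_preimage h V) le_rfl hpV u
  rw [fres_self] at h1
  have h2 : cst s (f ⁻¹ᵁ V) (1 - c * c) ∈ idealAt _ p hpV := by
    have h3 := add_mem (Ideal.mul_mem_left _ (tw h u) hc) (Ideal.mul_mem_left _ (cst s _ c) h1)
    have h4 := add_mem h3 (Ideal.mul_mem_left _ (cst s _ c) hc)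
    have h5 : tw h u * (u - cst s _ c) + cst s _ c * (tw h u - u) + cst s _ c * (u - cst s _ c) =
        tw h u * u - cst s _ c * cst s _ c := by ring
    have h6 := h5 ▸ h4
    rw [huu, ← map_one (cst s (f ⁻¹ᵁ V)), ← map_mul, ← map_sub] at h6
    exact h6
  rw [cst_mem_idealAt_iff, sub_eq_zero] at h2
  rcases mul_self_eq_one_iff.1 h2.symm with rfl | rfl
  · rw [map_one] at hc
    exact Or.inl (hasInvGen_of_sub_one_mem h hL hφ s hfib hpV he hu hc)
  · refine Or.inr (hasInvGen_of_sub_one_mem h hL (fun U x => ?_) s hfib hpV he (u := -u) ?_ ?_)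
    · rw [act_neg, act_neg, map_neg, neg_neg, hφ]
    · rw [act_neg, hu, neg_smul]
    · rw [map_neg, map_one] at hc
      have h3 := neg_mem hc
      have h4 : -(u - -1) = -u - 1 := by ring
      rwa [h4] at h3

omit hL hφ [IsFinite f] in
lemma not_hasInvGen_and_of_eq {p : X} (hp : IsClosed {p}) (htp : t p = p)
    (h₁ : HasInvGen h φ (f p)) (h₂ : HasInvGen h (-φ) (f p)) : False := by
  obtain ⟨W, hW, e', he', hφ'⟩ := h₂
  obtain ⟨V, hVW, hpV', e, he, hφe⟩ := h₁.exists_le h hW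
  have hpV : p ∈ f ⁻¹ᵁ V := hpV'
  have hφ'' : act h φ (res L (f.preimage_mono hVW) e') = -res L (f.preimage_mono hVW) e' := by
    rw [act_neg, neg_eq_iff_eq_neg] at hφ'
    rw [act_res, hφ', map_neg]
  replace he' := he'.res (f.preimage_mono hVW)
  generalize res L (f.preimage_mono hVW) e' = e' at he' hφ''
  obtain ⟨u, rfl⟩ := he.exists_smul' e'
  have hu : tw h u = -u := by
    apply he.smul_injective'
    rw [act_smul, hφe] at hφ''
    rw [hφ'', neg_smul]
  have h1 := sub_mem_idealAt_of_fixed s hs hp htp (le_preimage_preimage h V) le_rfl hpV u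
  rw [fres_self] at h1
  change tw h u - u ∈ _ at h1
  rw [hu, ← neg_add', Ideal.neg_mem_iff] at h1
  exact not_isUnit_of_mem_idealAt (mem_idealAt_of_add_self s h1) (he.isUnit_of_smul he')

end Action

/-! ### Existence of linearizations -/

section Scalars

variable {X : Scheme.{0}}

/-- Multiplication by a global function. -/
noncomputable def scale (M : X.Modules) (a : Γ(X, ⊤)) : M ⟶ M :=
  mkHom M M (fun U =>
    { toFun := fun m => (fres le_top a : Γ(X, U)) • m
      map_zero' := smul_zero _
      map_add' := smul_add _ })
    (fun U V h s => by
      change (fres le_top a : Γ(X, V)) • res M h s = res M h ((fres le_top a : Γ(X, U)) • s)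
      rw [res_smul, fres_fres])
    (fun U r s => by
      change (fres le_top a : Γ(X, U)) • r • s = r • (fres le_top a : Γ(X, U)) • s
      rw [smul_comm])

lemma homLE_scale {Y : Scheme.{0}} {f : Y ⟶ X} {M : X.Modules} {G : Y.Modules}
    (b : M ⟶ (Scheme.Modules.pushforward f).obj G) (a : Γ(X, ⊤)) {U : X.Opens} {V : Y.Opens}
    (h : V ≤ f ⁻¹ᵁ U) (s : Γ(M, U)) :
    homLE (scale M a ≫ b) h s = pb f h (fres le_top a) • homLE b h s := by
  rw [← homLE_smul]
  rfl

/-- An endomorphism of a line bundle on a connected proper reduced curve is a scalar. -/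
lemma IsLineBundle.exists_eq_cst (s : X ⟶ Spec (.of ℂ)) [IsProper s] [IsReduced X]
    [ConnectedSpace X] {M : X.Modules} (hM : IsLineBundle M) (b : M ⟶ M) :
    ∃ c : ℂ, ∀ (U : X.Opens) (m : Γ(M, U)), b.app U m = cst s U c • m := by
  have hloc : ∀ x ∈ (⊤ : X.Opens), ∃ V ≤ (⊤ : X.Opens), x ∈ V ∧
      ∃ u : Γ(X, V), ∀ W (h : W ≤ V) (m : Γ(M, W)), b.app W m = fres h u • m := by
    intro x _
    obtain ⟨U, e, hx, he⟩ := isLineBundle_iff.1 hM x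
    obtain ⟨u, hu⟩ := he.exists_smul' (b.app U e)
    refine ⟨U, le_top, hx, u, fun W h m => ?_⟩
    obtain ⟨r, rfl⟩ := he.exists_smul h m
    have h1 : b.app W (r • res M h e) = r • b.app W (res M h e) := b.app_smul r _
    rw [h1, app_res, hu, res_smul, smul_comm]
  obtain ⟨u, hu⟩ := exists_fun_glue (U := ⊤)
    (fun V u => ∀ W (h : W ≤ V) (m : Γ(M, W)), b.app W m = fres h u • m)
    (by
      intro V W h u _ hu W' hW' m
      rw [fres_fres, hu W' (hW'.trans h) m])
    (by
      intro V _ u u' h₁ h₂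
      refine fun_ext _ _ fun x hx => ?_
      obtain ⟨U, e, hxU, he⟩ := isLineBundle_iff.1 hM x
      refine ⟨V ⊓ U, inf_le_left, ⟨hx, hxU⟩, he.smul_injective inf_le_right ?_⟩
      rw [← h₁ _ inf_le_left, ← h₂ _ inf_le_left])
    hloc
  obtain ⟨c, rfl⟩ := PrymEigen.exists_eq_cst s u
  refine ⟨c, fun U m => mod_ext _ _ fun x hx => ?_⟩
  obtain ⟨V, hV, hxV, u', hu'⟩ := hloc x trivial
  refine ⟨U ⊓ V, inf_le_left, ⟨hx, hxV⟩, ?_⟩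
  rw [← app_res, hu' _ inf_le_right, res_smul, fres_cst, ← hu V hV u' hu', fres_fres, fres_cst]

end Scalars

namespace Cover

variable (D : Cover)

theorem exists_isLinearization {L : D.C'.Modules} (hL : IsLineBundle L)
    (α : (Scheme.Modules.pullback D.τ).obj L ≅ L) :
    ∃ φ : L ⟶ (Scheme.Modules.pushforward D.τ).obj L, IsLinearization D.adm.involution L φ := by
  let a := coadj D.τ α.hom
  have hpre : ∀ U : D.C'.Opens, U ≤ D.τ ⁻¹ᵁ (D.τ ⁻¹ᵁ U) := fun U => by
    rw [← Scheme.Hom.comp_preimage, D.adm.involution]; exact le_rfl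
  let b : L ⟶ L := mkHom L L (fun U => (homLE a (hpre U)).comp (homLE a (le_refl (D.τ ⁻¹ᵁ U))))
    (fun U V h s => by
      change homLE a _ (homLE a _ (res L h s)) = res L h (homLE a _ (homLE a _ s))
      rw [homLE_res, res_homLE, ← res_homLE a le_rfl (D.τ.preimage_mono h), homLE_res])
    (fun U r s => by
      change homLE a _ (homLE a _ (r • s)) = r • homLE a _ (homLE a _ s)
      rw [homLE_smul, homLE_smul, pb_pb, pb_congr D.adm.involution]
      congr 1
      exact (pb_id le_rfl r).trans (fres_self _ _))
  obtain ⟨c, hc⟩ := hL.exists_eq_cst D.s' b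
  have hc0 : c ≠ 0 := by
    rintro rfl
    obtain ⟨x⟩ : Nonempty D.C' := inferInstance
    obtain ⟨U, e, hx, he⟩ := isLineBundle_iff.1 hL x
    have h1 := hc U e
    rw [map_zero, zero_smul] at h1
    have hgen : ∀ {A B : D.C'.Opens} (h : B ≤ D.τ ⁻¹ᵁ A) {e : Γ(L, A)}, IsGenerator L e →
        IsGenerator L (homLE a h e) := by
      intro A B h e he
      rw [homLE_coadj]
      exact (he.psec D.τ h).map_iso α
    have h2 : IsGenerator L (homLE a (hpre U) (homLE a (le_refl (D.τ ⁻¹ᵁ U)) e)) :=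
      hgen _ (hgen _ he)
    have h3 : homLE a (hpre U) (homLE a (le_refl (D.τ ⁻¹ᵁ U)) e) = 0 := h1
    rw [h3] at h2
    refine h2.not_vanishesAt hx ?_
    rw [← zero_smul Γ(D.C', U) e]
    exact vanishesAt_smul (hp := hx) e (zero_mem _)
  obtain ⟨z, hz⟩ := IsAlgClosed.exists_eq_mul_self c⁻¹
  refine ⟨scale L (cst D.s' ⊤ z) ≫ a, (isLinearization_iff _ _ _).2 ?_⟩
  intro U V W hV hW hWU s
  rw [homLE_scale, homLE_scale, homLE_smul, fres_cst, fres_cst, pb_cst _ D.τ_s', pb_cst _ D.τ_s',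
    pb_cst _ D.τ_s', ← mul_smul, ← map_mul, ← hz]
  have h1 : homLE a hW (homLE a hV s) = res L hWU (b.app U s) := by
    change _ = res L hWU (homLE a _ (homLE a _ s))
    rw [res_homLE, ← res_homLE a le_rfl hV, homLE_res]
  rw [h1, hc, res_smul, fres_cst, ← mul_smul, ← map_mul, inv_mul_cancel₀ hc0, map_one, one_smul]

end Cover


/-! ### Twists -/

section Twist

variable {X Y : Scheme.{0}} {F : X.Modules}

lemma mem_range_app_of_locally {M : X.Modules} (α : M ⟶ F)
    (hα : ∀ U : X.Opens, Function.Injective (α.app U)) {U : X.Opens} (s : Γ(F, U))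
    (h : ∀ x ∈ U, ∃ (V : X.Opens) (hV : V ≤ U), x ∈ V ∧ res F hV s ∈ Set.range (α.app V)) :
    s ∈ Set.range (α.app U) := by
  have hloc : ∀ x ∈ U, ∃ V ≤ U, x ∈ V ∧ ∃ n : Γ(M, V), ∃ hV : V ≤ U, α.app V n = res F hV s :=
    fun x hx => by
      obtain ⟨V, hV, hxV, n, hn⟩ := h x hx
      exact ⟨V, hV, hxV, n, hV, hn⟩
  obtain ⟨n, hn⟩ := exists_mod_glue (M := M) (U := U)
    (fun W n => ∃ hW : W ≤ U, α.app W n = res F hW s)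
    (by
      rintro W W' hW' n - ⟨hW, e⟩
      exact ⟨hW'.trans hW, by rw [app_res, e, res_res]⟩)
    (by
      rintro W - n n' ⟨_, e⟩ ⟨_, e'⟩
      exact hα W (e.trans e'.symm))
    hloc
  refine ⟨n, mod_ext _ _ fun x hx => ?_⟩
  obtain ⟨V, hV, hxV, n', h', e⟩ := hloc x hx
  refine ⟨V, hV, hxV, ?_⟩
  rw [← app_res, hn V hV n' ⟨h', e⟩, e]

/-- `m` generates over `U` the subsheaf of `F` of sections vanishing at the points of `E`. -/
def IsTwistGen (E : Set X) {U : X.Opens} (m : Γ(F, U)) : Prop :=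
  ∀ (V : X.Opens) (h : V ≤ U), (Function.Injective fun a : Γ(X, V) => a • res F h m) ∧
    ∀ s : Γ(F, V), (∃ a : Γ(X, V), s = a • res F h m) ↔ ∀ p ∈ V, p ∈ E → VanishesAt F s p

lemma IsTwistGen.res {E : Set X} {U : X.Opens} {m : Γ(F, U)} (hm : IsTwistGen E m) {V : X.Opens}
    (h : V ≤ U) : IsTwistGen E (PrymEigen.res F h m) := by
  intro W hW
  rw [res_res]
  exact hm W (hW.trans h)

lemma IsTwistGen.smul_injective {E : Set X} {U : X.Opens} {m : Γ(F, U)} (hm : IsTwistGen E m)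
    {a b : Γ(X, U)} (h : a • m = b • m) : a = b := by
  refine (hm U le_rfl).1 ?_
  simpa using h

lemma IsTwistGen.exists_smul {E : Set X} {U : X.Opens} {m : Γ(F, U)} (hm : IsTwistGen E m)
    (s : Γ(F, U)) (hs : ∀ p ∈ U, p ∈ E → VanishesAt F s p) : ∃ a : Γ(X, U), s = a • m := by
  obtain ⟨a, ha⟩ := ((hm U le_rfl).2 s).2 hs
  exact ⟨a, by simpa using ha⟩

lemma IsTwistGen.vanishesAt {E : Set X} {U : X.Opens} {m : Γ(F, U)} (hm : IsTwistGen E m)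
    {p : X} (hp : p ∈ U) (hpE : p ∈ E) : VanishesAt F m p :=
  ((hm U le_rfl).2 m).1 ⟨1, by simp⟩ p hp hpE

lemma IsGenerator.isTwistGen {E : Set X} {U : X.Opens} {e : Γ(F, U)} (he : IsGenerator F e)
    (hE : ∀ p ∈ U, p ∉ E) : IsTwistGen E e := by
  refine fun V h => ⟨fun a b hab => he.smul_injective h hab, fun s => ⟨fun _ p hp hpE => ?_, ?_⟩⟩
  · exact (hE p (h hp) hpE).elim
  · exact fun _ => he.exists_smul h s

lemma IsTwistGen.isGenerator {E : Set X} {U : X.Opens} {e : Γ(F, U)} (he : IsTwistGen E e)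
    (hE : ∀ p ∈ U, p ∉ E) : IsGenerator F e := by
  intro V h
  refine ⟨(he V h).1, fun s => ?_⟩
  obtain ⟨a, ha⟩ := ((he V h).2 s).2 fun p hp hpE => (hE p (h hp) hpE).elim
  exact ⟨a, ha.symm⟩

lemma IsGenerator.isTwistGen_smul {E : Set X} {U : X.Opens} {e : Γ(F, U)} (he : IsGenerator F e)
    {p : X} {hp : p ∈ U} {t : Γ(X, U)} (hd : IsDVR (X.presheaf.stalk p)) (ht : IsParam t p hp)
    (hz : ∀ q (hq : q ∈ U), t ∈ idealAt U q hq → q = p) (hE : ∀ q ∈ U, q ∈ E ↔ q = p) :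
    IsTwistGen E (t • e) := by
  intro V h
  have hn : ∀ q (hq : q ∈ V), X.presheaf.germ V q hq (fres h t) ∈
      nonZeroDivisors (X.presheaf.stalk q) := by
    intro q hq
    rw [germ_fres]
    by_cases hqp : q = p
    · subst hqp; exact ht.germ_mem_nonZeroDivisors hd
    · exact germ_mem_nonZeroDivisors_of_notMem fun h' => hqp (hz q _ h')
  refine ⟨fun a b hab => ?_, fun s => ⟨?_, fun hs => ?_⟩⟩
  · simp only [res_smul, ← mul_smul] at hab
    have h1 := he.smul_injective h hab
    rw [mul_comm a, mul_comm b] at h1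
    exact mul_left_cancel_of_germ hn h1
  · rintro ⟨a, rfl⟩ q hq hqE
    have hqp := (hE q (h hq)).1 hqE
    subst hqp
    rw [res_smul, ← mul_smul, (he.res h).vanishesAt_smul_iff _ hq]
    refine Ideal.mul_mem_left _ _ ((fres_mem_idealAt _ _ _).2 ht.mem_idealAt)
  · obtain ⟨g, rfl⟩ := he.exists_smul h s
    obtain ⟨b, rfl⟩ := exists_mul_eq_of_germ_dvd (fres h t) g hn fun q hq => by
      by_cases hqp : q = p
      · subst hqp
        have h1 := hs q hq ((hE q (h hq)).2 rfl)
        rw [(he.res h).vanishesAt_smul_iff _ hq] at h1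
        exact IsParam.germ_dvd (hp := hq) hd ((isParam_fres _ _ _).2 ht) h1
      · exact (isUnit_germ_iff.2 fun h' => hqp (hz q (h hq) ((fres_mem_idealAt _ _ _).1 h'))).dvd
    exact ⟨b, by rw [res_smul, ← mul_smul, mul_comm]⟩

lemma IsTwist.isTwistGen {f : X ⟶ Y} {M : Y.Modules} {j : (Scheme.Modules.pullback f).obj M ⟶ F}
    {E : Set X} (hj : IsTwist j E) {V : Y.Opens} {m : Γ(M, V)} (hm : IsGenerator M m)
    {U : X.Opens} (h : U ≤ f ⁻¹ᵁ V) : IsTwistGen E (homLE (coadj f j) h m) := by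
  intro W hW
  have hg := hm.psec f (hW.trans h)
  have key : ∀ a : Γ(X, W), a • res F hW (homLE (coadj f j) h m) =
      j.app W (a • psec f M (hW.trans h) m) := by
    intro a
    rw [res_homLE, homLE_coadj]
    exact (j.app_smul a _).symm
  refine ⟨fun a b hab => ?_, fun s => ?_⟩
  · simp only [key] at hab
    exact hg.smul_injective' ((hj W).1 hab)
  · rw [← (hj W).2 s]
    constructor
    · rintro ⟨a, rfl⟩
      exact ⟨_, (key a).symm⟩
    · rintro ⟨n, rfl⟩
      obtain ⟨a, rfl⟩ := hg.exists_smul' n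
      exact ⟨a, (key a).symm⟩

lemma isTwist_of_isTwistGen {f : X ⟶ Y} {M : Y.Modules}
    (a : M ⟶ (Scheme.Modules.pushforward f).obj F) {E : Set X}
    (h : ∀ p : X, ∃ (V : Y.Opens) (m : Γ(M, V)), f p ∈ V ∧ IsGenerator M m ∧
      IsTwistGen E (homLE a (le_refl (f ⁻¹ᵁ V)) m)) : IsTwist (adj f a) E := by
  intro U
  have hinj : ∀ U : X.Opens, Function.Injective ((adj f a).app U) := by
    intro U n n' hn
    refine mod_ext _ _ fun p hp => ?_
    obtain ⟨V, m, hpV, hm, ht⟩ := h p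
    have hpI : p ∈ U ⊓ f ⁻¹ᵁ V := ⟨hp, hpV⟩
    refine ⟨U ⊓ f ⁻¹ᵁ V, inf_le_left, hpI, ?_⟩
    have hg := hm.psec f (inf_le_right : U ⊓ f ⁻¹ᵁ V ≤ f ⁻¹ᵁ V)
    obtain ⟨b, hb⟩ := hg.exists_smul' (res _ inf_le_left n)
    obtain ⟨b', hb'⟩ := hg.exists_smul' (res _ inf_le_left n')
    have h1 := congrArg (res F (inf_le_left : U ⊓ f ⁻¹ᵁ V ≤ U)) hn
    rw [← app_res, ← app_res, hb, hb'] at h1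
    have key : ∀ b : Γ(X, U ⊓ f ⁻¹ᵁ V), (adj f a).app (U ⊓ f ⁻¹ᵁ V) (b • psec f M inf_le_right m) =
        b • res F inf_le_right (homLE a (le_refl (f ⁻¹ᵁ V)) m) := by
      intro b
      rw [res_homLE, ← adj_psec]
      exact (adj f a).app_smul b _
    rw [key, key] at h1
    rw [hb, hb', (ht _ inf_le_right).1 h1]
  refine ⟨hinj U, fun s => ⟨?_, fun hs => ?_⟩⟩
  · rintro ⟨n, rfl⟩ p hp hpE
    obtain ⟨V, m, hpV, hm, ht⟩ := h p
    have hpI : p ∈ U ⊓ f ⁻¹ᵁ V := ⟨hp, hpV⟩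
    have hg := hm.psec f (inf_le_right : U ⊓ f ⁻¹ᵁ V ≤ f ⁻¹ᵁ V)
    obtain ⟨b, hb⟩ := hg.exists_smul' (res _ inf_le_left n)
    rw [← vanishesAt_res_iff inf_le_left _ hpI, ← app_res, hb]
    have h1 : (adj f a).app (U ⊓ f ⁻¹ᵁ V) (b • psec f M inf_le_right m) =
        b • homLE a inf_le_right m := by
      rw [← adj_psec]
      exact (adj f a).app_smul b _
    rw [h1]
    have h2 := (ht.res (inf_le_right : U ⊓ f ⁻¹ᵁ V ≤ f ⁻¹ᵁ V)).vanishesAt hpI hpE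
    rw [res_homLE] at h2
    exact h2.smul b
  · refine mem_range_app_of_locally _ hinj s fun p hp => ?_
    obtain ⟨V, m, hpV, hm, ht⟩ := h p
    have hpI : p ∈ U ⊓ f ⁻¹ᵁ V := ⟨hp, hpV⟩
    obtain ⟨b, hb⟩ := (ht.res (inf_le_right : U ⊓ f ⁻¹ᵁ V ≤ f ⁻¹ᵁ V)).exists_smul
      (res F inf_le_left s) fun q hq hqE => (vanishesAt_res_iff _ _ hq).2 (hs q hq.1 hqE)
    refine ⟨U ⊓ f ⁻¹ᵁ V, inf_le_left, hpI, b • psec f M inf_le_right m, ?_⟩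
    rw [hb, res_homLE, ← adj_psec]
    exact (adj f a).app_smul b _

end Twist


lemma liftHom_neg {X Y : Scheme.{0}} (f : X ⟶ Y) (t : X ⟶ X) (τ : Y ⟶ Y) (h : t ≫ f = f ≫ τ)
    {L : Y.Modules} (φ : L ⟶ (Scheme.Modules.pushforward τ).obj L) :
    liftHom f t τ h (-φ) = -liftHom f t τ h φ := by
  refine pullback_hom_ext f fun U s => ?_
  have hW : t ⁻¹ᵁ (f ⁻¹ᵁ U) ≤ f ⁻¹ᵁ (τ ⁻¹ᵁ U) := by
    rw [← Scheme.Hom.comp_preimage, h]; exact le_rfl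
  have key : ∀ ψ : L ⟶ (Scheme.Modules.pushforward τ).obj L,
      (liftHom f t τ h ψ).app (f ⁻¹ᵁ U) (pullSec f L U s) =
        psec f L hW (homLE ψ (le_refl (τ ⁻¹ᵁ U)) s) := by
    intro ψ
    rw [pullSec_eq_psec]
    exact (app_eq_homLE _ _).trans (homLE_liftHom f t τ h ψ le_rfl le_rfl le_rfl hW s)
  rw [key, homLE_neg]
  refine (map_neg (psec f L hW) _).trans ?_
  rw [← key]
  rfl

namespace Cover

variable (D : Cover) {L : D.C'.Modules} (φ : L ⟶ (Scheme.Modules.pushforward D.τ).obj L)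

variable (L) in
/-- The pullback of `L` to the normalization. -/
noncomputable abbrev F : D.Ch.Modules := (Scheme.Modules.pullback D.ν).obj L

/-- The action of `φ` on the pullback of `L` to the normalization. -/
noncomputable def φh : D.F L ⟶ (Scheme.Modules.pushforward D.τh).obj (D.F L) :=
  liftHom D.ν D.τh D.τ D.lift φ

/-- The action of `φ` on sections of the pullback of `L`. -/
noncomputable abbrev acth {V : D.N.Opens} : Γ(D.F L, D.πh ⁻¹ᵁ V) →+ Γ(D.F L, D.πh ⁻¹ᵁ V) :=
  act D.τh_πh (D.φh φ)

lemma acth_neg {V : D.N.Opens} (s : Γ(D.F L, D.πh ⁻¹ᵁ V)) : D.acth (-φ) s = -D.acth φ s := by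
  rw [acth, φh, liftHom_neg]
  exact act_neg _ _ _

lemma acth_psec {V₀ : D.C.Opens} {V : D.N.Opens} (h : D.πh ⁻¹ᵁ V ≤ D.ν ⁻¹ᵁ (D.π ⁻¹ᵁ V₀))
    (s : Γ(L, D.π ⁻¹ᵁ V₀)) :
    D.acth φ (psec D.ν L h s) = psec D.ν L h (act D.adm.invariant φ s) :=
  homLE_liftHom D.ν D.τh D.τ D.lift φ h _ _ _ s

/-- `L` has an invariant generator near `y`. -/
abbrev InvGen (y : D.C) : Prop := HasInvGen D.adm.invariant φ y

lemma preimage_le {V₀ : D.C.Opens} {V : D.N.Opens} (h : V ≤ D.νN ⁻¹ᵁ V₀) :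
    D.πh ⁻¹ᵁ V ≤ D.ν ⁻¹ᵁ (D.π ⁻¹ᵁ V₀) := by
  rw [← Scheme.Hom.comp_preimage, ← D.comm, Scheme.Hom.comp_preimage]
  exact D.πh.preimage_mono h

variable {φ}

lemma InvGen.exists_frame {D : Cover} {L : D.C'.Modules}
    {φ : L ⟶ (Scheme.Modules.pushforward D.τ).obj L} {z : D.N} (H : D.InvGen φ (D.νN z))
    {W : D.N.Opens} (hz : z ∈ W) :
    ∃ (V : D.N.Opens) (_ : V ≤ W) (_ : z ∈ V) (e : Γ(D.F L, D.πh ⁻¹ᵁ V)),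
      IsGenerator (D.F L) e ∧ D.acth φ e = e := by
  obtain ⟨V₀, hy, e, he, hφ⟩ := H
  exact ⟨D.νN ⁻¹ᵁ V₀ ⊓ W, inf_le_right, ⟨hy, hz⟩, psec D.ν L (D.preimage_le inf_le_left) e,
    he.psec _ _, by rw [acth_psec, hφ]⟩

section Linearized

variable (hL : IsLineBundle L) (hφ : IsLinearization D.adm.involution L φ)

include hL hφ

lemma invGen_of_notMem {y : D.C} (hy : IsClosed {y}) (hyT : y ∉ D.T) : D.InvGen φ y := by
  obtain ⟨x, rfl⟩ := D.quot.exists_apply_eq y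
  have hx := isClosed_singleton_of_isFinite D.π hy
  exact hasInvGen_of_ne _ hL (fun _ s => hφ.act_act _ s) D.quot hx fun h =>
    hyT (D.apply_mem_T_iff.2 ((D.adm.fixed_iff x hx).1 h))

lemma invGen_or {y : D.C} (hy : IsClosed {y}) : D.InvGen φ y ∨ D.InvGen (-φ) y := by
  by_cases hyT : y ∈ D.T
  · obtain ⟨x, hx, rfl⟩ := hyT
    exact hasInvGen_or_of_eq _ hL (fun _ s => hφ.act_act _ s) D.s' D.τ_s' hx.1 (D.τ_apply hx)
      fun q hq => D.eq_of_apply_eq hx hq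
  · exact Or.inl (D.invGen_of_notMem hL hφ hy hyT)

omit hL hφ in
lemma not_invGen_and {x : D.C'} (hx : x ∈ D.S) (h₁ : D.InvGen φ (D.π x))
    (h₂ : D.InvGen (-φ) (D.π x)) : False :=
  not_hasInvGen_and_of_eq _ D.s' D.τ_s' hx.1 (D.τ_apply hx) h₁ h₂

end Linearized

variable (φ) in
/-- The nodes at which `L` has a `φ`-anti-invariant generator. -/
def negNodes : Set D.C' := {x | x ∈ D.S ∧ D.InvGen (-φ) (D.π x)}

variable (φ) in
lemma negNodes_subset : D.negNodes φ ⊆ D.S := fun _ h => h.1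

lemma negNodes_neg (hL : IsLineBundle L) (hφ : IsLinearization D.adm.involution L φ) :
    D.negNodes (-φ) = D.S \ D.negNodes φ := by
  ext x
  constructor
  · rintro ⟨hx, h⟩
    rw [neg_neg] at h
    exact ⟨hx, fun h' => D.not_invGen_and hx h h'.2⟩
  · rintro ⟨hx, h⟩
    refine ⟨hx, ?_⟩
    rw [neg_neg]
    exact (D.invGen_or hL hφ (isClosed_singleton_apply D.π hx.1)).resolve_right
      fun h' => h ⟨hx, h'⟩

lemma exists_isolating_N (z : D.N) {W : D.N.Opens} (hz : z ∈ W) :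
    ∃ V ≤ W, z ∈ V ∧ ∀ q ∈ V, D.νN q ∈ D.T → q = z := by
  obtain ⟨U, hzU, hU⟩ := exists_isolating D.finite_preimage_T
    (fun z hz => D.isClosed_of_mem_preimage_T hz) z
  exact ⟨U ⊓ W, inf_le_right, ⟨hzU, hz⟩, fun q hq hqT => hU q hq.1 hqT⟩

lemma vanishesAt_of_acth_eq {p : D.Ch} (hp : D.ν p ∈ D.negNodes φ) {V : D.N.Opens}
    (hpV : p ∈ D.πh ⁻¹ᵁ V) {s : Γ(D.F L, D.πh ⁻¹ᵁ V)} (hs : D.acth φ s = s) :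
    VanishesAt (D.F L) s p := by
  have hinv := hp.2
  rw [← D.νN_πh] at hinv
  obtain ⟨V', hV', hpV'', e, he, hφe⟩ := hinv.exists_frame (W := V) hpV
  have hpV' : p ∈ D.πh ⁻¹ᵁ V' := hpV''
  rw [← vanishesAt_res_iff (D.πh.preimage_mono hV') s hpV']
  have hs' : D.acth φ (res _ (D.πh.preimage_mono hV') s) = res _ (D.πh.preimage_mono hV') s := by
    rw [act_res, hs]
  obtain ⟨a, ha⟩ := he.exists_smul' (res _ (D.πh.preimage_mono hV') s)
  rw [ha] at hs' ⊢
  rw [he.vanishesAt_smul_iff _ hpV']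
  rw [acth_neg, neg_eq_iff_eq_neg] at hφe
  rw [act_smul, hφe, smul_neg, ← neg_smul] at hs'
  have h1 := he.smul_injective' hs'
  exact D.mem_idealAt_of_tw_eq_neg hp.1 hpV' (neg_eq_iff_eq_neg.1 h1)

lemma exists_invTwistGen (hL : IsLineBundle L) (hφ : IsLinearization D.adm.involution L φ)
    {z : D.N} (hz : IsClosed {z}) {W : D.N.Opens} (hzW : z ∈ W) :
    ∃ (V : D.N.Opens) (_ : V ≤ W) (_ : z ∈ V) (m : Γ(D.F L, D.πh ⁻¹ᵁ V)),
      IsTwistGen (D.ν ⁻¹' D.negNodes φ) m ∧ D.acth φ m = m := by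
  obtain ⟨W', hW', hzW', hiso⟩ := D.exists_isolating_N z hzW
  have hT : ∀ q ∈ D.πh ⁻¹ᵁ W', D.ν q ∈ D.S → D.πh q = z := fun q hq hqS =>
    hiso _ hq (by rw [D.νN_πh, D.apply_mem_T_iff]; exact hqS)
  by_cases hinv : D.InvGen φ (D.νN z)
  · obtain ⟨V, hV, hzV, e, he, hφe⟩ := hinv.exists_frame hzW'
    refine ⟨V, hV.trans hW', hzV, e, he.isTwistGen fun q hq hqI => ?_, hφe⟩
    have h1 := hT q (hV hq) hqI.1
    refine D.not_invGen_and hqI.1 ?_ hqI.2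
    rwa [← D.νN_πh, h1]
  · have hcl : IsClosed {D.νN z} := isClosed_singleton_apply D.νN hz
    have hinv' := (D.invGen_or hL hφ hcl).resolve_left hinv
    have hzT : D.νN z ∈ D.T := by
      by_contra h
      exact hinv (D.invGen_of_notMem hL hφ hcl h)
    obtain ⟨p, rfl⟩ := D.πh_surjective z
    have hp : D.ν p ∈ D.S := by
      rw [D.νN_πh, D.apply_mem_T_iff] at hzT
      exact hzT
    obtain ⟨V, hV, hzV, e, he, hφe⟩ := hinv'.exists_frame hzW'
    obtain ⟨V', hV', hpV', t, -, ht, htz, htw⟩ := D.exists_anti_param hp hzV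
    refine ⟨V', hV'.trans (hV.trans hW'), hpV', t • res _ (D.πh.preimage_mono hV') e,
      (he.res _).isTwistGen_smul (D.isDVR_of_mem_S hp) ht htz fun q hq => ⟨fun hqI => ?_, ?_⟩, ?_⟩
    · exact D.eq_of_πh_eq hp (hT q (hV (hV' hq)) hqI.1)
    · rintro rfl
      exact ⟨hp, by rwa [← D.νN_πh]⟩
    · rw [acth_neg, neg_eq_iff_eq_neg] at hφe
      rw [act_smul, act_res, hφe, htw, map_neg, smul_neg, neg_smul, neg_neg]

/-- Every point of a curve specializes to a closed point, so that local statements need only be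
checked near closed points. -/
lemma forall_of_closed {X : Scheme.{0}} (s : X ⟶ Spec (.of ℂ)) [LocallyOfFiniteType s]
    {P : X.Opens → Prop} (h : ∀ x, IsClosed {x} → ∃ V, x ∈ V ∧ P V) (x : X) : ∃ V, x ∈ V ∧ P V := by
  obtain ⟨y, -, hy, hxy⟩ := exists_closed_mem s (Opens.mem_top x)
  obtain ⟨V, hyV, hV⟩ := h y hy
  exact ⟨V, hxy.mem_open V.2 hyV, hV⟩

variable (φ) in
/-- The invariant sections of the pullback of `L` to the normalization. -/
noncomputable def invSubsheaf : D.N.Modules :=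
  subsheaf ((Scheme.Modules.pushforward D.πh).obj (D.F L))
    (fun V =>
      { carrier := {s | D.acth φ (V := V) s = s}
        add_mem' := fun {a b} ha hb => by
          have h1 : D.acth φ (V := V) a = a := ha
          have h2 : D.acth φ (V := V) b = b := hb
          exact (map_add (D.acth φ (V := V)) a b).trans
            (congrArg₂ (fun x y : Γ(D.F L, D.πh ⁻¹ᵁ V) => x + y) h1 h2)
        zero_mem' := map_zero (D.acth φ (V := V))
        smul_mem' := fun r a ha => by
          have h1 : D.acth φ (V := V) a = a := ha
          have h2 : D.acth φ (V := V) (pb D.πh le_rfl r • (show Γ(D.F L, D.πh ⁻¹ᵁ V) from a)) =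
              pb D.πh le_rfl r • (show Γ(D.F L, D.πh ⁻¹ᵁ V) from a) := by
            rw [act_smul, tw_pb, h1]
          rw [← app_eq_pb] at h2
          exact h2 })
    (fun U V h s hs => by
      have h1 : D.acth φ (V := U) s = s := hs
      exact (act_res D.τh_πh (D.φh φ) (D.πh.preimage_mono h) s).trans
        (congrArg (res (D.F L) (D.πh.preimage_mono h)) h1))
    (fun U s hs => by
      refine mod_ext (M := D.F L) _ _ fun p hp => ?_
      obtain ⟨V, hV, hpV, h1⟩ := hs (D.πh p) hp
      refine ⟨D.πh ⁻¹ᵁ V, D.πh.preimage_mono hV, hpV, ?_⟩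
      exact (act_res D.τh_πh (D.φh φ) (D.πh.preimage_mono hV) s).symm.trans h1)

variable (φ) in
/-- The inclusion of the invariant sections. -/
noncomputable def invι : D.invSubsheaf φ ⟶ (Scheme.Modules.pushforward D.πh).obj (D.F L) :=
  subsheafι _ _ _ _

lemma invι_injective (V : D.N.Opens) : Function.Injective ((D.invι φ).app V) :=
  subsheafι_injective _ _ _ _ _

lemma mem_range_invι {V : D.N.Opens} (s : Γ(D.F L, D.πh ⁻¹ᵁ V)) :
    s ∈ Set.range (fun m : Γ(D.invSubsheaf φ, V) => homLE (D.invι φ) (le_refl (D.πh ⁻¹ᵁ V)) m) ↔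
      D.acth φ s = s := by
  have h1 : (fun m : Γ(D.invSubsheaf φ, V) => homLE (D.invι φ) (le_refl (D.πh ⁻¹ᵁ V)) m) =
      fun m => (D.invι φ).app V m := funext fun m => (app_eq_homLE _ _).symm
  rw [h1]
  exact mem_range_subsheafι ((Scheme.Modules.pushforward D.πh).obj (D.F L)) _ _ _ V s

lemma isGenerator_of_isTwistGen {M : D.N.Modules} 
    (a : M ⟶ (Scheme.Modules.pushforward D.πh).obj (D.F L))
    (hinj : ∀ V, Function.Injective (fun m : Γ(M, V) => homLE a (le_refl (D.πh ⁻¹ᵁ V)) m))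
    (hrange : ∀ V (m : Γ(M, V)), D.acth φ (homLE a (le_refl (D.πh ⁻¹ᵁ V)) m) = homLE a le_rfl m)
    {V : D.N.Opens} {m : Γ(M, V)} (hm : IsTwistGen (D.ν ⁻¹' D.negNodes φ)
      (homLE a (le_refl (D.πh ⁻¹ᵁ V)) m)) : IsGenerator M m := by
  intro W hW
  have key : ∀ g : Γ(D.N, W), homLE a (le_refl (D.πh ⁻¹ᵁ W)) (g • res M hW m) =
      pb D.πh le_rfl g • res _ (D.πh.preimage_mono hW) (homLE a (le_refl (D.πh ⁻¹ᵁ V)) m) := by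
    intro g
    rw [homLE_smul, homLE_res, res_homLE]
  have hm' := hm.res (D.πh.preimage_mono hW)
  constructor
  · intro g g' hg
    have h1 := congrArg (homLE a (le_refl (D.πh ⁻¹ᵁ W))) hg
    dsimp only at h1
    rw [key, key] at h1
    exact D.pb_πh_injective le_rfl le_rfl (hm'.smul_injective h1)
  · intro n
    obtain ⟨b, hb⟩ := hm'.exists_smul (homLE a le_rfl n) fun p hp hpI =>
      D.vanishesAt_of_acth_eq hpI hp (hrange W n)
    have htw : tw D.τh_πh b = b := by
      apply hm'.smul_injective
      rw [← hb, ← hrange W n, hb, act_smul, act_res, hrange]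
    obtain ⟨g, rfl⟩ := D.exists_desc b htw
    refine ⟨g, hinj W ?_⟩
    dsimp only
    rw [key, hb]

theorem isLineBundle_invSubsheaf (hL : IsLineBundle L)
    (hφ : IsLinearization D.adm.involution L φ) : IsLineBundle (D.invSubsheaf φ) ∧
      IsTwist (adj D.πh (D.invι φ)) (D.ν ⁻¹' D.negNodes φ) := by
  have key : ∀ z : D.N, ∃ V, z ∈ V ∧ ∃ m : Γ(D.invSubsheaf φ, V), IsGenerator _ m ∧
      IsTwistGen (D.ν ⁻¹' D.negNodes φ) (homLE (D.invι φ) (le_refl (D.πh ⁻¹ᵁ V)) m) := by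
    refine forall_of_closed D.sN fun z hz => ?_
    obtain ⟨V, -, hzV, m, hm, hφm⟩ := D.exists_invTwistGen hL hφ hz (Opens.mem_top z)
    obtain ⟨m, rfl⟩ := (D.mem_range_invι m).2 hφm
    refine ⟨V, hzV, m, D.isGenerator_of_isTwistGen (D.invι φ) ?_ ?_ hm, hm⟩
    · intro V
      have h1 : (fun m : Γ(D.invSubsheaf φ, V) => homLE (D.invι φ) (le_refl (D.πh ⁻¹ᵁ V)) m) =
        fun m => (D.invι φ).app V m := funext fun m => (app_eq_homLE _ _).symm
      rw [h1]
      exact D.invι_injective V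
    · exact fun V m => (D.mem_range_invι _).1 ⟨m, rfl⟩
  constructor
  · rw [isLineBundle_iff]
    intro z
    obtain ⟨V, hzV, m, hm, -⟩ := key z
    exact ⟨V, m, hzV, hm⟩
  · refine isTwist_of_isTwistGen _ fun p => ?_
    obtain ⟨V, hzV, m, hm, hm'⟩ := key (D.πh p)
    exact ⟨V, m, hzV, hm, hm'⟩

end Cover


section

variable {X Y : Scheme.{0}} {f : X ⟶ Y} {F : X.Modules} {M : Y.Modules}

/-- Two morphisms, the first of which is injective with image the sections vanishing along `E`,
differ by a global function if the image of the second one vanishes along `E`. -/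
lemma exists_ratio (hM : IsLineBundle M) (a b : M ⟶ (Scheme.Modules.pushforward f).obj F)
    {E : Set X} (ha : ∀ (V : Y.Opens) (m : Γ(M, V)), IsGenerator M m →
      IsTwistGen E (homLE a (le_refl (f ⁻¹ᵁ V)) m))
    (hb : ∀ (V : Y.Opens) (m : Γ(M, V)), IsGenerator M m → ∀ p ∈ f ⁻¹ᵁ V, p ∈ E →
      VanishesAt F (homLE b (le_refl (f ⁻¹ᵁ V)) m) p) :
    ∃ u : Γ(X, ⊤), ∀ (V : Y.Opens) (m : Γ(M, V)), homLE b (le_refl (f ⁻¹ᵁ V)) m =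
      (fres le_top u : Γ(X, f ⁻¹ᵁ V)) • homLE a (le_refl (f ⁻¹ᵁ V)) m := by
  rw [isLineBundle_iff] at hM
  have hloc : ∀ p ∈ (⊤ : X.Opens), ∃ U ≤ (⊤ : X.Opens), p ∈ U ∧ ∃ u : Γ(X, U),
      ∀ (V : Y.Opens) (m : Γ(M, V)) (W : X.Opens) (hWU : W ≤ U) (hW : W ≤ f ⁻¹ᵁ V),
        homLE b hW m = fres hWU u • homLE a hW m := by
    intro p _
    obtain ⟨V, m, hpV, hm⟩ := hM (f p)
    obtain ⟨u, hu⟩ := (ha V m hm).exists_smul _ (hb V m hm)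
    refine ⟨f ⁻¹ᵁ V, le_top, hpV, u, fun V' m' W hWU hW => ?_⟩
    obtain ⟨r, hr⟩ := hm.exists_smul (inf_le_right : V' ⊓ V ≤ V) (res M inf_le_left m')
    have hWI : W ≤ f ⁻¹ᵁ (V' ⊓ V) := le_inf hW hWU
    rw [← homLE_res b (inf_le_left : V' ⊓ V ≤ V') hWI, ← homLE_res a (inf_le_left : V' ⊓ V ≤ V') hWI,
      hr, homLE_smul, homLE_smul, homLE_res, homLE_res, ← res_homLE b le_rfl hWU, hu, res_smul,
      res_homLE, smul_comm]
  obtain ⟨u, hu⟩ := exists_fun_glue (U := ⊤)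
    (fun U u => ∀ (V : Y.Opens) (m : Γ(M, V)) (W : X.Opens) (hWU : W ≤ U) (hW : W ≤ f ⁻¹ᵁ V),
        homLE b hW m = fres hWU u • homLE a hW m)
    (by
      intro U U' h u _ hu V m W hWU hW
      rw [fres_fres]
      exact hu V m W (hWU.trans h) hW)
    (by
      intro U _ u u' h₁ h₂
      refine fun_ext _ _ fun p hp => ?_
      obtain ⟨V, m, hpV, hm⟩ := hM (f p)
      refine ⟨U ⊓ f ⁻¹ᵁ V, inf_le_left, ⟨hp, hpV⟩, ?_⟩
      have h3 := ha V m hm _ (inf_le_right : U ⊓ f ⁻¹ᵁ V ≤ f ⁻¹ᵁ V)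
      refine h3.1 ?_
      dsimp only
      rw [res_homLE, ← h₁ V m, ← h₂ V m])
    hloc
  refine ⟨u, fun V m => mod_ext _ _ fun p hp => ?_⟩
  obtain ⟨U, hU, hpU, u', hu'⟩ := hloc p trivial
  refine ⟨f ⁻¹ᵁ V ⊓ U, inf_le_left, ⟨hp, hpU⟩, ?_⟩
  rw [res_homLE, hu' V m _ inf_le_right inf_le_left, ← hu U hU u' hu', fres_fres, res_smul,
    res_homLE, fres_fres]

/-- Subobjects with the same sections are isomorphic. -/
lemma nonempty_iso_of_range_eq {A B G : X.Modules} (α : A ⟶ G) (β : B ⟶ G)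
    (hα : ∀ U, Function.Injective (α.app U)) (hβ : ∀ U, Function.Injective (β.app U))
    (h : ∀ U, Set.range (α.app U) = Set.range (β.app U)) : Nonempty (A ≅ B) := by
  have h1 : ∀ (U : X.Opens) (a : Γ(A, U)), ∃ b : Γ(B, U), β.app U b = α.app U a := by
    intro U a
    have : α.app U a ∈ Set.range (β.app U) := h U ▸ ⟨a, rfl⟩
    exact this
  choose g hg using h1
  let γ : A ⟶ B := mkHom A B
    (fun U =>
      { toFun := g U
        map_zero' := hβ U (by rw [hg, map_zero, map_zero])
        map_add' := fun a b => hβ U (by rw [hg, map_add, map_add, hg, hg]) })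
    (fun U V i s => hβ V (by
      change β.app V (g V _) = β.app V (res B i (g U s))
      rw [hg, app_res, app_res, hg]))
    (fun U r s => hβ U (by
      change β.app U (g U _) = β.app U (r • g U s)
      rw [hg]
      refine (α.app_smul r s).trans (Eq.trans ?_ (β.app_smul r (g U s)).symm)
      exact congrArg (fun x : Γ(G, U) => r • x) (hg U s).symm))
  have : IsIso γ := isIso_of_bijective γ fun U => by
    constructor
    · intro a b hab
      apply hα U
      rw [← hg, ← hg]
      exact congrArg (β.app U) hab
    · intro b
      have : β.app U b ∈ Set.range (α.app U) := h U ▸ ⟨b, rfl⟩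
      obtain ⟨a, ha⟩ := this
      exact ⟨a, hβ U ((hg U a).trans ha)⟩
  exact ⟨asIso γ⟩

end

namespace Cover

variable {D : Cover} {L : D.C'.Modules} {φ : L ⟶ (Scheme.Modules.pushforward D.τ).obj L}
  {M : D.N.Modules} {j : (Scheme.Modules.pullback D.πh).obj M ⟶ D.F L}

variable (φ j) in
/-- The image of `j` is generated by `φ`-invariant sections. -/
def Adapted : Prop :=
  ∀ (V : D.N.Opens) (m : Γ(M, V)),
    D.acth φ (homLE (coadj D.πh j) (le_refl (D.πh ⁻¹ᵁ V)) m) = homLE (coadj D.πh j) le_rfl m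

lemma sub_one_mem_or_add_one_mem {I : Set D.C'} (hI : I ⊆ D.S) (hj : IsTwist j (D.ν ⁻¹' I))
    {p : D.Ch} (hp : D.ν p ∈ D.S) (hinv : D.InvGen φ (D.π (D.ν p))) {V : D.N.Opens}
    (hpV : p ∈ D.πh ⁻¹ᵁ V) {m : Γ(M, V)} (hm : IsGenerator M m) {u : Γ(D.Ch, D.πh ⁻¹ᵁ V)}
    (hu : D.acth φ (homLE (coadj D.πh j) (le_refl (D.πh ⁻¹ᵁ V)) m) =
      u • homLE (coadj D.πh j) le_rfl m) :
    (D.ν p ∉ I → u - 1 ∈ idealAt _ p hpV) ∧ (D.ν p ∈ I → u + 1 ∈ idealAt _ p hpV) := by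
  rw [← D.νN_πh] at hinv
  have hd := D.isDVR_of_mem_S hp
  obtain ⟨W, hWV, hzW, hiso⟩ := D.exists_isolating_N (D.πh p) hpV
  obtain ⟨V₁, hV₁, hzV₁, e, he, hφe⟩ := hinv.exists_frame hzW
  obtain ⟨V₂, hV₂, hpV₂, t, -, ht, htz, htw⟩ := D.exists_anti_param hp hzV₁
  have hV₂V := D.πh.preimage_mono (hV₂.trans (hV₁.trans hWV))
  have hE : ∀ q ∈ D.πh ⁻¹ᵁ V₂, q ∈ D.ν ⁻¹' I → q = p := fun q hq hqI =>
    D.eq_of_πh_eq hp (hiso _ (hV₁ (hV₂ hq)) (by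
      rw [D.νN_πh, D.apply_mem_T_iff]; exact hI hqI))
  have htg := (hj.isTwistGen hm (le_refl (D.πh ⁻¹ᵁ V))).res hV₂V
  replace hu := congrArg (res (D.F L) hV₂V) hu
  rw [← act_res, res_smul] at hu
  replace he := he.res (D.πh.preimage_mono hV₂)
  have hφe' : D.acth φ (res _ (D.πh.preimage_mono hV₂) e) = res _ (D.πh.preimage_mono hV₂) e := by
    rw [act_res, hφe]
  have hiff : ∀ c, fres hV₂V c ∈ idealAt _ p hpV₂ ↔ c ∈ idealAt _ p hpV := fun c =>
    fres_mem_idealAt _ _ _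
  generalize res (D.F L) (D.πh.preimage_mono hV₂) e = e at he hφe'
  generalize res (D.F L) hV₂V (homLE (coadj D.πh j) (le_refl (D.πh ⁻¹ᵁ V)) m) = n at htg hu
  obtain ⟨f, rfl⟩ := he.exists_smul' n
  rw [act_smul, hφe', ← mul_smul] at hu
  replace hu := he.smul_injective' hu
  rw [← hiff, ← hiff, map_sub, map_add, map_one]
  generalize fres hV₂V u = u at hu
  constructor
  · intro hpI
    have hf : IsUnit f := he.isUnit_of_smul (htg.isGenerator fun q hq hqE => by
      obtain rfl := hE q hq hqE
      exact hpI hqE)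
    have h1 := D.tw_sub_mem hp hpV₂ f
    rw [hu, ← sub_one_mul] at h1
    exact ((idealAt_isPrime _ p hpV₂).mem_or_mem h1).resolve_right
      fun h2 => not_isUnit_of_mem_idealAt h2 hf
  · intro hpI
    obtain ⟨b, hb⟩ := htg.exists_smul (t • e) fun q hq hqE => by
      obtain rfl := hE q hq hqE
      exact vanishesAt_smul (hp := hq) e ht.mem_idealAt
    rw [← mul_smul] at hb
    replace hb := he.smul_injective' hb
    have hf : f ∈ idealAt _ p hpV₂ := by
      have := htg.vanishesAt hpV₂ hpI
      rwa [he.vanishesAt_smul_iff _ hpV₂] at this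
    obtain ⟨c, rfl⟩ := ht.exists_eq_mul hd htz hf
    have hn : ∀ q (hq : q ∈ D.πh ⁻¹ᵁ V₂), D.Ch.presheaf.germ _ q hq t ∈
        nonZeroDivisors (D.Ch.presheaf.stalk q) := by
      intro q hq
      by_cases hqp : q = p
      · subst hqp; exact ht.germ_mem_nonZeroDivisors hd
      · exact germ_mem_nonZeroDivisors_of_notMem fun h' => hqp (htz q hq h')
    have hbc : b * c = 1 := mul_left_cancel_of_germ hn (by rw [mul_one]; nth_rw 2 [hb]; ring)
    have htc : -tw D.τh_πh c = u * c := mul_left_cancel_of_germ hn (by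
      rw [map_mul, htw] at hu
      rw [mul_left_comm t u, ← hu]; ring)
    have h1 := D.tw_sub_mem hp hpV₂ c
    have h2 : (u + 1) * c = -(tw D.τh_πh c - c) := by rw [add_mul, ← htc]; ring
    rw [← Ideal.neg_mem_iff, ← h2] at h1
    exact ((idealAt_isPrime _ p hpV₂).mem_or_mem h1).resolve_right
      fun h2 => not_isUnit_of_mem_idealAt h2 (IsUnit.of_mul_eq_one b (by rw [mul_comm, hbc]))

section

variable (hL : IsLineBundle L) (hφ : IsLinearization D.adm.involution L φ) (hM : IsLineBundle M)
  {I : Set D.C'} (hI : I ⊆ D.S) (hj : IsTwist j (D.ν ⁻¹' I))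

omit hL hφ hM hI hj in
lemma nonempty_closed_N (D : Cover) : ∃ z : D.N, IsClosed {z} := by
  obtain ⟨x⟩ : Nonempty D.C' := inferInstance
  obtain ⟨p, -⟩ := D.ν_surjective x
  obtain ⟨z, -, hz, -⟩ := exists_closed_mem D.sN (Opens.mem_top (D.πh p))
  exact ⟨z, hz⟩

include hL hφ hM hI hj

theorem adapted_or : Adapted φ j ∨ Adapted (-φ) j := by
  obtain ⟨u, hu⟩ := exists_ratio hM (coadj D.πh j)
    (coadj D.πh j ≫ action D.τh_πh (D.φh φ)) (fun V m hm => hj.isTwistGen hm le_rfl)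
    (fun V m hm p hp hpI => by
      have h1 : homLE (coadj D.πh j ≫ action D.τh_πh (D.φh φ)) (le_refl (D.πh ⁻¹ᵁ V)) m =
        D.acth φ (homLE (coadj D.πh j) (le_refl (D.πh ⁻¹ᵁ V)) m) := by
          rw [← app_eq_homLE, ← app_eq_homLE]; rfl
      rw [h1]
      refine VanishesAt.homLE (D.φh φ) _ hp ?_
      rw [D.τh_apply (hI hpI)]
      exact (hj.isTwistGen hm le_rfl).vanishesAt hp hpI)
  replace hu : ∀ (V : D.N.Opens) (m : Γ(M, V)),
      D.acth φ (homLE (coadj D.πh j) (le_refl (D.πh ⁻¹ᵁ V)) m) =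
        (fres le_top u : Γ(D.Ch, D.πh ⁻¹ᵁ V)) • homLE (coadj D.πh j) le_rfl m := by
    intro V m
    rw [← hu, ← app_eq_homLE, ← app_eq_homLE]; rfl
  have hfib : ∀ x ∈ D.S, ∃ c : ℂ, ∀ p, D.ν p = x → u - cst D.sh ⊤ c ∈ idealAt ⊤ p trivial := by
    intro x hx
    have key : ∀ p (hp : D.ν p = x), ∃ (V : D.N.Opens) (hpV : p ∈ D.πh ⁻¹ᵁ V) (m : Γ(M, V)),
        IsGenerator M m ∧ ∀ c : ℂ, u - cst D.sh ⊤ c ∈ idealAt ⊤ p trivial ↔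
          fres le_top u - cst D.sh _ c ∈ idealAt (D.πh ⁻¹ᵁ V) p hpV := by
      intro p hp
      obtain ⟨V, m, hpV, hm⟩ := isLineBundle_iff.1 hM (D.πh p)
      refine ⟨V, hpV, m, hm, fun c => ?_⟩
      rw [← fres_mem_idealAt (le_top : D.πh ⁻¹ᵁ V ≤ ⊤) _ hpV, map_sub, fres_cst]
    rcases D.invGen_or hL hφ (isClosed_singleton_apply D.π hx.1) with hinv | hinv
    · by_cases hxI : x ∈ I
      · refine ⟨-1, fun p hp => ?_⟩
        subst hp
        obtain ⟨V, hpV, m, hm, h⟩ := key p rfl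
        rw [h, map_neg, map_one, sub_neg_eq_add]
        exact (sub_one_mem_or_add_one_mem hI hj hx hinv hpV hm (hu V m)).2 hxI
      · refine ⟨1, fun p hp => ?_⟩
        subst hp
        obtain ⟨V, hpV, m, hm, h⟩ := key p rfl
        rw [h, map_one]
        exact (sub_one_mem_or_add_one_mem hI hj hx hinv hpV hm (hu V m)).1 hxI
    · have hu' : ∀ (V : D.N.Opens) (m : Γ(M, V)),
          D.acth (-φ) (homLE (coadj D.πh j) (le_refl (D.πh ⁻¹ᵁ V)) m) =
          (-fres le_top u : Γ(D.Ch, D.πh ⁻¹ᵁ V)) • homLE (coadj D.πh j) le_rfl m := by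
        intro V m
        rw [acth_neg, hu, neg_smul]
      by_cases hxI : x ∈ I
      · refine ⟨1, fun p hp => ?_⟩
        subst hp
        obtain ⟨V, hpV, m, hm, h⟩ := key p rfl
        rw [h, map_one, ← Ideal.neg_mem_iff, neg_sub, sub_eq_neg_add]
        exact (sub_one_mem_or_add_one_mem hI hj hx hinv hpV hm (hu' V m)).2 hxI
      · refine ⟨-1, fun p hp => ?_⟩
        subst hp
        obtain ⟨V, hpV, m, hm, h⟩ := key p rfl
        rw [h, map_neg, map_one, sub_neg_eq_add, ← Ideal.neg_mem_iff, neg_add']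
        exact (sub_one_mem_or_add_one_mem hI hj hx hinv hpV hm (hu' V m)).1 hxI
  obtain ⟨c, rfl⟩ := D.exists_eq_cst_of_fibres u hfib
  simp only [fres_cst] at hu
  have hc : c * c = 1 := by
    obtain ⟨z, hz⟩ := nonempty_closed_N D
    obtain ⟨V, m, hzV, hm⟩ := isLineBundle_iff.1 hM z
    have hex : ∃ (W : D.N.Opens) (_ : W ≤ V) (_ : z ∈ W) (e : Γ(D.F L, D.πh ⁻¹ᵁ W)) (ε : ℂ),
        ε * ε = 1 ∧ IsGenerator (D.F L) e ∧
        D.acth φ e = (cst D.sh (D.πh ⁻¹ᵁ W) ε : Γ(D.Ch, D.πh ⁻¹ᵁ W)) • e := by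
      rcases D.invGen_or hL hφ (isClosed_singleton_apply D.νN hz) with hinv | hinv
      · obtain ⟨W, hW, hzW, e, he, hφe⟩ := hinv.exists_frame hzV
        exact ⟨W, hW, hzW, e, 1, by ring, he, by rw [map_one, one_smul, hφe]⟩
      · obtain ⟨W, hW, hzW, e, he, hφe⟩ := hinv.exists_frame hzV
        rw [acth_neg, neg_eq_iff_eq_neg] at hφe
        exact ⟨W, hW, hzW, e, -1, by ring, he, by rw [map_neg, map_one, neg_smul, one_smul, hφe]⟩
    obtain ⟨W, hW, hzW, e, ε, hε, he, hφe⟩ := hex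
    obtain ⟨p, rfl⟩ := D.πh_surjective z
    have hpW : p ∈ D.πh ⁻¹ᵁ W := hzW
    have h1 := hu W (res M hW m)
    have htg := hj.isTwistGen (hm.res hW) (le_refl (D.πh ⁻¹ᵁ W))
    obtain ⟨f, hf⟩ := he.exists_smul' (homLE (coadj D.πh j) (le_refl (D.πh ⁻¹ᵁ W)) (res M hW m))
    rw [hf] at h1 htg
    rw [act_smul, hφe, ← mul_smul, ← mul_smul] at h1
    have h2 : tw D.τh_πh f * cst D.sh _ ε = cst D.sh _ c * f := he.smul_injective' h1
    have htwc : ∀ a : ℂ, tw D.τh_πh (cst D.sh (D.πh ⁻¹ᵁ W) a) = cst D.sh _ a := fun a =>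
      pb_cst D.τh D.τh_sh _ a
    have h3 := congrArg (tw D.τh_πh) h2
    rw [map_mul, map_mul, tw_tw _ D.τh_τh, htwc, htwc] at h3
    have h4 : cst D.sh (D.πh ⁻¹ᵁ W) (c * c) * f = cst D.sh _ (ε * ε) * f := by
      rw [map_mul, mul_assoc, ← h2, map_mul, mul_comm (tw D.τh_πh f), mul_left_comm, ← h3]; ring
    have h5 : cst D.sh (D.πh ⁻¹ᵁ W) (c * c) = cst D.sh _ (ε * ε) :=
      htg.smul_injective (by rw [← mul_smul, ← mul_smul, h4])
    have h6 : cst D.sh (D.πh ⁻¹ᵁ W) (c * c - ε * ε) ∈ idealAt _ p hpW := by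
      rw [map_sub, h5, sub_self]; exact zero_mem _
    rw [cst_mem_idealAt_iff, sub_eq_zero, hε] at h6
    exact h6
  rcases mul_self_eq_one_iff.1 hc with rfl | rfl
  · exact Or.inl fun V m => by rw [hu, map_one, one_smul]
  · exact Or.inr fun V m => by rw [acth_neg, hu, map_neg, map_one, neg_smul, one_smul, neg_neg]

lemma Adapted.eq_negNodes (h : Adapted φ j) : I = D.negNodes φ := by
  have key : ∀ x ∈ D.S, (x ∈ I → ¬ D.InvGen φ (D.π x)) ∧ (x ∉ I → ¬ D.InvGen (-φ) (D.π x)) := by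
    intro x hx
    obtain ⟨p, rfl⟩ := D.ν_surjective x
    obtain ⟨V, m, hpV', hm⟩ := isLineBundle_iff.1 hM (D.πh p)
    have hpV : p ∈ D.πh ⁻¹ᵁ V := hpV'
    have htwo : (1 + 1 : Γ(D.Ch, D.πh ⁻¹ᵁ V)) ∉ idealAt _ p hpV := fun h1 =>
      (idealAt_isPrime _ p hpV).ne_top ((Ideal.eq_top_iff_one _).2 (mem_idealAt_of_add_self D.sh h1))
    constructor
    · intro hpI hinv
      exact htwo ((sub_one_mem_or_add_one_mem (u := 1) hI hj hx hinv hpV hm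
        (by rw [h V m, one_smul])).2 hpI)
    · intro hpI hinv
      have := (sub_one_mem_or_add_one_mem (u := -1) hI hj hx hinv hpV hm
        (by rw [acth_neg, h V m, neg_smul, one_smul])).1 hpI
      rw [← neg_add', Ideal.neg_mem_iff] at this
      exact htwo this
  ext x
  constructor
  · intro hxI
    exact ⟨hI hxI, (D.invGen_or hL hφ (isClosed_singleton_apply D.π (hI hxI).1)).resolve_left
      ((key x (hI hxI)).1 hxI)⟩
  · rintro ⟨hx, hinv⟩
    by_contra hxI
    exact (key x hx).2 hxI hinv

end

lemma coadj_injective (hM : IsLineBundle M) {E : Set D.Ch} (hj : IsTwist j E) (V : D.N.Opens) :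
    Function.Injective ((coadj D.πh j).app V) := by
  intro m m' h
  refine mod_ext _ _ fun z hz => ?_
  obtain ⟨W, n, hzW, hn⟩ := isLineBundle_iff.1 hM z
  obtain ⟨r, hr⟩ := hn.exists_smul (inf_le_right : V ⊓ W ≤ W) (res M inf_le_left m)
  obtain ⟨r', hr'⟩ := hn.exists_smul (inf_le_right : V ⊓ W ≤ W) (res M inf_le_left m')
  refine ⟨V ⊓ W, inf_le_left, ⟨hz, hzW⟩, ?_⟩
  have h1 : homLE (coadj D.πh j) (le_refl (D.πh ⁻¹ᵁ V)) m = homLE (coadj D.πh j) le_rfl m' := by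
    rw [← app_eq_homLE, ← app_eq_homLE, h]
  have h2 := congrArg (res (D.F L) (D.πh.preimage_mono (inf_le_left : V ⊓ W ≤ V))) h1
  rw [res_homLE, res_homLE, ← homLE_res _ inf_le_left le_rfl, ← homLE_res _ inf_le_left le_rfl, hr,
    hr', homLE_smul, homLE_smul] at h2
  have h3 := (hj.isTwistGen (hn.res (inf_le_right : V ⊓ W ≤ W))
    (le_refl (D.πh ⁻¹ᵁ (V ⊓ W)))).smul_injective h2
  rw [hr, hr', D.pb_πh_injective le_rfl le_rfl h3]

lemma Adapted.mem_range (h : Adapted φ j) (hM : IsLineBundle M)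
    (hj : IsTwist j (D.ν ⁻¹' D.negNodes φ)) {V : D.N.Opens} {s : Γ(D.F L, D.πh ⁻¹ᵁ V)}
    (hs : D.acth φ s = s) : ∃ m : Γ(M, V), homLE (coadj D.πh j) le_rfl m = s := by
  obtain ⟨m, hm⟩ := mem_range_app_of_locally (coadj D.πh j) (coadj_injective hM hj) (U := V) s (by
    intro z hz
    obtain ⟨W, n, hzW, hn⟩ := isLineBundle_iff.1 hM z
    refine ⟨V ⊓ W, inf_le_left, ⟨hz, hzW⟩, ?_⟩
    have htg := hj.isTwistGen (hn.res (inf_le_right : V ⊓ W ≤ W)) (le_refl (D.πh ⁻¹ᵁ (V ⊓ W)))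
    have hs' : D.acth φ (res (D.F L) (D.πh.preimage_mono (inf_le_left : V ⊓ W ≤ V)) s) =
        res (D.F L) (D.πh.preimage_mono inf_le_left) s := by
      rw [act_res, hs]
    obtain ⟨b, hb⟩ := htg.exists_smul (res (D.F L) (D.πh.preimage_mono inf_le_left) s)
      fun p hp hpI => D.vanishesAt_of_acth_eq hpI hp hs'
    obtain ⟨g, rfl⟩ := D.exists_desc b (by
      apply htg.smul_injective
      rw [← hb, ← hs', hb, act_smul, h])
    refine ⟨g • res M inf_le_right n, ?_⟩
    rw [app_eq_homLE, homLE_smul]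
    exact hb.symm)
  exact ⟨m, by rw [← app_eq_homLE]; exact hm⟩

lemma nonempty_iso_of_adapted {M' : D.N.Modules} {j' : (Scheme.Modules.pullback D.πh).obj M' ⟶ D.F L}
    (hM : IsLineBundle M) (hM' : IsLineBundle M') (h : Adapted φ j) (h' : Adapted φ j')
    (hj : IsTwist j (D.ν ⁻¹' D.negNodes φ)) (hj' : IsTwist j' (D.ν ⁻¹' D.negNodes φ)) :
    Nonempty (M ≅ M') := by
  refine nonempty_iso_of_range_eq (coadj D.πh j) (coadj D.πh j') (coadj_injective hM hj)
    (coadj_injective hM' hj') fun V => Set.Subset.antisymm ?_ ?_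
  · rintro _ ⟨m, rfl⟩
    obtain ⟨m', hm'⟩ := h'.mem_range hM' hj' (h V m)
    exact ⟨m', by rw [app_eq_homLE, app_eq_homLE]; exact hm'⟩
  · rintro _ ⟨m, rfl⟩
    obtain ⟨m', hm'⟩ := h.mem_range hM hj (h' V m)
    exact ⟨m', by rw [app_eq_homLE, app_eq_homLE]; exact hm'⟩

lemma not_nonempty_iso (hS : D.S = ∅) {M' : D.N.Modules}
    {j' : (Scheme.Modules.pullback D.πh).obj M' ⟶ D.F L} {I I' : Set D.C'} (hI : I ⊆ D.S)
    (hM : IsLineBundle M) (h : Adapted φ j) (h' : Adapted (-φ) j')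
    (hj : IsTwist j (D.ν ⁻¹' I)) (hj' : IsTwist j' (D.ν ⁻¹' I')) : IsEmpty (M ≅ M') := by
  refine ⟨fun γ => ?_⟩
  have hb : ∀ (V : D.N.Opens) (m : Γ(M, V)),
      homLE (γ.hom ≫ coadj D.πh j') (le_refl (D.πh ⁻¹ᵁ V)) m =
        homLE (coadj D.πh j') (le_refl (D.πh ⁻¹ᵁ V)) (γ.hom.app V m) := fun V m => rfl
  obtain ⟨w, hw⟩ := exists_ratio hM (coadj D.πh j) (γ.hom ≫ coadj D.πh j')
    (fun V m hm => hj.isTwistGen hm le_rfl) (fun V m hm p hp hpI => by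
      have := hI hpI
      rw [hS] at this
      exact this.elim)
  obtain ⟨c, rfl⟩ := D.exists_eq_cst_of_fibres w fun x hx => by
    rw [hS] at hx
    exact hx.elim
  obtain ⟨z, hz⟩ := nonempty_closed_N D
  obtain ⟨V, m, hzV, hm⟩ := isLineBundle_iff.1 hM z
  obtain ⟨p, rfl⟩ := D.πh_surjective z
  have hpV : p ∈ D.πh ⁻¹ᵁ V := hzV
  have h1 := hw V m
  rw [hb, fres_cst] at h1
  have h2 := h' V (γ.hom.app V m)
  have htwc : tw D.τh_πh (cst D.sh (D.πh ⁻¹ᵁ V) c) = cst D.sh _ c := pb_cst D.τh D.τh_sh _ c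
  rw [h1, acth_neg, act_smul, htwc, h V m, ← neg_smul] at h2
  have h3 := (hj.isTwistGen hm (le_refl (D.πh ⁻¹ᵁ V))).smul_injective h2
  rw [← map_neg] at h3
  have h4 : cst D.sh (D.πh ⁻¹ᵁ V) (c - -c) ∈ idealAt _ p hpV := by
    rw [map_sub, h3, sub_self]; exact zero_mem _
  rw [cst_mem_idealAt_iff, sub_neg_eq_add, add_self_eq_zero] at h4
  rw [h4, map_zero, zero_smul] at h1
  have htg := hj'.isTwistGen (hm.map_iso γ) (le_refl (D.πh ⁻¹ᵁ V))
  have h5 : (1 : Γ(D.Ch, D.πh ⁻¹ᵁ V)) = 0 := htg.smul_injective (by rw [h1, smul_zero, smul_zero])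
  refine (idealAt_isPrime _ p hpV).ne_top ((Ideal.eq_top_iff_one _).2 ?_)
  rw [h5]
  exact zero_mem _

/-- The second twist is adapted to the opposite linearization. -/
lemma Adapted.neg_of_compl (hL : IsLineBundle L) (hφ : IsLinearization D.adm.involution L φ)
    (hM : IsLineBundle M) {I : Set D.C'} (hI : I ⊆ D.S) (hj : IsTwist j (D.ν ⁻¹' I))
    (h : Adapted φ j) {M' : D.N.Modules} {j' : (Scheme.Modules.pullback D.πh).obj M' ⟶ D.F L}
    (hM' : IsLineBundle M') (hj' : IsTwist j' (D.ν ⁻¹' (D.S \ I)))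
    (hne : D.S = ∅ → IsEmpty (M ≅ M')) : Adapted (-φ) j' := by
  refine (adapted_or hL hφ hM' Set.sdiff_subset hj').resolve_left fun h' => ?_
  obtain rfl := h.eq_negNodes hL hφ hM hI hj
  have h1 := h'.eq_negNodes hL hφ hM' Set.sdiff_subset hj'
  have hS : D.S = ∅ := by
    ext x
    refine ⟨fun hx => ?_, fun hx => hx.elim⟩
    by_cases hxI : x ∈ D.negNodes φ
    · exact (h1.symm ▸ hxI : x ∈ D.S \ D.negNodes φ).2 hxI
    · exact (hxI (h1 ▸ ⟨hx, hxI⟩)).elim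
  rw [h1] at hj'
  exact (hne hS).false (nonempty_iso_of_adapted hM hM' h h' hj hj').some

end Cover


/-- A morphism between finite schemes over `X` which are isomorphic to `X` over `W`. -/
lemma isIso_morphismRestrict_of_comp {X Y Z : Scheme.{0}} (f : Y ⟶ X) (g : Z ⟶ Y) [IsAffineHom g]
    {h : Z ⟶ X} (e : g ≫ f = h) {W : X.Opens} (hf : IsIso (f ∣_ W)) (hh : IsIso (h ∣_ W)) :
    IsIso (g ∣_ (f ⁻¹ᵁ W)) := by
  subst e
  refine isIso_morphismRestrict_of_locally g fun y hy => ?_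
  obtain ⟨V, hV, hyV, hVW⟩ := exists_affine_le y hy
  refine ⟨V, hVW, hyV, isIso_of_pb_bijective g hV ?_⟩
  obtain ⟨V₀, hV₀, rfl⟩ := exists_preimage_eq f hf hVW
  have h1 := pb_bijective_of_isIso f hf hV₀
  have h2 := pb_bijective_of_isIso _ hh hV₀
  have h3 : (pb (g ≫ f) (le_refl ((g ≫ f) ⁻¹ᵁ V₀)) : Γ(X, V₀) → Γ(Z, g ⁻¹ᵁ (f ⁻¹ᵁ V₀))) =
      pb g (le_refl (g ⁻¹ᵁ (f ⁻¹ᵁ V₀))) ∘ pb f le_rfl :=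
    funext fun x => (pb_pb g f _ _ x).symm
  exact (Function.Bijective.of_comp_iff _ h1).1 (h3 ▸ h2)

namespace Cover

/-- The normalization of the base curve at the images of a set of nodes of the covering curve. -/
structure Partial (D : Cover) (I : Set D.C') where
  sub : I ⊆ D.S
  N₁ : Scheme.{0}
  ν₁ : N₁ ⟶ D.C
  norm : IsNormalizationAt ν₁ (D.π '' I)
  μ : D.N ⟶ N₁
  fac : μ ≫ ν₁ = D.νN

namespace Partial

variable {D : Cover} {I : Set D.C'} (Q : D.Partial I)

instance : IsFinite Q.ν₁ := Q.norm.finite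
instance : IsFinite Q.μ := by
  have : IsFinite (Q.μ ≫ Q.ν₁) := by rw [Q.fac]; infer_instance
  exact IsFinite.of_comp Q.μ Q.ν₁
instance : IsLocallyNoetherian Q.N₁ := LocallyOfFiniteType.isLocallyNoetherian Q.ν₁

/-- The structure morphism of the partial normalization. -/
noncomputable abbrev s₁ : Q.N₁ ⟶ Spec (.of ℂ) := Q.ν₁ ≫ D.s

include Q in
lemma isClosed_image : IsClosed (D.π '' I) :=
  D.π.isClosedMap _ (D.adm.nodal_total.isClosed_of_subset Q.sub)

include Q in
lemma image_subset_T : D.π '' I ⊆ D.T := Set.image_mono Q.sub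

omit Q in
lemma mem_image_iff {x : D.C'} (hx : x ∈ D.S) : D.π x ∈ D.π '' I ↔ x ∈ I := by
  refine ⟨?_, fun h => ⟨x, h, rfl⟩⟩
  rintro ⟨x', hx', h⟩
  exact D.eq_of_apply_eq hx h ▸ hx'

instance : IsReduced Q.N₁ := Q.norm.isReduced Q.isClosed_image

/-- The open set over which nothing is changed. -/
def G : D.C.Opens := ⟨(D.π '' I)ᶜ, Q.isClosed_image.isOpen_compl⟩

lemma isIso_ν₁ : IsIso (Q.ν₁ ∣_ Q.G) := Q.norm.isIso Q.isClosed_image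

lemma ν₁_μ (z : D.N) : Q.ν₁ (Q.μ z) = D.νN z := by rw [← Scheme.Hom.comp_apply, Q.fac]

lemma isClosed_of_mem {y : Q.N₁} (hy : Q.ν₁ y ∈ D.T) : IsClosed {y} :=
  isClosed_singleton_of_isFinite Q.ν₁ (D.isClosed_of_mem_T hy)

lemma isNodalCurve : IsNodalCurve Q.s₁ where
  proper := inferInstance
  reduced := inferInstance
  smooth_or_node y hy := by
    by_cases h : Q.ν₁ y ∈ D.π '' I
    · exact Or.inl (Q.norm.normal y h)
    · let e := stalkEquiv Q.ν₁ Q.isIso_ν₁ (y := y) h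
      exact (D.adm.nodal_base.smooth_or_node _ (isClosed_singleton_apply Q.ν₁ hy)).imp
        (fun h => h.of_ringEquiv e) (fun h => h.of_ringEquiv e)

lemma exists_specializes {y : Q.N₁} (hy : Q.ν₁ y ∈ D.π '' I) : ∃ ξ, ξ ⤳ y ∧ Q.ν₁ ξ ∉ D.T := by
  obtain ⟨ξ, hξ, hne⟩ := Q.norm.exists_specializes
    (fun x hx => D.isClosed_of_mem_T (Q.image_subset_T hx)) hy
  refine ⟨ξ, hξ, fun h => hne ?_⟩
  have h1 := Q.isClosed_of_mem h
  have h2 : y ∈ ({ξ} : Set Q.N₁) := h1.closure_eq ▸ hξ.mem_closure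
  exact (h2 : y = ξ) ▸ hy

lemma νN_surjective (D : Cover) (y : D.C) : ∃ z, D.νN z = y := by
  obtain ⟨x, rfl⟩ := D.quot.exists_apply_eq y
  obtain ⟨p, rfl⟩ := D.ν_surjective x
  exact ⟨D.πh p, D.νN_πh p⟩

lemma eq_of_ν₁_eq {y y' : Q.N₁} (h : Q.ν₁ y = Q.ν₁ y') (hy : Q.ν₁ y ∉ D.π '' I) : y = y' := by
  obtain ⟨_, -, hu⟩ := existsUnique_of_isIso Q.ν₁ Q.isIso_ν₁ hy
  exact (hu y rfl).trans (hu y' h.symm).symm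

lemma μ_surjective (y : Q.N₁) : ∃ z, Q.μ z = y := by
  have h1 : ∀ y, Q.ν₁ y ∉ D.π '' I → ∃ z, Q.μ z = y := by
    intro y hy
    obtain ⟨z, hz⟩ := νN_surjective D (Q.ν₁ y)
    exact ⟨z, Q.eq_of_ν₁_eq ((Q.ν₁_μ z).trans hz) (by rwa [Q.ν₁_μ, hz])⟩
  by_cases hy : Q.ν₁ y ∈ D.π '' I
  · obtain ⟨ξ, hξ, hξT⟩ := Q.exists_specializes hy
    obtain ⟨η, rfl⟩ := h1 ξ fun h => hξT (Q.image_subset_T h)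
    exact hξ.mem_closed Q.μ.isClosedMap.isClosed_range ⟨η, rfl⟩
  · exact h1 y hy

lemma pb_μ_injective {V : Q.N₁.Opens} {U : D.N.Opens} (h : U ≤ Q.μ ⁻¹ᵁ V)
    (h' : Q.μ ⁻¹ᵁ V ≤ U) : Function.Injective (pb Q.μ h) :=
  pb_injective _ _ fun y hy => by
    obtain ⟨z, rfl⟩ := Q.μ_surjective y
    exact ⟨z, h' hy, rfl⟩

lemma finite_preimage_T : (Q.ν₁ ⁻¹' D.T).Finite :=
  D.finite_T.preimage' fun y _ => Q.ν₁.finite_preimage_singleton y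

lemma exists_isolating (y : Q.N₁) {W : Q.N₁.Opens} (hy : y ∈ W) :
    ∃ V ≤ W, y ∈ V ∧ ∀ q ∈ V, Q.ν₁ q ∈ D.T → q = y := by
  obtain ⟨U, hyU, hU⟩ := PrymEigen.exists_isolating Q.finite_preimage_T
    (fun z hz => Q.isClosed_of_mem hz) y
  exact ⟨U ⊓ W, inf_le_right, ⟨hyU, hy⟩, fun q hq hqT => hU q hq.1 hqT⟩

lemma isIso_μ_of_le {W : D.C.Opens} (h : IsIso (D.νN ∣_ W)) (hW : W ≤ Q.G) :
    IsIso (Q.μ ∣_ (Q.ν₁ ⁻¹ᵁ W)) :=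
  isIso_morphismRestrict_of_comp Q.ν₁ Q.μ Q.fac
    (isIso_morphismRestrict_mono Q.ν₁ hW Q.isIso_ν₁) h

lemma G_le : D.G ≤ Q.G := fun _ hy h => hy (Q.image_subset_T h)

lemma exists_isIso_of_mem {y : Q.N₁} (hy : Q.ν₁ y ∈ D.π '' I) {W : Q.N₁.Opens} (hW : y ∈ W) :
    ∃ V ≤ W, y ∈ V ∧ IsIso (Q.μ ∣_ V) ∧ ∀ q ∈ V, Q.ν₁ q ∈ D.T → q = y := by
  obtain ⟨V₁, hV₁, hyV₁, hiso⟩ := Q.exists_isolating y hW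
  obtain ⟨V, hV, hyV, hVV₁⟩ := exists_affine_le y hyV₁
  refine ⟨V, hVV₁.trans hV₁, hyV, isIso_of_pb_bijective Q.μ hV
    ⟨Q.pb_μ_injective _ le_rfl, fun b => ?_⟩, fun q hq => hiso q (hVV₁ hq)⟩
  have hcl := Q.isClosed_of_mem (Q.image_subset_T hy)
  have hle : V ⊓ Q.ν₁ ⁻¹ᵁ D.G ≤ V := inf_le_left
  have hb := (pb_bijective_of_isIso Q.μ (Q.isIso_μ_of_le D.isIso_νN Q.G_le)
    (inf_le_right : V ⊓ Q.ν₁ ⁻¹ᵁ D.G ≤ _))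
  obtain ⟨g, hg⟩ := hb.2 (fres (Q.μ.preimage_mono hle) b)
  obtain ⟨z, rfl⟩ := Q.μ_surjective y
  have hclz := isClosed_singleton_of_isFinite Q.μ hcl
  obtain ⟨g', hg'⟩ := exists_extension Q.μ (p := z) (D.isDVR_N hclz) (Q.norm.normal _ hy) hcl hle hyV
    (fun q hq hne => ⟨hq, fun h => hne (hiso q (hVV₁ hq) h)⟩) g (U := Q.μ ⁻¹ᵁ V) hyV b (by
      have := congrArg (fres (inf_le_right :
        Q.μ ⁻¹ᵁ V ⊓ Q.μ ⁻¹ᵁ (V ⊓ Q.ν₁ ⁻¹ᵁ D.G) ≤ _)) hg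
      simpa using this)
  refine ⟨g', sub_eq_zero.1 (eq_zero_of_forall_mem_idealAt _ fun q hq => ?_)⟩
  have h1 := Q.μ.preimage_mono hle
  have h2 : fres h1 (pb Q.μ le_rfl g') = fres h1 b := by
    rw [fres_pb, ← hg, ← hg', pb_fres]
  have h3 : ∃ ξ, ξ ⤳ q ∧ ξ ∈ Q.μ ⁻¹ᵁ (V ⊓ Q.ν₁ ⁻¹ᵁ D.G) := by
    by_cases hqT : D.νN q ∈ D.T
    · obtain ⟨ξ, hξ, hξT⟩ := D.exists_specializes_N hqT
      refine ⟨ξ, hξ, hξ.mem_open (Q.μ ⁻¹ᵁ V).2 hq, ?_⟩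
      change Q.ν₁ (Q.μ ξ) ∉ D.T
      rwa [Q.ν₁_μ]
    · refine ⟨q, specializes_rfl, hq, ?_⟩
      change Q.ν₁ (Q.μ q) ∉ D.T
      rwa [Q.ν₁_μ]
  obtain ⟨ξ, hξ, hξU⟩ := h3
  refine idealAt_le_of_specializes (hp := h1 hξU) hξ ?_
  rw [← fres_mem_idealAt h1 _ hξU, map_sub, h2, sub_self]
  exact zero_mem _

lemma isNormalization : IsNormalization Q.μ where
  finite := inferInstance
  iso_away U hU := by
    refine isIso_morphismRestrict_of_locally Q.μ fun y₀ hy₀ => ?_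
    obtain ⟨y, hyU, hy, hsp⟩ := exists_closed_mem Q.s₁ hy₀
    suffices h : ∃ V ≤ U, y ∈ V ∧ IsIso (Q.μ ∣_ V) by
      obtain ⟨V, hV, hyV, h⟩ := h
      exact ⟨V, hV, hsp.mem_open V.2 hyV, h⟩
    have hd : IsDVR (Q.N₁.presheaf.stalk y) := by
      by_contra h
      exact Set.disjoint_left.1 hU hyU ⟨hy, h⟩
    by_cases h : Q.ν₁ y ∈ D.π '' I
    · obtain ⟨V, hV, hyV, hi, -⟩ := Q.exists_isIso_of_mem h hyU
      exact ⟨V, hV, hyV, hi⟩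
    · have hcl : IsClosed (singularPoints D.C) := D.adm.nodal_base.isClosed_of_subset subset_rfl
      let W : D.C.Opens := ⟨(singularPoints D.C)ᶜ, hcl.isOpen_compl⟩
      have h1 := Q.isIso_μ_of_le (W := W ⊓ Q.G) (D.norm_base.iso_away _
        (Set.disjoint_left.2 fun z hz hz' => hz.1 hz')) inf_le_right
      have hyW : y ∈ Q.ν₁ ⁻¹ᵁ (W ⊓ Q.G) :=
        ⟨fun h2 => h2.2 ((isDVR_iff_of_isIso Q.ν₁ Q.isIso_ν₁ h).2 hd), h⟩
      exact ⟨U ⊓ Q.ν₁ ⁻¹ᵁ (W ⊓ Q.G), inf_le_left, ⟨hyU, hyW⟩,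
        isIso_morphismRestrict_mono Q.μ inf_le_right h1⟩
  normal z hz := D.isDVR_N (isClosed_singleton_of_isFinite Q.μ hz.1)

end Partial

end Cover


lemma vanishesAt_zero {X : Scheme.{0}} {M : X.Modules} {U : X.Opens} {p : X} (hp : p ∈ U) :
    VanishesAt M (0 : Γ(M, U)) p :=
  ⟨U, le_rfl, hp, by rw [map_zero]; exact zero_mem _⟩

namespace Cover

variable {D : Cover} {L : D.C'.Modules}

/-- The values of the section `s` of the pullback of `L` at the points over `x` come from a single
element of the fibre of `L` at `x`. -/
def GlueAt {W : D.Ch.Opens} (s : Γ(D.F L, W)) (x : D.C') : Prop :=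
  ∃ (U : D.C'.Opens) (l : Γ(L, U)), x ∈ U ∧ ∀ p ∈ W, D.ν p = x →
    VanishesAt (D.F L) (res (D.F L) (inf_le_left : W ⊓ D.ν ⁻¹ᵁ U ≤ W) s -
      psec D.ν L (inf_le_right : W ⊓ D.ν ⁻¹ᵁ U ≤ D.ν ⁻¹ᵁ U) l) p

section

variable {W : D.Ch.Opens} {s s' : Γ(D.F L, W)} {x : D.C'}

lemma glueAt_of_vanishesAt (h : ∀ p ∈ W, D.ν p = x → VanishesAt (D.F L) s p) : GlueAt s x := by
  refine ⟨⊤, 0, trivial, fun p hp hpx => ?_⟩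
  have hpI : p ∈ W ⊓ D.ν ⁻¹ᵁ ⊤ := ⟨hp, trivial⟩
  rw [map_zero, sub_zero, vanishesAt_res_iff _ _ hpI]
  exact h p hp hpx

lemma GlueAt.add (h : GlueAt s x) (h' : GlueAt s' x) : GlueAt (s + s') x := by
  obtain ⟨U, l, hx, h⟩ := h
  obtain ⟨U', l', hx', h'⟩ := h'
  refine ⟨U ⊓ U', res L inf_le_left l + res L inf_le_right l', ⟨hx, hx'⟩, fun p hp hpx => ?_⟩
  subst hpx
  have hpI : p ∈ W ⊓ D.ν ⁻¹ᵁ (U ⊓ U') := ⟨hp, hx, hx'⟩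
  have h1 := (vanishesAt_res_iff (inf_le_inf le_rfl (D.ν.preimage_mono inf_le_left) :
    W ⊓ D.ν ⁻¹ᵁ (U ⊓ U') ≤ W ⊓ D.ν ⁻¹ᵁ U) _ hpI).2 (h p hp rfl)
  have h2 := (vanishesAt_res_iff (inf_le_inf le_rfl (D.ν.preimage_mono inf_le_right) :
    W ⊓ D.ν ⁻¹ᵁ (U ⊓ U') ≤ W ⊓ D.ν ⁻¹ᵁ U') _ hpI).2 (h' p hp rfl)
  have h3 := h1.add h2
  simp only [map_sub, res_res, res_psec] at h3
  simp only [map_add, psec_res]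
  convert h3 using 1
  abel

lemma GlueAt.smul (h : GlueAt s x) {b : Γ(D.Ch, W)} (c : ℂ)
    (hb : ∀ p (hp : p ∈ W), D.ν p = x → b - cst D.sh W c ∈ idealAt W p hp) : GlueAt (b • s) x := by
  obtain ⟨U, l, hx, h⟩ := h
  refine ⟨U, cst D.s' U c • l, hx, fun p hp hpx => ?_⟩
  subst hpx
  have hpI : p ∈ W ⊓ D.ν ⁻¹ᵁ U := ⟨hp, hx⟩
  have h1 := vanishesAt_smul (res (D.F L) (inf_le_left : W ⊓ D.ν ⁻¹ᵁ U ≤ W) s)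
    ((fres_mem_idealAt (inf_le_left : W ⊓ D.ν ⁻¹ᵁ U ≤ W) _ hpI).2 (hb p hp rfl))
  have h2 := h1.add ((h p hp rfl).smul (cst D.sh _ c))
  have h3 : pb D.ν (inf_le_right : W ⊓ D.ν ⁻¹ᵁ U ≤ D.ν ⁻¹ᵁ U) (cst D.s' U c) = cst D.sh _ c :=
    pb_cst D.ν rfl _ c
  rw [res_smul, psec_smul, h3]
  convert h2 using 1
  rw [map_sub, fres_cst, sub_smul, smul_sub]
  abel

lemma GlueAt.res {W' : D.Ch.Opens} (h : GlueAt s x) (hW : W' ≤ W) :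
    GlueAt (res (D.F L) hW s) x := by
  obtain ⟨U, l, hx, h⟩ := h
  refine ⟨U, l, hx, fun p hp hpx => ?_⟩
  subst hpx
  have hpI : p ∈ W' ⊓ D.ν ⁻¹ᵁ U := ⟨hp, hx⟩
  have h1 := (vanishesAt_res_iff (inf_le_inf hW le_rfl : W' ⊓ D.ν ⁻¹ᵁ U ≤ W ⊓ D.ν ⁻¹ᵁ U) _ hpI).2
    (h p (hW hp) rfl)
  simpa using h1

lemma GlueAt.of_res {W' : D.Ch.Opens} (hW : W' ≤ W) (h : GlueAt (PrymEigen.res (D.F L) hW s) x)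
    (hx : ∀ p ∈ W, D.ν p = x → p ∈ W') : GlueAt s x := by
  obtain ⟨U, l, hxU, h⟩ := h
  refine ⟨U, l, hxU, fun p hp hpx => ?_⟩
  have hpW' := hx p hp hpx
  subst hpx
  have hpI : p ∈ W' ⊓ D.ν ⁻¹ᵁ U := ⟨hpW', hxU⟩
  rw [← vanishesAt_res_iff (inf_le_inf hW le_rfl : W' ⊓ D.ν ⁻¹ᵁ U ≤ W ⊓ D.ν ⁻¹ᵁ U) _ hpI]
  simpa using h p hpW' rfl

lemma glueAt_psec {U : D.C'.Opens} (hW : W ≤ D.ν ⁻¹ᵁ U) (l : Γ(L, U)) (hx : x ∈ U) :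
    GlueAt (psec D.ν L hW l) x := by
  refine ⟨U, l, hx, fun p hp hpx => ?_⟩
  subst hpx
  have hpI : p ∈ W ⊓ D.ν ⁻¹ᵁ U := ⟨hp, hx⟩
  rw [res_psec, sub_self]
  exact vanishesAt_zero hpI

end

lemma psec_ν_injective (hL : IsLineBundle L) {V : D.C'.Opens} {U : D.Ch.Opens}
    (h : U ≤ D.ν ⁻¹ᵁ V) (h' : D.ν ⁻¹ᵁ V ≤ U) : Function.Injective (psec D.ν L h) := by
  intro l l' hll
  refine mod_ext _ _ fun x hx => ?_
  obtain ⟨W, e, hxW, he⟩ := isLineBundle_iff.1 hL x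
  obtain ⟨r, hr⟩ := he.exists_smul (inf_le_right : V ⊓ W ≤ W) (res L inf_le_left l)
  obtain ⟨r', hr'⟩ := he.exists_smul (inf_le_right : V ⊓ W ≤ W) (res L inf_le_left l')
  refine ⟨V ⊓ W, inf_le_left, ⟨hx, hxW⟩, ?_⟩
  have h2 := congrArg (res (D.F L) ((D.ν.preimage_mono (inf_le_left : V ⊓ W ≤ V)).trans h')) hll
  rw [res_psec, res_psec, ← psec_res _ _ inf_le_left le_rfl, ← psec_res _ _ inf_le_left le_rfl, hr,
    hr', psec_smul, psec_smul] at h2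
  have h3 := ((he.res (inf_le_right : V ⊓ W ≤ W)).psec D.ν
    (le_refl (D.ν ⁻¹ᵁ (V ⊓ W)))).smul_injective' h2
  rw [hr, hr', D.pb_ν_injective le_rfl le_rfl h3]

lemma exists_desc_sec (hL : IsLineBundle L) {V : D.C'.Opens} {U : D.Ch.Opens} (hU : U ≤ D.ν ⁻¹ᵁ V)
    (hU' : D.ν ⁻¹ᵁ V ≤ U) (s : Γ(D.F L, U)) (hs : ∀ x ∈ V, x ∈ D.S → GlueAt s x) :
    ∃ l : Γ(L, V), psec D.ν L hU l = s := by
  obtain rfl := le_antisymm hU hU'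
  let α : L ⟶ (Scheme.Modules.pushforward D.ν).obj (D.F L) :=
    (Scheme.Modules.pullbackPushforwardAdjunction D.ν).unit.app L
  have hα : ∀ (V : D.C'.Opens) (l : Γ(L, V)), α.app V l = psec D.ν L (le_refl (D.ν ⁻¹ᵁ V)) l :=
    fun V l => pullSec_eq_psec D.ν L l
  obtain ⟨l, hl⟩ := mem_range_app_of_locally α (fun V l l' h => psec_ν_injective hL
      (le_refl (D.ν ⁻¹ᵁ V)) le_rfl (by rw [← hα, ← hα]; exact h)) (U := V) s (by
    intro x hx
    obtain ⟨W, e, hxW, he⟩ := isLineBundle_iff.1 hL x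
    refine ⟨V ⊓ W, inf_le_left, ⟨hx, hxW⟩, ?_⟩
    have he' := he.res (inf_le_right : V ⊓ W ≤ W)
    obtain ⟨f, hf⟩ := (he'.psec D.ν (le_refl (D.ν ⁻¹ᵁ (V ⊓ W)))).exists_smul'
      (res (D.F L) (D.ν.preimage_mono (inf_le_left : V ⊓ W ≤ V)) s)
    obtain ⟨g, rfl⟩ := D.exists_desc_ν f (by
      intro p hp hpS
      obtain ⟨U, l, hpU, h⟩ := (hs (D.ν p) hp.1 hpS).res
        (D.ν.preimage_mono (inf_le_left : V ⊓ W ≤ V))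
      obtain ⟨b, hb⟩ := he'.exists_smul (inf_le_left : (V ⊓ W) ⊓ U ≤ V ⊓ W) (res L inf_le_right l)
      refine ⟨V ⊓ W ⊓ U, ⟨hp, hpU⟩, b, fun q hq hqp => ?_⟩
      have hle : D.ν ⁻¹ᵁ (V ⊓ W) ⊓ D.ν ⁻¹ᵁ (V ⊓ W ⊓ U) ≤ D.ν ⁻¹ᵁ (V ⊓ W) ⊓ D.ν ⁻¹ᵁ U :=
        inf_le_inf le_rfl (D.ν.preimage_mono inf_le_right)
      have h1 := (vanishesAt_res_iff hle _ hq).2 (h q hq.1 hqp)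
      rw [← (((he'.psec D.ν (le_refl (D.ν ⁻¹ᵁ (V ⊓ W)))).res
        (inf_le_left : D.ν ⁻¹ᵁ (V ⊓ W) ⊓ D.ν ⁻¹ᵁ (V ⊓ W ⊓ U) ≤ _))).vanishesAt_smul_iff _ hq]
      have h2 := congrArg (psec D.ν L (inf_le_right : D.ν ⁻¹ᵁ (V ⊓ W) ⊓ D.ν ⁻¹ᵁ (V ⊓ W ⊓ U) ≤ _)) hb
      rw [psec_smul] at h2
      simp only [psec_res] at h2
      convert h1 using 1
      rw [map_sub, hf]
      simp only [sub_smul, res_smul, res_psec, psec_res, h2, fres_fres])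
    refine ⟨g • res L inf_le_right e, ?_⟩
    rw [hα, psec_smul]
    exact hf.symm)
  exact ⟨l, (hα V l).symm.trans hl⟩

namespace Partial

variable {I : Set D.C'} (Q : D.Partial I) {M : D.N.Modules}
  (j : (Scheme.Modules.pullback D.πh).obj M ⟶ D.F L)

lemma preimage_le {V₀ : D.C.Opens} : D.ν ⁻¹ᵁ (D.π ⁻¹ᵁ V₀) ≤ D.πh ⁻¹ᵁ (Q.μ ⁻¹ᵁ (Q.ν₁ ⁻¹ᵁ V₀)) := by
  rw [← Scheme.Hom.comp_preimage, ← Scheme.Hom.comp_preimage, ← Scheme.Hom.comp_preimage,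
    ← D.comm, Category.assoc, Q.fac]

lemma le_preimage {V₀ : D.C.Opens} : D.πh ⁻¹ᵁ (Q.μ ⁻¹ᵁ (Q.ν₁ ⁻¹ᵁ V₀)) ≤ D.ν ⁻¹ᵁ (D.π ⁻¹ᵁ V₀) := by
  rw [← Scheme.Hom.comp_preimage, ← Scheme.Hom.comp_preimage, ← Scheme.Hom.comp_preimage,
    ← D.comm, Category.assoc, Q.fac]

lemma ν₁_μ_πh (p : D.Ch) : Q.ν₁ (Q.μ (D.πh p)) = D.π (D.ν p) := by rw [Q.ν₁_μ, D.νN_πh]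

lemma μ_πh_eq {p q : D.Ch} (h : D.ν q = D.ν p) (hp : D.ν p ∈ D.S \ I) :
    Q.μ (D.πh q) = Q.μ (D.πh p) :=
  Q.eq_of_ν₁_eq (by rw [Q.ν₁_μ_πh, Q.ν₁_μ_πh, h]) (by
    rw [Q.ν₁_μ_πh, h, mem_image_iff hp.1]
    exact hp.2)

/-- The sections of `M` satisfying the gluing condition at the remaining nodes. -/
def glueSet (V : Q.N₁.Opens) : Set Γ(M, Q.μ ⁻¹ᵁ V) :=
  {m | ∀ x ∈ D.S \ I, GlueAt (homLE (coadj D.πh j) (le_refl (D.πh ⁻¹ᵁ (Q.μ ⁻¹ᵁ V))) m) x}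

variable {j}

lemma smul_mem_glueSet {V : Q.N₁.Opens} {m : Γ(M, Q.μ ⁻¹ᵁ V)} (hm : m ∈ Q.glueSet j V)
    (r : Γ(Q.N₁, V)) : pb Q.μ (le_refl (Q.μ ⁻¹ᵁ V)) r • m ∈ Q.glueSet j V := by
  intro x hx
  rw [homLE_smul]
  by_cases h : ∃ p ∈ D.πh ⁻¹ᵁ (Q.μ ⁻¹ᵁ V), D.ν p = x
  · obtain ⟨p, hp, rfl⟩ := h
    have hpV : Q.μ (D.πh p) ∈ V := hp
    have hcl : IsClosed {Q.μ (D.πh p)} := Q.isClosed_of_mem (by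
      rw [Q.ν₁_μ_πh]; exact D.apply_mem_T_iff.2 hx.1)
    obtain ⟨c, hc⟩ := exists_cst_sub_mem Q.s₁ hcl hpV r
    refine (hm _ hx).smul c fun q hq hqp => ?_
    have h1 : pb D.πh le_rfl (pb Q.μ (le_refl (Q.μ ⁻¹ᵁ V)) r) - cst D.sh _ c =
        pb (D.πh ≫ Q.μ) (le_refl _) (r - cst Q.s₁ V c) := by
      have h3 : (D.πh ≫ Q.μ) ≫ Q.s₁ = D.sh := by
        rw [Category.assoc, reassoc_of% Q.fac]; exact D.πh_sN
      rw [pb_pb, map_sub, pb_cst _ h3]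
      rfl
    refine h1 ▸ ?_
    refine (pb_mem_idealAt _ _ _ hq).2 ?_
    have key : ∀ y (hy : y ∈ V), y = Q.μ (D.πh p) → r - cst Q.s₁ V c ∈ idealAt V y hy := by
      rintro _ _ rfl
      exact hc
    exact key _ _ (Q.μ_πh_eq hqp hx)
  · push Not at h
    exact glueAt_of_vanishesAt fun p hp hpx => (h p hp hpx).elim

lemma add_mem_glueSet {V : Q.N₁.Opens} {m m' : Γ(M, Q.μ ⁻¹ᵁ V)} (hm : m ∈ Q.glueSet j V)
    (hm' : m' ∈ Q.glueSet j V) : m + m' ∈ Q.glueSet j V := fun x hx => by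
  rw [map_add]
  exact (hm x hx).add (hm' x hx)

lemma zero_mem_glueSet (V : Q.N₁.Opens) : (0 : Γ(M, Q.μ ⁻¹ᵁ V)) ∈ Q.glueSet j V := fun x _ => by
  rw [map_zero]
  exact glueAt_of_vanishesAt fun p hp _ => vanishesAt_zero hp

lemma res_mem_glueSet {U V : Q.N₁.Opens} (h : V ≤ U) {m : Γ(M, Q.μ ⁻¹ᵁ U)}
    (hm : m ∈ Q.glueSet j U) : res M (Q.μ.preimage_mono h) m ∈ Q.glueSet j V := fun x hx => by
  have := (hm x hx).res (D.πh.preimage_mono (Q.μ.preimage_mono h))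
  rw [res_homLE] at this
  rw [homLE_res]
  exact this

lemma mem_glueSet_of_locally {U : Q.N₁.Opens} {m : Γ(M, Q.μ ⁻¹ᵁ U)}
    (hm : ∀ y ∈ U, ∃ (V : Q.N₁.Opens) (h : V ≤ U), y ∈ V ∧
      res M (Q.μ.preimage_mono h) m ∈ Q.glueSet j V) : m ∈ Q.glueSet j U := fun x hx => by
  by_cases h : ∃ p ∈ D.πh ⁻¹ᵁ (Q.μ ⁻¹ᵁ U), D.ν p = x
  · obtain ⟨p, hp, rfl⟩ := h
    obtain ⟨V, hV, hpV, h1⟩ := hm (Q.μ (D.πh p)) hp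
    have h2 := h1 _ hx
    rw [homLE_res, ← res_homLE (coadj D.πh j) le_rfl
      (D.πh.preimage_mono (Q.μ.preimage_mono hV))] at h2
    refine h2.of_res _ fun q hq hqp => ?_
    change Q.μ (D.πh q) ∈ V
    rw [Q.μ_πh_eq hqp hx]
    exact hpV
  · push Not at h
    exact glueAt_of_vanishesAt fun p hp hpx => (h p hp hpx).elim

/-- The sheaf obtained by gluing at the remaining nodes. -/
noncomputable def glue (j : (Scheme.Modules.pullback D.πh).obj M ⟶ D.F L) : Q.N₁.Modules :=
  subsheaf ((Scheme.Modules.pushforward Q.μ).obj M)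
    (fun V =>
      { carrier := Q.glueSet j V
        add_mem' := fun {_ _} ha hb => Q.add_mem_glueSet ha hb
        zero_mem' := Q.zero_mem_glueSet V
        smul_mem' := fun r m hm => by
          have := Q.smul_mem_glueSet hm r
          rw [← app_eq_pb] at this
          exact this })
    (fun _ _ h _ hm => Q.res_mem_glueSet h hm)
    (fun _ _ hm => Q.mem_glueSet_of_locally hm)

/-- The inclusion of the glued sheaf. -/
noncomputable def glueι (j : (Scheme.Modules.pullback D.πh).obj M ⟶ D.F L) :
    Q.glue j ⟶ (Scheme.Modules.pushforward Q.μ).obj M :=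
  subsheafι _ _ _ _

lemma glueι_injective (V : Q.N₁.Opens) : Function.Injective ((Q.glueι j).app V) :=
  subsheafι_injective _ _ _ _ _

lemma homLE_glueι_injective (V : Q.N₁.Opens) :
    Function.Injective (homLE (Q.glueι j) (le_refl (Q.μ ⁻¹ᵁ V))) := fun a b h =>
  Q.glueι_injective V (by rw [app_eq_homLE, app_eq_homLE]; exact h)

lemma mem_range_glueι {V : Q.N₁.Opens} (m : Γ(M, Q.μ ⁻¹ᵁ V)) :
    (∃ n : Γ(Q.glue j, V), homLE (Q.glueι j) (le_refl (Q.μ ⁻¹ᵁ V)) n = m) ↔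
      m ∈ Q.glueSet j V := by
  have h1 := mem_range_subsheafι ((Scheme.Modules.pushforward Q.μ).obj M)
    (fun V =>
      { carrier := Q.glueSet j V
        add_mem' := fun {_ _} ha hb => Q.add_mem_glueSet ha hb
        zero_mem' := Q.zero_mem_glueSet V
        smul_mem' := fun r m hm => by
          have := Q.smul_mem_glueSet hm r
          rw [← app_eq_pb] at this
          exact this })
    (fun _ _ h _ hm => Q.res_mem_glueSet h hm)
    (fun _ _ hm => Q.mem_glueSet_of_locally hm) V m
  refine Iff.trans (exists_congr fun n => ?_) h1
  rw [← app_eq_homLE]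
  rfl

lemma homLE_glueι_mem {V : Q.N₁.Opens} (n : Γ(Q.glue j, V)) :
    homLE (Q.glueι j) (le_refl (Q.μ ⁻¹ᵁ V)) n ∈ Q.glueSet j V :=
  (Q.mem_range_glueι _).1 ⟨n, rfl⟩

lemma isGluing_glueι : IsGluing D.ν D.πh Q.μ L M j (D.S \ I) (Q.glueι j) := by
  intro V
  refine ⟨Q.glueι_injective V, fun m => ?_⟩
  have h1 : m ∈ Set.range ((Q.glueι j).app V) ↔
      ∃ n : Γ(Q.glue j, V), homLE (Q.glueι j) (le_refl (Q.μ ⁻¹ᵁ V)) n = m :=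
    exists_congr fun n => by
      rw [← app_eq_homLE]
      exact Iff.rfl
  refine h1.trans ((Q.mem_range_glueι m).trans (forall₂_congr fun x hx => ?_))
  rw [homLE_coadj, ← pullSec_eq_psec]
  rfl

end Partial

end Cover


namespace Cover

/-- A line bundle `M` on the normalization of the base curve, with an adapted twist `π^* M ⟶ ν^* L`
along the points over the nodes in `I`. -/
structure Twist (D : Cover) (L : D.C'.Modules) (φ : L ⟶ (Scheme.Modules.pushforward D.τ).obj L)
    (I : Set D.C') where
  line : IsLineBundle L
  lin : IsLinearization D.adm.involution L φ
  M : D.N.Modules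
  j : (Scheme.Modules.pullback D.πh).obj M ⟶ D.F L
  isLineBundle : IsLineBundle M
  isTwist : IsTwist j (D.ν ⁻¹' I)
  adapted : Adapted φ j
  eq : I = D.negNodes φ

namespace Twist

variable {D : Cover} {L : D.C'.Modules} {φ : L ⟶ (Scheme.Modules.pushforward D.τ).obj L}
  {I : Set D.C'} (T : D.Twist L φ I) (Q : D.Partial I)

/-- The section of the pullback of `L` given by a section of the glued sheaf. -/
noncomputable def sec (V : Q.N₁.Opens) :
    Γ(Q.glue T.j, V) →+ Γ(D.F L, D.πh ⁻¹ᵁ (Q.μ ⁻¹ᵁ V)) :=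
  (homLE (coadj D.πh T.j) (le_refl (D.πh ⁻¹ᵁ (Q.μ ⁻¹ᵁ V)))).comp
    (homLE (Q.glueι T.j) (le_refl (Q.μ ⁻¹ᵁ V)))

lemma sec_apply {V : Q.N₁.Opens} (n : Γ(Q.glue T.j, V)) : T.sec Q V n =
    homLE (coadj D.πh T.j) (le_refl (D.πh ⁻¹ᵁ (Q.μ ⁻¹ᵁ V)))
      (homLE (Q.glueι T.j) (le_refl (Q.μ ⁻¹ᵁ V)) n) := rfl

lemma sec_res {U V : Q.N₁.Opens} (h : V ≤ U) (n : Γ(Q.glue T.j, U)) :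
    T.sec Q V (res _ h n) = res (D.F L) (D.πh.preimage_mono (Q.μ.preimage_mono h)) (T.sec Q U n) := by
  rw [sec_apply, sec_apply, homLE_res, res_homLE, ← res_homLE (Q.glueι T.j) le_rfl
    (Q.μ.preimage_mono h), homLE_res]

lemma sec_smul {V : Q.N₁.Opens} (r : Γ(Q.N₁, V)) (n : Γ(Q.glue T.j, V)) :
    T.sec Q V (r • n) = pb D.πh (le_refl (D.πh ⁻¹ᵁ (Q.μ ⁻¹ᵁ V))) (pb Q.μ le_rfl r) • T.sec Q V n := by
  rw [sec_apply, sec_apply, homLE_smul, homLE_smul]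

lemma sec_injective (V : Q.N₁.Opens) : Function.Injective (T.sec Q V) := by
  intro n n' h
  apply Q.homLE_glueι_injective
  apply coadj_injective T.isLineBundle T.isTwist
  rw [app_eq_homLE, app_eq_homLE]
  exact h

lemma acth_sec {V : Q.N₁.Opens} (n : Γ(Q.glue T.j, V)) :
    D.acth φ (T.sec Q V n) = T.sec Q V n := T.adapted _ _

lemma exists_desc {V : D.C.Opens} (n : Γ(Q.glue T.j, Q.ν₁ ⁻¹ᵁ V)) :
    ∃ l : Γ(L, D.π ⁻¹ᵁ V), psec D.ν L Q.le_preimage l = T.sec Q _ n := by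
  refine exists_desc_sec T.line Q.le_preimage Q.preimage_le _ fun x hx hxS => ?_
  by_cases hxI : x ∈ I
  · refine glueAt_of_vanishesAt fun p hp hpx => ?_
    subst hpx
    exact D.vanishesAt_of_acth_eq (T.eq ▸ hxI) hp (T.acth_sec Q n)
  · exact Q.homLE_glueι_mem n x ⟨hxS, hxI⟩

lemma act_eq_of_psec_eq {V : D.C.Opens} {l : Γ(L, D.π ⁻¹ᵁ V)} {n : Γ(Q.glue T.j, Q.ν₁ ⁻¹ᵁ V)}
    (h : psec D.ν L Q.le_preimage l = T.sec Q _ n) : act D.adm.invariant φ l = l := by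
  apply psec_ν_injective T.line Q.le_preimage Q.preimage_le
  rw [← acth_psec, h, acth_sec]

lemma exists_sec {V : D.C.Opens} {l : Γ(L, D.π ⁻¹ᵁ V)} (h : act D.adm.invariant φ l = l) :
    ∃ n : Γ(Q.glue T.j, Q.ν₁ ⁻¹ᵁ V), T.sec Q _ n = psec D.ν L Q.le_preimage l := by
  obtain ⟨m, hm⟩ := T.adapted.mem_range T.isLineBundle (by rw [← T.eq]; exact T.isTwist)
    (V := Q.μ ⁻¹ᵁ (Q.ν₁ ⁻¹ᵁ V)) (s := psec D.ν L Q.le_preimage l) (by rw [acth_psec, h])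
  obtain ⟨n, rfl⟩ := (Q.mem_range_glueι m).2 (by
    intro x hx
    rw [hm]
    by_cases hxV : x ∈ D.π ⁻¹ᵁ V
    · exact glueAt_psec _ _ hxV
    · refine glueAt_of_vanishesAt fun p hp hpx => ?_
      subst hpx
      exact (hxV (Q.le_preimage hp)).elim)
  exact ⟨n, hm⟩

lemma exists_isGenerator_away {V : D.C.Opens} (hV : V ≤ Q.G) {e : Γ(L, D.π ⁻¹ᵁ V)}
    (he : IsGenerator L e) (h : act D.adm.invariant φ e = e) :
    ∃ n : Γ(Q.glue T.j, Q.ν₁ ⁻¹ᵁ V), T.sec Q _ n = psec D.ν L Q.le_preimage e ∧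
      IsGenerator (Q.glue T.j) n := by
  obtain ⟨n, hn⟩ := T.exists_sec Q h
  refine ⟨n, hn, fun U hU => ?_⟩
  obtain ⟨U, hUV, rfl⟩ := exists_preimage_eq Q.ν₁ Q.isIso_ν₁ (hU.trans (Q.ν₁.preimage_mono hV))
  have hb := pb_bijective_of_isIso Q.ν₁ Q.isIso_ν₁ hUV
  have hle : U ⊓ V ≤ V := inf_le_right
  have hUle : Q.ν₁ ⁻¹ᵁ U ≤ Q.ν₁ ⁻¹ᵁ (U ⊓ V) := le_inf le_rfl hU
  have hUle' : Q.ν₁ ⁻¹ᵁ (U ⊓ V) = Q.ν₁ ⁻¹ᵁ U := le_antisymm (Q.ν₁.preimage_mono inf_le_left) hUle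
  have hUV' : U ⊓ V = U := by
    refine le_antisymm inf_le_left fun y hy => ⟨hy, ?_⟩
    obtain ⟨z, rfl, -⟩ := existsUnique_of_isIso Q.ν₁ Q.isIso_ν₁ (hUV hy)
    exact hU hy
  rw [inf_eq_left] at hUV'
  have he' := he.res (D.π.preimage_mono hUV')
  have hpull : ∀ g : Γ(D.C, U), T.sec Q _ (pb Q.ν₁ (le_refl (Q.ν₁ ⁻¹ᵁ U)) g • res _ hU n) =
      psec D.ν L Q.le_preimage (pb D.π (le_refl (D.π ⁻¹ᵁ U)) g • res L (D.π.preimage_mono hUV') e) := by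
    intro g
    have e1 : (D.πh ≫ Q.μ) ≫ Q.ν₁ = D.ν ≫ D.π := by rw [Category.assoc, Q.fac, D.comm]
    rw [sec_smul, sec_res, hn, psec_smul, psec_res, res_psec, pb_pb, pb_pb, pb_pb, pb_congr e1]
  constructor
  · intro f f' hff
    obtain ⟨g, rfl⟩ := hb.2 f
    obtain ⟨g', rfl⟩ := hb.2 f'
    have h1 := congrArg (T.sec Q _) hff
    dsimp only at h1
    rw [hpull, hpull] at h1
    have h2 := he'.smul_injective' (psec_ν_injective T.line Q.le_preimage Q.preimage_le h1)
    rw [D.quot.inj U h2]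
  · intro m
    obtain ⟨l, hl⟩ := T.exists_desc Q m
    have hl' := T.act_eq_of_psec_eq Q hl
    obtain ⟨f, rfl⟩ := he'.exists_smul' l
    obtain ⟨g, rfl⟩ := D.quot.desc U f (by
      apply he'.smul_injective'
      rw [act_smul, act_res, h] at hl'
      exact hl')
    exact ⟨pb Q.ν₁ le_rfl g, T.sec_injective Q _ (by dsimp only; rw [hpull, hl])⟩

lemma exists_isGenerator_over {y : Q.N₁} (hy : Q.ν₁ y ∈ D.π '' I) {W : Q.N₁.Opens} (hyW : y ∈ W) :
    ∃ V ≤ W, y ∈ V ∧ IsIso (Q.μ ∣_ V) ∧ (∀ q ∈ V, Q.ν₁ q ∈ D.T → q = y) ∧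
      ∃ n : Γ(Q.glue T.j, V), IsGenerator (Q.glue T.j) n ∧
        IsGenerator T.M (homLE (Q.glueι T.j) (le_refl (Q.μ ⁻¹ᵁ V)) n) := by
  obtain ⟨V, hVW, hyV, hV, hiso⟩ := Q.exists_isIso_of_mem hy hyW
  obtain ⟨z, rfl⟩ := Q.μ_surjective y
  obtain ⟨U, m, hzU, hm⟩ := isLineBundle_iff.1 T.isLineBundle z
  obtain ⟨V', hV', hVU⟩ := exists_preimage_eq Q.μ hV (inf_le_left : Q.μ ⁻¹ᵁ V ⊓ U ≤ Q.μ ⁻¹ᵁ V)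
  have hzV' : z ∈ Q.μ ⁻¹ᵁ V' := hVU ▸ ⟨hyV, hzU⟩
  have hglue : ∀ (W : Q.N₁.Opens) (_ : W ≤ V') (m : Γ(T.M, Q.μ ⁻¹ᵁ W)), m ∈ Q.glueSet T.j W := by
    intro W hW m x hx
    refine glueAt_of_vanishesAt fun p hp hpx => ?_
    subst hpx
    have h1 : Q.ν₁ (Q.μ (D.πh p)) ∈ D.T := by
      rw [Q.ν₁_μ_πh]; exact D.apply_mem_T_iff.2 hx.1
    have h2 := hiso _ (hV' (hW hp)) h1
    rw [← h2, Q.ν₁_μ_πh, Partial.mem_image_iff hx.1] at hy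
    exact (hx.2 hy).elim
  have hm' := hm.res (hVU.le.trans inf_le_right)
  obtain ⟨n, hn⟩ := (Q.mem_range_glueι _).2 (hglue V' le_rfl (res T.M (hVU.le.trans inf_le_right) m))
  refine ⟨V', hV'.trans hVW, hzV', isIso_morphismRestrict_mono Q.μ hV' hV,
    fun q hq => hiso q (hV' hq), n, fun W hW => ?_, hn ▸ hm'⟩
  have hb := pb_bijective_of_isIso Q.μ hV (hW.trans hV')
  have key : ∀ f : Γ(Q.N₁, W), homLE (Q.glueι T.j) (le_refl (Q.μ ⁻¹ᵁ W)) (f • res _ hW n) =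
      pb Q.μ le_rfl f • res T.M (Q.μ.preimage_mono hW)
        (res T.M (hVU.le.trans inf_le_right) m) := by
    intro f
    rw [homLE_smul, homLE_res, ← hn, res_homLE]
  constructor
  · intro f f' hff
    have h1 := congrArg (homLE (Q.glueι T.j) (le_refl (Q.μ ⁻¹ᵁ W))) hff
    dsimp only at h1
    rw [key, key] at h1
    exact hb.1 (hm'.smul_injective _ h1)
  · intro k
    obtain ⟨f, hf⟩ := hm'.exists_smul (Q.μ.preimage_mono hW)
      (homLE (Q.glueι T.j) (le_refl (Q.μ ⁻¹ᵁ W)) k)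
    obtain ⟨g, rfl⟩ := hb.2 f
    exact ⟨g, Q.homLE_glueι_injective W (by dsimp only; rw [key, hf])⟩

include T in
lemma exists_invGen (y : D.C) (hy : IsClosed {y}) (hyI : y ∉ D.π '' I) : D.InvGen φ y := by
  by_cases hyT : y ∈ D.T
  · refine (D.invGen_or T.line T.lin hy).resolve_right fun h => ?_
    obtain ⟨x, hx, rfl⟩ := hyT
    exact hyI ⟨x, T.eq ▸ ⟨hx, h⟩, rfl⟩
  · exact D.invGen_of_notMem T.line T.lin hy hyT

lemma isLineBundle_glue : IsLineBundle (Q.glue T.j) := by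
  rw [isLineBundle_iff]
  intro y₀
  obtain ⟨V, hV, n, hn⟩ := forall_of_closed Q.s₁
    (P := fun V => ∃ n : Γ(Q.glue T.j, V), IsGenerator (Q.glue T.j) n) (fun y hy => by
      by_cases hyI : Q.ν₁ y ∈ D.π '' I
      · obtain ⟨V, -, hyV, -, -, n, hn, -⟩ := T.exists_isGenerator_over Q hyI (Opens.mem_top y)
        exact ⟨V, hyV, n, hn⟩
      · obtain ⟨V, hV, hyV, e, he, hφe⟩ := HasInvGen.exists_le _ (T.exists_invGen (Q.ν₁ y)
          (isClosed_singleton_apply Q.ν₁ hy) hyI) (W := Q.G) hyI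
        obtain ⟨n, -, hn⟩ := T.exists_isGenerator_away Q hV he hφe
        exact ⟨Q.ν₁ ⁻¹ᵁ V, hyV, n, hn⟩) y₀
  exact ⟨V, n, hV, hn⟩

/-- The section of `L` given by a section of the glued sheaf. -/
noncomputable def inclSec (V : D.C.Opens) : Γ(Q.glue T.j, Q.ν₁ ⁻¹ᵁ V) →+ Γ(L, D.π ⁻¹ᵁ V) :=
  AddMonoidHom.mk' (fun n => (T.exists_desc Q n).choose) fun n n' => by
    apply psec_ν_injective T.line Q.le_preimage Q.preimage_le
    refine (T.exists_desc Q (n + n')).choose_spec.trans ?_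
    rw [map_add, map_add, (T.exists_desc Q n).choose_spec, (T.exists_desc Q n').choose_spec]

lemma psec_inclSec {V : D.C.Opens} (n : Γ(Q.glue T.j, Q.ν₁ ⁻¹ᵁ V)) :
    psec D.ν L Q.le_preimage (T.inclSec Q V n) = T.sec Q _ n :=
  (T.exists_desc Q n).choose_spec

lemma act_inclSec {V : D.C.Opens} (n : Γ(Q.glue T.j, Q.ν₁ ⁻¹ᵁ V)) :
    act D.adm.invariant φ (T.inclSec Q V n) = T.inclSec Q V n :=
  T.act_eq_of_psec_eq Q (T.psec_inclSec Q n)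

lemma inclSec_injective (V : D.C.Opens) : Function.Injective (T.inclSec Q V) := fun n n' h =>
  T.sec_injective Q _ (by rw [← psec_inclSec, h, psec_inclSec])

include T in
lemma act_act {V : D.C.Opens} (l : Γ(L, D.π ⁻¹ᵁ V)) :
    act D.adm.invariant φ (act D.adm.invariant φ l) = l := T.lin.act_act _ l

lemma exists_inclSec {V : D.C.Opens} {l : Γ(L, D.π ⁻¹ᵁ V)} (h : act D.adm.invariant φ l = l) :
    ∃ n, T.inclSec Q V n = l := by
  obtain ⟨n, hn⟩ := T.exists_sec Q h
  exact ⟨n, psec_ν_injective T.line Q.le_preimage Q.preimage_le (by rw [psec_inclSec, hn])⟩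

lemma inclSec_res {U V : D.C.Opens} (h : V ≤ U) (n : Γ(Q.glue T.j, Q.ν₁ ⁻¹ᵁ U)) :
    T.inclSec Q V (res _ (Q.ν₁.preimage_mono h) n) =
      res L (D.π.preimage_mono h) (T.inclSec Q U n) := by
  apply psec_ν_injective T.line Q.le_preimage Q.preimage_le
  rw [psec_inclSec, sec_res, psec_res, ← psec_inclSec, res_psec]

lemma inclSec_smul {V : D.C.Opens} (r : Γ(D.C, V)) (n : Γ(Q.glue T.j, Q.ν₁ ⁻¹ᵁ V)) :
    T.inclSec Q V (pb Q.ν₁ (le_refl (Q.ν₁ ⁻¹ᵁ V)) r • n) =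
      pb D.π (le_refl (D.π ⁻¹ᵁ V)) r • T.inclSec Q V n := by
  apply psec_ν_injective T.line Q.le_preimage Q.preimage_le
  have e1 : (D.πh ≫ Q.μ) ≫ Q.ν₁ = D.ν ≫ D.π := by rw [Category.assoc, Q.fac, D.comm]
  rw [psec_inclSec, sec_smul, psec_smul, psec_inclSec, pb_pb, pb_pb, pb_pb, pb_congr e1]

/-- Half of the sum of a section and its image under the action. -/
noncomputable def avg (φ : L ⟶ (Scheme.Modules.pushforward D.τ).obj L) {V : D.C.Opens}
    (l : Γ(L, D.π ⁻¹ᵁ V)) : Γ(L, D.π ⁻¹ᵁ V) :=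
  (cst D.s' (D.π ⁻¹ᵁ V) (1 / 2) : Γ(D.C', D.π ⁻¹ᵁ V)) • (l + act D.adm.invariant φ l)

include T in
lemma act_avg {V : D.C.Opens} (l : Γ(L, D.π ⁻¹ᵁ V)) :
    act D.adm.invariant φ (avg φ l) = avg φ l := by
  have h : tw D.adm.invariant (cst D.s' (D.π ⁻¹ᵁ V) (1 / 2)) = cst D.s' _ (1 / 2) :=
    pb_cst D.τ D.τ_s' _ _
  rw [avg, act_smul, h, map_add, T.act_act, add_comm]

lemma half_add_half {V : D.C.Opens} (l : Γ(L, D.π ⁻¹ᵁ V)) :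
    (cst D.s' (D.π ⁻¹ᵁ V) (1 / 2) : Γ(D.C', D.π ⁻¹ᵁ V)) • (l + l) = l := by
  rw [smul_add, ← add_smul, ← map_add, add_halves, map_one, one_smul]

lemma avg_of_act_eq {V : D.C.Opens} {l : Γ(L, D.π ⁻¹ᵁ V)} (h : act D.adm.invariant φ l = l) :
    avg φ l = l := by
  rw [avg, h, half_add_half]

lemma avg_of_act_eq_neg {V : D.C.Opens} {l : Γ(L, D.π ⁻¹ᵁ V)} (h : act D.adm.invariant φ l = -l) :
    avg φ l = 0 := by
  rw [avg, h, add_neg_cancel, smul_zero]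

/-- The projection of a section of `L` to its invariant part. -/
noncomputable def projSec (V : D.C.Opens) : Γ(L, D.π ⁻¹ᵁ V) →+ Γ(Q.glue T.j, Q.ν₁ ⁻¹ᵁ V) :=
  AddMonoidHom.mk' (fun l => (T.exists_inclSec Q (T.act_avg l)).choose) fun l l' => by
    apply T.inclSec_injective Q
    refine (T.exists_inclSec Q (T.act_avg (l + l'))).choose_spec.trans ?_
    rw [map_add, (T.exists_inclSec Q (T.act_avg l)).choose_spec,
      (T.exists_inclSec Q (T.act_avg l')).choose_spec, avg, avg, avg, ← smul_add, map_add,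
      add_add_add_comm]

lemma inclSec_projSec {V : D.C.Opens} (l : Γ(L, D.π ⁻¹ᵁ V)) :
    T.inclSec Q V (T.projSec Q V l) = avg φ l := (T.exists_inclSec Q (T.act_avg l)).choose_spec

/-- The inclusion of the direct image of the glued sheaf in the direct image of `L`. -/
noncomputable def incl : (Scheme.Modules.pushforward Q.ν₁).obj (Q.glue T.j) ⟶
    (Scheme.Modules.pushforward D.π).obj L :=
  mkHom ((Scheme.Modules.pushforward Q.ν₁).obj (Q.glue T.j)) ((Scheme.Modules.pushforward D.π).obj L)
    (fun V => T.inclSec Q V) (fun _ _ h n => T.inclSec_res Q h n) (fun U r n => by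
      have := T.inclSec_smul Q r n
      rw [← app_eq_pb, ← app_eq_pb] at this
      exact this)

/-- The projection of the direct image of `L` to its invariant part. -/
noncomputable def proj : (Scheme.Modules.pushforward D.π).obj L ⟶
    (Scheme.Modules.pushforward Q.ν₁).obj (Q.glue T.j) :=
  mkHom ((Scheme.Modules.pushforward D.π).obj L) ((Scheme.Modules.pushforward Q.ν₁).obj (Q.glue T.j))
    (fun V => T.projSec Q V)
    (fun U V h => fun (l : Γ(L, D.π ⁻¹ᵁ U)) => by
      have : T.projSec Q V (res L (D.π.preimage_mono h) l) =
          res _ (Q.ν₁.preimage_mono h) (T.projSec Q U l) := by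
        apply T.inclSec_injective Q
        rw [inclSec_projSec, T.inclSec_res Q h, inclSec_projSec, avg, avg, res_smul, fres_cst, map_add,
          ← act_res]
      exact this)
    (fun U r => fun (l : Γ(L, D.π ⁻¹ᵁ U)) => by
      have : T.projSec Q U (pb D.π (le_refl (D.π ⁻¹ᵁ U)) r • l) =
          pb Q.ν₁ (le_refl (Q.ν₁ ⁻¹ᵁ U)) r • T.projSec Q U l := by
        apply T.inclSec_injective Q
        rw [inclSec_projSec, inclSec_smul, inclSec_projSec, avg, avg, act_smul, tw_pb, ← smul_add,
          smul_comm]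
      rw [← app_eq_pb, ← app_eq_pb] at this
      exact this)

/-- The direct image of `L` is the sum of its eigensheaves. -/
theorem exists_iso {I' : Set D.C'} (T' : D.Twist L (-φ) I') (Q' : D.Partial I') :
    ∃ e : (Scheme.Modules.pushforward D.π).obj L ≅
        (Scheme.Modules.pushforward Q.ν₁).obj (Q.glue T.j) ⊞
          (Scheme.Modules.pushforward Q'.ν₁).obj (Q'.glue T'.j),
      action D.adm.invariant φ ≫ e.hom = e.hom ≫ biprod.map (𝟙 _) (-𝟙 _) := by
  have hneg : ∀ {V : D.C.Opens} (n : Γ(Q'.glue T'.j, Q'.ν₁ ⁻¹ᵁ V)),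
      act D.adm.invariant φ (T'.inclSec Q' V n) = -T'.inclSec Q' V n := fun n => by
    have := T'.act_inclSec Q' n
    rwa [act_neg, neg_eq_iff_eq_neg] at this
  have h₁₁ : T.incl Q ≫ T.proj Q = 𝟙 _ := hom_ext' fun V (n : Γ(Q.glue T.j, Q.ν₁ ⁻¹ᵁ V)) => by
    change T.projSec Q V (T.inclSec Q V n) = n
    apply T.inclSec_injective Q
    rw [inclSec_projSec, avg_of_act_eq (T.act_inclSec Q n)]
  have h₁₂ : T.incl Q ≫ T'.proj Q' = 0 := hom_ext' fun V (n : Γ(Q.glue T.j, Q.ν₁ ⁻¹ᵁ V)) => by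
    change T'.projSec Q' V (T.inclSec Q V n) = 0
    apply T'.inclSec_injective Q'
    rw [inclSec_projSec, avg_of_act_eq_neg (by rw [act_neg, T.act_inclSec Q n]), map_zero]
  have h₂₁ : T'.incl Q' ≫ T.proj Q = 0 := hom_ext' fun V (n : Γ(Q'.glue T'.j, Q'.ν₁ ⁻¹ᵁ V)) => by
    change T.projSec Q V (T'.inclSec Q' V n) = 0
    apply T.inclSec_injective Q
    rw [inclSec_projSec, avg_of_act_eq_neg (hneg n), map_zero]
  have h₂₂ : T'.incl Q' ≫ T'.proj Q' = 𝟙 _ := hom_ext' fun V (n : Γ(Q'.glue T'.j, Q'.ν₁ ⁻¹ᵁ V)) => by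
    change T'.projSec Q' V (T'.inclSec Q' V n) = n
    apply T'.inclSec_injective Q'
    rw [inclSec_projSec, avg_of_act_eq (T'.act_inclSec Q' n)]
  have hsum : T.proj Q ≫ T.incl Q + T'.proj Q' ≫ T'.incl Q' = 𝟙 _ :=
    hom_ext' fun V (l : Γ(L, D.π ⁻¹ᵁ V)) => by
      change T.inclSec Q V (T.projSec Q V l) + T'.inclSec Q' V (T'.projSec Q' V l) = l
      rw [inclSec_projSec, inclSec_projSec, avg, avg, ← smul_add, act_neg, add_add_add_comm,
        add_neg_cancel, add_zero, half_add_half]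
  have ha₁ : action D.adm.invariant φ ≫ T.proj Q = T.proj Q :=
    hom_ext' fun V (l : Γ(L, D.π ⁻¹ᵁ V)) => by
      change T.projSec Q V (act D.adm.invariant φ l) = T.projSec Q V l
      apply T.inclSec_injective Q
      rw [inclSec_projSec, inclSec_projSec, avg, avg, T.act_act, add_comm]
  have ha₂ : action D.adm.invariant φ ≫ T'.proj Q' = -T'.proj Q' :=
    hom_ext' fun V (l : Γ(L, D.π ⁻¹ᵁ V)) => by
      change T'.projSec Q' V (act D.adm.invariant φ l) = -T'.projSec Q' V l
      apply T'.inclSec_injective Q'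
      rw [map_neg, inclSec_projSec, inclSec_projSec, avg, avg, act_neg, act_neg, T.act_act,
        ← smul_neg, neg_add, neg_neg, add_comm]
  refine ⟨biprodIso (T.incl Q) (T'.incl Q') (T.proj Q) (T'.proj Q') h₁₁ h₁₂ h₂₁ h₂₂ hsum, ?_⟩
  change action D.adm.invariant φ ≫ biprod.lift _ _ = biprod.lift _ _ ≫ _
  apply biprod.hom_ext
  · simp [ha₁]
  · simp [ha₂]

end Twist

end Cover


/-! ### Generic points -/

section Generic

variable {X : Scheme.{0}}

/-- `ξ` is the generic point of an irreducible component. -/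
def IsGeneric (ξ : X) : Prop := ∀ η : X, η ⤳ ξ → η = ξ

lemma exists_isGeneric (x : X) : ∃ ξ : X, IsGeneric ξ ∧ ξ ⤳ x := by
  have hirr := isIrreducible_irreducibleComponent (x := x)
  have hg := hirr.isGenericPoint_genericPoint_closure
  rw [isClosed_irreducibleComponent.closure_eq] at hg
  refine ⟨hirr.genericPoint, fun η hη => ?_, hg.specializes mem_irreducibleComponent⟩
  have h1 : irreducibleComponent x ⊆ closure {η} := by
    rw [← hg.def]
    exact hη.closure_subset
  have h2 : closure {η} ≤ irreducibleComponent x :=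
    (irreducibleComponent_mem_irreducibleComponents x).2 isIrreducible_singleton.closure h1
  have h3 : closure {η} = irreducibleComponent x := le_antisymm h2 h1
  exact (IsGenericPoint.eq (h3 : IsGenericPoint η _) hg)

/-- Every point of `X` has a neighbourhood meeting only the components through the point. -/
lemma exists_isGeneric_specializes [NoetherianSpace X] (x : X) {W : X.Opens} (hW : x ∈ W) :
    ∃ U ≤ W, x ∈ U ∧ ∀ ξ ∈ U, IsGeneric ξ → ξ ⤳ x := by
  have hfin : {ξ : X | IsGeneric ξ}.Finite := by
    refine Set.Finite.of_finite_image (f := fun ξ => closure {ξ})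
      (NoetherianSpace.finite_irreducibleComponents.subset ?_) ?_
    · rintro _ ⟨ξ, hξ, rfl⟩
      obtain ⟨η, hη, hηξ⟩ := exists_isGeneric ξ
      have hg := (isIrreducible_irreducibleComponent (x := ξ)).isGenericPoint_genericPoint_closure
      rw [isClosed_irreducibleComponent.closure_eq] at hg
      have h1 := hξ _ (hg.specializes mem_irreducibleComponent)
      have h2 : closure {ξ} = irreducibleComponent ξ := by
        rw [← hg.def]
        exact congrArg (fun z => closure {z}) h1.symm
      change closure {ξ} ∈ _
      rw [h2]
      exact irreducibleComponent_mem_irreducibleComponents ξ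
    · intro ξ _ η _ h
      exact IsGenericPoint.eq (rfl : IsGenericPoint ξ (closure {ξ})) h.symm
  let Z : Set X := ⋃ ξ ∈ {ξ : X | IsGeneric ξ ∧ ¬ ξ ⤳ x}, closure {ξ}
  have hZ : IsClosed Z := (hfin.subset fun ξ h => h.1).isClosed_biUnion fun _ _ => isClosed_closure
  refine ⟨⟨Zᶜ, hZ.isOpen_compl⟩ ⊓ W, inf_le_right, ⟨?_, hW⟩, ?_⟩
  · intro h
    obtain ⟨ξ, hξ, hx⟩ := Set.mem_iUnion₂.1 h
    exact hξ.2 (specializes_iff_mem_closure.2 hx)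
  · intro ξ hξU hξ
    by_contra h
    exact hξU.1 (Set.mem_iUnion₂.2 ⟨ξ, ⟨hξ, h⟩, subset_closure rfl⟩)

/-- A function on a reduced scheme vanishes near a generic point if it does so at this point. -/
lemma IsGeneric.germ_eq_zero [NoetherianSpace X] [IsReduced X] {ξ : X} (hξ : IsGeneric ξ)
    {U : X.Opens} {hU : ξ ∈ U} {f : Γ(X, U)} (hf : f ∈ idealAt U ξ hU) :
    X.presheaf.germ U ξ hU f = 0 := by
  obtain ⟨V, hVU, hξV, hV⟩ := exists_isGeneric_specializes ξ hU
  have h1 : fres hVU f = 0 := by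
    refine eq_zero_of_forall_mem_idealAt _ fun p hp => ?_
    obtain ⟨η, hη, hηp⟩ := exists_isGeneric p
    have h2 : η = ξ := hξ η (hV η (hηp.mem_open V.2 hp) hη)
    subst h2
    rw [fres_mem_idealAt]
    exact idealAt_le_of_specializes (hp := hU) hηp hf
  rw [← germ_fres hVU f ξ hξV, h1, map_zero]

lemma IsGeneric.isUnit_or_eq_zero [NoetherianSpace X] [IsReduced X] {ξ : X} (hξ : IsGeneric ξ)
    (a : X.presheaf.stalk ξ) : IsUnit a ∨ a = 0 := by
  obtain ⟨U, hU, f, rfl⟩ := exists_germ ξ a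
  by_cases hf : f ∈ idealAt U ξ hU
  · exact Or.inr (hξ.germ_eq_zero hf)
  · exact Or.inl (isUnit_germ_iff.2 hf)

/-- A function vanishing at all generic points is zero. -/
lemma eq_zero_of_germ_generic [IsReduced X] {U : X.Opens} (f : Γ(X, U))
    (h : ∀ ξ (hξ : ξ ∈ U), IsGeneric ξ → X.presheaf.germ U ξ hξ f = 0) : f = 0 := by
  refine eq_zero_of_forall_mem_idealAt _ fun p hp => ?_
  obtain ⟨ξ, hξ, hξp⟩ := exists_isGeneric p
  refine idealAt_le_of_specializes (hp := hξp.mem_open U.2 hp) hξp ?_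
  rw [mem_idealAt, h ξ _ hξ]
  exact zero_mem _

lemma germ_specializes {p ξ : X} (h : ξ ⤳ p) {U : X.Opens} (hp : p ∈ U) (f : Γ(X, U)) :
    (X.presheaf.stalkSpecializes h).hom (X.presheaf.germ U p hp f) =
      X.presheaf.germ U ξ (h.mem_open U.2 hp) f :=
  ConcreteCategory.congr_hom (X.presheaf.germ_stalkSpecializes (U := U) hp h) f

/-- There is only one component through a point at which the local ring is a domain. -/
lemma IsGeneric.eq_of_specializes {p ξ η : X} (hd : IsDVR (X.presheaf.stalk p)) (hξ : IsGeneric ξ)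
    (hη : IsGeneric η) (h : ξ ⤳ p) (h' : η ⤳ p) : ξ = η := by
  obtain ⟨hd, hv⟩ := hd
  obtain ⟨U, hU, hp, -⟩ := exists_affine_le p (W := ⊤) trivial
  have hpr : (RingHom.ker (X.presheaf.germ U p hp).hom).IsPrime := RingHom.ker_isPrime _
  obtain ⟨ζ, hζ, e⟩ := exists_idealAt_eq hU (RingHom.ker (X.presheaf.germ U p hp).hom)
  have key : ∀ ξ : X, IsGeneric ξ → ξ ⤳ p → ζ = ξ := by
    intro ξ hξ h
    refine hξ ζ (specializes_of_idealAt_le hU (hp := hζ) (hq := h.mem_open U.2 hp) ?_)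
    rw [e]
    intro f hf
    have h1 : X.presheaf.germ U p hp f = 0 := hf
    rw [mem_idealAt, ← germ_specializes h hp, h1, map_zero]
    exact zero_mem _
  rw [← key ξ hξ h, ← key η hη h']

lemma IsGeneric.ne_of_isDVR {p ξ : X} (hd : IsDVR (X.presheaf.stalk p)) (hξ : IsGeneric ξ) :
    ξ ≠ p := by
  rintro rfl
  obtain ⟨η, hη, hne⟩ := exists_specializes_ne hd
  exact hne (hξ η hη)

/-- A nonzero function near a point at which the local ring is a domain does not vanish at the
generic point. -/
lemma specializes_ne_zero {p ξ : X} (hd : IsDVR (X.presheaf.stalk p)) (hξ : IsGeneric ξ) (h : ξ ⤳ p)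
    {a : X.presheaf.stalk p} (ha : a ≠ 0) : (X.presheaf.stalkSpecializes h).hom a ≠ 0 := by
  intro h0
  obtain ⟨hd', hv⟩ := id hd
  obtain ⟨W, hpW, b, rfl⟩ := exists_germ p a
  obtain ⟨U, hU, hp, hUW⟩ := exists_affine_le p hpW
  have hpr : (RingHom.ker (X.presheaf.germ U p hp).hom).IsPrime := RingHom.ker_isPrime _
  obtain ⟨ζ, hζ, e⟩ := exists_idealAt_eq hU (RingHom.ker (X.presheaf.germ U p hp).hom)
  have h2 : ζ = ξ := by
    refine hξ ζ (specializes_of_idealAt_le hU (hp := hζ) (hq := h.mem_open U.2 hp) ?_)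
    rw [e]
    intro f hf
    have h1 : X.presheaf.germ U p hp f = 0 := hf
    rw [mem_idealAt, ← germ_specializes h hp, h1, map_zero]
    exact zero_mem _
  subst h2
  have h3 : fres hUW b ∈ idealAt U ζ hζ := by
    rw [germ_specializes] at h0
    rw [mem_idealAt, germ_fres, h0]
    exact zero_mem _
  rw [e] at h3
  have h4 : X.presheaf.germ U p hp (fres hUW b) = 0 := h3
  rw [germ_fres] at h4
  exact ha h4

end Generic

/-! ### Differentials -/

section Differentials

/-- The differentials of a local `ℂ`-algebra with principal maximal ideal. -/
lemma exists_D_eq_smul_D {A : Type*} [CommRing A] [IsLocalRing A] [Algebra ℂ A]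
    [Algebra.EssFiniteType ℂ A] {t : A} (ht : IsLocalRing.maximalIdeal A = Ideal.span {t})
    (hc : ∀ b : A, ∃ c : ℂ, b - algebraMap ℂ A c ∈ IsLocalRing.maximalIdeal A) (b : A) :
    ∃ a : A, KaehlerDifferential.D ℂ A b = a • KaehlerDifferential.D ℂ A t := by
  have h1 : (⊤ : Submodule A (Ω[A⁄ℂ])) ≤ Submodule.span A {KaehlerDifferential.D ℂ A t} := by
    refine Submodule.le_of_le_smul_of_le_jacobson_bot (I := IsLocalRing.maximalIdeal A)
      Module.Finite.fg_top (IsLocalRing.maximalIdeal_le_jacobson _) ?_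
    rw [← KaehlerDifferential.span_range_derivation, Submodule.span_le]
    rintro _ ⟨b, rfl⟩
    obtain ⟨c, hc⟩ := hc b
    rw [ht, Ideal.mem_span_singleton] at hc
    obtain ⟨d, hd⟩ := hc
    have h2 : KaehlerDifferential.D ℂ A b =
        d • KaehlerDifferential.D ℂ A t + t • KaehlerDifferential.D ℂ A d := by
      rw [eq_add_of_sub_eq hd, map_add, Derivation.map_algebraMap, add_zero, Derivation.leibniz,
        add_comm]
    rw [h2]
    refine add_mem (Submodule.mem_sup_left (Submodule.smul_mem _ _ (Submodule.mem_span_singleton_self _)))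
      (Submodule.mem_sup_right (Submodule.smul_mem_smul ?_ ?_))
    · rw [ht]; exact Ideal.mem_span_singleton_self t
    · rw [KaehlerDifferential.span_range_derivation]; trivial
  obtain ⟨a, ha⟩ := Submodule.mem_span_singleton.1 (h1 (x := KaehlerDifferential.D ℂ A b) trivial)
  exact ⟨a, ha.symm⟩

variable {A K : Type*} [CommRing A] [CommRing K] [Algebra ℂ A] [Algebra ℂ K]

lemma exists_D_map_eq (φ : A →+* K) (hφ : ∀ c, φ (algebraMap ℂ A c) = algebraMap ℂ K c) {a b t : A}
    (h : KaehlerDifferential.D ℂ A b = a • KaehlerDifferential.D ℂ A t) :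
    KaehlerDifferential.D ℂ K (φ b) = φ a • KaehlerDifferential.D ℂ K (φ t) := by
  let := φ.toAlgebra
  have : IsScalarTower ℂ A K := IsScalarTower.of_algebraMap_eq fun c => (hφ c).symm
  have h1 := congrArg (KaehlerDifferential.map ℂ ℂ A K) h
  rw [map_smul, KaehlerDifferential.map_D, KaehlerDifferential.map_D] at h1
  exact h1

lemma mem_regularDifferentials_iff [IsLocalRing A] [Algebra.EssFiniteType ℂ A] (φ : A →+* K)
    (hφ : ∀ c, φ (algebraMap ℂ A c) = algebraMap ℂ K c) {t : A}
    (ht : IsLocalRing.maximalIdeal A = Ideal.span {t})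
    (hc : ∀ b : A, ∃ c : ℂ, b - algebraMap ℂ A c ∈ IsLocalRing.maximalIdeal A) (η : Ω[K⁄ℂ]) :
    η ∈ regularDifferentials φ ↔ ∃ a : A, η = φ a • KaehlerDifferential.D ℂ K (φ t) := by
  constructor
  · intro h
    induction h using AddSubgroup.closure_induction with
    | mem x hx =>
      obtain ⟨⟨a, b⟩, rfl⟩ := hx
      obtain ⟨a', ha'⟩ := exists_D_eq_smul_D ht hc b
      exact ⟨a * a', by
        dsimp only
        rw [exists_D_map_eq φ hφ ha', smul_smul, map_mul]⟩
    | zero => exact ⟨0, by rw [map_zero, zero_smul]⟩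
    | add x y _ _ hx hy =>
      obtain ⟨a, rfl⟩ := hx
      obtain ⟨b, rfl⟩ := hy
      exact ⟨a + b, by rw [map_add, add_smul]⟩
    | neg x _ hx =>
      obtain ⟨a, rfl⟩ := hx
      exact ⟨-a, by rw [map_neg, neg_smul]⟩
  · rintro ⟨a, rfl⟩
    exact AddSubgroup.subset_closure ⟨⟨a, t⟩, rfl⟩

end Differentials

section Stalks

variable {Y : Scheme.{0}} (s : Y ⟶ Spec (.of ℂ)) [LocallyOfFiniteType s]

lemma essFiniteType_stalk (y : Y) : (stalkAlgebra s y).algebraMap.EssFiniteType := by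
  let S := Spec (.of ℂ)
  let g : ℂ →+* S.presheaf.stalk (s y) :=
    ((Scheme.ΓSpecIso (.of ℂ)).inv ≫ S.presheaf.germ ⊤ (s y) trivial).hom
  have hg : Function.Surjective g := by
    intro a
    have hU : IsAffineOpen (⊤ : S.Opens) := isAffineOpen_top S
    obtain ⟨f, b, hb, h1⟩ := exists_mul_germ hU (p := s y) trivial a
    have hsurj : Function.Bijective (Scheme.ΓSpecIso (.of ℂ)).inv.hom :=
      ConcreteCategory.bijective_of_isIso (Scheme.ΓSpecIso (.of ℂ)).inv
    obtain ⟨f, rfl⟩ := hsurj.2 f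
    obtain ⟨b, rfl⟩ := hsurj.2 b
    have hb0 : b ≠ 0 := by
      rintro rfl
      rw [map_zero] at hb
      exact hb (zero_mem _)
    have h2 : g b * a = g f := h1
    refine ⟨b⁻¹ * f, ?_⟩
    rw [map_mul, ← h2, ← mul_assoc, ← map_mul, inv_mul_cancel₀ hb0, map_one, one_mul]
  have h1 : (stalkAlgebra s y).algebraMap = (s.stalkMap y).hom.comp g := by
    have := Scheme.Hom.germ_stalkMap s ⊤ y trivial
    change ((Scheme.ΓSpecIso (.of ℂ)).inv ≫ s.appTop ≫ Y.presheaf.germ ⊤ y trivial).hom =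
      ((Scheme.ΓSpecIso (.of ℂ)).inv ≫ S.presheaf.germ ⊤ (s y) trivial ≫ s.stalkMap y).hom
    rw [this]
    rfl
  rw [h1]
  exact RingHom.EssFiniteType.comp (RingHom.FiniteType.of_surjective g hg).essFiniteType
    (LocallyOfFiniteType.stalkMap s y)

variable [∀ y : Y, Algebra ℂ (Y.presheaf.stalk y)]
  (hA : ∀ y : Y, algebraMap ℂ (Y.presheaf.stalk y) = (stalkAlgebra s y).algebraMap)

include hA

omit [LocallyOfFiniteType s] in
lemma algebraMap_eq_germ {y : Y} {U : Y.Opens} (hy : y ∈ U) (c : ℂ) :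
    algebraMap ℂ (Y.presheaf.stalk y) c = Y.presheaf.germ U y hy (cst s U c) := by
  rw [hA, germ_cst]

omit [LocallyOfFiniteType s] in
lemma specializes_algebraMap {p ξ : Y} (h : ξ ⤳ p) (c : ℂ) :
    (Y.presheaf.stalkSpecializes h).hom (algebraMap ℂ (Y.presheaf.stalk p) c) =
      algebraMap ℂ (Y.presheaf.stalk ξ) c := by
  rw [algebraMap_eq_germ s hA (Opens.mem_top p), algebraMap_eq_germ s hA (Opens.mem_top ξ),
    germ_specializes]

lemma mem_regularDifferentials_stalk {p ξ : Y} (hp : IsClosed {p}) (h : ξ ⤳ p)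
    (hd : IsDVR (Y.presheaf.stalk p)) {t : Y.presheaf.stalk p} (ht : Irreducible t)
    (η : Ω[Y.presheaf.stalk ξ⁄ℂ]) :
    η ∈ regularDifferentials (Y.presheaf.stalkSpecializes h).hom ↔
      ∃ a, η = (Y.presheaf.stalkSpecializes h).hom a •
        KaehlerDifferential.D ℂ _ ((Y.presheaf.stalkSpecializes h).hom t) := by
  obtain ⟨_, _⟩ := hd
  have : Algebra.EssFiniteType ℂ (Y.presheaf.stalk p) := by
    rw [← RingHom.essFiniteType_algebraMap, hA]
    exact essFiniteType_stalk s p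
  refine mem_regularDifferentials_iff _ (specializes_algebraMap s hA h) ht.maximalIdeal_eq
    (fun b => ?_) η
  obtain ⟨U, hpU, f, rfl⟩ := exists_germ p b
  obtain ⟨c, hc⟩ := exists_cst_sub_mem s hp hpU f
  refine ⟨c, ?_⟩
  rw [mem_idealAt, map_sub] at hc
  rwa [algebraMap_eq_germ s hA hpU]

end Stalks


section Rosenlicht

variable {X Y : Scheme.{0}} (n : Y ⟶ X) [∀ y : Y, Algebra ℂ (Y.presheaf.stalk y)]

/-- Rational differentials over an open set. -/
abbrev RatDiff (U : X.Opens) : Type := ∀ ξ : GenericOver n U, Ω[Y.presheaf.stalk ξ.1⁄ℂ]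

variable {n} in
/-- Restriction of rational differentials. -/
def RatDiff.restr {U V : X.Opens} (i : V ≤ U) (ω : RatDiff n U) : RatDiff n V :=
  fun ξ => ω ⟨ξ.1, ξ.2.1, i ξ.2.2⟩

variable {n} in
/-- The condition on the poles and residues at the points over `x`. -/
def RatDiff.PoleCond {U : X.Opens} (ω : RatDiff n U) (x : X) : Prop :=
  ∃ r : Y → ℂ, (∀ p : Y, n p = x → ∀ (ξ : GenericOver n U) (h : ξ.1 ⤳ p),
    HasSimplePole (Y.presheaf.stalkSpecializes h).hom (ω ξ) (r p)) ∧
      ∑ᶠ p ∈ {p : Y | n p = x}, r p = 0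

variable {n} in
lemma RatDiff.poleCond_restr {U V : X.Opens} (i : V ≤ U) (ω : RatDiff n U) {x : X} (hx : x ∈ V) :
    (ω.restr i).PoleCond x ↔ ω.PoleCond x := by
  refine exists_congr fun r => and_congr_left fun _ => forall₂_congr fun p hp => ?_
  constructor
  · intro H ξ h
    have hpV : p ∈ n ⁻¹ᵁ V := by
      rw [Scheme.Hom.mem_preimage, hp]
      exact hx
    have hξV : n ξ.1 ∈ V := h.mem_open (n ⁻¹ᵁ V).2 hpV
    exact H (⟨ξ.1, ξ.2.1, hξV⟩ : GenericOver n V) h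
  · intro H ξ h
    exact H (⟨ξ.1, ξ.2.1, i ξ.2.2⟩ : GenericOver n U) h

/-- A semilinear map from a sheaf to rational differentials. -/
structure RosMap (W : X.Modules) where
  ρ : ∀ U : X.Opens, Γ(W, U) →+ RatDiff n U
  map_res : ∀ (U V : X.Opens) (i : V ≤ U) (s : Γ(W, U)), ρ V (res W i s) = (ρ U s).restr i
  map_smul : ∀ (U : X.Opens) (f : Γ(X, U)) (s : Γ(W, U)) (ξ : GenericOver n U),
    ρ U (f • s) ξ = Y.presheaf.germ (n ⁻¹ᵁ U) ξ.1 ξ.2.2 (pb n le_rfl f) • ρ U s ξ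

namespace RosMap

variable {n} {W : X.Modules} (R : RosMap n W)

/-- Over `U`, the sheaf is identified with the Rosenlicht differentials. -/
def IsRosOn (U : X.Opens) : Prop :=
  Function.Injective (R.ρ U) ∧
    ∀ ω : RatDiff n U, ω ∈ Set.range (R.ρ U) ↔ ∀ x ∈ U, IsClosed {x} → ω.PoleCond x

lemma isRosenlicht (h : ∀ U, R.IsRosOn U) : IsRosenlicht n W :=
  ⟨R.ρ, fun U V i s ξ => congrFun (R.map_res U V i s) ξ, fun U f s ξ => by
    rw [app_eq_pb]; exact R.map_smul U f s ξ, fun U => (h U).1, fun U => (h U).2⟩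

lemma exists_of_isRosenlicht (h : IsRosenlicht n W) : ∃ R : RosMap n W, ∀ U, R.IsRosOn U := by
  obtain ⟨ρ, h1, h2, h3, h4⟩ := h
  exact ⟨⟨ρ, fun U V i s => funext fun ξ => h1 U V i s ξ, fun U f s ξ => by
    rw [h2, app_eq_pb]⟩, fun U => ⟨h3 U, h4 U⟩⟩

lemma isRosOn_of_locally (s : X ⟶ Spec (.of ℂ)) [LocallyOfFiniteType s] {U : X.Opens}
    (h : ∀ y ∈ U, IsClosed {y} → ∃ V ≤ U, y ∈ V ∧ ∀ V' ≤ V, R.IsRosOn V') : R.IsRosOn U := by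
  have h' : ∀ x ∈ U, ∃ V ≤ U, x ∈ V ∧ ∀ V' ≤ V, R.IsRosOn V' := by
    intro x hx
    obtain ⟨y, hyU, hy, hxy⟩ := exists_closed_mem s hx
    obtain ⟨V, hV, hyV, hR⟩ := h y hyU hy
    exact ⟨V, hV, hxy.mem_open V.2 hyV, hR⟩
  constructor
  · rw [injective_iff_map_eq_zero]
    intro t ht
    refine mod_ext _ _ fun x hx => ?_
    obtain ⟨V, hV, hxV, hR⟩ := h' x hx
    refine ⟨V, hV, hxV, (hR V le_rfl).1 ?_⟩
    rw [R.map_res, R.map_res, ht, map_zero]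
  · intro ω
    constructor
    · rintro ⟨t, rfl⟩ x hx hcl
      obtain ⟨V, hV, hxV, hR⟩ := h' x hx
      have := ((hR V le_rfl).2 (R.ρ V (res W hV t))).1 ⟨_, rfl⟩ x hxV hcl
      rwa [R.map_res, RatDiff.poleCond_restr _ _ hxV] at this
    · intro hω
      have key : ∀ V (hV : V ≤ U), R.IsRosOn V → ∃ t, R.ρ V t = ω.restr hV := fun V hV hR =>
        (hR.2 _).2 fun x hx hcl => (RatDiff.poleCond_restr _ _ hx).2 (hω x (hV hx) hcl)
      obtain ⟨t, ht⟩ := exists_mod_glue (M := W) (U := U)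
        (fun V t => ∃ hV : V ≤ U, R.ρ V t = ω.restr hV)
        (by
          rintro V V' i t - ⟨hV, e⟩
          refine ⟨i.trans hV, ?_⟩
          rw [R.map_res, e]
          rfl)
        (by
          rintro V _ t t' ⟨hV, e⟩ ⟨_, e'⟩
          refine mod_ext _ _ fun x hx => ?_
          obtain ⟨V', hV', hxV', hR⟩ := h' x (hV hx)
          refine ⟨V ⊓ V', inf_le_left, ⟨hx, hxV'⟩, (hR _ inf_le_right).1 ?_⟩
          rw [R.map_res, R.map_res, e, e'])
        (fun x hx => by
          obtain ⟨V, hV, hxV, hR⟩ := h' x hx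
          obtain ⟨t, ht⟩ := key V hV (hR V le_rfl)
          exact ⟨V, hV, hxV, t, hV, ht⟩)
      refine ⟨t, funext fun ξ => ?_⟩
      obtain ⟨V, hV, hxV, hR⟩ := h' _ ξ.2.2
      obtain ⟨t', ht'⟩ := key V hV (hR V le_rfl)
      have h1 := congrFun (R.map_res U V hV t) ⟨ξ.1, ξ.2.1, hxV⟩
      rw [ht V hV t' ⟨hV, ht'⟩, ht'] at h1
      exact h1.symm

end RosMap

/-- A generator near the image of a point, with an associated differential. -/
structure DiffFrame (W : X.Modules) (ξ : Y) where
  V : X.Opens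
  mem : n ξ ∈ V
  w : Γ(W, V)
  gen : IsGenerator W w
  η : Ω[Y.presheaf.stalk ξ⁄ℂ]

namespace DiffFrame

variable {n} {W : X.Modules} {ξ : Y} (F : DiffFrame n W ξ)

lemma mem_preimage {U : X.Opens} (hU : n ξ ∈ U) : ξ ∈ n ⁻¹ᵁ (U ⊓ F.V) := ⟨hU, F.mem⟩

/-- The coefficient of a section in the given frame. -/
noncomputable def coef (U : X.Opens) (hU : n ξ ∈ U) (s : Γ(W, U)) : Y.presheaf.stalk ξ :=
  Y.presheaf.germ (n ⁻¹ᵁ (U ⊓ F.V)) ξ (F.mem_preimage hU)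
    (pb n le_rfl (F.gen.exists_smul (inf_le_right : U ⊓ F.V ≤ F.V) (res W inf_le_left s)).choose)

lemma coef_eq {U O : X.Opens} (hU : n ξ ∈ U) (s : Γ(W, U)) (hOU : O ≤ U) (hOV : O ≤ F.V)
    (hO : ξ ∈ n ⁻¹ᵁ O) {k : Γ(X, O)} (hk : res W hOU s = k • res W hOV F.w) :
    F.coef U hU s = Y.presheaf.germ (n ⁻¹ᵁ O) ξ hO (pb n le_rfl k) := by
  have hle : O ≤ U ⊓ F.V := le_inf hOU hOV
  have h1 := (F.gen.exists_smul (inf_le_right : U ⊓ F.V ≤ F.V) (res W inf_le_left s)).choose_spec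
  have h2 := congrArg (res W hle) h1
  rw [res_res, res_smul, res_res, hk] at h2
  have h3 := F.gen.smul_injective hOV h2
  have h4 := germ_fres (n.preimage_mono hle) (pb n le_rfl (F.gen.exists_smul
    (inf_le_right : U ⊓ F.V ≤ F.V) (res W inf_le_left s)).choose) ξ hO
  rw [fres_pb] at h4
  rw [h3, pb_fres]
  exact h4.symm

lemma exists_coef {U : X.Opens} (s : Γ(W, U)) : ∃ k : Γ(X, U ⊓ F.V),
    res W inf_le_left s = k • res W inf_le_right F.w :=
  F.gen.exists_smul (inf_le_right : U ⊓ F.V ≤ F.V) (res W inf_le_left s)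

lemma coef_zero {U : X.Opens} (hU : n ξ ∈ U) : F.coef U hU (0 : Γ(W, U)) = 0 := by
  rw [F.coef_eq hU 0 inf_le_left inf_le_right (F.mem_preimage hU) (k := 0)
    (by rw [map_zero, zero_smul]), map_zero, map_zero]

lemma coef_add {U : X.Opens} (hU : n ξ ∈ U) (s t : Γ(W, U)) :
    F.coef U hU (s + t) = F.coef U hU s + F.coef U hU t := by
  obtain ⟨k, hk⟩ := F.exists_coef s
  obtain ⟨l, hl⟩ := F.exists_coef t
  rw [F.coef_eq hU s inf_le_left inf_le_right (F.mem_preimage hU) hk,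
    F.coef_eq hU t inf_le_left inf_le_right (F.mem_preimage hU) hl,
    F.coef_eq hU (s + t) inf_le_left inf_le_right (F.mem_preimage hU) (k := k + l)
      (by rw [map_add, hk, hl, add_smul]), map_add, map_add]

lemma coef_res {U V : X.Opens} (i : V ≤ U) (hV : n ξ ∈ V) (s : Γ(W, U)) :
    F.coef V hV (res W i s) = F.coef U (i hV) s := by
  obtain ⟨k, hk⟩ := F.exists_coef (res W i s)
  rw [F.coef_eq hV _ inf_le_left inf_le_right (F.mem_preimage hV) hk,
    F.coef_eq (i hV) s (inf_le_left.trans i) inf_le_right (F.mem_preimage hV)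
      (by rw [← hk, res_res])]

lemma coef_smul {U : X.Opens} (hU : n ξ ∈ U) (f : Γ(X, U)) (s : Γ(W, U)) :
    F.coef U hU (f • s) = Y.presheaf.germ (n ⁻¹ᵁ U) ξ hU (pb n le_rfl f) * F.coef U hU s := by
  obtain ⟨k, hk⟩ := F.exists_coef s
  have h1 := germ_fres (n.preimage_mono (inf_le_left : U ⊓ F.V ≤ U)) (pb n le_rfl f) ξ
    (F.mem_preimage hU)
  rw [fres_pb] at h1
  rw [F.coef_eq hU s inf_le_left inf_le_right (F.mem_preimage hU) hk,
    F.coef_eq hU (f • s) inf_le_left inf_le_right (F.mem_preimage hU) (k := fres inf_le_left f * k)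
      (by rw [res_smul, hk, mul_smul]), map_mul, map_mul, pb_fres, h1]

end DiffFrame

variable {n} in
/-- The semilinear map to rational differentials with prescribed values on generators. -/
noncomputable def RosMap.ofFrames {W : X.Modules} (F : ∀ ξ : Y, IsGeneric ξ → DiffFrame n W ξ) :
    RosMap n W where
  ρ U :=
    { toFun := fun s ξ => (F ξ.1 ξ.2.1).coef U ξ.2.2 s • (F ξ.1 ξ.2.1).η
      map_zero' := funext fun ξ =>
        (congrArg (· • (F ξ.1 ξ.2.1).η) ((F ξ.1 ξ.2.1).coef_zero ξ.2.2)).trans (zero_smul _ _)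
      map_add' := fun s t => funext fun ξ =>
        (congrArg (· • (F ξ.1 ξ.2.1).η) ((F ξ.1 ξ.2.1).coef_add ξ.2.2 s t)).trans (add_smul _ _ _) }
  map_res U V i s := funext fun ξ =>
    congrArg (· • (F ξ.1 ξ.2.1).η) ((F ξ.1 ξ.2.1).coef_res i ξ.2.2 s)
  map_smul U f s ξ :=
    (congrArg (· • (F ξ.1 ξ.2.1).η) ((F ξ.1 ξ.2.1).coef_smul ξ.2.2 f s)).trans (mul_smul _ _ _)

variable {n} in
lemma RosMap.ofFrames_apply {W : X.Modules} (F : ∀ ξ : Y, IsGeneric ξ → DiffFrame n W ξ)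
    {U O : X.Opens} (s : Γ(W, U)) (ξ : GenericOver n U) (hOU : O ≤ U) (hOV : O ≤ (F ξ.1 ξ.2.1).V)
    (hO : ξ.1 ∈ n ⁻¹ᵁ O) {k : Γ(X, O)} (hk : res W hOU s = k • res W hOV (F ξ.1 ξ.2.1).w) :
    (RosMap.ofFrames F).ρ U s ξ =
      Y.presheaf.germ (n ⁻¹ᵁ O) ξ.1 hO (pb n le_rfl k) • (F ξ.1 ξ.2.1).η := by
  change (F ξ.1 ξ.2.1).coef U ξ.2.2 s • (F ξ.1 ξ.2.1).η = _
  rw [(F ξ.1 ξ.2.1).coef_eq ξ.2.2 s hOU hOV hO hk]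

variable {n} in
/-- Rosenlicht differentials over an open set over which a finite morphism is an isomorphism. -/
lemma RosMap.isRosOn_of_isIso {X₁ : Scheme.{0}} {f : X₁ ⟶ X} [IsFinite f] {m : Y ⟶ X₁}
    (e : m ≫ f = n) {W : X.Modules} {W₁ : X₁.Modules} (R : RosMap n W) (R₁ : RosMap m W₁)
    {U : X.Opens} (hU : IsIso (f ∣_ U)) {w : Γ(W, U)} {w₁ : Γ(W₁, f ⁻¹ᵁ U)} (hw : IsGenerator W w)
    (hw₁ : IsGenerator W₁ w₁) (h : ∀ (ξ : Y) (hξ : IsGeneric ξ) (h₁ : m ξ ∈ f ⁻¹ᵁ U) (h₂ : n ξ ∈ U),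
      R₁.ρ _ w₁ ⟨ξ, hξ, h₁⟩ = R.ρ _ w ⟨ξ, hξ, h₂⟩) (hR : R.IsRosOn U) : R₁.IsRosOn (f ⁻¹ᵁ U) := by
  have he : ∀ z, n z = f (m z) := fun z => by rw [← e, Scheme.Hom.comp_apply]
  have hb := pb_bijective_of_isIso f hU le_rfl
  have hm₁ : ∀ ξ : GenericOver n U, m ξ.1 ∈ f ⁻¹ᵁ U := fun ξ => by
    rw [Scheme.Hom.mem_preimage, ← he]
    exact ξ.2.2
  have hm₂ : ∀ ξ : GenericOver m (f ⁻¹ᵁ U), n ξ.1 ∈ U := fun ξ => by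
    rw [he]
    exact ξ.2.2
  let c₁ : GenericOver n U → GenericOver m (f ⁻¹ᵁ U) := fun ξ => ⟨ξ.1, ξ.2.1, hm₁ ξ⟩
  let c₂ : GenericOver m (f ⁻¹ᵁ U) → GenericOver n U := fun ξ => ⟨ξ.1, ξ.2.1, hm₂ ξ⟩
  let c : RatDiff m (f ⁻¹ᵁ U) → RatDiff n U := fun ω ξ => ω (c₁ ξ)
  have hc : Function.Injective c := by
    intro ω ω' h
    funext ξ
    exact congrFun h (c₂ ξ)
  have hρ : ∀ g : Γ(X, U), c (R₁.ρ _ (pb f le_rfl g • w₁)) = R.ρ _ (g • w) := by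
    intro g
    funext ξ
    have h1 : R₁.ρ _ (pb f le_rfl g • w₁) (c₁ ξ) = R.ρ _ (g • w) ξ := by
      have hle : m ⁻¹ᵁ (f ⁻¹ᵁ U) ≤ n ⁻¹ᵁ U := by rw [← e]; exact le_rfl
      have h1 : pb m (le_refl (m ⁻¹ᵁ (f ⁻¹ᵁ U))) (pb f le_rfl g) = fres hle (pb n le_rfl g) := by
        rw [pb_pb, pb_congr e, fres_pb]
      have h2 := R₁.map_smul _ (pb f le_rfl g) w₁ (c₁ ξ)
      have h3 : Y.presheaf.germ (m ⁻¹ᵁ (f ⁻¹ᵁ U)) ξ.1 (hm₁ ξ) (pb m le_rfl (pb f le_rfl g)) =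
          Y.presheaf.germ (n ⁻¹ᵁ U) ξ.1 ξ.2.2 (pb n le_rfl g) := by
        rw [h1]
        exact germ_fres hle _ ξ.1 (hm₁ ξ)
      rw [R.map_smul, h2, ← h3]
      exact congrArg _ (h ξ.1 ξ.2.1 (hm₁ ξ) ξ.2.2)
    exact h1
  have hpole : ∀ (ω : RatDiff m (f ⁻¹ᵁ U)) (x : X₁), f x ∈ U → (ω.PoleCond x ↔ (c ω).PoleCond (f x)) := by
    intro ω x hx
    have hset : ∀ p, n p = f x ↔ m p = x := by
      intro p
      rw [he]
      refine ⟨fun h => ?_, fun h => by rw [h]⟩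
      obtain ⟨_, -, hu⟩ := existsUnique_of_isIso f hU hx
      exact (hu _ h).trans (hu _ rfl).symm
    refine exists_congr fun r => ?_
    simp only [hset]
    refine and_congr_left fun _ => forall₂_congr fun p hp => ?_
    exact ⟨fun H ξ h => H (c₁ ξ) h, fun H ξ h => H (c₂ ξ) h⟩
  constructor
  · intro s t hst
    obtain ⟨a, rfl⟩ := hw₁.exists_smul' s
    obtain ⟨b, rfl⟩ := hw₁.exists_smul' t
    obtain ⟨a, rfl⟩ := hb.2 a
    obtain ⟨b, rfl⟩ := hb.2 b
    have h1 := congrArg c hst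
    rw [hρ, hρ] at h1
    rw [hw.smul_injective' (hR.1 h1)]
  · intro ω
    have h1 : ω ∈ Set.range (R₁.ρ (f ⁻¹ᵁ U)) ↔ c ω ∈ Set.range (R.ρ U) := by
      constructor
      · rintro ⟨s, rfl⟩
        obtain ⟨a, rfl⟩ := hw₁.exists_smul' s
        obtain ⟨a, rfl⟩ := hb.2 a
        exact ⟨a • w, (hρ a).symm⟩
      · rintro ⟨s, hs⟩
        obtain ⟨a, rfl⟩ := hw.exists_smul' s
        exact ⟨pb f le_rfl a • w₁, hc (by rw [hρ, hs])⟩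
    rw [h1, hR.2]
    constructor
    · intro H x hx hcl
      exact (hpole ω x hx).2 (H _ hx (isClosed_singleton_apply f hcl))
    · intro H x hx hcl
      obtain ⟨x, rfl, -⟩ := existsUnique_of_isIso f hU hx
      exact (hpole ω x hx).1 (H x hx (isClosed_singleton_of_isFinite f hcl))

end Rosenlicht


namespace RosMap

variable {X Y : Scheme.{0}} {n : Y ⟶ X} [∀ y : Y, Algebra ℂ (Y.presheaf.stalk y)] {W : X.Modules}
  (R : RosMap n W)

/-- The value of a section at a generic point. -/
noncomputable def val {U : X.Opens} (s : Γ(W, U)) {ξ : Y} (hξ : IsGeneric ξ) (hU : ξ ∈ n ⁻¹ᵁ U) :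
    Ω[Y.presheaf.stalk ξ⁄ℂ] := R.ρ U s ⟨ξ, hξ, hU⟩

lemma val_res {U V : X.Opens} (i : V ≤ U) (s : Γ(W, U)) {ξ : Y} (hξ : IsGeneric ξ)
    (hV : ξ ∈ n ⁻¹ᵁ V) : R.val (res W i s) hξ hV = R.val s hξ (n.preimage_mono i hV) :=
  congrFun (R.map_res U V i s) ⟨ξ, hξ, hV⟩

lemma val_smul {U : X.Opens} (f : Γ(X, U)) (s : Γ(W, U)) {ξ : Y} (hξ : IsGeneric ξ)
    (hU : ξ ∈ n ⁻¹ᵁ U) :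
    R.val (f • s) hξ hU = Y.presheaf.germ (n ⁻¹ᵁ U) ξ hU (pb n le_rfl f) • R.val s hξ hU :=
  R.map_smul U f s ⟨ξ, hξ, hU⟩

end RosMap

/-- A norm map from the direct image of `L`, for the quotient by an involution. -/
structure NormMap {X Y : Scheme.{0}} {τ : X ⟶ X} {π : X ⟶ Y} (h : τ ≫ π = π) (L : X.Modules)
    (W : Y.Modules) where
  N : ∀ U : Y.Opens, Γ(L, π ⁻¹ᵁ U) → Γ(W, U)
  map_res : ∀ (U V : Y.Opens) (i : V ≤ U) (s : Γ(L, π ⁻¹ᵁ U)),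
    N V (res L (π.preimage_mono i) s) = res W i (N U s)
  map_smul : ∀ (U : Y.Opens) (s : Γ(L, π ⁻¹ᵁ U)) (f : Γ(X, π ⁻¹ᵁ U)) (g : Γ(Y, U)),
    pb π le_rfl g = f * tw h f → N U (f • s) = g • N U s
  gen : ∀ (U : Y.Opens) (s : Γ(L, π ⁻¹ᵁ U)), IsGenerator L s → IsGenerator W (N U s)

lemma IsNorm.exists_normMap {X Y : Scheme.{0}} {τ : X ⟶ X} {π : X ⟶ Y} {h : τ ≫ π = π}
    {L : X.Modules} {W : Y.Modules} (H : IsNorm h L W) : Nonempty (NormMap h L W) := by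
  obtain ⟨-, N, h1, h2, h3⟩ := H
  exact ⟨N, h1, fun U s f g e => h2 U s f g (by rw [app_eq_pb]; exact e), h3⟩

namespace Cover

variable (D : Cover)

instance : CompactSpace D.N := by
  have : CompactSpace D.C := D.adm.nodal_base.compactSpace
  exact QuasiCompact.compactSpace_of_compactSpace D.νN

instance : NoetherianSpace D.N := by
  have : IsNoetherian D.N := {}
  infer_instance

variable {D} in
lemma notMem_T_of_isGeneric {ξ : D.N} (hξ : IsGeneric ξ) : D.νN ξ ∉ D.T := by
  intro h
  obtain ⟨η, hη, hηT⟩ := D.exists_specializes_N h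
  exact hηT (hξ η hη ▸ h)

namespace Twist

variable {D} {L : D.C'.Modules} {φ : L ⟶ (Scheme.Modules.pushforward D.τ).obj L}
  {I : Set D.C'} (T : D.Twist L φ I) (Q : D.Partial I)

/-- An invariant generator near the image of a point, away from the nodes in `I`. -/
structure Frame (z : D.N) where
  V : D.C.Opens
  mem : Q.μ z ∈ Q.ν₁ ⁻¹ᵁ V
  e : Γ(L, D.π ⁻¹ᵁ V)
  gen_e : IsGenerator L e
  n : Γ(Q.glue T.j, Q.ν₁ ⁻¹ᵁ V)
  gen_n : IsGenerator (Q.glue T.j) n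
  sec_n : T.sec Q _ n = psec D.ν L Q.le_preimage e

lemma exists_frame {z : D.N} (hz : D.νN z ∈ Q.G) : Nonempty (T.Frame Q z) := by
  obtain ⟨y, hyG, hy, hzy⟩ := exists_closed_mem D.s hz
  obtain ⟨V, hV, hyV, e, he, hφe⟩ := HasInvGen.exists_le _ (T.exists_invGen y hy hyG) hyG
  obtain ⟨n, hn, hng⟩ := T.exists_isGenerator_away Q hV he hφe
  have hzV : D.νN z ∈ V := hzy.mem_open V.2 hyV
  have hmem : Q.μ z ∈ Q.ν₁ ⁻¹ᵁ V := by
    rw [Scheme.Hom.mem_preimage, Q.ν₁_μ]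
    exact hzV
  exact ⟨V, hmem, e, he, n, hng, hn⟩

variable [∀ y : D.N, Algebra ℂ (D.N.presheaf.stalk y)] {W : D.C.Modules}
  (ν : NormMap D.adm.invariant L W) (R : RosMap D.νN W)

omit [∀ y : D.N, Algebra ℂ (D.N.presheaf.stalk y)] in
lemma νN_mem {z : D.N} {V : D.C.Opens} (h : Q.μ z ∈ Q.ν₁ ⁻¹ᵁ V) : z ∈ D.νN ⁻¹ᵁ V := by
  rw [Scheme.Hom.mem_preimage, ← Q.ν₁_μ]
  exact h

/-- The squares of local sections of the glued sheaf as rational differentials. -/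
noncomputable def rosMap : RosMap Q.μ (tensor (Q.glue T.j) (Q.glue T.j)) :=
  RosMap.ofFrames fun ξ hξ =>
    let F := (T.exists_frame Q (Q.G_le (notMem_T_of_isGeneric hξ))).some
    { V := Q.ν₁ ⁻¹ᵁ F.V
      mem := F.mem
      w := tmulSec F.n F.n
      gen := F.gen_n.tmulSec F.gen_n
      η := R.val (ν.N F.V F.e) hξ (νN_mem Q F.mem) }

omit [∀ y : D.N, Algebra ℂ (D.N.presheaf.stalk y)] in
lemma exists_norm {V : D.C.Opens} (u : Γ(D.C', D.π ⁻¹ᵁ V)) :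
    ∃ g, pb D.π (le_refl (D.π ⁻¹ᵁ V)) g = u * tw D.adm.invariant u :=
  D.quot.desc V _ (by rw [map_mul, tw_tw _ D.adm.involution, mul_comm])

omit [∀ y : D.N, Algebra ℂ (D.N.presheaf.stalk y)] in
/-- Pullback of functions commutes with the involutions. -/
lemma tw_pb_ν {V : D.N.Opens} {V₀ : D.C.Opens} (h : D.πh ⁻¹ᵁ V ≤ D.ν ⁻¹ᵁ (D.π ⁻¹ᵁ V₀))
    (u : Γ(D.C', D.π ⁻¹ᵁ V₀)) :
    tw D.τh_πh (pb D.ν h u) = pb D.ν h (tw D.adm.invariant u) := by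
  rw [tw, tw, pb_pb, pb_pb, pb_congr D.lift]

lemma rosMap_tmulSec {V₀ : D.C.Opens} {e : Γ(L, D.π ⁻¹ᵁ V₀)}
    {V : Q.N₁.Opens} (hV : V ≤ Q.ν₁ ⁻¹ᵁ V₀) {n : Γ(Q.glue T.j, V)}
    {f : Γ(D.Ch, D.πh ⁻¹ᵁ (Q.μ ⁻¹ᵁ V))}
    (hle : D.πh ⁻¹ᵁ (Q.μ ⁻¹ᵁ V) ≤ D.ν ⁻¹ᵁ (D.π ⁻¹ᵁ V₀)) (hn : T.sec Q V n = f • psec D.ν L hle e)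
    {h : Γ(D.N, Q.μ ⁻¹ᵁ V)}
    (hh : pb D.πh (le_refl (D.πh ⁻¹ᵁ (Q.μ ⁻¹ᵁ V))) h = f * tw D.τh_πh f) {ξ : D.N}
    (hξ : IsGeneric ξ) (hξV : ξ ∈ Q.μ ⁻¹ᵁ V) :
    (T.rosMap Q ν R).val (tmulSec n n) hξ hξV =
      D.N.presheaf.germ _ ξ hξV h • R.val (ν.N V₀ e) hξ (νN_mem Q (hV hξV)) := by
  let F := (T.exists_frame Q (Q.G_le (notMem_T_of_isGeneric hξ))).some
  let A := V₀ ⊓ F.V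
  let O := V ⊓ Q.ν₁ ⁻¹ᵁ F.V
  have hOV : O ≤ V := inf_le_left
  have hOF : O ≤ Q.ν₁ ⁻¹ᵁ F.V := inf_le_right
  have hOA : O ≤ Q.ν₁ ⁻¹ᵁ A := le_inf (hOV.trans hV) hOF
  have hξO : ξ ∈ Q.μ ⁻¹ᵁ O := ⟨hξV, F.mem⟩
  have hξA : ξ ∈ D.νN ⁻¹ᵁ A := νN_mem Q (hOA hξO)
  have hAle : D.πh ⁻¹ᵁ (Q.μ ⁻¹ᵁ O) ≤ D.ν ⁻¹ᵁ (D.π ⁻¹ᵁ A) :=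
    D.preimage_le fun z hz => νN_mem Q (hOA hz)
  obtain ⟨u, hu⟩ := F.gen_e.exists_smul (D.π.preimage_mono inf_le_right)
    (res L (D.π.preimage_mono (inf_le_left : A ≤ V₀)) e)
  obtain ⟨g, hg⟩ := exists_norm u
  obtain ⟨k, hk⟩ := F.gen_n.exists_smul hOF (res _ hOV n)
  have h1 : pb D.πh (le_refl (D.πh ⁻¹ᵁ (Q.μ ⁻¹ᵁ O))) (pb Q.μ le_rfl k) =
      fres (D.πh.preimage_mono (Q.μ.preimage_mono hOV)) f * pb D.ν hAle u := by
    have h2 := congrArg (T.sec Q O) hk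
    rw [sec_smul, sec_res, sec_res, hn, F.sec_n, res_smul, res_psec, res_psec] at h2
    have h3 := congrArg (psec D.ν L hAle) hu
    rw [psec_smul, psec_res, psec_res] at h3
    rw [h3, smul_smul] at h2
    exact ((F.gen_e.psec D.ν _).smul_injective' h2).symm
  have h2 : pb Q.μ (le_refl (Q.μ ⁻¹ᵁ O)) (k * k) = fres (Q.μ.preimage_mono hOV) h *
      pb D.νN (fun z hz => νN_mem Q (hOA hz)) g := by
    apply D.pb_πh_injective (le_refl (D.πh ⁻¹ᵁ (Q.μ ⁻¹ᵁ O))) le_rfl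
    have h3 := congrArg (tw D.τh_πh) h1
    rw [tw_pb, map_mul, tw_fres, tw_pb_ν] at h3
    have h4 := congrArg (fres (D.πh.preimage_mono (Q.μ.preimage_mono hOV))) hh
    rw [fres_pb, map_mul] at h4
    have h5 := congrArg (pb D.ν hAle) hg
    rw [pb_pb, map_mul] at h5
    rw [map_mul, map_mul, map_mul, pb_fres, h4, pb_pb _ D.νN, pb_congr D.comm, h5]
    nth_rewrite 1 [h1]
    rw [h3]
    ring
  have h3 : res _ hOV (tmulSec n n) = (k * k) • res _ hOF (tmulSec F.n F.n) := by
    rw [res_tmulSec, res_tmulSec, hk, tmulSec_smul_smul]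
  have h4 : R.val (ν.N V₀ e) hξ (νN_mem Q (hV hξV)) =
      D.N.presheaf.germ _ ξ hξA (pb D.νN le_rfl g) • R.val (ν.N F.V F.e) hξ (νN_mem Q F.mem) := by
    have h5 : R.val (ν.N A (res L (D.π.preimage_mono inf_le_left) e)) hξ hξA =
        R.val (g • ν.N A (res L (D.π.preimage_mono inf_le_right) F.e)) hξ hξA := by
      rw [hu, ν.map_smul A _ u g hg]
    rw [R.val_smul, ν.map_res V₀ A inf_le_left, ν.map_res F.V A inf_le_right, R.val_res,
      R.val_res] at h5
    exact h5
  have h5 := RosMap.ofFrames_apply (fun ξ hξ =>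
    let F := (T.exists_frame Q (Q.G_le (notMem_T_of_isGeneric hξ))).some
    ({ V := Q.ν₁ ⁻¹ᵁ F.V
       mem := F.mem
       w := tmulSec F.n F.n
       gen := F.gen_n.tmulSec F.gen_n
       η := R.val (ν.N F.V F.e) hξ (νN_mem Q F.mem) } : DiffFrame Q.μ _ ξ))
    (tmulSec n n) ⟨ξ, hξ, hξV⟩ hOV hOF hξO h3
  refine h5.trans ?_
  have h6 := germ_fres (Q.μ.preimage_mono hOV) h ξ hξO
  have h7 := germ_fres (fun z hz => νN_mem Q (hOA hz) : Q.μ ⁻¹ᵁ O ≤ D.νN ⁻¹ᵁ A)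
    (pb D.νN le_rfl g) ξ hξO
  rw [fres_pb] at h7
  rw [h4, h2, map_mul, h6, h7, mul_smul]

/-- Away from the nodes in `I`, squares of local sections are Rosenlicht differentials. -/
lemma isRosOn_away (hR : ∀ U, R.IsRosOn U) {y : Q.N₁} (hy : IsClosed {y})
    (hyI : Q.ν₁ y ∉ D.π '' I) :
    ∃ V, y ∈ V ∧ ∀ V' ≤ V, (T.rosMap Q ν R).IsRosOn V' := by
  obtain ⟨V, hV, hyV, e, he, hφe⟩ := HasInvGen.exists_le _ (T.exists_invGen _
    (isClosed_singleton_apply Q.ν₁ hy) hyI) (W := Q.G) hyI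
  obtain ⟨n, hn, hng⟩ := T.exists_isGenerator_away Q hV he hφe
  refine ⟨Q.ν₁ ⁻¹ᵁ V, hyV, fun V' hV' => ?_⟩
  obtain ⟨U, hU, rfl⟩ := exists_preimage_eq Q.ν₁ Q.isIso_ν₁ (hV'.trans (Q.ν₁.preimage_mono hV))
  have hU' : U ≤ V := fun x hx => by
    obtain ⟨y, rfl, -⟩ := existsUnique_of_isIso Q.ν₁ Q.isIso_ν₁ (hU hx)
    exact hV' hx
  refine RosMap.isRosOn_of_isIso Q.fac R _ (isIso_morphismRestrict_mono Q.ν₁ hU Q.isIso_ν₁)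
    ((ν.gen V e he).res hU') ((hng.tmulSec hng).res hV') (fun ξ hξ h₁ h₂ => ?_) (hR U)
  have h3 := T.rosMap_tmulSec Q ν R le_rfl (n := n) (f := 1) Q.le_preimage (by rw [hn, one_smul])
    (h := 1) (by rw [map_one, map_one, one_mul]) hξ (hV' h₁)
  rw [map_one, one_smul] at h3
  have h4 := (T.rosMap Q ν R).val_res hV' (tmulSec n n) hξ h₁
  have h5 := R.val_res hU' (ν.N V e) hξ h₂
  exact h4.trans (h3.trans h5.symm)

end Twist

end Cover


section Poles

variable {Y : Scheme.{0}} [NoetherianSpace Y] [IsReduced Y] [∀ y : Y, Algebra ℂ (Y.presheaf.stalk y)]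

omit [∀ y : Y, Algebra ℂ (Y.presheaf.stalk y)] in
lemma IsGeneric.exists_inv {p ξ : Y} (hd : IsDVR (Y.presheaf.stalk p)) (hξ : IsGeneric ξ)
    (h : ξ ⤳ p) {t : Y.presheaf.stalk p} (ht : t ≠ 0) :
    ∃ u, u * (Y.presheaf.stalkSpecializes h).hom t = 1 :=
  ((hξ.isUnit_or_eq_zero _).resolve_right (specializes_ne_zero hd hξ h ht)).exists_left_inv

lemma IsGeneric.hasSimplePole_zero_iff {p ξ : Y} (hd : IsDVR (Y.presheaf.stalk p))
    (hξ : IsGeneric ξ) (h : ξ ⤳ p) (ω : Ω[Y.presheaf.stalk ξ⁄ℂ]) :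
    HasSimplePole (Y.presheaf.stalkSpecializes h).hom ω 0 ↔
      ω ∈ regularDifferentials (Y.presheaf.stalkSpecializes h).hom := by
  constructor
  · rintro ⟨t, u, -, -, hω⟩
    rwa [map_zero, zero_mul, zero_smul, sub_zero] at hω
  · intro hω
    obtain ⟨_, _⟩ := id hd
    obtain ⟨t, ht⟩ := IsDiscreteValuationRing.exists_irreducible (Y.presheaf.stalk p)
    obtain ⟨u, hu⟩ := hξ.exists_inv hd h ht.ne_zero
    exact ⟨t, u, ht, hu, by rwa [map_zero, zero_mul, zero_smul, sub_zero]⟩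

lemma IsGeneric.eq_zero_of_smul_eq_zero {ξ : Y} (hξ : IsGeneric ξ) {ω : Ω[Y.presheaf.stalk ξ⁄ℂ]}
    (hω : ω ≠ 0) {a : Y.presheaf.stalk ξ} (ha : a • ω = 0) : a = 0 :=
  (hξ.isUnit_or_eq_zero a).resolve_left fun h => hω (h.smul_eq_zero.1 ha)

/-- Rosenlicht differentials near a smooth point `y` with the sole preimage `P`, if a generator
corresponds to a generator of the regular differentials at `P`. -/
lemma RosMap.isRosOn_of_regular {X : Scheme.{0}} {n : Y ⟶ X} [IsFinite n] [IsLocallyNoetherian X]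
    {W : X.Modules} (R : RosMap n W) {P : Y} (hP : IsDVR (Y.presheaf.stalk P))
    (hd : IsDVR (X.presheaf.stalk (n P))) (hcl : IsClosed {n P}) (hu : ∀ p, n p = n P → p = P)
    (hinj : ∀ {A : X.Opens}, Function.Injective (pb n (le_refl (n ⁻¹ᵁ A)))) {V : X.Opens}
    (hV : ∀ ξ ∈ n ⁻¹ᵁ V, IsGeneric ξ → ξ ⤳ P) {w : Γ(W, V)} (hw : IsGenerator W w)
    (hne : ∀ ξ (hξ : IsGeneric ξ) (hξV : ξ ∈ n ⁻¹ᵁ V), R.val w hξ hξV ≠ 0)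
    (hreg : ∀ ξ (hξ : IsGeneric ξ) (hξV : ξ ∈ n ⁻¹ᵁ V) (h : ξ ⤳ P) (ω : Ω[Y.presheaf.stalk ξ⁄ℂ]),
      ω ∈ regularDifferentials (Y.presheaf.stalkSpecializes h).hom ↔
        ∃ a, ω = (Y.presheaf.stalkSpecializes h).hom a • R.val w hξ hξV)
    (hR : ∀ V' ≤ V, n P ∉ V' → R.IsRosOn V') : ∀ V' ≤ V, R.IsRosOn V' := by
  intro V' hV'
  by_cases hy : n P ∈ V'
  swap
  · exact hR V' hV' hy
  let V'' : X.Opens := V' ⊓ ⟨{n P}ᶜ, hcl.isOpen_compl⟩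
  have hle : V'' ≤ V' := inf_le_left
  have hR'' : R.IsRosOn V'' := hR V'' (hle.trans hV') fun h => h.2 rfl
  have hgen : ∀ ξ ∈ n ⁻¹ᵁ V', IsGeneric ξ → ξ ∈ n ⁻¹ᵁ V'' := fun ξ h hξ =>
    ⟨h, fun h' => hξ.ne_of_isDVR hP (hu ξ h')⟩
  have hset : {p : Y | n p = n P} = {P} := Set.ext fun p => ⟨hu p, fun h => congrArg n h⟩
  have hval : ∀ {A : X.Opens} (hA : A ≤ V) (g : Γ(X, A)) (ξ : Y) (hξ : IsGeneric ξ) (h : ξ ∈ n ⁻¹ᵁ A),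
      R.val (g • res W hA w) hξ h =
        Y.presheaf.germ _ ξ h (pb n le_rfl g) • R.val w hξ (n.preimage_mono hA h) :=
    fun hA g ξ hξ h => by rw [R.val_smul, R.val_res]
  refine ⟨(injective_iff_map_eq_zero _).2 fun s hs => ?_, fun ω => ⟨?_, fun hω => ?_⟩⟩
  · obtain ⟨g, rfl⟩ := hw.exists_smul hV' s
    have h1 : pb n (le_refl (n ⁻¹ᵁ V')) g = 0 := eq_zero_of_germ_generic _ fun ξ hξ' hξ =>
      hξ.eq_zero_of_smul_eq_zero (hne ξ hξ (n.preimage_mono hV' hξ'))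
        ((hval hV' g ξ hξ hξ').symm.trans (congrFun hs ⟨ξ, hξ, hξ'⟩))
    rw [hinj (h1.trans (map_zero _).symm), zero_smul]
  · rintro ⟨s, rfl⟩ x hx hxcl
    by_cases hxy : x = n P
    · subst hxy
      refine ⟨0, fun p hp ξ h => ?_, by simp⟩
      obtain rfl := hu p hp
      have hpV : p ∈ n ⁻¹ᵁ V' := hx
      obtain ⟨g, rfl⟩ := hw.exists_smul hV' s
      refine (IsGeneric.hasSimplePole_zero_iff hP ξ.2.1 h _).2 ((hreg _ ξ.2.1 (n.preimage_mono hV' ξ.2.2) h _).2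
        ⟨Y.presheaf.germ (n ⁻¹ᵁ V') p hpV (pb n le_rfl g), ?_⟩)
      rw [germ_specializes]
      exact hval hV' g ξ.1 ξ.2.1 ξ.2.2
    · have hx' : x ∈ V'' := ⟨hx, hxy⟩
      have h1 := (hR''.2 (R.ρ V'' (res W hle s))).1 ⟨_, rfl⟩ x hx' hxcl
      rwa [R.map_res, RatDiff.poleCond_restr _ _ hx'] at h1
  · obtain ⟨σ, hσ⟩ := (hR''.2 (ω.restr hle)).2 fun x hx hxcl =>
      (RatDiff.poleCond_restr hle ω hx).2 (hω x (hle hx) hxcl)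
    obtain ⟨g, rfl⟩ := hw.exists_smul (hle.trans hV') σ
    have hgω : ∀ ξ (hξ : IsGeneric ξ) (h : ξ ∈ n ⁻¹ᵁ V'), ω ⟨ξ, hξ, h⟩ =
        Y.presheaf.germ (n ⁻¹ᵁ V'') ξ (hgen ξ h hξ) (pb n le_rfl g) •
          R.val w hξ (n.preimage_mono hV' h) := fun ξ hξ h =>
      (congrFun hσ ⟨ξ, hξ, hgen ξ h hξ⟩).symm.trans (hval _ g ξ hξ _)
    obtain ⟨r, hr, hsum⟩ := hω _ hy hcl
    rw [hset, finsum_mem_singleton] at hsum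
    obtain ⟨η, hη, hηP⟩ := exists_isGeneric P
    have hPV' : P ∈ n ⁻¹ᵁ V' := hy
    have hηV' : η ∈ n ⁻¹ᵁ V' := hηP.mem_open (n ⁻¹ᵁ V').2 hPV'
    have h1 := hr P rfl ⟨η, hη, hηV'⟩ hηP
    rw [hsum] at h1
    obtain ⟨a, ha⟩ := (hreg η hη (n.preimage_mono hV' hηV') hηP _).1
      ((hη.hasSimplePole_zero_iff hP hηP _).1 h1)
    obtain ⟨B, hPB, a, rfl⟩ := exists_germ P a
    have hag : pb n (inf_le_right : B ⊓ n ⁻¹ᵁ V'' ≤ n ⁻¹ᵁ V'') g =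
        fres (inf_le_left : B ⊓ n ⁻¹ᵁ V'' ≤ B) a := by
      rw [← sub_eq_zero]
      refine eq_zero_of_germ_generic _ fun ξ hξ' hξ => ?_
      obtain rfl : ξ = η := hξ.eq_of_specializes hP hη
        (hV ξ (n.preimage_mono (hle.trans hV') hξ'.2) hξ) hηP
      have h2 := germ_fres (inf_le_right : B ⊓ n ⁻¹ᵁ V'' ≤ n ⁻¹ᵁ V'') (pb n le_rfl g) ξ hξ'
      rw [fres_pb] at h2
      have h3 := (hgω ξ hξ hηV').symm.trans ha
      rw [germ_specializes, ← sub_eq_zero, ← sub_smul] at h3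
      have h4 := hξ.eq_zero_of_smul_eq_zero (hne _ hξ _) h3
      rw [map_sub, germ_fres, h2]
      exact h4
    obtain ⟨g', rfl⟩ := exists_extension n hP hd hcl hle hy (fun q hq hne => ⟨hq, hne⟩) g hPB a hag
    refine ⟨g' • res W hV' w, funext fun ξ => ?_⟩
    refine (hval hV' g' ξ.1 ξ.2.1 ξ.2.2).trans ((hgω ξ.1 ξ.2.1 ξ.2.2).trans ?_).symm
    have h2 := germ_fres (n.preimage_mono hle) (pb n le_rfl g') ξ.1 (hgen ξ.1 ξ.2.2 ξ.2.1)
    rw [fres_pb] at h2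
    rw [pb_fres, h2]

end Poles


section LogDifferentials

variable {Y : Scheme.{0}} [∀ y : Y, Algebra ℂ (Y.presheaf.stalk y)]

/-- The logarithmic differential of a function at a point. -/
noncomputable def dlog {U : Y.Opens} (s : Γ(Y, U)) {ξ : Y} (hξ : ξ ∈ U) : Ω[Y.presheaf.stalk ξ⁄ℂ] :=
  Ring.inverse (Y.presheaf.germ U ξ hξ s) • KaehlerDifferential.D ℂ _ (Y.presheaf.germ U ξ hξ s)

lemma dlog_mem_regularDifferentials {U : Y.Opens} {s : Γ(Y, U)} {p ξ : Y} (h : ξ ⤳ p) (hp : p ∈ U)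
    (hs : IsUnit (Y.presheaf.germ U p hp s)) (hξ : ξ ∈ U) :
    dlog s hξ ∈ regularDifferentials (Y.presheaf.stalkSpecializes h).hom := by
  obtain ⟨b, hb⟩ := hs.exists_left_inv
  have h1 := congrArg (Y.presheaf.stalkSpecializes h).hom hb
  rw [map_mul, map_one, germ_specializes] at h1
  have h2 : Ring.inverse (Y.presheaf.germ U ξ hξ s) = (Y.presheaf.stalkSpecializes h).hom b := by
    rw [← one_mul (Ring.inverse _), ← h1, mul_assoc,
      Ring.mul_inverse_cancel _ (IsUnit.of_mul_eq_one_right _ h1), mul_one]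
  refine AddSubgroup.subset_closure ⟨⟨b, Y.presheaf.germ U p hp s⟩, ?_⟩
  dsimp only
  rw [germ_specializes, dlog, h2]

variable [NoetherianSpace Y] [IsReduced Y]

lemma hasSimplePole_dlog_sub {U : Y.Opens} {s s' : Γ(Y, U)} {p ξ : Y} (hp : p ∈ U)
    (hd : IsDVR (Y.presheaf.stalk p)) (hg : IsGeneric ξ) (h : ξ ⤳ p)
    (hs : IsParam s p hp) (hs' : IsUnit (Y.presheaf.germ U p hp s')) (hξ : ξ ∈ U) :
    HasSimplePole (Y.presheaf.stalkSpecializes h).hom (dlog s hξ - dlog s' hξ) 1 := by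
  obtain ⟨_, _⟩ := id hd
  have h1 : IsUnit (Y.presheaf.germ U ξ hξ s) := by
    rw [← germ_specializes h hp]
    exact (hg.isUnit_or_eq_zero _).resolve_right (specializes_ne_zero hd hg h hs.ne_zero)
  refine ⟨_, Ring.inverse (Y.presheaf.germ U ξ hξ s), hs, ?_, ?_⟩
  · rw [germ_specializes, Ring.inverse_mul_cancel _ h1]
  · rw [map_one, one_mul, germ_specializes, ← dlog, sub_sub_cancel_left]
    exact neg_mem (dlog_mem_regularDifferentials h hp hs' hξ)

omit [NoetherianSpace Y] [IsReduced Y] in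
lemma HasSimplePole.neg {A K : Type*} [CommRing A] [CommRing K] [Algebra ℂ K] {f : A →+* K}
    {η : Ω[K⁄ℂ]} {c : ℂ} (h : HasSimplePole f η c) : HasSimplePole f (-η) (-c) := by
  obtain ⟨t, u, ht, hu, hη⟩ := h
  refine ⟨t, u, ht, hu, ?_⟩
  rw [map_neg, neg_mul, neg_smul, sub_neg_eq_add, neg_add_eq_sub, ← neg_sub]
  exact neg_mem hη

end LogDifferentials

namespace Cover

variable (D : Cover)

lemma exists_ne_of_mem_T {P : D.N} (hP : D.νN P ∈ D.T) : ∃ Q, D.νN Q = D.νN P ∧ Q ≠ P := by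
  obtain ⟨p, rfl⟩ := D.πh_surjective P
  rw [D.νN_πh, D.apply_mem_T_iff] at hP
  obtain ⟨p₁, p₂, h₁, h₂, hne⟩ := (D.isNodeFibre hP).exists_ne
  have hne' : D.πh p₂ ≠ D.πh p₁ := fun h => hne (D.eq_of_πh_eq (h₁ ▸ hP) h).symm
  by_cases h : D.πh p₁ = D.πh p
  · exact ⟨D.πh p₂, by rw [D.νN_πh, D.νN_πh, h₂], fun h' => hne' (h'.trans h.symm)⟩
  · exact ⟨D.πh p₁, by rw [D.νN_πh, D.νN_πh, h₁], h⟩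

variable {D} [∀ y : D.N, Algebra ℂ (D.N.presheaf.stalk y)] {W : D.C.Modules} {R : RosMap D.νN W}
  (hR : ∀ U, R.IsRosOn U) {U : D.C.Opens} {w : Γ(W, U)} (hw : IsGenerator W w)

include hR hw

lemma val_ne_zero {ξ : D.N} (hξ : IsGeneric ξ) (hU : ξ ∈ D.νN ⁻¹ᵁ U) : R.val w hξ hU ≠ 0 := by
  intro h0
  have hξG : ξ ∈ D.νN ⁻¹ᵁ (D.G ⊓ U) := ⟨notMem_T_of_isGeneric hξ, hU⟩
  obtain ⟨B, hB, hξB, hgen⟩ := exists_isGeneric_specializes ξ hξG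
  obtain ⟨A, -, rfl⟩ := exists_preimage_eq D.νN D.isIso_νN
    (hB.trans (D.νN.preimage_mono inf_le_left))
  have hAU : A ⊓ U ≤ U := inf_le_right
  have hle : D.νN ⁻¹ᵁ A ≤ D.νN ⁻¹ᵁ (A ⊓ U) := fun z hz => ⟨hz, (hB hz).2⟩
  have h1 : R.ρ (A ⊓ U) (res W hAU w) = 0 := by
    funext ζ
    have h2 : ζ.1 = ξ := hξ _ (hgen ζ.1 ζ.2.2.1 ζ.2.1)
    obtain ⟨ζ, hζ, hζA⟩ := ζ
    obtain rfl : ζ = ξ := h2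
    exact (R.val_res hAU w hζ hζA).trans h0
  have h2 := (hR _).1 (h1.trans (map_zero _).symm)
  have h3 : (1 : Γ(D.C, A ⊓ U)) = 0 := (hw.res hAU).smul_injective' (by rw [one_smul, zero_smul, h2])
  have h4 := congrArg (D.C.presheaf.germ (A ⊓ U) (D.νN ξ) (hle hξB)) h3
  rw [map_one, map_zero] at h4
  exact one_ne_zero h4

variable (hA : ∀ y : D.N, algebraMap ℂ (D.N.presheaf.stalk y) = (stalkAlgebra D.sN y).algebraMap)

include hA

lemma residue_ne_zero {P ξ : D.N} (hP : D.νN P ∈ D.T) (hPU : D.νN P ∈ U) (hξ : IsGeneric ξ)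
    (h : ξ ⤳ P) (hξU : ξ ∈ D.νN ⁻¹ᵁ U) {c : ℂ}
    (hc : HasSimplePole (D.N.presheaf.stalkSpecializes h).hom (R.val w hξ hξU) c) : c ≠ 0 := by
  rintro rfl
  obtain ⟨Q, hQP, hne⟩ := D.exists_ne_of_mem_T hP
  have hclP := D.isClosed_of_mem_preimage_T hP
  have hclQ := D.isClosed_of_mem_preimage_T (hQP ▸ hP)
  have hdP := D.isDVR_N hclP
  have hdQ := D.isDVR_N hclQ
  obtain ⟨V₁, hV₁, hPV₁, s₁, -, hs₁, hz₁⟩ := exists_isParam_tube D.νN hclP hdP hPU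
  obtain ⟨V, hV, hQV', s₂, -, hs₂, hz₂⟩ := exists_isParam_tube D.νN hclQ hdQ (hQP ▸ hPV₁ : D.νN Q ∈ V₁)
  have hPV : P ∈ D.νN ⁻¹ᵁ V := (hQP ▸ hQV' : D.νN P ∈ V)
  have hQV : Q ∈ D.νN ⁻¹ᵁ V := hQV'
  have hs₁' : IsParam (fres (D.νN.preimage_mono hV) s₁) P hPV :=
    (isParam_fres (D.νN.preimage_mono hV) s₁ hPV).2 hs₁
  have hz₁' : ∀ q (hq : q ∈ D.νN ⁻¹ᵁ V), fres (D.νN.preimage_mono hV) s₁ ∈ idealAt _ q hq → q = P :=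
    fun q hq hz => hz₁ q (D.νN.preimage_mono hV hq) (by rwa [fres_mem_idealAt] at hz)
  generalize fres (D.νN.preimage_mono hV) s₁ = s₁ at hs₁' hz₁'
  have hu₁ : ∀ q (hq : q ∈ D.νN ⁻¹ᵁ V), q ≠ P → IsUnit (D.N.presheaf.germ _ q hq s₁) :=
    fun q hq hqP => isUnit_germ_iff.2 fun hz => hqP (hz₁' q hq hz)
  have hu₂ : ∀ q (hq : q ∈ D.νN ⁻¹ᵁ V), q ≠ Q → IsUnit (D.N.presheaf.germ _ q hq s₂) :=
    fun q hq hqP => isUnit_germ_iff.2 fun hz => hqP (hz₂ q hq hz)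
  let ω : RatDiff D.νN V := fun ζ => dlog s₁ (ξ := ζ.1) ζ.2.2 - dlog s₂ (ξ := ζ.1) ζ.2.2
  have hω : ∀ x ∈ V, IsClosed {x} → ω.PoleCond x := by
    classical
    intro x hx hxcl
    refine ⟨fun p => if p = P then 1 else if p = Q then -1 else 0, fun p hp ζ hζ => ?_, ?_⟩
    · have hpV : p ∈ D.νN ⁻¹ᵁ V := (hp ▸ hx : D.νN p ∈ V)
      dsimp only
      by_cases hpP : p = P
      · subst hpP
        rw [if_pos rfl]
        exact hasSimplePole_dlog_sub hpV hdP ζ.2.1 hζ hs₁' (hu₂ _ hpV hne.symm) ζ.2.2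
      rw [if_neg hpP]
      by_cases hpQ : p = Q
      · subst hpQ
        rw [if_pos rfl]
        have h1 := (hasSimplePole_dlog_sub hpV hdQ ζ.2.1 hζ hs₂ (hu₁ _ hpV hne) ζ.2.2).neg
        rw [neg_sub] at h1
        exact h1
      rw [if_neg hpQ]
      have hpcl : IsClosed {p} := isClosed_singleton_of_isFinite D.νN (hp ▸ hxcl)
      exact (IsGeneric.hasSimplePole_zero_iff (D.isDVR_N hpcl) ζ.2.1 hζ _).2
        (sub_mem (dlog_mem_regularDifferentials hζ hpV (hu₁ _ hpV hpP) ζ.2.2)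
          (dlog_mem_regularDifferentials hζ hpV (hu₂ _ hpV hpQ) ζ.2.2))
    · by_cases hxP : D.νN P = x
      · rw [finsum_mem_inter_support_eq _ _ {P, Q}, finsum_mem_pair hne.symm]
        · rw [if_pos rfl, if_neg hne, if_pos rfl, add_neg_cancel]
        · ext p
          refine and_congr_left fun hp => ⟨fun _ => ?_, ?_⟩
          · by_contra hpn
            rw [Set.mem_insert_iff, Set.mem_singleton_iff, not_or] at hpn
            exact hp ((if_neg hpn.1).trans (if_neg hpn.2))
          · rintro (rfl | rfl)
            · exact hxP
            · exact hQP.trans hxP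
      · refine finsum_mem_of_eqOn_zero fun p hp => ?_
        have h1 : p ≠ P := by rintro rfl; exact hxP hp
        have h2 : p ≠ Q := by rintro rfl; exact hxP (hQP.symm.trans hp)
        exact (if_neg h1).trans (if_neg h2)
  obtain ⟨v, hv⟩ := ((hR V).2 ω).2 hω
  have hVU : V ≤ U := hV.trans hV₁
  obtain ⟨g, rfl⟩ := hw.exists_smul hVU v
  have hξV : ξ ∈ D.νN ⁻¹ᵁ V := h.mem_open (D.νN ⁻¹ᵁ V).2 hPV
  have h1 : D.N.presheaf.germ _ ξ hξV (pb D.νN le_rfl g) • R.val w hξ hξU =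
      dlog s₁ hξV - dlog s₂ hξV := by
    have h2 := R.val_smul g (res W hVU w) hξ hξV
    rw [R.val_res] at h2
    exact h2.symm.trans (congrFun hv ⟨ξ, hξ, hξV⟩)
  have key := mem_regularDifferentials_stalk D.sN hA hclP h hdP hs₁'
  obtain ⟨b, hb⟩ := (key _).1 ((hξ.hasSimplePole_zero_iff hdP h _).1 hc)
  obtain ⟨a, ha⟩ := (key _).1 (dlog_mem_regularDifferentials h hPV (hu₂ _ hPV hne.symm) hξV)
  obtain ⟨_, _⟩ := id hdP
  have hs : IsUnit (D.N.presheaf.germ _ ξ hξV s₁) := by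
    rw [← germ_specializes h hPV]
    exact (hξ.isUnit_or_eq_zero _).resolve_right (specializes_ne_zero hdP hξ h hs₁'.ne_zero)
  let t := D.N.presheaf.germ _ P hPV s₁
  let g₀ := D.N.presheaf.germ _ P hPV (pb D.νN (le_refl (D.νN ⁻¹ᵁ V)) g)
  have h2 : IsUnit (1 - t * (g₀ * b + a)) := by
    have h3 : t * (g₀ * b + a) ∈ IsLocalRing.maximalIdeal (D.N.presheaf.stalk P) :=
      Ideal.mul_mem_right _ _ ((IsLocalRing.mem_maximalIdeal _).2 hs₁'.not_isUnit)
    by_contra h4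
    have h5 := add_mem ((IsLocalRing.mem_maximalIdeal _).2 h4) h3
    rw [sub_add_cancel] at h5
    exact (IsLocalRing.mem_maximalIdeal _).1 h5 isUnit_one
  have h3 : (D.N.presheaf.stalkSpecializes h).hom (1 - t * (g₀ * b + a)) •
      KaehlerDifferential.D ℂ _ ((D.N.presheaf.stalkSpecializes h).hom t) = 0 := by
    rw [hb, ha, dlog, eq_sub_iff_add_eq] at h1
    have h4 := congrArg (D.N.presheaf.germ _ ξ hξV s₁ • ·) h1
    dsimp only at h4
    rw [smul_smul (D.N.presheaf.germ _ ξ hξV s₁) (Ring.inverse _), Ring.mul_inverse_cancel _ hs,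
      one_smul] at h4
    simp only [germ_specializes] at h4
    simp only [t, g₀, map_sub, map_mul, map_one, map_add, germ_specializes]
    rw [sub_smul, one_smul, mul_smul, add_smul, mul_smul, h4, sub_self]
  refine val_ne_zero hR hw hξ hξU ?_
  rw [hb, (h2.map _).smul_eq_zero.1 h3, smul_zero]

end Cover


lemma mem_regularDifferentials_iff_of_residue {Y : Scheme.{0}} (s : Y ⟶ Spec (.of ℂ))
    [LocallyOfFiniteType s] [∀ y : Y, Algebra ℂ (Y.presheaf.stalk y)]
    (hA : ∀ y : Y, algebraMap ℂ (Y.presheaf.stalk y) = (stalkAlgebra s y).algebraMap) {p ξ : Y}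
    (hp : IsClosed {p}) (h : ξ ⤳ p) (hd : IsDVR (Y.presheaf.stalk p)) {η : Ω[Y.presheaf.stalk ξ⁄ℂ]}
    {c : ℂ} (hc : c ≠ 0) (hη : HasSimplePole (Y.presheaf.stalkSpecializes h).hom η c)
    {x : Y.presheaf.stalk p} (hx : Irreducible x) (ω : Ω[Y.presheaf.stalk ξ⁄ℂ]) :
    ω ∈ regularDifferentials (Y.presheaf.stalkSpecializes h).hom ↔
      ∃ a, ω = (Y.presheaf.stalkSpecializes h).hom a •
        (Y.presheaf.stalkSpecializes h).hom x • η := by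
  obtain ⟨t, u, ht, hu, hη⟩ := hη
  have key := mem_regularDifferentials_stalk s hA hp h hd ht
  obtain ⟨b, hb⟩ := (key _).1 hη
  obtain ⟨_, _⟩ := id hd
  obtain ⟨v, rfl⟩ := (IsDiscreteValuationRing.associated_of_irreducible _ ht hx)
  have hunit : IsUnit (algebraMap ℂ (Y.presheaf.stalk p) c + t * b) := by
    by_contra h1
    have h2 := sub_mem ((IsLocalRing.mem_maximalIdeal _).2 h1) (Ideal.mul_mem_right b _
      ((IsLocalRing.mem_maximalIdeal _).2 ht.not_isUnit))
    rw [add_sub_cancel_right] at h2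
    exact (IsLocalRing.mem_maximalIdeal _).1 h2 ((IsUnit.mk0 c hc).map _)
  obtain ⟨w, hw⟩ := hunit
  have h1 : (Y.presheaf.stalkSpecializes h).hom (t * v) • η =
      (Y.presheaf.stalkSpecializes h).hom (v * w) •
        KaehlerDifferential.D ℂ _ ((Y.presheaf.stalkSpecializes h).hom t) := by
    rw [eq_add_of_sub_eq hb, hw, smul_add, smul_smul, smul_smul, ← add_smul]
    congr 1
    rw [map_mul, map_mul, map_add, map_mul, specializes_algebraMap s hA]
    linear_combination (Y.presheaf.stalkSpecializes h).hom v * algebraMap ℂ _ c * hu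
  rw [key]
  constructor
  · rintro ⟨a, rfl⟩
    refine ⟨a * ↑(v * w)⁻¹, ?_⟩
    rw [h1, smul_smul, ← map_mul, mul_assoc, ← Units.val_mul, ← Units.val_mul, inv_mul_cancel,
      Units.val_one, mul_one]
  · rintro ⟨a, rfl⟩
    exact ⟨a * (v * w), by rw [h1, smul_smul, ← map_mul]⟩

namespace Cover

variable (D : Cover)

lemma isParam_of_pb_eq {p : D.Ch} (hp : D.ν p ∈ D.S) {V : D.N.Opens} {hpV : p ∈ D.πh ⁻¹ᵁ V}
    {f : Γ(D.Ch, D.πh ⁻¹ᵁ V)} (hf : IsParam f p hpV) (htw : tw D.τh_πh f = -f) {h : Γ(D.N, V)}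
    (hh : pb D.πh (le_refl (D.πh ⁻¹ᵁ V)) h = f * tw D.τh_πh f) : IsParam h (D.πh p) hpV := by
  have hcl : IsClosed {D.πh p} := D.isClosed_of_mem_preimage_T (by
    rw [D.νN_πh]
    exact D.apply_mem_T_iff.2 hp)
  have hd := D.isDVR_of_mem_S hp
  obtain ⟨U, hpU', s, hs⟩ := exists_isParam (D.isDVR_N hcl)
  have hpU : p ∈ D.πh ⁻¹ᵁ U := hpU'
  have h1 : pb D.πh (le_refl (D.πh ⁻¹ᵁ U)) s ∈ idealAt _ p hpU :=
    (pb_mem_idealAt D.πh le_rfl s hpU).2 hs.mem_idealAt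
  have h2 := mt (isParam_iff hd (hp := hpU)).2
    (D.not_isParam_of_tw_eq hp (hpV := hpU) (tw_pb D.τh_πh le_rfl s))
  rw [not_and_not_right] at h2
  have h3 := h2 h1
  obtain ⟨_, _⟩ := id hd
  obtain ⟨_, _⟩ := D.isDVR_N hcl
  rw [hf.maximalIdeal_eq, Ideal.span_singleton_pow, Ideal.mem_span_singleton] at h3
  obtain ⟨b, hb⟩ := h3
  have h4 := congrArg (D.Ch.presheaf.germ _ p hpV) hh
  rw [htw, map_mul, map_neg, germ_pb] at h4
  have h5 : ¬IsUnit (D.N.presheaf.germ V (D.πh p) hpV h) := fun hu => by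
    have h6 := hu.map (D.πh.stalkMap p).hom
    have h7 : IsUnit (D.Ch.presheaf.germ _ p hpV f * -D.Ch.presheaf.germ _ p hpV f) := h4 ▸ h6
    exact hf.not_isUnit (isUnit_of_mul_isUnit_left h7)
  have h6 := (IsLocalRing.mem_maximalIdeal _).2 h5
  rw [hs.maximalIdeal_eq, Ideal.mem_span_singleton] at h6
  obtain ⟨a, ha⟩ := h6
  rw [germ_pb] at hb
  rw [ha, map_mul, hb] at h4
  have h7 : b * (D.πh.stalkMap p) a = -1 := by
    apply mul_left_cancel₀ (pow_ne_zero 2 hf.ne_zero)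
    rw [← mul_assoc]
    exact h4.trans (by ring)
  have h8 : IsUnit ((D.πh.stalkMap p) a) :=
    isUnit_of_mul_isUnit_right (x := b) (h7 ▸ isUnit_one.neg)
  change Irreducible (D.N.presheaf.germ V (D.πh p) hpV h)
  rw [ha]
  exact (irreducible_mul_isUnit (isUnit_of_map_unit (D.πh.stalkMap p).hom _ h8)).2 hs

namespace Twist

variable {D} {L : D.C'.Modules} {φ : L ⟶ (Scheme.Modules.pushforward D.τ).obj L}
  {I : Set D.C'} (T : D.Twist L φ I) (Q : D.Partial I)

lemma exists_frame_over {p : D.Ch} (hp : D.ν p ∈ I) :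
    ∃ (V₀ : D.C.Opens) (e : Γ(L, D.π ⁻¹ᵁ V₀)) (V : Q.N₁.Opens) (_ : V ≤ Q.ν₁ ⁻¹ᵁ V₀)
      (hle : D.πh ⁻¹ᵁ (Q.μ ⁻¹ᵁ V) ≤ D.ν ⁻¹ᵁ (D.π ⁻¹ᵁ V₀)) (n : Γ(Q.glue T.j, V))
      (f : Γ(D.Ch, D.πh ⁻¹ᵁ (Q.μ ⁻¹ᵁ V))) (h : Γ(D.N, Q.μ ⁻¹ᵁ V)) (hP : D.πh p ∈ Q.μ ⁻¹ᵁ V),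
      IsGenerator L e ∧ IsGenerator (Q.glue T.j) n ∧ T.sec Q V n = f • psec D.ν L hle e ∧
      pb D.πh (le_refl (D.πh ⁻¹ᵁ (Q.μ ⁻¹ᵁ V))) h = f * tw D.τh_πh f ∧ IsParam h (D.πh p) hP ∧
      (∀ z, Q.μ z = Q.μ (D.πh p) → z = D.πh p) ∧
      (∀ q ∈ V, Q.ν₁ q ∈ D.T → q = Q.μ (D.πh p)) ∧
      ∀ ξ ∈ Q.μ ⁻¹ᵁ V, IsGeneric ξ → ξ ⤳ D.πh p := by
  have hpS := Q.sub hp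
  have hpi : Q.ν₁ (Q.μ (D.πh p)) = D.π (D.ν p) := Q.ν₁_μ_πh p
  have hy : Q.ν₁ (Q.μ (D.πh p)) ∈ D.π '' I := by
    rw [hpi]
    exact ⟨_, hp, rfl⟩
  have hinv : D.InvGen (-φ) (D.π (D.ν p)) := (T.eq ▸ hp : D.ν p ∈ D.negNodes φ).2
  obtain ⟨V₀, hV₀, e, he, hφe⟩ := hinv
  rw [act_neg, neg_eq_iff_eq_neg] at hφe
  have hyV₀ : Q.μ (D.πh p) ∈ Q.ν₁ ⁻¹ᵁ V₀ := by
    rw [Scheme.Hom.mem_preimage, hpi]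
    exact hV₀
  obtain ⟨V₁, hV₁, hyV₁, hiso₁, -⟩ := Q.exists_isIso_of_mem hy hyV₀
  have hPV₁ : D.πh p ∈ Q.μ ⁻¹ᵁ V₁ := hyV₁
  obtain ⟨B, hB, hPB, hgen⟩ := exists_isGeneric_specializes _ hPV₁
  obtain ⟨V₂, hV₂, rfl⟩ := exists_preimage_eq Q.μ hiso₁ hB
  obtain ⟨V, hV, hyV, hiso, hVT, n, hn, hm⟩ := T.exists_isGenerator_over Q hy (W := V₂) hPB
  have hVV₀ : V ≤ Q.ν₁ ⁻¹ᵁ V₀ := hV.trans (hV₂.trans hV₁)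
  have hle : D.πh ⁻¹ᵁ (Q.μ ⁻¹ᵁ V) ≤ D.ν ⁻¹ᵁ (D.π ⁻¹ᵁ V₀) :=
    D.preimage_le fun z hz => νN_mem Q (hVV₀ hz)
  have hPV : D.πh p ∈ Q.μ ⁻¹ᵁ V := hyV
  have hpV : p ∈ D.πh ⁻¹ᵁ (Q.μ ⁻¹ᵁ V) := hyV
  have huniq : ∀ z, Q.μ z = Q.μ (D.πh p) → z = D.πh p := by
    intro z hz
    obtain ⟨_, -, hu⟩ := existsUnique_of_isIso Q.μ hiso hyV
    exact (hu z hz).trans (hu _ rfl).symm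
  obtain ⟨f, hf⟩ := (he.psec D.ν hle).exists_smul' (T.sec Q V n)
  have htw : tw D.τh_πh f = -f := by
    have h1 := congrArg (D.acth φ) hf
    have h2 : D.acth φ (f • psec D.ν L hle e) = tw D.τh_πh f • D.acth φ (psec D.ν L hle e) :=
      act_smul _ _ _ _
    rw [T.acth_sec, h2, acth_psec, hφe, map_neg, smul_neg, ← neg_smul, hf] at h1
    exact neg_eq_iff_eq_neg.1 ((he.psec D.ν hle).smul_injective' h1).symm
  have hft := T.isTwist.isTwistGen hm (le_refl (D.πh ⁻¹ᵁ (Q.μ ⁻¹ᵁ V)))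
  have hfp : IsParam f p hpV := by
    obtain ⟨U, hpU, t, ht⟩ := exists_isParam (D.isDVR_of_mem_S hpS)
    have hUV : U ⊓ D.πh ⁻¹ᵁ (Q.μ ⁻¹ᵁ V) ≤ D.πh ⁻¹ᵁ (Q.μ ⁻¹ᵁ V) := inf_le_right
    have hpO : p ∈ U ⊓ D.πh ⁻¹ᵁ (Q.μ ⁻¹ᵁ V) := ⟨hpU, hpV⟩
    obtain ⟨a, ha⟩ := ((hft _ hUV).2 (fres inf_le_left t • psec D.ν L (hUV.trans hle) e)).2
      fun q hq hqI => by
        have h1 : Q.μ (D.πh q) = Q.μ (D.πh p) := hVT _ (hUV hq) (by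
          rw [Q.ν₁_μ_πh]
          exact D.apply_mem_T_iff.2 (Q.sub hqI))
        obtain rfl := D.eq_of_πh_eq hpS (huniq _ h1)
        exact vanishesAt_smul _ (hp := hq) ((fres_mem_idealAt _ _ _).2 ht.mem_idealAt)
    have h1 : fres inf_le_left t = a * fres hUV f := by
      apply ((he.psec D.ν hle).res hUV).smul_injective'
      rw [res_psec, ha, mul_smul, ← sec_apply, hf, res_smul, res_psec]
    have h2 := congrArg (D.Ch.presheaf.germ _ p hpO) h1
    rw [germ_fres, map_mul, germ_fres] at h2
    have h3 : Irreducible (D.Ch.presheaf.germ U p hpU t) := ht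
    rw [h2] at h3
    have h4 := h3.isUnit_or_isUnit rfl
    have h5 := h4.resolve_right fun h => isUnit_germ_iff.1 h (D.mem_idealAt_of_tw_eq_neg hpS hpV htw)
    exact (irreducible_isUnit_mul h5).1 h3
  obtain ⟨h, hh⟩ := D.exists_desc (f * tw D.τh_πh f) (by
    rw [map_mul, tw_tw _ D.τh_τh, mul_comm])
  exact ⟨V₀, e, V, hVV₀, hle, n, f, h, hPV, he, hn, hf, hh, D.isParam_of_pb_eq hpS hfp htw hh, huniq,
    hVT, fun ξ hξ => hgen ξ (hV hξ)⟩

variable [∀ y : D.N, Algebra ℂ (D.N.presheaf.stalk y)] {W : D.C.Modules}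
  (ν : NormMap D.adm.invariant L W) {R : RosMap D.νN W}
  (hA : ∀ y : D.N, algebraMap ℂ (D.N.presheaf.stalk y) = (stalkAlgebra D.sN y).algebraMap)

include hA

/-- Squares of local sections of the glued sheaf are Rosenlicht differentials. -/
lemma isRosOn (hR : ∀ U, R.IsRosOn U) (U : Q.N₁.Opens) : (T.rosMap Q ν R).IsRosOn U := by
  have haway : ∀ y, IsClosed {y} → Q.ν₁ y ∉ D.π '' I → ∀ U : Q.N₁.Opens, y ∈ U →
      ∃ V ≤ U, y ∈ V ∧ ∀ V' ≤ V, (T.rosMap Q ν R).IsRosOn V' := fun y hy hyI U hyU => by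
    obtain ⟨V, hyV, hV⟩ := T.isRosOn_away Q ν R hR hy hyI
    exact ⟨V ⊓ U, inf_le_right, ⟨hyV, hyU⟩, fun V' h => hV V' (h.trans inf_le_left)⟩
  refine RosMap.isRosOn_of_locally _ Q.s₁ fun y hyU hy => ?_
  by_cases hyI : Q.ν₁ y ∈ D.π '' I
  swap
  · exact haway y hy hyI U hyU
  obtain ⟨z, rfl⟩ := Q.μ_surjective y
  obtain ⟨p, rfl⟩ := D.πh_surjective z
  have hpI : D.ν p ∈ I := by
    obtain ⟨x, hx, h⟩ := hyI
    rw [Q.ν₁_μ_πh] at h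
    exact D.eq_of_apply_eq (Q.sub hx) h.symm ▸ hx
  obtain ⟨V₀, e, V, hV, hle, n, f, h, hP, he, hn, hf, hh, hhP, huniq, hVT, hgen⟩ :=
    T.exists_frame_over Q hpI
  have hνP : D.νN (D.πh p) ∈ D.T := by
    rw [D.νN_πh]
    exact D.apply_mem_T_iff.2 (Q.sub hpI)
  have hcl := D.isClosed_of_mem_preimage_T hνP
  have hd := D.isDVR_N hcl
  have hw := ν.gen V₀ e he
  have hPV₀ : D.νN (D.πh p) ∈ V₀ := νN_mem Q (hV hP)
  have hval : ∀ ξ (hξ : IsGeneric ξ) (hξV : ξ ∈ Q.μ ⁻¹ᵁ V) (hs : ξ ⤳ D.πh p),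
      (T.rosMap Q ν R).val (tmulSec n n) hξ hξV = (D.N.presheaf.stalkSpecializes hs).hom
        (D.N.presheaf.germ _ _ hP h) • R.val (ν.N V₀ e) hξ (νN_mem Q (hV hξV)) :=
    fun ξ hξ hξV hs => by
      rw [germ_specializes]
      exact T.rosMap_tmulSec Q ν R hV hle hf hh hξ hξV
  have key := RosMap.isRosOn_of_regular (T.rosMap Q ν R) hd (Q.norm.normal _ hyI) hy huniq
    (fun {_} => Q.pb_μ_injective _ le_rfl) hgen (hn.tmulSec hn)
    (fun ξ hξ hξV h0 => by
      rw [hval ξ hξ hξV (hgen ξ hξV hξ)] at h0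
      obtain ⟨_, _⟩ := id hd
      exact specializes_ne_zero hd hξ (hgen ξ hξV hξ) hhP.ne_zero
        (hξ.eq_zero_of_smul_eq_zero (val_ne_zero hR hw hξ _) h0))
    (fun ξ hξ hξV hs ω => by
      rw [hval ξ hξ hξV hs]
      obtain ⟨r, hr, -⟩ := ((hR V₀).2 _).1 ⟨ν.N V₀ e, rfl⟩ _ hPV₀ (D.isClosed_of_mem_T hνP)
      have h1 := hr _ rfl ⟨ξ, hξ, νN_mem Q (hV hξV)⟩ hs
      exact mem_regularDifferentials_iff_of_residue D.sN hA hcl hs hd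
        (residue_ne_zero hR hw hA hνP hPV₀ hξ hs (νN_mem Q (hV hξV)) h1) h1 hhP ω)
    (fun V' hV' hyV' => RosMap.isRosOn_of_locally _ Q.s₁ fun q hq hqcl => haway q hqcl (fun hqI =>
      hyV' (hVT q (hV' hq) (Q.image_subset_T hqI) ▸ hq)) V' hq)
  exact ⟨V ⊓ U, inf_le_right, ⟨hP, hyU⟩, fun V' h' => key V' (h'.trans inf_le_left)⟩

end Twist

/-- The square of the glued sheaf is the dualizing sheaf. -/
theorem Twist.isThetaCharacteristic {D : Cover} {L : D.C'.Modules}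
    {φ : L ⟶ (Scheme.Modules.pushforward D.τ).obj L} {I : Set D.C'} (T : D.Twist L φ I)
    (Q : D.Partial I) {W : D.C.Modules} (hW : IsDualizing D.s D.νN W)
    (hN : IsNorm D.adm.invariant L W) : IsThetaCharacteristic Q.s₁ Q.μ (Q.glue T.j) := by
  refine ⟨T.isLineBundle_glue Q, Q.isNodalCurve, Q.isNormalization, ?_⟩
  obtain ⟨-, -, hW⟩ := hW
  obtain ⟨ν⟩ := hN.exists_normMap
  have e : Q.μ ≫ Q.s₁ = D.sN := by rw [Partial.s₁, reassoc_of% Q.fac]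
  rw [e]
  let := fun y : D.N => stalkAlgebra D.sN y
  obtain ⟨R, hR⟩ := RosMap.exists_of_isRosenlicht hW
  exact RosMap.isRosenlicht _ (T.isRosOn Q ν (fun _ => rfl) hR)

end Cover


namespace Cover

variable (D : Cover) {L : D.C'.Modules} {φ : L ⟶ (Scheme.Modules.pushforward D.τ).obj L}

lemma adapted_invι : Adapted φ (adj D.πh (D.invι φ)) := by
  intro V m
  rw [homLE_coadj, adj_psec]
  exact (D.mem_range_invι _).1 ⟨m, rfl⟩

variable {D} {M : D.N.Modules} {j : (Scheme.Modules.pullback D.πh).obj M ⟶ D.F L} {I : Set D.C'}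

def Adapted.twist (h : Adapted φ j) (hL : IsLineBundle L)
    (hφ : IsLinearization D.adm.involution L φ) (hM : IsLineBundle M) (hI : I ⊆ D.S)
    (hj : IsTwist j (D.ν ⁻¹' I)) : D.Twist L φ I :=
  ⟨hL, hφ, M, j, hM, hj, h, h.eq_negNodes hL hφ hM hI hj⟩

lemma exists_adapted (hL : IsLineBundle L) (hφ : IsLinearization D.adm.involution L φ)
    (hM : IsLineBundle M) (hI : I ⊆ D.S) (hj : IsTwist j (D.ν ⁻¹' I)) :
    ∃ φ', IsLinearization D.adm.involution L φ' ∧ Adapted φ' j :=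
  (adapted_or hL hφ hM hI hj).elim (fun h => ⟨φ, hφ, h⟩) fun h => ⟨-φ, hφ.neg, h⟩

lemma exists_twist_compl (hL : IsLineBundle L) (hφ : IsLinearization D.adm.involution L φ)
    (hM : IsLineBundle M) (hI : I ⊆ D.S) (hj : IsTwist j (D.ν ⁻¹' I)) :
    ∃ (M' : D.N.Modules) (j' : (Scheme.Modules.pullback D.πh).obj M' ⟶ D.F L),
      IsLineBundle M' ∧ IsTwist j' (D.ν ⁻¹' (D.S \ I)) ∧ (D.S = ∅ → IsEmpty (M ≅ M')) := by
  obtain ⟨ψ, hψ, h⟩ := exists_adapted hL hφ hM hI hj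
  obtain ⟨hM', hj'⟩ := D.isLineBundle_invSubsheaf hL hψ.neg
  refine ⟨_, adj D.πh (D.invι (-ψ)), hM', ?_, fun hS => not_nonempty_iso hS hI hM h D.adapted_invι hj hj'⟩
  rw [h.eq_negNodes hL hψ hM hI hj, ← D.negNodes_neg hL hψ]
  exact hj'

/-- The decomposition of the direct image of `L` in eigensheaves. -/
theorem exists_eigensheaves (hL : IsLineBundle L) (hφ : IsLinearization D.adm.involution L φ)
    (hM : IsLineBundle M) (hI : I ⊆ D.S) (hj : IsTwist j (D.ν ⁻¹' I)) {M' : D.N.Modules}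
    {j' : (Scheme.Modules.pullback D.πh).obj M' ⟶ D.F L} (hM' : IsLineBundle M')
    (hj' : IsTwist j' (D.ν ⁻¹' (D.S \ I))) (hne : D.S = ∅ → IsEmpty (M ≅ M')) (Q : D.Partial I)
    (Q' : D.Partial (D.S \ I)) :
    ∃ (A : Q.N₁.Modules) (A' : Q'.N₁.Modules) (a : A ⟶ (Scheme.Modules.pushforward Q.μ).obj M)
      (a' : A' ⟶ (Scheme.Modules.pushforward Q'.μ).obj M'),
      IsLineBundle A ∧ IsLineBundle A' ∧ IsGluing D.ν D.πh Q.μ L M j (D.S \ I) a ∧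
      IsGluing D.ν D.πh Q'.μ L M' j' I a' ∧
      (∀ φ, IsLinearization D.adm.involution L φ →
        ∃ e : (Scheme.Modules.pushforward D.π).obj L ≅
            (Scheme.Modules.pushforward Q.ν₁).obj A ⊞ (Scheme.Modules.pushforward Q'.ν₁).obj A',
          action D.adm.invariant φ ≫ e.hom = e.hom ≫ biprod.map (𝟙 _) (-𝟙 _) ∨
          action D.adm.invariant (-φ) ≫ e.hom = e.hom ≫ biprod.map (𝟙 _) (-𝟙 _)) ∧
      ((∃ W : D.C.Modules, IsDualizing D.s D.νN W ∧ IsNorm D.adm.invariant L W) →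
        IsThetaCharacteristic Q.s₁ Q.μ A ∧ IsThetaCharacteristic Q'.s₁ Q'.μ A') := by
  have hI' : D.S \ I ⊆ D.S := Set.sdiff_subset
  have key : ∀ φ, IsLinearization D.adm.involution L φ → Adapted φ j → Adapted (-φ) j' :=
    fun φ hφ h => h.neg_of_compl hL hφ hM hI hj hM' hj' hne
  obtain ⟨ψ, hψ, h⟩ := exists_adapted hL hφ hM hI hj
  let T := h.twist hL hψ hM hI hj
  let T' := (key ψ hψ h).twist hL hψ.neg hM' hI' hj'
  have hglue := Q'.isGluing_glueι (j := j')
  rw [Set.sdiff_sdiff_cancel_left hI] at hglue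
  refine ⟨Q.glue j, Q'.glue j', Q.glueι j, Q'.glueι j', T.isLineBundle_glue Q,
    T'.isLineBundle_glue Q', Q.isGluing_glueι, hglue, fun φ hφ => ?_, ?_⟩
  · rcases adapted_or hL hφ hM hI hj with h | h
    · obtain ⟨e, he⟩ := (h.twist hL hφ hM hI hj).exists_iso Q
        ((key φ hφ h).twist hL hφ.neg hM' hI' hj') Q'
      exact ⟨e, Or.inl he⟩
    · obtain ⟨e, he⟩ := (h.twist hL hφ.neg hM hI hj).exists_iso Q
        ((key (-φ) hφ.neg h).twist hL hφ.neg.neg hM' hI' hj') Q'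
      exact ⟨e, Or.inr he⟩
  · rintro ⟨W, hW, hN⟩
    exact ⟨T.isThetaCharacteristic Q hW hN, T'.isThetaCharacteristic Q' hW hN⟩

end Cover

end PrymEigen

theorem proposition3p8
    {C' C Ch N : Scheme.{0}} (s' : C' ⟶ Spec (.of ℂ)) (s : C ⟶ Spec (.of ℂ))
    (τ : C' ⟶ C') (π : C' ⟶ C) (hπ : PrymEigen.IsAdmissibleDoubleCover s' s τ π)
    (ν : Ch ⟶ C') (hν : PrymEigen.IsNormalization ν)
    (νN : N ⟶ C) (hνN : PrymEigen.IsNormalization νN)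
    (τh : Ch ⟶ Ch) (hτh : τh ≫ ν = ν ≫ τ) (πh : Ch ⟶ N) (hπh : πh ≫ νN = ν ≫ π)
    (L : C'.Modules) (hL : PrymEigen.IsLineBundle L)
    (hτL : Nonempty ((Scheme.Modules.pullback τ).obj L ≅ L)) :
    (∃ φ : L ⟶ (Scheme.Modules.pushforward τ).obj L,
      PrymEigen.IsLinearization hπ.involution L φ) ∧
    (∃ I ⊆ PrymEigen.singularPoints C', ∃ (Mh₁ : N.Modules)
      (j₁ : (Scheme.Modules.pullback πh).obj Mh₁ ⟶ (Scheme.Modules.pullback ν).obj L),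
      PrymEigen.IsLineBundle Mh₁ ∧ PrymEigen.IsTwist j₁ (ν ⁻¹' I)) ∧
    ∀ I ⊆ PrymEigen.singularPoints C', ∀ (Mh₁ : N.Modules)
      (j₁ : (Scheme.Modules.pullback πh).obj Mh₁ ⟶ (Scheme.Modules.pullback ν).obj L),
      PrymEigen.IsLineBundle Mh₁ → PrymEigen.IsTwist j₁ (ν ⁻¹' I) →
      (∃ (Mh₂ : N.Modules)
        (j₂ : (Scheme.Modules.pullback πh).obj Mh₂ ⟶ (Scheme.Modules.pullback ν).obj L),
        PrymEigen.IsLineBundle Mh₂ ∧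
        PrymEigen.IsTwist j₂ (ν ⁻¹' (PrymEigen.singularPoints C' \ I)) ∧
        (PrymEigen.singularPoints C' = ∅ → IsEmpty (Mh₁ ≅ Mh₂))) ∧
      ∀ (Mh₂ : N.Modules)
        (j₂ : (Scheme.Modules.pullback πh).obj Mh₂ ⟶ (Scheme.Modules.pullback ν).obj L),
        PrymEigen.IsLineBundle Mh₂ →
        PrymEigen.IsTwist j₂ (ν ⁻¹' (PrymEigen.singularPoints C' \ I)) →
        (PrymEigen.singularPoints C' = ∅ → IsEmpty (Mh₁ ≅ Mh₂)) →
        ∀ (N₁ N₂ : Scheme.{0}) (ν₁ : N₁ ⟶ C) (ν₂ : N₂ ⟶ C) (μ₁ : N ⟶ N₁) (μ₂ : N ⟶ N₂),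
          PrymEigen.IsNormalizationAt ν₁ (π '' I) →
          PrymEigen.IsNormalizationAt ν₂ (π '' (PrymEigen.singularPoints C' \ I)) →
          μ₁ ≫ ν₁ = νN → μ₂ ≫ ν₂ = νN →
          ∃ (M₁ : N₁.Modules) (M₂ : N₂.Modules)
            (a₁ : M₁ ⟶ (Scheme.Modules.pushforward μ₁).obj Mh₁)
            (a₂ : M₂ ⟶ (Scheme.Modules.pushforward μ₂).obj Mh₂),
            PrymEigen.IsLineBundle M₁ ∧ PrymEigen.IsLineBundle M₂ ∧
            PrymEigen.IsGluing ν πh μ₁ L Mh₁ j₁ (PrymEigen.singularPoints C' \ I) a₁ ∧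
            PrymEigen.IsGluing ν πh μ₂ L Mh₂ j₂ I a₂ ∧
            (∀ φ : L ⟶ (Scheme.Modules.pushforward τ).obj L,
              PrymEigen.IsLinearization hπ.involution L φ →
              ∃ e : (Scheme.Modules.pushforward π).obj L ≅
                  (Scheme.Modules.pushforward ν₁).obj M₁ ⊞ (Scheme.Modules.pushforward ν₂).obj M₂,
                PrymEigen.action hπ.invariant φ ≫ e.hom = e.hom ≫ biprod.map (𝟙 _) (-𝟙 _) ∨
                PrymEigen.action hπ.invariant (-φ) ≫ e.hom =
                  e.hom ≫ biprod.map (𝟙 _) (-𝟙 _)) ∧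
            ((∃ W : C.Modules, PrymEigen.IsDualizing s νN W ∧
                PrymEigen.IsNorm hπ.invariant L W) →
              PrymEigen.IsThetaCharacteristic (ν₁ ≫ s) μ₁ M₁ ∧
              PrymEigen.IsThetaCharacteristic (ν₂ ≫ s) μ₂ M₂) := by

  let D : PrymEigen.Cover := ⟨C', C, Ch, N, s', s, τ, π, hπ, ν, hν, νN, hνN, τh, hτh, πh, hπh⟩
  obtain ⟨φ₀, hφ₀⟩ := PrymEigen.Cover.exists_isLinearization D hL hτL.some
  obtain ⟨hM₀, hj₀⟩ := PrymEigen.Cover.isLineBundle_invSubsheaf D hL hφ₀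
  refine ⟨⟨φ₀, hφ₀⟩, ⟨D.negNodes φ₀, D.negNodes_subset φ₀, _, _, hM₀, hj₀⟩, ?_⟩
  intro I hI Mh₁ j₁ hM₁ hj₁
  refine ⟨PrymEigen.Cover.exists_twist_compl (D := D) hL hφ₀ hM₁ hI hj₁, ?_⟩
  intro Mh₂ j₂ hM₂ hj₂ hne N₁ N₂ ν₁ ν₂ μ₁ μ₂ hν₁ hν₂ hμ₁ hμ₂
  exact PrymEigen.Cover.exists_eigensheaves (D := D) hL hφ₀ hM₁ hI hj₁ hM₂ hj₂ hne
    ⟨hI, N₁, ν₁, hν₁, μ₁, hμ₁⟩ ⟨Set.sdiff_subset, N₂, ν₂, hν₂, μ₂, hμ₂⟩
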